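/- Let $s\ge 2$ be a fixed integer; $\log$ is the logarithm to base $2$. For $x\in\{0,1\}^L$ let $\mathcal B_{1,s}(x)\subseteq\{0,1\}^{L-1}$ be the set of sequences obtained from $x$ by one deletion and at most $s$ substitutions. A code $\mathcal C\subseteq\{0,1\}^L$ is a single-deletion $s$-substitution correcting code if $\mathcal B_{1,s}(c)\cap\mathcal B_{1,s}(c')=\emptyset$ for all distinct $c,c'\in\mathcal C$; its redundancy is $r(\mathcal C)=L-\log|\mathcal C|$. An encoding function $\{0,1\}^k\to\{0,1\}^L$ is systematic if the information sequence appears, in order, on a fixed set of $k$ coordinates of the codeword. Weighted-sum syndrome. For $x\in\{0,1\}^L$ and $1\le j\le 2s+1$ let $f(x)_j=\sum_{i=1}^{L}x_i\big(\sum_{\ell=1}^{i}\ell^{\,j-1}\big) \bmod (2s+1)L^j$, and let $M(f(x))=\sum_{j=1}^{2s+1} f(x)_j\prod_{i=1}^{j-1}(2s+1)L^i$, a number in $[0,(2s+1)^{2s+1}L^{(s+1)(2s+1)}-1]$. As a binary sequence, $f(x)$ is the binary representation of $M(f(x))$ with $\lceil (s+1)(2s+1)\log L+(2s+1)\log(2s+1)\rceil$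 digits. BCH precoder. For every $m\ge 1$ fix a primitive element of $\mathbb F_{2^m}$. Given $k\ge1$, let $m$ be the smallest positive integer for which the binary narrow-sense primitive BCH code of length $2^m-1$ and designed distance $2s+1$ has dimension $k'\ge k$, and let $n_0=2^m-1-(k'-k)$. The map $h:\{0,1\}^k\to\{0,1\}^{n_0}$ is $h(x)=(x,p)$, where $(0,x,p)$ is the codeword of this BCH code whose first $k'$ symbols are $k'-k$ zeros followed by $x$. Let $\mathcal C_0=h(\{0,1\}^k)$. Syndrome compression. Let $w$ be a positive integer and let $P:\{0,1\}^{n_0}\to[1,2^w-1]$ be such that $M(f(c))\not\equiv M(f(c'))\pmod{P(c)}$ whenever $c\ne c'$ are in $\mathcal C_0$ and $\mathcal B_{1,s}(c)\cap\mathcal B_{1,s}(c')\neq\emptyset$. Let $g:\{0,1\}^{n_0}\to\{0,1\}^{n_1}$, $n_1=2w$, be the map $g(c)=\big(M(f(c))\bmod P(c),\,P(c)\big)$, both entries being written in binary with $w$ digits. Let $\mathcal E(x)=\big(h(x),\,g(h(x)),\,\mathrm{Rep}_{2s+2}(f(g(h(x))))\big)$, where $\mathrm{Rep}_{2s+2}$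 repeats every symbol $2s+2$ times, and let $\mathcal C=\mathcal E(\{0,1\}^k)$. Theorem. (1) For every choice of the primitive elements and of $w,P$ as above (for each $k$) and every $k\ge1$, $\mathcal E$ is systematic and $\mathcal C$ is a single-deletion $s$-substitution correcting code of length $n=n_0+n_1+n_2$, where $n_2=(2s+2)\lceil (s+1)(2s+1)\log n_1+(2s+1)\log(2s+1)\rceil$. If moreover $n_1=2(s+2)\log n_0+o(\log n_0)$ as $k\to\infty$, then $r(\mathcal C)\le(3s+4)\log n+o(\log n)$. (2) There is a choice of the primitive elements and of $w,P$ for all $k$, with $n_1=2(s+2)\log n_0+o(\log n_0)$, for which the family of codes has encoding complexity $O(n^{s+3})$ and decoding complexity $O(n^{s+2})$: there are two programs for a word RAM with words of $O(\log n)$ bits (unit-cost arithmetic, comparison, bitwise and memory operations) which depend only on $s$; the first computes $\mathcal E(x)$ from $k$ and $x\in\{0,1\}^k$ in $O(n^{s+3})$ steps, and the second computes $x$ from $k$ and any $y\in\mathcal B_{1,s}(\mathcal E(x))$ in $O(n^{s+2})$ steps, for all $k\ge 1$. The implied constants depend only on $s$. -/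

import Mathlib

open Filter Asymptotics

/-! ### Binary sequences, deletions and substitutions -/

/-- Binary sequences of length `L`. -/
abbrev Bits (L : ℕ) : Type := Fin L → ZMod 2

/-- The set of all sequences that are obtained from `x` by `t` deletions and at most `s`
substitutions: `y` is a subsequence `x ∘ φ` of length `L - t` in which at most `s` symbols have
been changed. -/
def errorBall (t s : ℕ) {L : ℕ} (x : Bits L) : Set (Bits (L - t)) :=
  {y | ∃ φ : Fin (L - t) ↪o Fin L, hammingDist y (fun i => x (φ i)) ≤ s}

/-- A `t`-deletion `s`-substitution correcting code: the error balls of distinct codewords are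
disjoint, so that a codeword can be recovered from every element of its error ball. -/
def IsDelSubCorrecting (t s : ℕ) {L : ℕ} (C : Set (Bits L)) : Prop :=
  ∀ c ∈ C, ∀ c' ∈ C, c ≠ c' → Disjoint (errorBall t s c) (errorBall t s c')

/-- An encoding function is systematic if the information sequence can be read off, in order, on
a fixed set of coordinates of the codeword. -/
def IsSystematic {k L : ℕ} (E : Bits k → Bits L) : Prop :=
  ∃ I : Fin k ↪o Fin L, ∀ (u : Bits k) (i : Fin k), E u (I i) = u i

/-- The redundancy `L - log₂ |C|` of a code of length `L`. -/
noncomputable def redundancy {L : ℕ} (C : Set (Bits L)) : ℝ :=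
  (L : ℝ) - Real.logb 2 (C.ncard : ℝ)

/-- The binary representation of `a` with `w` digits (least significant digit first). -/
def toBits (w a : ℕ) : Bits w := fun i => if a.testBit i then 1 else 0

/-- The encoding function of the `r`-fold repetition code: every symbol is repeated `r` times. -/
def rep (r : ℕ) {L : ℕ} (v : Bits L) : Bits (L * r) := fun i => v i.divNat

/-! ### The weighted-sum syndrome `f` -/

/-- The weight `a^(j)_i = 1^(j-1) + 2^(j-1) + ⋯ + i^(j-1)`. -/
def weight (j i : ℕ) : ℕ := ∑ l ∈ Finset.Icc 1 i, l ^ (j - 1)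

/-- The component `f(x)_j = x · a^(j) mod (2s+1) L^j`. -/
def syndrome (s : ℕ) {L : ℕ} (x : Bits L) (j : ℕ) : ℕ :=
  (∑ i : Fin L, (x i).val * weight j (i + 1)) % ((2 * s + 1) * L ^ j)

/-- The mixed-radix value `M(f(x)) = ∑_{j=1}^{2s+1} f(x)_j ∏_{i=1}^{j-1} (2s+1) L^i`, a number
below `(2s+1)^(2s+1) L^((s+1)(2s+1))`. -/
def syndromeValue (s : ℕ) {L : ℕ} (x : Bits L) : ℕ :=
  ∑ j ∈ Finset.Icc 1 (2 * s + 1),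
    syndrome s x j * ∏ i ∈ Finset.Icc 1 (j - 1), ((2 * s + 1) * L ^ i)

/-- The number `⌈(s+1)(2s+1) log₂ L + (2s+1) log₂ (2s+1)⌉` of binary digits of `M(f(x))`. -/
def syndromeLength (s L : ℕ) : ℕ :=
  Nat.clog 2 ((2 * s + 1) ^ (2 * s + 1) * L ^ ((s + 1) * (2 * s + 1)))

/-- `f(x)` as a binary sequence. -/
def syndromeBits (s : ℕ) {L : ℕ} (x : Bits L) : Bits (syndromeLength s L) :=
  toBits (syndromeLength s L) (syndromeValue s x)

/-! ### The precoder `h` from shortened BCH codes -/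

/-- The choice of one primitive element of each field `𝔽_{2^m}`. -/
def IsPrimitiveFamily (α : (m : ℕ) → GaloisField 2 m) : Prop :=
  ∀ m, 1 ≤ m → orderOf (α m) = 2 ^ m - 1

/-- The binary narrow-sense primitive BCH code of length `2^m - 1` and designed distance `2s+1`:
the words `c` whose polynomial `c(X) = ∑ c_j X^j` vanishes at `α, α², …, α^{2s}`. -/
def bchCode (s m : ℕ) (α : GaloisField 2 m) : Submodule (ZMod 2) (Bits (2 ^ m - 1)) where
  carrier := {c | ∀ i ∈ Finset.Icc 1 (2 * s),
    ∑ j : Fin (2 ^ m - 1), algebraMap (ZMod 2) (GaloisField 2 m) (c j) * α ^ (i * (j : ℕ)) = 0}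
  zero_mem' := by
    intro i _
    simp
  add_mem' := by
    intro a b ha hb i hi
    have h1 := ha i hi
    have h2 := hb i hi
    simp only [Pi.add_apply, map_add, add_mul, Finset.sum_add_distrib, h1, h2, add_zero]
  smul_mem' := by
    intro r a ha i hi
    have h1 := ha i hi
    simp only [Pi.smul_apply, smul_eq_mul, map_mul, mul_assoc, ← Finset.mul_sum, h1, mul_zero]

section Construction

variable (s : ℕ) (α : (m : ℕ) → GaloisField 2 m) (k : ℕ)

/-- The smallest positive `m` for which the BCH code of length `2^m - 1` has dimension at least
`k`. -/
noncomputable def bchDegree : ℕ :=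
  sInf {m | 1 ≤ m ∧ k ≤ Module.finrank (ZMod 2) (bchCode s m (α m))}

/-- The number `2^m - 1 - k'` of parity symbols, `k'` being the dimension of the BCH code. -/
noncomputable def parityLength : ℕ :=
  2 ^ bchDegree s α k - 1 -
    Module.finrank (ZMod 2) (bchCode s (bchDegree s α k) (α (bchDegree s α k)))

/-- The length `n₀ = 2^m - 1 - (k' - k) = k + (2^m - 1 - k')` of the shortened BCH code. -/
noncomputable abbrev precodeLength : ℕ := k + parityLength s α k

/-- The word `(0, …, 0, v)` of length `N`. -/
def padLeft (N : ℕ) {L : ℕ} (v : Bits L) : Bits N := fun j =>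
  if h : N - L ≤ (j : ℕ) then v ⟨(j : ℕ) - (N - L), by have := j.isLt; omega⟩ else 0

/-- The precoder `h(x) = (x, p)`, where `p` is the parity part of the codeword `(0, x, p)` of the
BCH code. -/
noncomputable def precode (x : Bits k) : Bits (precodeLength s α k) :=
  Fin.append x (Classical.epsilon fun p : Bits (parityLength s α k) =>
    padLeft (2 ^ bchDegree s α k - 1) (Fin.append x p) ∈
      bchCode s (bchDegree s α k) (α (bchDegree s α k)))

/-! ### Syndrome compression `g` -/

/-- The data of a syndrome compression: a modulus `P(c)` with `width` binary digits for every `c`,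
such that for all distinct precoded words `c`, `c'` whose error balls intersect,
`M(f(c)) ≢ M(f(c'))` modulo `P(c)`. -/
structure SyndromeCompression where
  width : ℕ
  modulus : Bits (precodeLength s α k) → ℕ
  modulus_pos : ∀ c, 1 ≤ modulus c
  modulus_lt : ∀ c, modulus c < 2 ^ width
  separates : ∀ c ∈ Set.range (precode s α k), ∀ c' ∈ Set.range (precode s α k), c' ≠ c →
    (errorBall 1 s c ∩ errorBall 1 s c').Nonempty →
      ¬ syndromeValue s c ≡ syndromeValue s c' [MOD modulus c]

variable {s α k}

namespace SyndromeCompression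

variable (G : SyndromeCompression s α k)

/-- The length `n₁` of `g(c)`. -/
abbrev length₁ : ℕ := G.width + G.width

/-- The map `g(c) = (M(f(c)) mod P(c), P(c))`. -/
noncomputable def compress (c : Bits (precodeLength s α k)) : Bits G.length₁ :=
  Fin.append (toBits G.width (syndromeValue s c % G.modulus c)) (toBits G.width (G.modulus c))

/-- The length `n₂` of the repetition-protected syndrome of `g(c)`. -/
abbrev length₂ : ℕ := syndromeLength s G.length₁ * (2 * s + 2)

/-- The length `n = n₀ + n₁ + n₂` of the code. -/
noncomputable abbrev codeLength : ℕ := precodeLength s α k + G.length₁ + G.length₂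

/-- The encoding function `E(x) = (h(x), g(h(x)), Rep_{2s+2}(f(g(h(x)))))`. -/
noncomputable def encode (x : Bits k) : Bits G.codeLength :=
  Fin.append (Fin.append (precode s α k x) (G.compress (precode s α k x)))
    (rep (2 * s + 2) (syndromeBits s (G.compress (precode s α k x))))

/-- The code. -/
noncomputable def code : Set (Bits G.codeLength) := Set.range G.encode

end SyndromeCompression

end Construction

/-! ### The word RAM

Programs of a small imperative language act on finitely many unbounded arrays of machine words.
Every operation, memory access and test counts as one step. A run is admissible for the word bound
`W` only if each value that occurs in it (constants, addresses, intermediate results) is smaller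
than `W`; a run with an overflow is stuck and yields no result. -/

/-- The unit-cost operations on words. -/
inductive WordOp where
  | add | sub | mul | div | mod | and | or | xor | lt | eq

/-- The value of an operation. -/
def WordOp.apply : WordOp → ℕ → ℕ → ℕ
  | .add, a, b => a + b
  | .sub, a, b => a - b
  | .mul, a, b => a * b
  | .div, a, b => a / b
  | .mod, a, b => a % b
  | .and, a, b => a &&& b
  | .or, a, b => a ||| b
  | .xor, a, b => a ^^^ b
  | .lt, a, b => if a < b then 1 else 0
  | .eq, a, b => if a = b then 1 else 0

/-- A memory state: `σ a i` is the content of cell `i` of array `a`. -/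
abbrev RamState : Type := ℕ → ℕ → ℕ

/-- Expressions: constants, the cell of the fixed array `a` at a computed address, operations. -/
inductive RamExpr where
  | const (c : ℕ)
  | cell (a : ℕ) (i : RamExpr)
  | op (o : WordOp) (e₁ e₂ : RamExpr)

namespace RamExpr

/-- The value of an expression. -/
def val (σ : RamState) : RamExpr → ℕ
  | const c => c
  | cell a i => σ a (i.val σ)
  | op o e₁ e₂ => o.apply (e₁.val σ) (e₂.val σ)

/-- The number of steps of the evaluation of an expression. -/
def cost : RamExpr → ℕ
  | const _ => 1
  | cell _ i => i.cost + 1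
  | op _ e₁ e₂ => e₁.cost + e₂.cost + 1

/-- All values that occur in the evaluation are smaller than `W`. -/
def Fits (W : ℕ) (σ : RamState) : RamExpr → Prop
  | const c => c < W
  | cell a i => i.Fits W σ ∧ σ a (i.val σ) < W
  | op o e₁ e₂ => e₁.Fits W σ ∧ e₂.Fits W σ ∧ o.apply (e₁.val σ) (e₂.val σ) < W

end RamExpr

/-- Programs. `store a i e` writes the value of `e` into the cell of array `a` at address `i`. -/
inductive RamProgram where
  | skip
  | store (a : ℕ) (i e : RamExpr)
  | seq (p q : RamProgram)
  | cond (b : RamExpr) (p q : RamProgram)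
  | loop (b : RamExpr) (p : RamProgram)

/-- The memory after writing `v` into cell `i` of array `a`. -/
def RamState.write (σ : RamState) (a i v : ℕ) : RamState :=
  Function.update σ a (Function.update (σ a) i v)

/-- `RamExec W p σ t σ'`: with word bound `W`, the program `p` started in the state `σ` halts in
the state `σ'` after `t` steps. A test succeeds if its value is not `0`. -/
inductive RamExec (W : ℕ) : RamProgram → RamState → ℕ → RamState → Prop
  | skip (σ : RamState) : RamExec W .skip σ 1 σ
  | store (σ : RamState) (a : ℕ) (i e : RamExpr) (hi : i.Fits W σ) (he : e.Fits W σ) :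
      RamExec W (.store a i e) σ (i.cost + e.cost + 1) (σ.write a (i.val σ) (e.val σ))
  | seq {p q : RamProgram} {σ σ₁ σ₂ : RamState} {t₁ t₂ : ℕ}
      (hp : RamExec W p σ t₁ σ₁) (hq : RamExec W q σ₁ t₂ σ₂) :
      RamExec W (.seq p q) σ (t₁ + t₂) σ₂
  | cond_true {b : RamExpr} {p q : RamProgram} {σ σ₁ : RamState} {t : ℕ}
      (hb : b.Fits W σ) (h : b.val σ ≠ 0) (hp : RamExec W p σ t σ₁) :
      RamExec W (.cond b p q) σ (b.cost + 1 + t) σ₁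
  | cond_false {b : RamExpr} {p q : RamProgram} {σ σ₁ : RamState} {t : ℕ}
      (hb : b.Fits W σ) (h : b.val σ = 0) (hq : RamExec W q σ t σ₁) :
      RamExec W (.cond b p q) σ (b.cost + 1 + t) σ₁
  | loop_done {b : RamExpr} {p : RamProgram} {σ : RamState}
      (hb : b.Fits W σ) (h : b.val σ = 0) :
      RamExec W (.loop b p) σ (b.cost + 1) σ
  | loop_step {b : RamExpr} {p : RamProgram} {σ σ₁ σ₂ : RamState} {t₁ t₂ : ℕ}
      (hb : b.Fits W σ) (h : b.val σ ≠ 0) (hp : RamExec W p σ t₁ σ₁)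
      (hl : RamExec W (.loop b p) σ₁ t₂ σ₂) :
      RamExec W (.loop b p) σ (b.cost + 1 + t₁ + t₂) σ₂

/-- The initial memory for the parameter `k` and the input word `v`: the cells `0` and `1` of
array `0` hold `k` and the length of `v`, array `1` holds `v`, and all other cells are `0`. -/
def RamState.input (k : ℕ) {L : ℕ} (v : Bits L) : RamState := fun a i =>
  if a = 0 then (if i = 0 then k else if i = 1 then L else 0)
  else if a = 1 then (if h : i < L then (v ⟨i, h⟩).val else 0)
  else 0

/-- The output convention: array `2` holds the word `u` and cell `0` of array `3` its length. -/
def RamState.HasOutput (σ : RamState) {L : ℕ} (u : Bits L) : Prop :=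
  σ 3 0 = L ∧ ∀ i : Fin L, σ 2 i = (u i).val

/-- With word bound `W`, the program `p` turns the parameter `k` and the input word `v` into the
output word `u` in at most `T` steps. -/
def RamProgram.ComputesWithin (p : RamProgram) (W T k : ℕ) {L L' : ℕ} (v : Bits L) (u : Bits L') :
    Prop :=
  ∃ (t : ℕ) (σ : RamState), t ≤ T ∧ RamExec W p (RamState.input k v) t σ ∧ σ.HasOutput u

/-! ### Families of codes and their complexity -/

section Families

variable {s : ℕ} {α : (m : ℕ) → GaloisField 2 m} (G : (k : ℕ) → SyndromeCompression s α k)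

/-- The compressed syndrome has length `n₁ = 2(s+2) log₂ n₀ + o(log n₀)`. -/
def HasCompressedLength : Prop :=
  (fun k => ((G k).length₁ : ℝ) - 2 * (s + 2) * Real.logb 2 (precodeLength s α k)) =o[atTop]
    (fun k => Real.logb 2 (precodeLength s α k))

/-- One program encodes all codes of the family, in `O(n^d)` steps on words of `O(log n)` bits. -/
def EncodingComplexity (d : ℕ) : Prop :=
  ∃ (p : RamProgram) (C : ℕ), ∀ k, 1 ≤ k → ∀ x : Bits k,
    p.ComputesWithin (C * (G k).codeLength ^ C) (C * (G k).codeLength ^ d) k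
      x ((G k).encode x)

/-- One program decodes all codes of the family from a single deletion and at most `s`
substitutions, in `O(n^d)` steps on words of `O(log n)` bits. -/
def DecodingComplexity (d : ℕ) : Prop :=
  ∃ (p : RamProgram) (C : ℕ), ∀ k, 1 ≤ k → ∀ x : Bits k,
    ∀ y ∈ errorBall 1 s ((G k).encode x),
      p.ComputesWithin (C * (G k).codeLength ^ C) (C * (G k).codeLength ^ d) k y x

end Families

/-! Correctness. Let one word arise from both `a` and `b` by a deletion and at most `s`
substitutions. Without their deleted positions, `a` and `b` differ in at most `2s` places. By Abel
summation the difference of their `j`-th weighted sums is the moment `∑ (l+1)^(j-1) u_l` of the tail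
sums `u_l = ∑_{i ≥ l} (a_i - b_i)`. The tail sums are at most `2s+1` in absolute value, so
congruence modulo `(2s+1) L^j` means that the moment vanishes. They also change sign at most `2s`
times, and a polynomial of degree at most `2s` that changes sign together with `u` turns the `2s+1`
vanishing moments into `u = 0` (`eq_zero_of_sign_changes`, `eq_of_moments`). An error of the
codeword acts on each of its three blocks as an error of the same kind (`Near.block`). Majority
votes recover `f(g)`, this recovers `g`, and `g` consists of a modulus and a residue which by the
choice of `P` single out `h(x)` (`SyndromeCompression.isDelSubCorrecting`). The redundancy is `s log
n` for the parity symbols, `2(s+2) log n` for `g`, and `O(log log n)` for the repetition block.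

A fast choice of `P` rests on two ideas. The codewords `c'` whose error ball meets that of `c` are
covered by only `O(n^(s+2))` trials: a deletion, an insertion and `s` substitutions lead from `c` to
a word within distance `s` of `c'`, and a table of BCH syndromes corrects the rest
(`exists_neighbour`). A modulus that divides none of the nonzero differences of syndrome values is
built factor by factor. Among the multipliers up to `2H` one lowers the number of bad differences by
the factor `H / A`, where the differences have `A` bits, since otherwise a power of the central
binomial coefficient of `H` would divide, and exceed, the product of the differences
(`exists_factor`). After `s+2` rounds with `H = n` and a last one with `H` polylogarithmic no bad
difference is left, the modulus has `(s+2) log n + o(log n)` bits, and the search takes `O(n^(s+3))`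
steps.

Field elements are handled as states of a shift register whose feedback polynomial is the least one
of full period; the primitive elements are chosen as roots of these polynomials
(`exists_primitiveFamily`). Feedback and generator polynomials, parity symbols, multipliers and
decoded words are all defined as least solutions, so that linear search computes them.

Running times are obtained from a calculus. `Comp c T f` says that one program, uniform in the index
of the context `c`, computes `f` in `O(T)` steps without overflow, and this is closed under
operations, table look-up, bounded loops and search. The decoder needs no search for a modulus: it
tries the `O(n^(s+1))` words from which the received block can arise, each in linear time
(`codeCandidate_spec`). -/

section

/-! ### Sizes of bitwise operations. -/

theorem Nat.or_le_add_self (a b : ℕ) : a ||| b ≤ a + b := by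
  induction a using Nat.strong_induction_on generalizing b with
  | _ a ih =>
  rcases Nat.eq_zero_or_pos a with rfl | ha
  · simp
  have h1 := ih (a / 2) (by omega) (b / 2)
  have h2 : (a ||| b) / 2 = a / 2 ||| b / 2 := Nat.or_div_two
  have h3 : (a ||| b) % 2 ≤ a % 2 + b % 2 := by
    have := Nat.or_mod_two_pow (a := a) (b := b) (n := 1)
    rw [pow_one] at this
    rw [this]
    rcases Nat.mod_two_eq_zero_or_one a with h | h <;>
      rcases Nat.mod_two_eq_zero_or_one b with h' | h' <;> simp [h, h']
  omega

theorem Nat.xor_le_add_self (a b : ℕ) : a ^^^ b ≤ a + b := by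
  induction a using Nat.strong_induction_on generalizing b with
  | _ a ih =>
  rcases Nat.eq_zero_or_pos a with rfl | ha
  · simp
  have h1 := ih (a / 2) (by omega) (b / 2)
  have h2 : (a ^^^ b) / 2 = a / 2 ^^^ b / 2 := Nat.xor_div_two
  have h3 : (a ^^^ b) % 2 = (a + b) % 2 := Nat.xor_mod_two_eq
  omega

/-! ### A calculus of computable functions for the word RAM -/

/-- A single polynomial bound for all operations at once: whatever is applied to polynomially
bounded values, the result still fits into a word of `O(log n)` bits. -/
theorem WordOp.apply_le (o : WordOp) (a b : ℕ) : o.apply a b ≤ (a + 1) * (b + 1) := by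
  cases o <;> simp only [WordOp.apply]
  · nlinarith [Nat.zero_le (a * b)]
  · nlinarith [Nat.zero_le (a * b), Nat.sub_le a b]
  · nlinarith
  · nlinarith [Nat.zero_le (a * b), Nat.div_le_self a b]
  · nlinarith [Nat.zero_le (a * b), Nat.mod_le a b]
  · nlinarith [Nat.zero_le (a * b), @Nat.and_le_left a b]
  · nlinarith [Nat.zero_le (a * b), Nat.or_le_add_self a b]
  · nlinarith [Nat.zero_le (a * b), Nat.xor_le_add_self a b]
  · split_ifs <;> nlinarith [Nat.zero_le (a * b)]
  · split_ifs <;> nlinarith [Nat.zero_le (a * b)]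

theorem RamExpr.Fits.mono {W W' : ℕ} (h : W ≤ W') {σ : RamState} :
    ∀ {e : RamExpr}, e.Fits W σ → e.Fits W' σ
  | .const _, hc => lt_of_lt_of_le hc h
  | .cell _ i, hc => ⟨RamExpr.Fits.mono h (e := i) hc.1, lt_of_lt_of_le hc.2 h⟩
  | .op _ e₁ e₂, hc => ⟨RamExpr.Fits.mono h (e := e₁) hc.1, RamExpr.Fits.mono h (e := e₂) hc.2.1,
      lt_of_lt_of_le hc.2.2 h⟩

theorem RamExec.mono {W W' : ℕ} (h : W ≤ W') {p : RamProgram} {σ σ' : RamState} {t : ℕ}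
    (hp : RamExec W p σ t σ') : RamExec W' p σ t σ' := by
  induction hp with
  | skip σ => exact .skip σ
  | store σ a i e hi he => exact .store σ a i e (hi.mono h) (he.mono h)
  | seq _ _ ih₁ ih₂ => exact .seq ih₁ ih₂
  | cond_true hb hv _ ih => exact .cond_true (hb.mono h) hv ih
  | cond_false hb hv _ ih => exact .cond_false (hb.mono h) hv ih
  | loop_done hb hv => exact .loop_done (hb.mono h) hv
  | loop_step hb hv _ _ ih₁ ih₂ => exact .loop_step (hb.mono h) hv ih₁ ih₂

/-- The program halts within `T` steps in a state satisfying `Q`. -/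
def Runs (W : ℕ) (p : RamProgram) (σ : RamState) (T : ℕ) (Q : RamState → Prop) : Prop :=
  ∃ t σ', t ≤ T ∧ RamExec W p σ t σ' ∧ Q σ'

namespace Runs

variable {W W' T T' T₁ T₂ : ℕ} {p q : RamProgram} {σ : RamState} {Q Q' Q₁ : RamState → Prop}

theorem mono (h : Runs W p σ T Q) (hW : W ≤ W') (hT : T ≤ T') (hQ : ∀ σ', Q σ' → Q' σ') :
    Runs W' p σ T' Q' := by
  obtain ⟨t, σ', ht, he, hq⟩ := h
  exact ⟨t, σ', ht.trans hT, he.mono hW, hQ _ hq⟩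

theorem seq (hp : Runs W p σ T₁ Q₁) (hq : ∀ σ', Q₁ σ' → Runs W q σ' T₂ Q) :
    Runs W (.seq p q) σ (T₁ + T₂) Q := by
  obtain ⟨t, σ', ht, he, h⟩ := hp
  obtain ⟨t', σ'', ht', he', h'⟩ := hq _ h
  exact ⟨t + t', σ'', add_le_add ht ht', .seq he he', h'⟩

theorem store {a : ℕ} {i e : RamExpr} (hi : i.Fits W σ) (he : e.Fits W σ)
    (hT : i.cost + e.cost + 1 ≤ T) (hQ : Q (σ.write a (i.val σ) (e.val σ))) :
    Runs W (.store a i e) σ T Q :=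
  ⟨_, _, hT, .store σ a i e hi he, hQ⟩

/-- The invariant is indexed by the number of passes made so far. Each pass has to supply the word
bound of the test, because an overflow leaves a program without any run. -/
theorem loop {b : RamExpr} (Inv : ℕ → RamState → Prop) (τ n : ℕ)
    (hstep : ∀ j < n, ∀ σ, Inv j σ → b.Fits W σ ∧ b.val σ ≠ 0 ∧ Runs W p σ τ (Inv (j + 1)))
    (hend : ∀ σ, Inv n σ → b.Fits W σ ∧ b.val σ = 0) (h0 : Inv 0 σ) :
    Runs W (.loop b p) σ (n * (b.cost + 1 + τ) + (b.cost + 1)) (Inv n) := by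
  suffices h : ∀ r j σ, j + r = n → Inv j σ →
      Runs W (.loop b p) σ (r * (b.cost + 1 + τ) + (b.cost + 1)) (Inv n) from
    h n 0 σ (by simp) h0
  intro r
  induction r with
  | zero =>
    intro j σ hj hI
    obtain rfl : j = n := by omega
    obtain ⟨h1, h2⟩ := hend σ hI
    exact ⟨_, σ, by simp, .loop_done h1 h2, hI⟩
  | succ r ih =>
    intro j σ hj hI
    obtain ⟨h1, h2, t, σ', ht, he, hI'⟩ := hstep j (by omega) σ hI
    obtain ⟨t', σ'', ht', he', hI''⟩ := ih (j + 1) σ' (by omega) hI'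
    refine ⟨_, σ'', ?_, .loop_step h1 h2 he he', hI''⟩
    rw [Nat.succ_mul]
    omega

end Runs

/-- Register `d`. -/
abbrev reg (d : ℕ) : RamExpr := .cell 4 (.const d)

/-- The assignment of `e` to register `d`. -/
abbrev setReg (d : ℕ) (e : RamExpr) : RamProgram := .store 4 (.const d) e

theorem RamState.write_same (σ : RamState) (a i v : ℕ) : σ.write a i v a i = v := by
  simp [RamState.write]

theorem RamState.write_ne_arr (σ : RamState) {a b : ℕ} (i v : ℕ) (h : b ≠ a) :
    σ.write a i v b = σ b := by
  simp [RamState.write, h]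

theorem RamState.write_ne (σ : RamState) {a i j : ℕ} (v : ℕ) (h : j ≠ i) :
    σ.write a i v a j = σ a j := by
  simp [RamState.write, h]

theorem Runs.setReg {W d T : ℕ} {e : RamExpr} {σ : RamState} {Q : RamState → Prop}
    (hd : d < W) (he : e.Fits W σ) (hT : e.cost + 2 ≤ T) (hQ : Q (σ.write 4 d (e.val σ))) :
    Runs W (setReg d e) σ T Q :=
  Runs.store (i := .const d) hd he (by simp only [RamExpr.cost]; omega) hQ

/-- The states differ only in the registers with numbers at least `d`. -/
def FrameEq (d : ℕ) (σ σ' : RamState) : Prop :=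
  (∀ a, a ≠ 4 → σ' a = σ a) ∧ ∀ j < d, σ' 4 j = σ 4 j

theorem FrameEq.refl (d : ℕ) (σ : RamState) : FrameEq d σ σ := ⟨fun _ _ => rfl, fun _ _ => rfl⟩

theorem FrameEq.trans {d : ℕ} {σ σ' σ'' : RamState} (h : FrameEq d σ σ') (h' : FrameEq d σ' σ'') :
    FrameEq d σ σ'' :=
  ⟨fun a ha => (h'.1 a ha).trans (h.1 a ha), fun j hj => (h'.2 j hj).trans (h.2 j hj)⟩

theorem FrameEq.mono {d d' : ℕ} {σ σ' : RamState} (h : FrameEq d' σ σ') (hd : d ≤ d') :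
    FrameEq d σ σ' := ⟨h.1, fun j hj => h.2 j (lt_of_lt_of_le hj hd)⟩

theorem FrameEq.write {d j : ℕ} (σ : RamState) (v : ℕ) (h : d ≤ j) :
    FrameEq d σ (σ.write 4 j v) :=
  ⟨fun _ ha => σ.write_ne_arr _ _ ha, fun i hi => σ.write_ne _ (by omega)⟩

/-- The situations in which a program is run: a size measure, the contents of the arrays, and the
values of the variables, as functions of an index. -/
structure Ctx (ι : Type) where
  size : ι → ℕ
  size_pos : ∀ i, 1 ≤ size i
  arr : ι → RamState
  vars : List (ι → ℕ)

namespace Ctx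

variable {ι κ : Type} (c : Ctx ι)

/-- The word bound with constant `C`. -/
def bound (C : ℕ) (i : ι) : ℕ := C * c.size i ^ C

/-- The values of `f` have logarithmically many bits in the size. -/
def Bdd (f : ι → ℕ) : Prop := ∃ C, ∀ i, f i < c.bound C i

/-- The state agrees with the context, the variables being held in the registers `ρ`. -/
def Holds (ρ : List ℕ) (i : ι) (σ : RamState) : Prop :=
  (∀ a, a ≠ 4 → σ a = c.arr i a) ∧ ρ.length = c.vars.length ∧
    ∀ q ∈ ρ.zip c.vars, σ 4 q.1 = q.2 i

/-- The context with an additional variable. -/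
def push (f : ι → ℕ) : Ctx ι := { c with vars := f :: c.vars }

/-- The context over another index family. -/
def comap (π : κ → ι) : Ctx κ where
  size := fun i => c.size (π i)
  size_pos := fun i => c.size_pos (π i)
  arr := fun i => c.arr (π i)
  vars := c.vars.map fun v => v ∘ π

/-- The context with array `a` replaced. -/
def setArr (a : ℕ) (A : ι → ℕ → ℕ) : Ctx ι :=
  { c with arr := fun i => Function.update (c.arr i) a (A i) }

/-- The context of the body of a loop with `b` iterations. -/
def loop (b : ι → ℕ) : Ctx (Σ i, Fin (b i)) :=
  (c.comap (Sigma.fst : (Σ i, Fin (b i)) → ι)).push fun p => (p.2 : ℕ)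

variable {c}

theorem bound_mono {C C' : ℕ} (h : C ≤ C') (i : ι) : c.bound C i ≤ c.bound C' i :=
  Nat.mul_le_mul h (Nat.pow_le_pow_right (c.size_pos i) h)

theorem le_bound (C : ℕ) (i : ι) : C ≤ c.bound C i :=
  Nat.le_mul_of_pos_right _ (Nat.pow_pos (c.size_pos i))

theorem bound_mul_le (C C' : ℕ) (i : ι) :
    c.bound C i * c.bound C' i ≤ c.bound (C * C' + C + C') i := by
  have h : c.bound C i * c.bound C' i = C * C' * c.size i ^ (C + C') := by
    simp only [bound, pow_add]; ring
  rw [h]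
  exact Nat.mul_le_mul (by omega) (Nat.pow_le_pow_right (c.size_pos i) (by omega))

theorem bound_add_le (C C' : ℕ) (i : ι) :
    c.bound C i + c.bound C' i ≤ c.bound (C + C') i := by
  have h1 : c.bound C i ≤ C * c.size i ^ (C + C') :=
    Nat.mul_le_mul_left _ (Nat.pow_le_pow_right (c.size_pos i) (by omega))
  have h2 : c.bound C' i ≤ C' * c.size i ^ (C + C') :=
    Nat.mul_le_mul_left _ (Nat.pow_le_pow_right (c.size_pos i) (by omega))
  have h3 : c.bound (C + C') i = C * c.size i ^ (C + C') + C' * c.size i ^ (C + C') := by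
    simp only [bound, add_mul]
  omega

namespace Bdd

variable {f g : ι → ℕ}

theorem mono (h : c.Bdd g) (hf : ∀ i, f i ≤ g i) : c.Bdd f := by
  obtain ⟨C, hC⟩ := h
  exact ⟨C, fun i => (hf i).trans_lt (hC i)⟩

theorem const (v : ℕ) : c.Bdd fun _ => v :=
  ⟨v + 1, fun i => Nat.lt_of_succ_le (le_bound (c := c) (v + 1) i)⟩

theorem size : c.Bdd c.size :=
  ⟨2, fun i => by
    have := c.size_pos i
    simp only [bound]
    nlinarith⟩

theorem add (hf : c.Bdd f) (hg : c.Bdd g) : c.Bdd fun i => f i + g i := by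
  obtain ⟨C, hC⟩ := hf
  obtain ⟨C', hC'⟩ := hg
  exact ⟨C + C', fun i => (add_lt_add (hC i) (hC' i)).trans_le (bound_add_le C C' i)⟩

theorem mul (hf : c.Bdd f) (hg : c.Bdd g) : c.Bdd fun i => f i * g i := by
  obtain ⟨C, hC⟩ := hf
  obtain ⟨C', hC'⟩ := hg
  exact ⟨C * C' + C + C', fun i =>
    (Nat.mul_lt_mul'' (hC i) (hC' i)).trans_le (bound_mul_le C C' i)⟩

theorem pow (hf : c.Bdd f) : ∀ m : ℕ, c.Bdd fun i => f i ^ m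
  | 0 => by simpa using const 1
  | m + 1 => by simpa only [pow_succ] using (pow hf m).mul hf

theorem op (o : WordOp) (hf : c.Bdd f) (hg : c.Bdd g) : c.Bdd fun i => o.apply (f i) (g i) :=
  ((hf.add (const 1)).mul (hg.add (const 1))).mono fun _ => o.apply_le _ _

theorem comap (hf : c.Bdd f) (π : κ → ι) : (c.comap π).Bdd fun i => f (π i) := by
  obtain ⟨C, hC⟩ := hf
  exact ⟨C, fun i => hC (π i)⟩

theorem sum {b : ι → ℕ} {g : (i : ι) → ℕ → ℕ} (hb : c.Bdd b)
    (hg : (c.loop b).Bdd fun p => g p.1 p.2) :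
    c.Bdd fun i => ∑ j ∈ Finset.range (b i), g i j := by
  obtain ⟨C', hC'⟩ := hg
  have h : c.Bdd fun i => c.bound C' i := by
    have := ((const (c := c) C').mul ((size (c := c)).pow C'))
    exact this
  refine (hb.mul h).mono fun i => ?_
  have : ∀ j ∈ Finset.range (b i), g i j ≤ c.bound C' i := fun j hj =>
    (hC' ⟨i, ⟨j, Finset.mem_range.1 hj⟩⟩).le
  simpa using Finset.sum_le_card_nsmul _ _ _ this

end Bdd

theorem Holds.frame {ρ : List ℕ} {i : ι} {σ σ' : RamState} {d : ℕ} (h : c.Holds ρ i σ)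
    (hf : FrameEq d σ σ') (hρ : ∀ r ∈ ρ, r < d) : c.Holds ρ i σ' :=
  ⟨fun a ha => (hf.1 a ha).trans (h.1 a ha), h.2.1, fun q hq =>
    (hf.2 _ (hρ _ (List.of_mem_zip hq).1)).trans (h.2.2 q hq)⟩

theorem Holds.push {ρ : List ℕ} {i : ι} {σ : RamState} {d : ℕ} {f : ι → ℕ} (h : c.Holds ρ i σ)
    (hd : σ 4 d = f i) : (c.push f).Holds (d :: ρ) i σ := by
  refine ⟨h.1, by simp [Ctx.push, h.2.1], ?_⟩
  simp only [Ctx.push, List.zip_cons_cons, List.mem_cons, forall_eq_or_imp]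
  exact ⟨hd, h.2.2⟩

theorem Holds.of_push {ρ : List ℕ} {r : ℕ} {i : ι} {σ : RamState} {f : ι → ℕ}
    (h : (c.push f).Holds (r :: ρ) i σ) : c.Holds ρ i σ := by
  obtain ⟨h1, h2, h3⟩ := h
  refine ⟨h1, by simpa [Ctx.push] using h2, fun q hq => h3 q ?_⟩
  simp [Ctx.push, hq]

theorem Holds.comap {ρ : List ℕ} {π : κ → ι} {i : κ} {σ : RamState} :
    (c.comap π).Holds ρ i σ ↔ c.Holds ρ (π i) σ := by
  unfold Holds
  simp only [Ctx.comap, List.length_map, List.zip_map_right, List.mem_map,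
    forall_exists_index, and_imp]
  refine and_congr_right fun _ => and_congr_right fun _ => ⟨fun h q hq => ?_, fun h q r hr hq => ?_⟩
  · exact h _ q hq rfl
  · subst hq
    exact h r hr

end Ctx

variable {ι κ : Type} {c : Ctx ι}

/-- In the context `c`, one program computes all `f i` within `O(T i + 1)` steps. -/
def Comp (c : Ctx ι) (T f : ι → ℕ) : Prop :=
  c.Bdd f ∧ ∀ (ρ : List ℕ) (d : ℕ), (∀ r ∈ ρ, r < d) → ∃ p C, ∀ i σ, c.Holds ρ i σ →
    Runs (c.bound C i) p σ (C * (T i + 1)) fun σ' => FrameEq d σ σ' ∧ σ' 4 d = f i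

namespace Comp

variable {T T' f g : ι → ℕ}

theorem bdd (h : Comp c T f) : c.Bdd f := h.1

theorem congr (h : Comp c T f) (hfg : ∀ i, g i = f i) : Comp c T g := by
  obtain rfl : g = f := funext hfg
  exact h

theorem mono (h : Comp c T f) (K : ℕ) (hT : ∀ i, T i ≤ K * (T' i + 1)) : Comp c T' f := by
  refine ⟨h.1, fun ρ d hρ => ?_⟩
  obtain ⟨p, C, hp⟩ := h.2 ρ d hρ
  refine ⟨p, C * (K + 1), fun i σ hσ => (hp i σ hσ).mono
    (Ctx.bound_mono (Nat.le_mul_of_pos_right _ (by omega)) i) ?_ fun _ h => h⟩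
  have := hT i
  rw [mul_assoc]
  exact Nat.mul_le_mul_left _ (by nlinarith)

theorem const (v : ℕ) : Comp c T fun _ => v := by
  refine ⟨.const v, fun ρ d hρ => ⟨setReg d (.const v), d + v + 3, fun i σ hσ => ?_⟩⟩
  have hb := Ctx.le_bound (c := c) (d + v + 3) i
  refine Runs.setReg (by omega) (show v < _ by omega) ?_ ⟨FrameEq.write _ _ le_rfl, σ.write_same ..⟩
  simp only [RamExpr.cost]
  nlinarith [Nat.zero_le (T i)]

theorem var {v : ι → ℕ} (h : v ∈ c.vars) (hv : c.Bdd v) : Comp c T v := by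
  refine ⟨hv, fun ρ d hρ => ?_⟩
  obtain ⟨l, hl, rfl⟩ := List.mem_iff_getElem.1 h
  obtain ⟨C, hC⟩ := hv
  by_cases hlen : ρ.length = c.vars.length
  swap
  -- With a wrong number of registers no state agrees with the context, so any program will do.
  · exact ⟨.skip, 0, fun i σ hσ => absurd hσ.2.1 hlen⟩
  have hl' : l < ρ.length := by omega
  refine ⟨setReg d (reg ρ[l]), C + d + 4, fun i σ hσ => ?_⟩
  have hq : σ 4 ρ[l] = c.vars[l] i :=
    hσ.2.2 (ρ[l], c.vars[l]) (by
      rw [List.mem_iff_getElem]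
      exact ⟨l, by simp; omega, by simp⟩)
  have hb := Ctx.le_bound (c := c) (C + d + 4) i
  have hr := hρ _ (List.getElem_mem hl')
  have hv := (hC i).trans_le (Ctx.bound_mono (c := c) (show C ≤ C + d + 4 by omega) i)
  refine Runs.setReg (by omega) ⟨show ρ[l] < _ by omega, ?_⟩ ?_
    ⟨FrameEq.write _ _ le_rfl, ?_⟩
  · simpa only [RamExpr.val, hq] using hv
  · simp only [RamExpr.cost]
    nlinarith [Nat.zero_le (T i)]
  · simp only [RamState.write_same, RamExpr.val, hq]

theorem cell {A : ι → ℕ → ℕ} (a : ℕ) (ha : a ≠ 4) (hA : ∀ i, c.arr i a = A i) (hf : Comp c T f)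
    (hB : c.Bdd fun i => A i (f i)) : Comp c T fun i => A i (f i) := by
  refine ⟨hB, fun ρ d hρ => ?_⟩
  obtain ⟨p, C, hp⟩ := hf.2 ρ d hρ
  obtain ⟨C₁, hC₁⟩ := hf.1
  obtain ⟨C₂, hC₂⟩ := hB
  refine ⟨.seq p (setReg d (.cell a (reg d))), C + C₁ + C₂ + d + 5, fun i σ hσ => ?_⟩
  have hb := Ctx.le_bound (c := c) (C + C₁ + C₂ + d + 5) i
  have h1 := (hC₁ i).trans_le (Ctx.bound_mono (c := c) (show C₁ ≤ C + C₁ + C₂ + d + 5 by omega) i)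
  have h2 := (hC₂ i).trans_le (Ctx.bound_mono (c := c) (show C₂ ≤ C + C₁ + C₂ + d + 5 by omega) i)
  refine ((Runs.seq ((hp i σ hσ).mono (Ctx.bound_mono (by omega) i) le_rfl fun _ h => h)
    (T₂ := 5) (Q := fun σ' => FrameEq d σ σ' ∧ σ' 4 d = A i (f i)) ?_).mono le_rfl ?_
      fun _ h => h)
  · rintro σ' ⟨hF, hd⟩
    have hA' : σ' a = A i := (hF.1 a ha).trans ((hσ.1 a ha).trans (hA i))
    refine Runs.setReg (by omega) ⟨⟨show d < _ by omega, ?_⟩, ?_⟩ (by simp [RamExpr.cost])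
      ⟨hF.trans (FrameEq.write _ _ le_rfl), ?_⟩
    · simpa only [RamExpr.val, hd] using h1
    · simpa only [RamExpr.val, hd, hA'] using h2
    · simp only [RamState.write_same, RamExpr.val, hd, hA']
  · nlinarith [Nat.zero_le (T i), Nat.zero_le ((C₁ + C₂ + d) * T i)]

/-- The first value waits in register `d` while the second is computed in the registers from `d + 1`
on. This stack discipline is the reason why `Comp` asks for a program for every `d` above the
registers in use. -/
theorem op (o : WordOp) (hf : Comp c T f) (hg : Comp c T g) :
    Comp c T fun i => o.apply (f i) (g i) := by
  have hB := Ctx.Bdd.op o hf.1 hg.1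
  refine ⟨hB, fun ρ d hρ => ?_⟩
  obtain ⟨p, C, hp⟩ := hf.2 ρ d hρ
  obtain ⟨q, C', hq⟩ := hg.2 ρ (d + 1) fun r hr => (hρ r hr).trans (by omega)
  obtain ⟨C₁, hC₁⟩ := hf.1
  obtain ⟨C₂, hC₂⟩ := hg.1
  obtain ⟨C₃, hC₃⟩ := hB
  set K := C + C' + C₁ + C₂ + C₃ + d + 7 with hK
  refine ⟨.seq p (.seq q (setReg d (.op o (reg d) (reg (d + 1))))), K, fun i σ hσ => ?_⟩
  have hb := Ctx.le_bound (c := c) K i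
  have h1 := (hC₁ i).trans_le (Ctx.bound_mono (c := c) (show C₁ ≤ K by omega) i)
  have h2 := (hC₂ i).trans_le (Ctx.bound_mono (c := c) (show C₂ ≤ K by omega) i)
  have h3 := (hC₃ i).trans_le (Ctx.bound_mono (c := c) (show C₃ ≤ K by omega) i)
  refine ((Runs.seq ((hp i σ hσ).mono (Ctx.bound_mono (by omega) i) le_rfl fun _ h => h)
    (T₂ := C' * (T i + 1) + 7) (Q := fun σ' => FrameEq d σ σ' ∧ σ' 4 d = o.apply (f i) (g i))
    ?_).mono le_rfl ?_ fun _ h => h)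
  · rintro σ₁ ⟨hF₁, hd₁⟩
    refine Runs.seq ((hq i σ₁ (hσ.frame hF₁ hρ)).mono (Ctx.bound_mono (by omega) i) le_rfl
      fun _ h => h) ?_
    rintro σ₂ ⟨hF₂, hd₂⟩
    have hd₁' : σ₂ 4 d = f i := (hF₂.2 d (by omega)).trans hd₁
    refine Runs.setReg (by omega) ⟨⟨show d < _ by omega, ?_⟩, ⟨show d + 1 < _ by omega, ?_⟩, ?_⟩
      (by simp [RamExpr.cost]) ⟨(hF₁.trans (hF₂.mono (by omega))).trans
        (FrameEq.write _ _ le_rfl), ?_⟩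
    · simpa only [RamExpr.val, hd₁'] using h1
    · simpa only [RamExpr.val, hd₂] using h2
    · simpa only [RamExpr.val, hd₁', hd₂] using h3
    · simp only [RamState.write_same, RamExpr.val, hd₁', hd₂]
  · have : K * (T i + 1) = C * (T i + 1) + C' * (T i + 1) + (C₁ + C₂ + C₃ + d + 7) * (T i + 1) := by
      rw [hK]; ring
    rw [this]
    nlinarith [Nat.zero_le (T i), Nat.zero_le ((C₁ + C₂ + C₃ + d) * (T i + 1))]

/-- A value is computed once and then stays in a register as a variable. Loops depend on this:
quantities that do not change are paid for outside the loop. -/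
theorem letv (hf : Comp c T f) (hg : Comp (c.push f) T g) : Comp c T g := by
  refine ⟨hg.1, fun ρ d hρ => ?_⟩
  obtain ⟨p, C, hp⟩ := hf.2 ρ d hρ
  obtain ⟨q, C', hq⟩ := hg.2 (d :: ρ) (d + 1) (by
    simp only [List.mem_cons, forall_eq_or_imp]
    exact ⟨by omega, fun r hr => (hρ r hr).trans (by omega)⟩)
  obtain ⟨C₂, hC₂⟩ := hg.1
  set K := C + C' + C₂ + d + 7 with hK
  refine ⟨.seq p (.seq q (setReg d (reg (d + 1)))), K, fun i σ hσ => ?_⟩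
  have hb := Ctx.le_bound (c := c) K i
  have h2 : g i < c.bound K i :=
    (hC₂ i).trans_le (Ctx.bound_mono (c := c.push f) (show C₂ ≤ K by omega) i)
  refine ((Runs.seq ((hp i σ hσ).mono (Ctx.bound_mono (by omega) i) le_rfl fun _ h => h)
    (T₂ := C' * (T i + 1) + 7) (Q := fun σ' => FrameEq d σ σ' ∧ σ' 4 d = g i)
    ?_).mono le_rfl ?_ fun _ h => h)
  · rintro σ₁ ⟨hF₁, hd₁⟩
    refine Runs.seq ((hq i σ₁ ((hσ.frame hF₁ hρ).push hd₁)).mono (Ctx.bound_mono (by omega) i)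
      le_rfl fun _ h => h) ?_
    rintro σ₂ ⟨hF₂, hd₂⟩
    refine Runs.setReg (by omega) ⟨show d + 1 < _ by omega, ?_⟩
      (by simp [RamExpr.cost]) ⟨(hF₁.trans (hF₂.mono (by omega))).trans
        (FrameEq.write _ _ le_rfl), ?_⟩
    · simpa only [RamExpr.val, hd₂] using h2
    · simp only [RamState.write_same, RamExpr.val, hd₂]
  · have : K * (T i + 1) = C * (T i + 1) + C' * (T i + 1) + (C₂ + d + 7) * (T i + 1) := by
      rw [hK]; ring
    rw [this]
    nlinarith [Nat.zero_le (T i), Nat.zero_le ((C₂ + d) * (T i + 1))]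

theorem comap (h : Comp c T f) (π : κ → ι) : Comp (c.comap π) (fun i => T (π i)) fun i => f (π i) := by
  refine ⟨h.1.comap π, fun ρ d hρ => ?_⟩
  obtain ⟨p, C, hp⟩ := h.2 ρ d hρ
  exact ⟨p, C, fun i σ hσ => hp (π i) σ (Ctx.Holds.comap.1 hσ)⟩

theorem weaken (h : Comp c T f) : Comp (c.push g) T f := by
  refine ⟨h.1, fun ρ d hρ => ?_⟩
  rcases ρ with _ | ⟨r, ρ⟩
  · exact ⟨.skip, 0, fun i σ hσ => by simpa [Ctx.push] using hσ.2.1⟩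
  · obtain ⟨p, C, hp⟩ := h.2 ρ d fun r hr => hρ r (by simp [hr])
    exact ⟨p, C, fun i σ hσ => hp i σ hσ.of_push⟩

theorem lift (h : Comp c T f) (b : ι → ℕ) :
    Comp (c.loop b) (fun p => T p.1) fun p => f p.1 := (h.comap Sigma.fst).weaken

end Comp

end

/-! ### Loops and linear search in the calculus. -/

section

variable {ι κ : Type} {c : Ctx ι}

namespace Comp

variable {T T' f g b : ι → ℕ}

/-- Primitive recursion: the body sees the counter and the previous value as the two most recent
variables. All intermediate values need a common bound, because each of them has to fit into a word.
-/
theorem fold {F : ι → ℕ → ℕ} (hb : Comp c T b) (h0 : Comp c T fun i => F i 0)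
    (hF : ∃ C, ∀ i, ∀ j ≤ b i, F i j < c.bound C i)
    (hs : Comp ((c.loop b).push fun p => F p.1 p.2) (fun p => T' p.1) fun p => F p.1 (p.2 + 1))
    (K : ℕ) (hT : ∀ i, (b i + 1) * (T' i + 1) ≤ K * (T i + 1)) :
    Comp c T fun i => F i (b i) := by
  obtain ⟨CF, hCF⟩ := hF
  refine ⟨⟨CF, fun i => hCF i _ le_rfl⟩, fun ρ d hρ => ?_⟩
  obtain ⟨p, C, hp⟩ := hb.2 ρ d hρ
  obtain ⟨q, C', hq⟩ := h0.2 ρ (d + 3) fun r hr => (hρ r hr).trans (by omega)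
  obtain ⟨u, C'', hu⟩ := hs.2 ((d + 1) :: d :: ρ) (d + 3) (by
    simp only [List.mem_cons, forall_eq_or_imp]
    exact ⟨by omega, by omega, fun r hr => (hρ r hr).trans (by omega)⟩)
  obtain ⟨Cb, hCb⟩ := hb.1
  -- Register `d` holds the counter, `d + 1` the current value and `d + 2` the number of passes; the
  -- body delivers its result in `d + 3`.
  set body : RamProgram := .seq u (.seq (setReg (d + 1) (reg (d + 3)))
    (setReg d (.op .add (reg d) (.const 1)))) with hbody
  set E : ℕ := C + C' + C'' + CF + Cb + d + 10 with hE
  refine ⟨.seq p (.seq (setReg (d + 2) (reg d)) (.seq q (.seq (setReg (d + 1) (reg (d + 3)))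
    (.seq (setReg d (.const 0)) (.seq (.loop (.op .lt (reg d) (reg (d + 2))) body)
      (setReg d (reg (d + 1)))))))), E + (C'' + 20) * K + 40, fun i σ hσ => ?_⟩
  have hbE := Ctx.le_bound (c := c) E i
  have hB : b i < c.bound E i := (hCb i).trans_le (Ctx.bound_mono (by omega) i)
  have hFE : ∀ j ≤ b i, F i j < c.bound E i := fun j hj =>
    (hCF i j hj).trans_le (Ctx.bound_mono (by omega) i)
  suffices hmain : Runs (c.bound E i) _ σ (C * (T i + 1) + (4 + (C' * (T i + 1) + (4 + (3 +
      ((b i * (5 + 1 + (C'' * (T' i + 1) + (4 + 6))) + (5 + 1)) + 4))))))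
      (fun σ' => FrameEq d σ σ' ∧ σ' 4 d = F i (b i)) by
    refine hmain.mono (Ctx.bound_mono (by omega) i) ?_ fun _ h => h
    have h1 : (C'' + 20) * ((b i + 1) * (T' i + 1)) ≤ (C'' + 20) * (K * (T i + 1)) :=
      Nat.mul_le_mul_left _ (hT i)
    have h2 : (C'' + 20) * ((b i + 1) * (T' i + 1)) = b i * (C'' * (T' i + 1)) + C'' * (T' i + 1)
      + 20 * b i * T' i + 20 * b i + 20 * T' i + 20 := by ring
    have h3 : (E + (C'' + 20) * K + 40) * (T i + 1) =
      C * (T i + 1) + C' * (T i + 1) + (C'' + CF + Cb + d + 10) * (T i + 1)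
        + (C'' + 20) * (K * (T i + 1)) + 40 * (T i + 1) := by rw [hE]; ring
    rw [h3]
    nlinarith [Nat.zero_le ((C'' + CF + Cb + d + 10) * (T i + 1)), Nat.zero_le (b i * T' i)]
  refine Runs.seq ((hp i σ hσ).mono (Ctx.bound_mono (by omega) i) le_rfl fun _ h => h) ?_
  rintro σ₁ ⟨hF₁, hd₁⟩
  refine Runs.seq (Q₁ := fun σ' => FrameEq d σ σ' ∧ σ' 4 (d + 2) = b i) (Runs.setReg (by omega)
    ⟨show d < _ by omega, ?_⟩ (by simp [RamExpr.cost])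
    ⟨hF₁.trans (FrameEq.write _ _ (by omega)), ?_⟩) ?_
  · simpa only [RamExpr.val, hd₁] using hB
  · simp only [RamState.write_same, RamExpr.val, hd₁]
  rintro σ₂ ⟨hF₂, hd₂⟩
  refine Runs.seq ((hq i σ₂ (hσ.frame hF₂ hρ)).mono (Ctx.bound_mono (by omega) i) le_rfl
    fun _ h => h) ?_
  rintro σ₃ ⟨hF₃, hd₃⟩
  refine Runs.seq (Q₁ := fun σ' => FrameEq d σ σ' ∧ σ' 4 (d + 2) = b i ∧ σ' 4 (d + 1) = F i 0)
    (Runs.setReg (by omega) ⟨show d + 3 < _ by omega, ?_⟩ (by simp [RamExpr.cost])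
    ⟨(hF₂.trans (hF₃.mono (by omega))).trans (FrameEq.write _ _ (by omega)), ?_, ?_⟩) ?_
  · simpa only [RamExpr.val, hd₃] using hFE 0 (by omega)
  · rw [RamState.write_ne _ _ (by omega), hF₃.2 _ (by omega), hd₂]
  · simp only [RamState.write_same, RamExpr.val, hd₃]
  rintro σ₄ ⟨hF₄, hd₄, he₄⟩
  refine Runs.seq (Q₁ := fun σ' => FrameEq d σ σ' ∧ σ' 4 (d + 2) = b i ∧ σ' 4 (d + 1) = F i 0 ∧
    σ' 4 d = 0) (Runs.setReg (by omega) (show 0 < _ by omega) (by simp [RamExpr.cost])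
    ⟨hF₄.trans (FrameEq.write _ _ (by omega)), ?_, ?_, ?_⟩) ?_
  · rw [RamState.write_ne _ _ (by omega), hd₄]
  · rw [RamState.write_ne _ _ (by omega), he₄]
  · simp only [RamState.write_same, RamExpr.val]
  rintro σ₅ ⟨hF₅, hd₅, he₅, hf₅⟩
  refine Runs.seq (Runs.loop (fun j σ' => FrameEq d σ σ' ∧ σ' 4 (d + 2) = b i ∧
    σ' 4 (d + 1) = F i j ∧ σ' 4 d = j) (C'' * (T' i + 1) + (4 + 6)) (b i) ?_ ?_
    ⟨hF₅, hd₅, he₅, hf₅⟩) ?_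
  · rintro j hj τ ⟨hFr, h2, h1, h0⟩
    refine ⟨⟨⟨show d < _ by omega, ?_⟩, ⟨show d + 2 < _ by omega, ?_⟩, ?_⟩, ?_, ?_⟩
    · simp only [RamExpr.val, h0]; omega
    · simp only [RamExpr.val, h2]; omega
    · simp only [RamExpr.val, h0, h2, WordOp.apply, hj, if_true]; omega
    · simp only [RamExpr.val, h0, h2, WordOp.apply, hj, if_true]; omega
    have hH : ((c.loop b).push fun p => F p.1 p.2).Holds ((d + 1) :: d :: ρ) ⟨i, ⟨j, hj⟩⟩ τ :=
      ((Ctx.Holds.comap.2 (hσ.frame hFr hρ)).push h0).push h1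
    refine Runs.seq ((hu ⟨i, ⟨j, hj⟩⟩ τ hH).mono
      (Ctx.bound_mono (c := c) (show C'' ≤ E by omega) i) le_rfl fun _ h => h) ?_
    rintro τ₁ ⟨hG₁, hk₁⟩
    refine Runs.seq (Q₁ := fun σ' => FrameEq d σ σ' ∧ σ' 4 (d + 2) = b i ∧
      σ' 4 (d + 1) = F i (j + 1) ∧ σ' 4 d = j)
      (Runs.setReg (by omega) ⟨show d + 3 < _ by omega, ?_⟩ (by simp [RamExpr.cost])
      ⟨(hFr.trans (hG₁.mono (by omega))).trans (FrameEq.write _ _ (by omega)), ?_, ?_, ?_⟩) ?_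
    · simpa only [RamExpr.val, hk₁] using hFE (j + 1) (by omega)
    · rw [RamState.write_ne _ _ (by omega), hG₁.2 _ (by omega), h2]
    · simp only [RamState.write_same, RamExpr.val, hk₁]
    · rw [RamState.write_ne _ _ (by omega), hG₁.2 _ (by omega), h0]
    rintro τ₂ ⟨hG₂, hi₂, hj₂, hk₂⟩
    refine Runs.setReg (by omega) ⟨⟨show d < _ by omega, ?_⟩, show 1 < _ by omega, ?_⟩
      (by simp [RamExpr.cost]) ⟨hG₂.trans (FrameEq.write _ _ (by omega)), ?_, ?_, ?_⟩
    · simp only [RamExpr.val, hk₂]; omega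
    · simp only [RamExpr.val, hk₂, WordOp.apply]; omega
    · rw [RamState.write_ne _ _ (by omega), hi₂]
    · rw [RamState.write_ne _ _ (by omega), hj₂]
    · simp only [RamState.write_same, RamExpr.val, hk₂, WordOp.apply]
  · rintro τ ⟨hFr, h2, h1, h0⟩
    refine ⟨⟨⟨show d < _ by omega, ?_⟩, ⟨show d + 2 < _ by omega, ?_⟩, ?_⟩, ?_⟩
    · simp only [RamExpr.val, h0]; omega
    · simp only [RamExpr.val, h2]; omega
    · simp only [RamExpr.val, h0, h2, WordOp.apply, lt_irrefl, if_false]; omega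
    · simp only [RamExpr.val, h0, h2, WordOp.apply, lt_irrefl, if_false]
  · rintro τ ⟨hFr, h2, h1, h0⟩
    refine Runs.setReg (by omega) ⟨show d + 1 < _ by omega, ?_⟩ (by simp [RamExpr.cost])
      ⟨hFr.trans (FrameEq.write _ _ (by omega)), ?_⟩
    · simpa only [RamExpr.val, h1] using hFE _ le_rfl
    · simp only [RamState.write_same, RamExpr.val, h1]

/-- Linear search: `L i` is the first index at which `g` does not vanish. -/
theorem find {L : ι → ℕ} {g : ι → ℕ → ℕ} (h0 : ∀ i, ∀ j < L i, g i j = 0)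
    (h1 : ∀ i, g i (L i) ≠ 0) (hL : c.Bdd L)
    (hg : Comp (c.loop fun i => L i + 1) (fun p => T' p.1) fun p => g p.1 p.2)
    (K : ℕ) (hT : ∀ i, (L i + 1) * (T' i + 1) ≤ K * (T i + 1)) : Comp c T L := by
  refine ⟨hL, fun ρ d hρ => ?_⟩
  obtain ⟨u, C, hu⟩ := hg.2 (d :: ρ) (d + 1) (by
    simp only [List.mem_cons, forall_eq_or_imp]
    exact ⟨by omega, fun r hr => (hρ r hr).trans (by omega)⟩)
  obtain ⟨CL, hCL⟩ := hL
  obtain ⟨Cg, hCg⟩ := hg.1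
  set E : ℕ := C + CL + Cg + d + 10 with hE
  -- Index `0` is evaluated before the loop, and every pass first increments and then evaluates.
  -- Hence `L i` passes make `L i + 1` evaluations, none of them beyond the index that is sought.
  refine ⟨.seq (setReg d (.const 0)) (.seq u (.loop (.op .eq (reg (d + 1)) (.const 0))
    (.seq (setReg d (.op .add (reg d) (.const 1))) u))), E + (C + 20) * K + 40, fun i σ hσ => ?_⟩
  have hbE := Ctx.le_bound (c := c) E i
  have hLE : L i < c.bound E i := (hCL i).trans_le (Ctx.bound_mono (by omega) i)
  have hgE : ∀ j (_ : j < L i + 1), g i j < c.bound E i := fun j hj =>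
    (hCg ⟨i, ⟨j, hj⟩⟩).trans_le (Ctx.bound_mono (c := c) (by omega) i)
  suffices hmain : Runs (c.bound E i) _ σ (3 + (C * (T' i + 1) +
      (L i * (4 + 1 + (6 + C * (T' i + 1))) + (4 + 1))))
      (fun σ' => FrameEq d σ σ' ∧ σ' 4 d = L i) by
    refine hmain.mono (Ctx.bound_mono (by omega) i) ?_ fun _ h => h
    have h1 : (C + 20) * ((L i + 1) * (T' i + 1)) ≤ (C + 20) * (K * (T i + 1)) :=
      Nat.mul_le_mul_left _ (hT i)
    have h2 : (C + 20) * ((L i + 1) * (T' i + 1)) = L i * (C * (T' i + 1)) + C * (T' i + 1)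
      + 20 * L i * T' i + 20 * L i + 20 * T' i + 20 := by ring
    have h3 : (E + (C + 20) * K + 40) * (T i + 1) =
      E * (T i + 1) + (C + 20) * (K * (T i + 1)) + 40 * (T i + 1) := by ring
    rw [h3]
    nlinarith [Nat.zero_le (E * (T i + 1)), Nat.zero_le (L i * T' i)]
  have key : ∀ j (_ : j < L i + 1) τ, FrameEq d σ τ → τ 4 d = j →
      Runs (c.bound E i) u τ (C * (T' i + 1)) fun τ' =>
        FrameEq d σ τ' ∧ τ' 4 d = j ∧ τ' 4 (d + 1) = g i j := by
    intro j hj τ hFr h0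
    have hH : (c.loop fun i => L i + 1).Holds (d :: ρ) ⟨i, ⟨j, hj⟩⟩ τ :=
      (Ctx.Holds.comap.2 (hσ.frame hFr hρ)).push h0
    refine (hu ⟨i, ⟨j, hj⟩⟩ τ hH).mono (Ctx.bound_mono (c := c) (show C ≤ E by omega) i) le_rfl ?_
    rintro τ₁ ⟨hG₁, hk₁⟩
    exact ⟨hFr.trans (hG₁.mono (by omega)), (hG₁.2 _ (by omega)).trans h0, hk₁⟩
  refine Runs.seq (Q₁ := fun σ' => FrameEq d σ σ' ∧ σ' 4 d = 0) (Runs.setReg (by omega)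
    (show 0 < _ by omega) (by simp [RamExpr.cost]) ⟨FrameEq.write _ _ le_rfl, ?_⟩) ?_
  · simp only [RamState.write_same, RamExpr.val]
  rintro σ₁ ⟨hF₁, hd₁⟩
  refine Runs.seq (key 0 (by omega) σ₁ hF₁ hd₁) ?_
  intro σ₂ h₂
  refine (Runs.loop (fun j τ => FrameEq d σ τ ∧ τ 4 d = j ∧ τ 4 (d + 1) = g i j)
    (6 + C * (T' i + 1)) (L i) ?_ ?_ h₂).mono le_rfl (by simp [RamExpr.cost])
    fun τ h => ⟨h.1, h.2.1⟩
  · rintro j hj τ ⟨hFr, hd, he⟩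
    rw [h0 i j hj] at he
    refine ⟨⟨⟨show d + 1 < _ by omega, ?_⟩, show 0 < _ by omega, ?_⟩, ?_, ?_⟩
    · simp only [RamExpr.val, he]; omega
    · simp only [RamExpr.val, he, WordOp.apply, if_true]; omega
    · simp only [RamExpr.val, he, WordOp.apply, if_true]; omega
    · refine Runs.seq (Q₁ := fun σ' => FrameEq d σ σ' ∧ σ' 4 d = j + 1) (Runs.setReg (by omega)
        ⟨⟨show d < _ by omega, ?_⟩, show 1 < _ by omega, ?_⟩ (by simp [RamExpr.cost])
        ⟨hFr.trans (FrameEq.write _ _ le_rfl), ?_⟩) ?_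
      · simp only [RamExpr.val, hd]; omega
      · simp only [RamExpr.val, hd, WordOp.apply]; omega
      · simp only [RamState.write_same, RamExpr.val, hd, WordOp.apply]
      · rintro τ' ⟨hF', hd'⟩
        exact key (j + 1) (by omega) τ' hF' hd'
  · rintro τ ⟨hFr, hd, he⟩
    have := hgE (L i) (by omega)
    refine ⟨⟨⟨show d + 1 < _ by omega, ?_⟩, show 0 < _ by omega, ?_⟩, ?_⟩
    · simpa only [RamExpr.val, he] using this
    · simp only [RamExpr.val, he, WordOp.apply, if_neg (h1 i)]; omega
    · simp only [RamExpr.val, he, WordOp.apply, if_neg (h1 i)]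

end Comp

end

/-! ### Sums, predicates and powers in the calculus. -/

section

variable {ι κ : Type} {c : Ctx ι}

namespace Comp

variable {T T' f g b : ι → ℕ}

theorem lift0 (h : Comp c 0 f) (b : ι → ℕ) : Comp (c.loop b) 0 fun p => f p.1 := h.lift b

theorem add (hf : Comp c T f) (hg : Comp c T g) : Comp c T fun i => f i + g i := hf.op .add hg
theorem sub (hf : Comp c T f) (hg : Comp c T g) : Comp c T fun i => f i - g i := hf.op .sub hg
theorem mul (hf : Comp c T f) (hg : Comp c T g) : Comp c T fun i => f i * g i := hf.op .mul hg
theorem div (hf : Comp c T f) (hg : Comp c T g) : Comp c T fun i => f i / g i := hf.op .div hg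
theorem mod (hf : Comp c T f) (hg : Comp c T g) : Comp c T fun i => f i % g i := hf.op .mod hg
theorem xor (hf : Comp c T f) (hg : Comp c T g) : Comp c T fun i => f i ^^^ g i := hf.op .xor hg

theorem pow (hf : Comp c T f) : ∀ m : ℕ, Comp c T fun i => f i ^ m
  | 0 => by simpa using const 1
  | m + 1 => by simpa only [pow_succ] using (pow hf m).mul hf

theorem head (hf : c.Bdd f) : Comp (c.push f) T f := var (by simp [Ctx.push]) hf

end Comp

theorem Ctx.Bdd.loop {f b : ι → ℕ} (hf : c.Bdd f) : (c.loop b).Bdd fun p => f p.1 :=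
  hf.comap Sigma.fst

theorem Ctx.Bdd.of_loop {F : ι → ℕ → ℕ} {b : ι → ℕ}
    (h : (c.loop fun i => b i + 1).Bdd fun p => F p.1 p.2) :
    ∃ C, ∀ i, ∀ j ≤ b i, F i j < c.bound C i := by
  obtain ⟨C, hC⟩ := h
  exact ⟨C, fun i j hj => hC ⟨i, ⟨j, by omega⟩⟩⟩

/-- The bitwise exclusive or of `g 0, …, g (n - 1)`. -/
def xsum (n : ℕ) (g : ℕ → ℕ) : ℕ := Nat.rec 0 (fun j a => a ^^^ g j) n

@[simp] theorem xsum_zero (g : ℕ → ℕ) : xsum 0 g = 0 := rfl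

theorem xsum_succ (n : ℕ) (g : ℕ → ℕ) : xsum (n + 1) g = xsum n g ^^^ g n := rfl

theorem xsum_le (n : ℕ) (g : ℕ → ℕ) : xsum n g ≤ ∑ j ∈ Finset.range n, g j := by
  induction n with
  | zero => simp
  | succ n ih =>
    rw [xsum_succ, Finset.sum_range_succ]
    exact (Nat.xor_le_add_self _ _).trans (by omega)

namespace Comp

variable {T T' f b : ι → ℕ} {g : ι → ℕ → ℕ}

theorem sum (hb : Comp c T b) (hg : Comp (c.loop b) (fun p => T' p.1) fun p => g p.1 p.2)
    (K : ℕ) (hT : ∀ i, (b i + 1) * (T' i + 1) ≤ K * (T i + 1)) :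
    Comp c T fun i => ∑ j ∈ Finset.range (b i), g i j := by
  obtain ⟨C, hC⟩ := hb.bdd.sum hg.bdd
  have hF : ∃ C, ∀ i, ∀ j ≤ b i, ∑ l ∈ Finset.range j, g i l < c.bound C i :=
    ⟨C, fun i j hj => lt_of_le_of_lt
      (Finset.sum_le_sum_of_subset (by simpa using hj)) (hC i)⟩
  refine fold (F := fun i j => ∑ l ∈ Finset.range j, g i l) hb ?_ hF ?_ K hT
  · simpa using const 0
  · obtain ⟨C, hC⟩ := hF
    simp only [Finset.sum_range_succ]
    exact (head ⟨C, fun p => hC p.1 p.2 p.2.isLt.le⟩).add hg.weaken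

theorem xsum (hb : Comp c T b) (hg : Comp (c.loop b) (fun p => T' p.1) fun p => g p.1 p.2)
    (K : ℕ) (hT : ∀ i, (b i + 1) * (T' i + 1) ≤ K * (T i + 1)) :
    Comp c T fun i => xsum (b i) (g i) := by
  obtain ⟨C, hC⟩ := hb.bdd.sum hg.bdd
  have hF : ∃ C, ∀ i, ∀ j ≤ b i, _root_.xsum j (g i) < c.bound C i :=
    ⟨C, fun i j hj => lt_of_le_of_lt ((xsum_le _ _).trans
      (Finset.sum_le_sum_of_subset (by simpa using hj))) (hC i)⟩
  refine fold (F := fun i j => _root_.xsum j (g i)) hb ?_ hF ?_ K hT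
  · simpa using const 0
  · obtain ⟨C, hC⟩ := hF
    simp only [xsum_succ]
    exact (head ⟨C, fun p => hC p.1 p.2 p.2.isLt.le⟩).xor hg.weaken

end Comp

open Classical in
/-- The predicate `P` is decided within `O(T i + 1)` steps. -/
def CompP (c : Ctx ι) (T : ι → ℕ) (P : ι → Prop) : Prop := Comp c T fun i => if P i then 1 else 0

namespace CompP

variable {T T' f g b : ι → ℕ} {P Q : ι → Prop}

theorem congr (h : CompP c T P) (hP : ∀ i, Q i ↔ P i) : CompP c T Q := by
  obtain rfl : Q = P := funext fun i => propext (hP i)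
  exact h

theorem ind (h : CompP c T P) [∀ i, Decidable (P i)] : Comp c T fun i => if P i then 1 else 0 :=
  Comp.congr h fun i => by congr

theorem lt (hf : Comp c T f) (hg : Comp c T g) : CompP c T fun i => f i < g i :=
  (hf.op .lt hg).congr fun i => by simp only [WordOp.apply]; congr

theorem eq (hf : Comp c T f) (hg : Comp c T g) : CompP c T fun i => f i = g i :=
  (hf.op .eq hg).congr fun i => by simp only [WordOp.apply]; congr

theorem not (h : CompP c T P) : CompP c T fun i => ¬ P i :=
  Comp.congr ((Comp.const 1).sub h) fun i => by by_cases hP : P i <;> simp [hP]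

theorem and (h : CompP c T P) (h' : CompP c T Q) : CompP c T fun i => P i ∧ Q i :=
  Comp.congr (h.mul h') fun i => by by_cases hP : P i <;> by_cases hQ : Q i <;> simp [hP, hQ]

theorem le (hf : Comp c T f) (hg : Comp c T g) : CompP c T fun i => f i ≤ g i :=
  (lt hg hf).not.congr fun i => by simp

theorem ne (hf : Comp c T f) (hg : Comp c T g) : CompP c T fun i => f i ≠ g i := (eq hf hg).not

/-- A bounded universal statement holds when the number of its counterexamples is zero. There is no
early exit, which does no harm to the order of the running time. -/
theorem ball {P : ι → ℕ → Prop} (hb : Comp c T b)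
    (hP : CompP (c.loop b) (fun p => T' p.1) fun p => P p.1 p.2)
    (K : ℕ) (hT : ∀ i, (b i + 1) * (T' i + 1) ≤ K * (T i + 1)) :
    CompP c T fun i => ∀ j < b i, P i j := by
  classical
  have h := Comp.sum (g := fun i j => if ¬ P i j then 1 else 0) hb hP.not.ind K hT
  refine (CompP.eq h (Comp.const 0)).congr fun i => ?_
  rw [Finset.sum_eq_zero_iff]
  simp

end CompP

namespace Comp

variable {T T' f g b : ι → ℕ} {P : ι → Prop}

/-- The choice is made arithmetically, as `[P] f + (1 - [P]) g`. Both branches are therefore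
evaluated, and both must be bounded and fast even where they are not selected. -/
theorem ite [∀ i, Decidable (P i)] (hP : CompP c T P) (hf : Comp c T f) (hg : Comp c T g) :
    Comp c T fun i => if P i then f i else g i :=
  ((hP.ind.mul hf).add (((const 1).sub hP.ind).mul hg)).congr fun i => by
    by_cases h : P i <;> simp [h]

theorem findP {L : ι → ℕ} {P : ι → ℕ → Prop} (h0 : ∀ i, ∀ j < L i, ¬ P i j)
    (h1 : ∀ i, P i (L i)) (hL : c.Bdd L)
    (hP : CompP (c.loop fun i => L i + 1) (fun p => T' p.1) fun p => P p.1 p.2)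
    (K : ℕ) (hT : ∀ i, (L i + 1) * (T' i + 1) ≤ K * (T i + 1)) : Comp c T L := by
  classical
  exact find (g := fun i j => if P i j then 1 else 0) (fun i j hj => by simp [h0 i j hj])
    (fun i => by simp [h1 i]) hL hP.ind K hT

theorem count {P : ι → ℕ → Prop} [∀ i j, Decidable (P i j)] (hb : Comp c T b)
    (hP : CompP (c.loop b) (fun p => T' p.1) fun p => P p.1 p.2)
    (K : ℕ) (hT : ∀ i, (b i + 1) * (T' i + 1) ≤ K * (T i + 1)) :
    Comp c T fun i => ((Finset.range (b i)).filter (P i)).card := by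
  simp only [Finset.card_filter]
  exact sum hb hP.ind K hT

/-- The bound is required for `f + 1` since it has to dominate all the lower powers as well, also
when `f` vanishes. -/
theorem vpow {e : ι → ℕ} (hf : Comp c T f) (he : Comp c T e)
    (hB : c.Bdd fun i => (f i + 1) ^ e i)
    (K : ℕ) (hT : ∀ i, e i + 1 ≤ K * (T i + 1)) : Comp c T fun i => f i ^ e i := by
  have hF : ∃ C, ∀ i, ∀ j ≤ e i, f i ^ j < c.bound C i := by
    obtain ⟨C, hC⟩ := hB
    refine ⟨C, fun i j hj => lt_of_le_of_lt ?_ (hC i)⟩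
    exact (Nat.pow_le_pow_left (Nat.le_succ _) j).trans (Nat.pow_le_pow_right (by omega) hj)
  refine hf.letv ?_
  refine fold (T' := 0) (F := fun i j => f i ^ j) he.weaken ?_ hF ?_ K (by simpa using hT)
  · simpa using const 1
  · obtain ⟨C, hC⟩ := hF
    simp only [pow_succ]
    exact (head ⟨C, fun p => hC p.1 p.2 p.2.isLt.le⟩).mul ((head hf.bdd).lift0 e).weaken

theorem pow_two {e : ι → ℕ} (he : Comp c T e) (hB : c.Bdd fun i => 2 ^ e i)
    (K : ℕ) (hT : ∀ i, e i + 1 ≤ K * (T i + 1)) : Comp c T fun i => 2 ^ e i := by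
  have hF : ∃ C, ∀ i, ∀ j ≤ e i, 2 ^ j < c.bound C i := by
    obtain ⟨C, hC⟩ := hB
    exact ⟨C, fun i j hj => lt_of_le_of_lt (Nat.pow_le_pow_right (by omega) hj) (hC i)⟩
  refine fold (T' := 0) (F := fun i j => 2 ^ j) he ?_ hF ?_ K (by simpa using hT)
  · simpa using const 1
  · obtain ⟨C, hC⟩ := hF
    simp only [pow_succ]
    exact (head ⟨C, fun p => hC p.1 p.2 p.2.isLt.le⟩).mul (const 2)

end Comp

/-! ### Variables -/

/-- `v` is the value of a variable with logarithmically many bits. -/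
def Var (c : Ctx ι) (v : ι → ℕ) : Prop := v ∈ c.vars ∧ c.Bdd v

namespace Var

variable {T f v : ι → ℕ}

theorem comp (h : Var c v) : Comp c T v := .var h.1 h.2

theorem push (h : Var c v) : Var (c.push f) v := ⟨by simp [Ctx.push, h.1], h.2⟩

theorem head (hf : c.Bdd f) : Var (c.push f) f := ⟨by simp [Ctx.push], hf⟩

theorem loop (h : Var c v) {b : ι → ℕ} : Var (c.loop b) fun p => v p.1 :=
  ⟨List.mem_cons_of_mem _ (List.mem_map_of_mem (f := fun v => v ∘ Sigma.fst) h.1), h.2.loop⟩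

theorem counter {b : ι → ℕ} (hb : c.Bdd b) : Var (c.loop b) fun p => (p.2 : ℕ) :=
  ⟨by simp [Ctx.loop, Ctx.push], hb.loop.mono fun p => p.2.isLt.le⟩

theorem setArr (h : Var c v) {a : ℕ} {A : ι → ℕ → ℕ} : Var (c.setArr a A) v := h

end Var

/-! ### Programs with arrays -/

/-- In the context `c`, one program establishes `Q` within `O(T i + 1)` steps. -/
def Achieves (c : Ctx ι) (T : ι → ℕ) (Q : ι → RamState → Prop) : Prop :=
  ∀ (ρ : List ℕ) (d : ℕ), (∀ r ∈ ρ, r < d) → ∃ p C, ∀ i σ, c.Holds ρ i σ →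
    Runs (c.bound C i) p σ (C * (T i + 1)) (Q i)

namespace Achieves

variable {T T' f : ι → ℕ} {Q : ι → RamState → Prop}

theorem skip (h : ∀ i σ, (∀ a, a ≠ 4 → σ a = c.arr i a) → Q i σ) : Achieves c T Q :=
  fun _ _ _ => ⟨.skip, 1, fun i σ hσ => ⟨1, σ, by omega, .skip σ, h i σ hσ.1⟩⟩

theorem letv (hf : Comp c T f) (hg : Achieves (c.push f) T Q) : Achieves c T Q := by
  intro ρ d hρ
  obtain ⟨p, C, hp⟩ := hf.2 ρ d hρ
  obtain ⟨q, C', hq⟩ := hg (d :: ρ) (d + 1) (by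
    simp only [List.mem_cons, forall_eq_or_imp]
    exact ⟨by omega, fun r hr => (hρ r hr).trans (by omega)⟩)
  refine ⟨.seq p q, C + C', fun i σ hσ => (Runs.seq
    ((hp i σ hσ).mono (Ctx.bound_mono (by omega) i) le_rfl fun _ h => h)
    (T₂ := C' * (T i + 1)) (Q := Q i) ?_).mono le_rfl (by rw [add_mul]) fun _ h => h⟩
  rintro σ₁ ⟨hF₁, hd₁⟩
  exact (hq i σ₁ ((hσ.frame hF₁ hρ).push hd₁)).mono
    (Ctx.bound_mono (c := c) (show C' ≤ C + C' by omega) i) le_rfl fun _ h => h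

/-- `S i j` is the content of array `a` after `j` writes. Address and value of a write are computed
in a context that already contains the earlier ones, and the rest of the program, passed as `hQ`,
runs with the finished array. -/
theorem scatter (a : ℕ) (ha : a ≠ 4) {b : ι → ℕ} {addr value : ι → ℕ → ℕ}
    (S : ι → ℕ → ℕ → ℕ) (h0 : ∀ i, S i 0 = c.arr i a)
    (hS : ∀ i, ∀ j < b i, S i (j + 1) = Function.update (S i j) (addr i j) (value i j))
    (hb : Comp c T b)
    (haddr : Comp ((c.loop b).setArr a fun p => S p.1 p.2) (fun p => T' p.1)
      fun p => addr p.1 p.2)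
    (hvalue : Comp ((c.loop b).setArr a fun p => S p.1 p.2) (fun p => T' p.1)
      fun p => value p.1 p.2)
    (K : ℕ) (hT : ∀ i, (b i + 1) * (T' i + 1) ≤ K * (T i + 1))
    (hQ : Achieves (c.setArr a fun i => S i (b i)) T Q) : Achieves c T Q := by
  intro ρ d hρ
  obtain ⟨p, C, hp⟩ := hb.2 ρ d hρ
  have hρ₁ : ∀ r ∈ d :: ρ, r < d + 2 := by
    simp only [List.mem_cons, forall_eq_or_imp]
    exact ⟨by omega, fun r hr => (hρ r hr).trans (by omega)⟩
  obtain ⟨u, C₁, hu⟩ := haddr.2 (d :: ρ) (d + 2) hρ₁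
  obtain ⟨v, C₂, hv⟩ := hvalue.2 (d :: ρ) (d + 3) fun r hr => (hρ₁ r hr).trans (by omega)
  obtain ⟨q, C₃, hq⟩ := hQ ρ d hρ
  obtain ⟨Cb, hCb⟩ := hb.1
  obtain ⟨Cu, hCu⟩ := haddr.1
  obtain ⟨Cv, hCv⟩ := hvalue.1
  set E : ℕ := C + C₁ + C₂ + C₃ + Cb + Cu + Cv + d + 10 with hE
  refine ⟨.seq p (.seq (setReg (d + 1) (reg d)) (.seq (setReg d (.const 0))
    (.seq (.loop (.op .lt (reg d) (reg (d + 1)))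
      (.seq u (.seq v (.seq (.store a (reg (d + 2)) (reg (d + 3)))
        (setReg d (.op .add (reg d) (.const 1))))))) q))), E + (C₁ + C₂ + 30) * K + 50,
    fun i σ hσ => ?_⟩
  have hbE := Ctx.le_bound (c := c) E i
  have hB : b i < c.bound E i := (hCb i).trans_le (Ctx.bound_mono (by omega) i)
  suffices hmain : Runs (c.bound E i) _ σ (C * (T i + 1) + (4 + (3 +
      ((b i * (5 + 1 + (C₁ * (T' i + 1) + (C₂ * (T' i + 1) + (5 + 6)))) + (5 + 1)) +
        C₃ * (T i + 1))))) (Q i) by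
    refine hmain.mono (Ctx.bound_mono (by omega) i) ?_ fun _ h => h
    have h1 : (C₁ + C₂ + 30) * ((b i + 1) * (T' i + 1)) ≤ (C₁ + C₂ + 30) * (K * (T i + 1)) :=
      Nat.mul_le_mul_left _ (hT i)
    have h2 : (C₁ + C₂ + 30) * ((b i + 1) * (T' i + 1)) = b i * (C₁ * (T' i + 1)) +
      b i * (C₂ * (T' i + 1)) + (C₁ + C₂) * (T' i + 1)
      + 30 * b i * T' i + 30 * b i + 30 * T' i + 30 := by ring
    have h3 : (E + (C₁ + C₂ + 30) * K + 50) * (T i + 1) =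
      C * (T i + 1) + C₃ * (T i + 1) + (C₁ + C₂ + Cb + Cu + Cv + d + 10) * (T i + 1)
        + (C₁ + C₂ + 30) * (K * (T i + 1)) + 50 * (T i + 1) := by rw [hE]; ring
    rw [h3]
    nlinarith [Nat.zero_le ((C₁ + C₂ + Cb + Cu + Cv + d + 10) * (T i + 1)),
      Nat.zero_le (b i * T' i), Nat.zero_le ((C₁ + C₂) * (T' i + 1))]
  refine Runs.seq ((hp i σ hσ).mono (Ctx.bound_mono (by omega) i) le_rfl fun _ h => h) ?_
  rintro σ₁ ⟨hF₁, hd₁⟩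
  refine Runs.seq (Q₁ := fun σ' => FrameEq d σ σ' ∧ σ' 4 (d + 1) = b i) (Runs.setReg (by omega)
    ⟨show d < _ by omega, ?_⟩ (by simp [RamExpr.cost])
    ⟨hF₁.trans (FrameEq.write _ _ (by omega)), ?_⟩) ?_
  · simpa only [RamExpr.val, hd₁] using hB
  · simp only [RamState.write_same, RamExpr.val, hd₁]
  rintro σ₂ ⟨hF₂, hd₂⟩
  refine Runs.seq (Q₁ := fun σ' => FrameEq d σ σ' ∧ σ' 4 (d + 1) = b i ∧ σ' 4 d = 0)
    (Runs.setReg (by omega) (show 0 < _ by omega) (by simp [RamExpr.cost])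
    ⟨hF₂.trans (FrameEq.write _ _ (by omega)), ?_, ?_⟩) ?_
  · rw [RamState.write_ne _ _ (by omega), hd₂]
  · simp only [RamState.write_same, RamExpr.val]
  rintro σ₃ ⟨hF₃, hd₃, he₃⟩
  have hHolds : ∀ j τ, (∀ x, x ≠ 4 → x ≠ a → τ x = c.arr i x) → τ a = S i j →
      (∀ x < d, τ 4 x = σ 4 x) → (c.setArr a fun i => S i j).Holds ρ i τ := by
    intro j τ h1 h2 h3
    refine ⟨fun x hx => ?_, hσ.2.1, fun q hq => ?_⟩
    · by_cases hxa : x = a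
      · subst hxa; simp [Ctx.setArr, h2]
      · simp [Ctx.setArr, hxa, h1 x hx hxa]
    · rw [h3 _ (hρ _ (List.of_mem_zip hq).1)]
      exact hσ.2.2 q hq
  refine Runs.seq (Runs.loop (fun j τ => (∀ x, x ≠ 4 → x ≠ a → τ x = c.arr i x) ∧ τ a = S i j ∧
    (∀ x < d, τ 4 x = σ 4 x) ∧ τ 4 (d + 1) = b i ∧ τ 4 d = j)
    (C₁ * (T' i + 1) + (C₂ * (T' i + 1) + (5 + 6))) (b i) ?_ ?_
    ⟨fun x hx _ => (hF₃.1 x hx).trans (hσ.1 x hx), by rw [h0, hF₃.1 a ha, hσ.1 a ha],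
      hF₃.2, hd₃, he₃⟩) ?_
  · rintro j hj τ ⟨ha1, ha2, hr, h1, h0⟩
    refine ⟨⟨⟨show d < _ by omega, ?_⟩, ⟨show d + 1 < _ by omega, ?_⟩, ?_⟩, ?_, ?_⟩
    · simp only [RamExpr.val, h0]; omega
    · simp only [RamExpr.val, h1]; omega
    · simp only [RamExpr.val, h0, h1, WordOp.apply, hj, if_true]; omega
    · simp only [RamExpr.val, h0, h1, WordOp.apply, hj, if_true]; omega
    have hH : ∀ τ', FrameEq (d + 2) τ τ' → ((c.loop b).setArr a fun p => S p.1 p.2).Holds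
        (d :: ρ) ⟨i, ⟨j, hj⟩⟩ τ' := by
      intro τ' hF
      have := hHolds j τ' (fun x hx hx' => (hF.1 x hx).trans (ha1 x hx hx'))
        ((hF.1 a ha).trans ha2) fun x hx => (hF.2 x (by omega)).trans (hr x hx)
      have h2 : (((c.comap Sigma.fst).setArr a fun p : (Σ i, Fin (b i)) => S p.1 p.2)).Holds
          ρ ⟨i, ⟨j, hj⟩⟩ τ' := ⟨this.1, by simpa [Ctx.setArr, Ctx.comap] using hσ.2.1,
            (Ctx.Holds.comap (π := (Sigma.fst : (Σ i, Fin (b i)) → ι)) (i := ⟨i, ⟨j, hj⟩⟩)).2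
              this |>.2.2⟩
      exact h2.push (f := fun p : (Σ i, Fin (b i)) => (p.2 : ℕ))
        ((hF.2 d (by omega)).trans h0)
    have hcu := (hCu ⟨i, ⟨j, hj⟩⟩).trans_le (Ctx.bound_mono (c := c) (show Cu ≤ E by omega) i)
    have hcv := (hCv ⟨i, ⟨j, hj⟩⟩).trans_le (Ctx.bound_mono (c := c) (show Cv ≤ E by omega) i)
    refine Runs.seq ((hu ⟨i, ⟨j, hj⟩⟩ τ (hH τ (FrameEq.refl _ _))).mono
      (Ctx.bound_mono (c := c) (show C₁ ≤ E by omega) i) le_rfl fun _ h => h) ?_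
    rintro τ₁ ⟨hG₁, hk₁⟩
    refine Runs.seq ((hv ⟨i, ⟨j, hj⟩⟩ τ₁ (hH τ₁ hG₁)).mono
      (Ctx.bound_mono (c := c) (show C₂ ≤ E by omega) i) le_rfl fun _ h => h) ?_
    rintro τ₂ ⟨hG₂, hk₂⟩
    have hk₁' : τ₂ 4 (d + 2) = addr i j := (hG₂.2 _ (by omega)).trans hk₁
    have hF' : FrameEq (d + 2) τ τ₂ := hG₁.trans (hG₂.mono (by omega))
    refine Runs.seq (Q₁ := fun τ => (∀ x, x ≠ 4 → x ≠ a → τ x = c.arr i x) ∧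
      τ a = S i (j + 1) ∧ (∀ x < d, τ 4 x = σ 4 x) ∧ τ 4 (d + 1) = b i ∧ τ 4 d = j)
      (Runs.store ⟨show d + 2 < _ by omega, ?_⟩ ⟨show d + 3 < _ by omega, ?_⟩
        (by simp [RamExpr.cost]) ⟨fun x hx hx' => ?_, ?_, fun x hx => ?_, ?_, ?_⟩) ?_
    · simpa only [RamExpr.val, hk₁'] using hcu
    · simpa only [RamExpr.val, hk₂] using hcv
    · rw [RamState.write_ne_arr _ _ _ hx', hF'.1 x hx, ha1 x hx hx']
    · simp only [RamState.write, RamExpr.val, hk₁', hk₂, Function.update_self]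
      rw [hS i j hj, hF'.1 a ha, ha2]
    · rw [RamState.write_ne_arr _ _ _ ha.symm, hF'.2 x (by omega), hr x hx]
    · rw [RamState.write_ne_arr _ _ _ ha.symm, hF'.2 _ (by omega), h1]
    · rw [RamState.write_ne_arr _ _ _ ha.symm, hF'.2 _ (by omega), h0]
    rintro τ₃ ⟨g1, g2, g3, g4, g5⟩
    refine Runs.setReg (by omega) ⟨⟨show d < _ by omega, ?_⟩, show 1 < _ by omega, ?_⟩
      (by simp [RamExpr.cost]) ⟨fun x hx hx' => ?_, ?_, fun x hx => ?_, ?_, ?_⟩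
    · simp only [RamExpr.val, g5]; omega
    · simp only [RamExpr.val, g5, WordOp.apply]; omega
    · rw [RamState.write_ne_arr _ _ _ hx, g1 x hx hx']
    · rw [RamState.write_ne_arr _ _ _ ha, g2]
    · rw [RamState.write_ne _ _ (by omega), g3 x hx]
    · rw [RamState.write_ne _ _ (by omega), g4]
    · simp only [RamState.write_same, RamExpr.val, g5, WordOp.apply]
  · rintro τ ⟨ha1, ha2, hr, h1, h0⟩
    refine ⟨⟨⟨show d < _ by omega, ?_⟩, ⟨show d + 1 < _ by omega, ?_⟩, ?_⟩, ?_⟩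
    · simp only [RamExpr.val, h0]; omega
    · simp only [RamExpr.val, h1]; omega
    · simp only [RamExpr.val, h0, h1, WordOp.apply, lt_irrefl, if_false]; omega
    · simp only [RamExpr.val, h0, h1, WordOp.apply, lt_irrefl, if_false]
  · rintro τ ⟨ha1, ha2, hr, h1, h0⟩
    have hH := hHolds (b i) τ ha1 ha2 hr
    exact (hq i τ ⟨hH.1, hH.2.1, hH.2.2⟩).mono
      (Ctx.bound_mono (c := c) (show C₃ ≤ E by omega) i) le_rfl fun _ h => h

theorem fill (a : ℕ) (ha : a ≠ 4) {b : ι → ℕ} {g : ι → ℕ → ℕ} (hb : Comp c T b)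
    (hg : Comp ((c.loop b).setArr a fun p x => if x < p.2 then g p.1 x else c.arr p.1 a x)
      (fun p => T' p.1) fun p => g p.1 p.2)
    (K : ℕ) (hT : ∀ i, (b i + 1) * (T' i + 1) ≤ K * (T i + 1))
    (hQ : Achieves (c.setArr a fun i x => if x < b i then g i x else c.arr i a x) T Q) :
    Achieves c T Q := by
  refine scatter a ha (b := b) (addr := fun _ j => j) (value := g)
    (fun i j x => if x < j then g i x else c.arr i a x) (fun i => by simp) (fun i j _ => ?_) hb ?_
    hg K hT hQ
  · funext x
    by_cases hx : x = j
    · subst hx; simp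
    · simp only [Function.update_of_ne hx]
      have : x < j + 1 ↔ x < j := by omega
      simp only [this]
  · exact (Var.counter hb.bdd).setArr.comp

end Achieves

end

/-! ### Sign changes and moments -/

/-- A polynomial with a simple zero strictly between the two positions of every sign change has
degree at most `m` and is nonzero at all positions. Its product with `u` has constant sign, while
the vanishing moments make the sum of the products zero; so every product is zero. -/
theorem eq_zero_of_sign_changes {L m : ℕ} {u : ℕ → ℤ} {τ : ℕ → Prop} [DecidablePred τ]
    (hpos : ∀ l < L, τ l → 0 ≤ u l) (hneg : ∀ l < L, ¬ τ l → u l ≤ 0)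
    (hm : ((Finset.range (L - 1)).filter fun l => ¬ (τ l ↔ τ (l + 1))).card ≤ m)
    (hmom : ∀ e ≤ m, ∑ l ∈ Finset.range L, ((l : ℤ) + 1) ^ e * u l = 0) :
    ∀ l < L, u l = 0 := by
  classical
  set S := (Finset.range (L - 1)).filter fun l => ¬ (τ l ↔ τ (l + 1)) with hS
  -- The factor for `r` vanishes at `r + 3/2`, halfway between the arguments `l + 1` for `l = r` and
  -- `l = r + 1`. Doubling keeps the coefficients integral.
  set p : Polynomial ℤ := ∏ r ∈ S, (Polynomial.C 2 * Polynomial.X - Polynomial.C (2 * (r : ℤ) + 3))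
    with hp
  have hdeg : p.natDegree ≤ m := by
    refine le_trans (Polynomial.natDegree_prod_le _ _) (le_trans (Finset.sum_le_card_nsmul _ _ 1
      fun r _ => ?_) (by simpa using hm))
    compute_degree
  set P : ℕ → ℤ := fun l => p.eval ((l : ℤ) + 1) with hP
  have hPl : ∀ l, P l = ∏ r ∈ S, (2 * ((l : ℤ) + 1) - (2 * (r : ℤ) + 3)) := fun l => by
    simp [hP, hp, Polynomial.eval_prod]
  have hsum : ∑ l ∈ Finset.range L, P l * u l = 0 := by
    simp only [hP, Polynomial.eval_eq_sum_range, Finset.sum_mul]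
    rw [Finset.sum_comm]
    refine Finset.sum_eq_zero fun e he => ?_
    have := hmom e (by simp at he; omega)
    rw [← mul_zero (p.coeff e), ← this, Finset.mul_sum]
    exact Finset.sum_congr rfl fun l _ => by ring
  set sg : ℕ → ℤ := fun l => if τ l then 1 else -1 with hsg
  have hsq : ∀ l, sg l * sg l = 1 := fun l => by
    simp only [hsg]; split_ifs <;> norm_num
  have hstep : ∀ l, l + 1 < L → 0 < (P l * sg l) * (P (l + 1) * sg (l + 1)) := by
    intro l hl
    -- The values of one factor at neighbouring positions are `2(l-r) - 1` and `2(l-r) + 1`. Their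
    -- product is negative only for `l = r`, so `P` changes sign exactly at the elements of `S`.
    have h1 : P l * P (l + 1) = ∏ r ∈ S, (4 * ((l : ℤ) - r) ^ 2 - 1) := by
      rw [hPl, hPl, ← Finset.prod_mul_distrib]
      refine Finset.prod_congr rfl fun r _ => ?_
      push_cast
      ring
    have h2 : ∀ r ∈ S.erase l, 0 < 4 * ((l : ℤ) - r) ^ 2 - 1 := by
      intro r hr
      have : (l : ℤ) - r ≠ 0 := by
        have := (Finset.mem_erase.1 hr).1
        omega
      have := Int.one_le_abs this
      nlinarith [sq_abs ((l : ℤ) - r)]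
    have h3 := Finset.prod_pos h2
    have h4 : (P l * sg l) * (P (l + 1) * sg (l + 1)) = (P l * P (l + 1)) * (sg l * sg (l + 1)) := by
      ring
    rw [h4, h1]
    by_cases hlS : l ∈ S
    · rw [← Finset.mul_prod_erase _ _ hlS]
      have : ¬ (τ l ↔ τ (l + 1)) := (Finset.mem_filter.1 hlS).2
      have h5 : sg l * sg (l + 1) = -1 := by
        simp only [hsg]
        by_cases h : τ l <;> by_cases h' : τ (l + 1) <;> simp_all
      rw [h5]
      nlinarith
    · rw [Finset.erase_eq_of_notMem hlS] at h3
      have : τ l ↔ τ (l + 1) := by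
        by_contra h
        exact hlS (Finset.mem_filter.2 ⟨Finset.mem_range.2 (by omega), h⟩)
      have h5 : sg l * sg (l + 1) = 1 := by
        simp only [hsg]
        by_cases h : τ l <;> by_cases h' : τ (l + 1) <;> simp_all
      rw [h5]
      linarith
  intro l hl
  have hL : 0 < L := by omega
  have hPne : ∀ l, P l ≠ 0 := fun l => by
    rw [hPl]
    refine Finset.prod_ne_zero_iff.2 fun r _ => ?_
    omega
  have hsgne : ∀ l, sg l ≠ 0 := fun l => by simp only [hsg]; split_ifs <;> norm_num
  have hall : ∀ l < L, 0 < (P 0 * sg 0) * (P l * sg l) := by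
    intro l
    induction l with
    | zero =>
      intro _
      exact mul_self_pos.2 (mul_ne_zero (hPne 0) (hsgne 0))
    | succ l ih =>
      intro h
      have h1 := ih (by omega)
      have h2 := hstep l h
      have h3 : 0 < (P l * sg l) * (P l * sg l) := mul_self_pos.2 (mul_ne_zero (hPne l) (hsgne l))
      have h4 := mul_pos h1 h2
      have h5 : P 0 * sg 0 * (P l * sg l) * (P l * sg l * (P (l + 1) * sg (l + 1))) =
        (P l * sg l * (P l * sg l)) * (P 0 * sg 0 * (P (l + 1) * sg (l + 1))) := by ring
      rw [h5] at h4
      exact pos_of_mul_pos_right h4 h3.le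
  have hterm : ∀ l ∈ Finset.range L, 0 ≤ (P 0 * sg 0) * (P l * u l) := by
    intro l hl
    have hl' := Finset.mem_range.1 hl
    have h1 : (P 0 * sg 0) * (P l * u l) = ((P 0 * sg 0) * (P l * sg l)) * (sg l * u l) := by
      have := hsq l
      calc _ = (P 0 * sg 0) * (P l * u l) * (sg l * sg l) := by rw [this, mul_one]
        _ = _ := by ring
    rw [h1]
    refine mul_nonneg (hall l hl').le ?_
    simp only [hsg]
    split_ifs with h
    · simpa using hpos l hl' h
    · simpa using hneg l hl' h
  have h0 : ∑ l ∈ Finset.range L, (P 0 * sg 0) * (P l * u l) = 0 := by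
    rw [← Finset.mul_sum, hsum, mul_zero]
  have := (Finset.sum_eq_zero_iff_of_nonneg hterm).1 h0 l (Finset.mem_range.2 hl)
  simpa [hPne, hsgne] using this

/-- The positions that remain after the deletion of position `d`. -/
def skip (d j : ℕ) : ℕ := if j < d then j else j + 1

theorem sum_Ico_skip {M : Type*} [AddCommMonoid M] (a : ℕ → M) {d L : ℕ} (hd : d < L) {l : ℕ}
    (hl : l ≤ L) : ∑ i ∈ Finset.Ico l L, a i = if l ≤ d
      then ∑ j ∈ Finset.Ico l (L - 1), a (skip d j) + a d
      else ∑ j ∈ Finset.Ico (l - 1) (L - 1), a (skip d j) := by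
  induction hl using Nat.decreasingInduction with
  | self => rw [if_neg (by omega)]; simp
  | of_succ l hl ih =>
    rw [Finset.sum_eq_sum_Ico_succ_bot (by omega), ih]
    rcases lt_trichotomy l d with h | h | h
    · rw [if_pos (by omega), if_pos (by omega), Finset.sum_eq_sum_Ico_succ_bot (a := l) (by omega)]
      simp only [skip, h, if_true, add_assoc]
    · rw [if_neg (by omega), if_pos (by omega), h, add_comm, Nat.add_sub_cancel]
    · rw [if_neg (by omega), if_neg (by omega),
        Finset.sum_eq_sum_Ico_succ_bot (a := l - 1) (by omega)]
      have h1 : skip d (l - 1) = l := by simp only [skip]; split_ifs <;> omega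
      rw [h1, Nat.add_sub_cancel, show l - 1 + 1 = l by omega]

theorem weight_succ (j i : ℕ) : weight j (i + 1) = ∑ l ∈ Finset.range (i + 1), (l + 1) ^ (j - 1) := by
  rw [weight, Finset.range_eq_Ico, Finset.sum_Ico_add' (fun l => l ^ (j - 1)) 0 (i + 1) 1]
  rfl

/-- Abel summation. Because the weights are sums of powers, the weighted sums of a word are the
power moments of its tail sums. -/
theorem sum_mul_weight (j L : ℕ) (e : ℕ → ℤ) :
    ∑ i ∈ Finset.range L, e i * (weight j (i + 1) : ℤ) =
      ∑ l ∈ Finset.range L, ((l : ℤ) + 1) ^ (j - 1) * ∑ i ∈ Finset.Ico l L, e i := by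
  simp only [weight_succ, Nat.cast_sum, Nat.cast_pow, Nat.cast_add, Nat.cast_one, Finset.mul_sum]
  simp only [Finset.range_eq_Ico]
  rw [Finset.sum_comm' (t' := Finset.Ico 0 L) (s' := fun l => Finset.Ico l L)]
  · exact Finset.sum_congr rfl fun l _ => Finset.sum_congr rfl fun i _ => by ring
  · intro x y
    simp only [Finset.mem_Ico]
    omega

/-- Let `Y` be the tail sums of the difference of the two shortened words and `β = b d'`. Up to the
shift `π` of the positions beyond `d`, the tail sum `u` exceeds `Y - β` by `0` or `1`. Thus the sign
of `u` is governed by whether `β ≤ Y`, and this can change only where `Y` changes, that is, at one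
of at most `2s` mismatches. The sizes of the tail sums make the congruences equalities, and the
criterion on sign changes applies. -/
theorem eq_of_moments_of_le {s L : ℕ} (hs : 1 ≤ s) {a b : ℕ → ℤ} (ha : ∀ i, a i = 0 ∨ a i = 1)
    (hb : ∀ i, b i = 0 ∨ b i = 1) {d d' : ℕ} (hdd : d ≤ d') (hd' : d' < L)
    (hcount : ((Finset.range (L - 1)).filter fun j => a (skip d j) ≠ b (skip d' j)).card ≤ 2 * s)
    (hmod : ∀ j ∈ Finset.Icc 1 (2 * s + 1), (((2 * s + 1) * L ^ j : ℕ) : ℤ) ∣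
      ∑ i ∈ Finset.range L, (a i - b i) * (weight j (i + 1) : ℤ)) :
    ∀ i < L, a i = b i := by
  classical
  set A : ℕ → ℤ := fun j => a (skip d j) with hA
  set B : ℕ → ℤ := fun j => b (skip d' j) with hB
  set Y : ℕ → ℤ := fun l => ∑ j ∈ Finset.Ico l (L - 1), (A j - B j) with hY
  set u : ℕ → ℤ := fun l => ∑ i ∈ Finset.Ico l L, (a i - b i) with hu
  set β := b d' with hβ
  set π : ℕ → ℕ := fun l => if l ≤ d then l else l - 1 with hπ
  have hβ01 : β = 0 ∨ β = 1 := hb d'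
  -- For `l ≤ d` the excess over `Y - β` is `a d`, between the two positions it is the symbol `B (l
  -- - 1)`, and beyond `d'` it is `β` itself. The order `d ≤ d'` ensures that the excess is never
  -- `-1`.
  have hY01 : ∀ l < L, u l = Y (π l) - β ∨ u l = Y (π l) - β + 1 := by
    intro l hl
    simp only [hu, Finset.sum_sub_distrib]
    rw [sum_Ico_skip a (by omega : d < L) hl.le, sum_Ico_skip b hd' hl.le]
    simp only [hπ, hY, Finset.sum_sub_distrib]
    by_cases h1 : l ≤ d
    · simp only [h1, h1.trans hdd, if_true]
      rcases ha d with h | h <;> rw [h]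
      · left; ring
      · right; ring
    · by_cases h2 : l ≤ d'
      · simp only [h1, h2, if_true, if_false]
        have h3 : ∑ j ∈ Finset.Ico (l - 1) (L - 1), B j = B (l - 1) + ∑ j ∈ Finset.Ico l (L - 1), B j := by
          rw [Finset.sum_eq_sum_Ico_succ_bot (by omega), show l - 1 + 1 = l by omega]
        rw [h3]
        rcases hb (skip d' (l - 1)) with h | h
        · left; simp only [hB, h]; ring
        · right; simp only [hB, h]; ring
      · simp only [h1, h2, if_false]
        rcases hβ01 with h | h <;> rw [h]
        · left; ring
        · right; ring
  have habs : ∀ j, |A j - B j| ≤ if A j ≠ B j then 1 else 0 := by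
    intro j
    by_cases h : A j = B j
    · simp [h]
    · simp only [ne_eq, h, not_false_eq_true, if_true]
      rcases ha (skip d j) with h1 | h1 <;> rcases hb (skip d' j) with h2 | h2 <;>
        simp [hA, hB, h1, h2]
  have hYb : ∀ l, |Y l| ≤ 2 * s := by
    intro l
    calc |Y l| ≤ ∑ j ∈ Finset.Ico l (L - 1), |A j - B j| := Finset.abs_sum_le_sum_abs _ _
      _ ≤ ∑ j ∈ Finset.Ico l (L - 1), (if A j ≠ B j then 1 else 0) :=
          Finset.sum_le_sum fun j _ => habs j
      _ ≤ ∑ j ∈ Finset.range (L - 1), (if A j ≠ B j then (1 : ℤ) else 0) := by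
          refine Finset.sum_le_sum_of_subset_of_nonneg ?_ fun j _ _ => by split_ifs <;> norm_num
          intro j hj
          simp at hj ⊢
          omega
      _ ≤ 2 * s := by
          rw [Finset.sum_boole]
          exact_mod_cast hcount
  have hub : ∀ l < L, |u l| ≤ 2 * s + 1 := by
    intro l hl
    have h1 := abs_le.1 (hYb (π l))
    rw [abs_le]
    rcases hY01 l hl with h | h <;> rcases hβ01 with h' | h' <;> rw [h, h'] <;>
      constructor <;> linarith [h1.1, h1.2]
  -- The modulus is exactly the sum of the crude bounds `(2s+1) L^e` over all positions, so a strict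
  -- inequality is needed somewhere. The last tail sum consists of one term and provides it.
  have hlast : |u (L - 1)| ≤ 1 := by
    have : u (L - 1) = a (L - 1) - b (L - 1) := by
      simp only [hu]
      rw [Finset.sum_eq_sum_Ico_succ_bot (by omega)]
      rw [show L - 1 + 1 = L by omega]
      simp
    rw [this]
    rcases ha (L - 1) with h1 | h1 <;> rcases hb (L - 1) with h2 | h2 <;> simp [h1, h2]
  have hmom : ∀ e ≤ 2 * s, ∑ l ∈ Finset.range L, ((l : ℤ) + 1) ^ e * u l = 0 := by
    intro e he
    have h1 := hmod (e + 1) (by simp; omega)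
    rw [sum_mul_weight, Nat.add_sub_cancel] at h1
    refine Int.eq_zero_of_abs_lt_dvd h1 ?_
    calc |∑ l ∈ Finset.range L, ((l : ℤ) + 1) ^ e * u l|
        ≤ ∑ l ∈ Finset.range L, |((l : ℤ) + 1) ^ e * u l| := Finset.abs_sum_le_sum_abs _ _
      _ < ∑ l ∈ Finset.range L, (L : ℤ) ^ e * (2 * s + 1) := by
          refine Finset.sum_lt_sum (fun l hl => ?_) ⟨L - 1, by simp; omega, ?_⟩
          · have hl := Finset.mem_range.1 hl
            rw [abs_mul, abs_of_nonneg (by positivity : (0 : ℤ) ≤ ((l : ℤ) + 1) ^ e)]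
            refine mul_le_mul ?_ (hub l hl) (abs_nonneg _) (by positivity)
            exact pow_le_pow_left₀ (by positivity) (by omega) e
          · rw [abs_mul, abs_of_nonneg (by positivity : (0 : ℤ) ≤ (((L - 1 : ℕ) : ℤ) + 1) ^ e)]
            have h2 : ((L - 1 : ℕ) : ℤ) + 1 = L := by omega
            rw [h2]
            have h3 : (0 : ℤ) < (L : ℤ) ^ e := pow_pos (by omega) e
            have h4 : (1 : ℤ) ≤ s := by exact_mod_cast hs
            nlinarith
      _ = _ := by
          simp only [Finset.sum_const, Finset.card_range, nsmul_eq_mul]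
          push_cast
          ring
  have hu0 : ∀ l < L, u l = 0 := by
    -- Since `Y - β` is an integer, the two possible values of `u` are both nonnegative if `β ≤ Y`
    -- and both nonpositive otherwise.
    refine eq_zero_of_sign_changes (m := 2 * s) (τ := fun l => β ≤ Y (π l)) ?_ ?_ ?_ hmom
    · intro l hl h
      rcases hY01 l hl with h' | h' <;> rw [h'] <;> linarith
    · intro l hl h
      rcases hY01 l hl with h' | h' <;> rw [h'] <;> omega
    -- A change between `l` and `l + 1` requires a mismatch at `π l`. The only collision of `π` is
    -- between `d` and `d + 1`, and there is no change at `d`, where `Y` is read twice at the same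
    -- place.
    · refine le_trans (Finset.card_le_card_of_injOn π ?_ ?_) hcount
      · intro l hl
        simp only [Finset.coe_filter, Set.mem_ofPred_eq, Finset.mem_range] at hl ⊢
        obtain ⟨hl, hne⟩ := hl
        have h1 : π l < L - 1 := by simp only [hπ]; split_ifs <;> omega
        refine ⟨h1, fun heq => hne ?_⟩
        have h2 : Y (π l) = Y (π (l + 1)) := by
          by_cases h3 : l = d
          · subst h3; simp [hπ]
          · have h4 : π (l + 1) = π l + 1 := by simp only [hπ]; split_ifs <;> omega
            rw [h4]
            simp only [hY]
            rw [Finset.sum_eq_sum_Ico_succ_bot h1]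
            simp only [hA, hB, heq, sub_self, zero_add]
        rw [h2]
      · intro l hl l' hl' h
        simp only [Finset.coe_filter, Set.mem_ofPred_eq] at hl hl'
        have key : ∀ l, ¬(β ≤ Y (π l) ↔ β ≤ Y (π (l + 1))) → l ≠ d := by
          intro l h h'
          subst h'
          simp [hπ] at h
        have h1 := key l hl.2
        have h2 := key l' hl'.2
        simp only [hπ] at h
        split_ifs at h <;> omega
  intro i hi
  have h1 := hu0 i hi
  have h2 : u i = a i - b i + u (i + 1) := by
    simp only [hu]
    rw [Finset.sum_eq_sum_Ico_succ_bot hi]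
  have h3 : u (i + 1) = 0 := by
    by_cases h : i + 1 < L
    · exact hu0 _ h
    · simp only [hu]
      rw [Finset.Ico_eq_empty (by omega)]
      simp
  omega

theorem eq_of_moments {s L : ℕ} (hs : 1 ≤ s) {a b : ℕ → ℤ} (ha : ∀ i, a i = 0 ∨ a i = 1)
    (hb : ∀ i, b i = 0 ∨ b i = 1) {d d' : ℕ} (hd : d < L) (hd' : d' < L)
    (hcount : ((Finset.range (L - 1)).filter fun j => a (skip d j) ≠ b (skip d' j)).card ≤ 2 * s)
    (hmod : ∀ j ∈ Finset.Icc 1 (2 * s + 1), (((2 * s + 1) * L ^ j : ℕ) : ℤ) ∣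
      ∑ i ∈ Finset.range L, (a i - b i) * (weight j (i + 1) : ℤ)) :
    ∀ i < L, a i = b i := by
  rcases le_total d d' with h | h
  · exact eq_of_moments_of_le hs ha hb h hd' hcount hmod
  · refine fun i hi => (eq_of_moments_of_le hs hb ha h hd ?_ ?_ i hi).symm
    · simpa only [ne_comm] using hcount
    · intro j hj
      rw [← dvd_neg, ← Finset.sum_neg_distrib]
      rw [Finset.sum_congr rfl fun i _ => show -((b i - a i) * (weight j (i + 1) : ℤ)) =
        (a i - b i) * (weight j (i + 1) : ℤ) by ring]
      exact hmod j hj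

section

/-! ### Words as functions -/

/-- The word `x`, continued by zeros. -/
def Bits.ext {L : ℕ} (x : Bits L) (j : ℕ) : ZMod 2 := if h : j < L then x ⟨j, h⟩ else 0

theorem Bits.ext_fin {L : ℕ} (x : Bits L) (j : Fin L) : x.ext j = x j := by simp [Bits.ext]

theorem Bits.ext_of_lt {L : ℕ} (x : Bits L) {j : ℕ} (h : j < L) : x.ext j = x ⟨j, h⟩ := by
  simp [Bits.ext, h]

theorem Bits.eq_of_ext {L : ℕ} {x y : Bits L} (h : ∀ j < L, x.ext j = y.ext j) : x = y := by
  funext j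
  rw [← x.ext_fin, ← y.ext_fin, h j j.isLt]

theorem hammingDist_eq_card {L : ℕ} (x y : Bits L) :
    hammingDist x y = ((Finset.range L).filter fun j => x.ext j ≠ y.ext j).card := by
  rw [hammingDist, Finset.card_filter, Finset.card_filter,
    ← Fin.sum_univ_eq_sum_range (fun j => if x.ext j ≠ y.ext j then 1 else 0) L]
  simp only [Bits.ext_fin]

/-- The word `y` of length `L - 1` arises from the word `x` of length `L` by the deletion of
position `d` and at most `s` substitutions. -/
def Near (s L d : ℕ) (y x : ℕ → ZMod 2) : Prop :=
  ((Finset.range (L - 1)).filter fun j => y j ≠ x (skip d j)).card ≤ s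

theorem skip_lt {d j L : ℕ} (h : j < L - 1) : skip d j < L := by
  simp only [skip]; split_ifs <;> omega

theorem skip_strictMono (d : ℕ) : StrictMono (skip d) := by
  intro a b h
  simp only [skip]
  split_ifs <;> omega

/-- An increasing map into one more point satisfies `j ≤ φ j ≤ j + 1`, and once it has jumped it
remains ahead. The missing point `d` is the first `j` with `φ j = j + 1`. -/
theorem exists_skip {L : ℕ} (hL : 1 ≤ L) (φ : Fin (L - 1) ↪o Fin L) :
    ∃ d < L, ∀ j : Fin (L - 1), (φ j : ℕ) = skip d j := by
  have hlo : ∀ j : Fin (L - 1), (j : ℕ) ≤ φ j := by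
    rintro ⟨j, hj⟩
    induction j with
    | zero => simp
    | succ j ih =>
      have h1 := ih (by omega)
      have h2 : φ ⟨j, by omega⟩ < φ ⟨j + 1, hj⟩ := φ.strictMono (by simp)
      rw [Fin.lt_def] at h2
      simp only at h1 ⊢
      omega
  have hhi : ∀ r : ℕ, ∀ j : Fin (L - 1), (j : ℕ) + r = L - 2 → (φ j : ℕ) ≤ j + 1 := by
    intro r
    induction r with
    | zero =>
      intro j hj
      have := (φ j).isLt
      omega
    | succ r ih =>
      intro j hj
      have h1 := ih ⟨j + 1, by omega⟩ (by simp only; omega)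
      have h2 : φ j < φ ⟨j + 1, by omega⟩ := φ.strictMono (by simp [Fin.lt_def])
      rw [Fin.lt_def] at h2
      simp only at h1
      omega
  have hhi' : ∀ j : Fin (L - 1), (φ j : ℕ) ≤ j + 1 := fun j =>
    hhi (L - 2 - j) j (by have := j.isLt; omega)
  have hmono : ∀ i j : Fin (L - 1), i ≤ j → (φ i : ℕ) = i + 1 → (φ j : ℕ) = j + 1 := by
    intro i j hij hi
    rcases hij.eq_or_lt with rfl | hlt
    · exact hi
    · by_contra hne
      have h1 : (φ j : ℕ) = j := by have := hlo j; have := hhi' j; omega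
      obtain ⟨m, hm⟩ := Nat.exists_eq_add_of_lt (Fin.lt_def.1 hlt)
      have key : ∀ m, ∀ j : Fin (L - 1), (j : ℕ) = i + m → (φ j : ℕ) = j + 1 := by
        intro m
        induction m with
        | zero => intro j hj; obtain rfl : j = i := Fin.ext (by simpa using hj); exact hi
        | succ m ih =>
          intro j hj
          have h2 := ih ⟨i + m, by have := j.isLt; omega⟩ rfl
          have h3 : φ ⟨i + m, by have := j.isLt; omega⟩ < φ j := φ.strictMono (by
            rw [Fin.lt_def]; simp only; omega)
          rw [Fin.lt_def] at h3
          simp only at h2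
          have := hhi' j
          omega
      exact hne (key _ j (by rw [hm, add_assoc]))
  by_cases h : ∃ j : Fin (L - 1), (φ j : ℕ) = j + 1
  · classical
    let d := (Finset.univ.filter fun j : Fin (L - 1) => (φ j : ℕ) = j + 1).min' (by
      obtain ⟨j, hj⟩ := h
      exact ⟨j, by simp [hj]⟩)
    have hd : (φ d : ℕ) = d + 1 := by
      have := Finset.min'_mem (Finset.univ.filter fun j : Fin (L - 1) => (φ j : ℕ) = j + 1) (by
        obtain ⟨j, hj⟩ := h
        exact ⟨j, by simp [hj]⟩)
      exact (Finset.mem_filter.1 this).2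
    refine ⟨d, by have := d.isLt; omega, fun j => ?_⟩
    simp only [skip]
    split_ifs with hjd
    · by_contra hne
      have h1 : (φ j : ℕ) = j + 1 := by have := hlo j; have := hhi' j; omega
      have : d ≤ j := Finset.min'_le _ _ (by simp [h1])
      rw [Fin.le_def] at this
      omega
    · exact hmono d j (by rw [Fin.le_def]; omega) hd
  · push Not at h
    -- No jump at all means that the last position is the missing one.
    refine ⟨L - 1, by omega, fun j => ?_⟩
    have := hlo j
    have := hhi' j
    have := h j
    have := j.isLt
    simp only [skip]
    split_ifs
    omega

/-- From here on, errors are described by functions on `ℕ` and an explicit deleted position; this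
avoids words whose length is a dependent type. -/
theorem mem_errorBall {s L : ℕ} (hL : 1 ≤ L) {x : Bits L} {y : Bits (L - 1)} :
    y ∈ errorBall 1 s x ↔ ∃ d < L, Near s L d y.ext x.ext := by
  have key : ∀ (φ : Fin (L - 1) ↪o Fin L) (d : ℕ), (∀ j : Fin (L - 1), (φ j : ℕ) = skip d j) →
      (hammingDist y (fun i => x (φ i)) ≤ s ↔ Near s L d y.ext x.ext) := by
    intro φ d h
    rw [hammingDist_eq_card, Near]
    have : ∀ j ∈ Finset.range (L - 1), (y.ext j ≠ Bits.ext (L := L - 1) (fun i => x (φ i)) j ↔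
        y.ext j ≠ x.ext (skip d j)) := by
      intro j hj
      have hj' := Finset.mem_range.1 hj
      have e1 : Bits.ext (L := L - 1) (fun i => x (φ i)) j = x.ext (skip d j) := by
        rw [Bits.ext_of_lt _ hj', ← h ⟨j, hj'⟩, x.ext_fin]
      rw [e1]
    rw [Finset.filter_congr this]
  constructor
  · rintro ⟨φ, hφ⟩
    obtain ⟨d, hd, h⟩ := exists_skip hL φ
    exact ⟨d, hd, (key φ d h).1 hφ⟩
  · rintro ⟨d, hd, h⟩
    let φ : Fin (L - 1) ↪o Fin L := OrderEmbedding.ofStrictMono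
      (fun j => ⟨skip d j, skip_lt j.isLt⟩) fun i j hij => skip_strictMono d hij
    exact ⟨φ, (key φ d fun j => rfl).2 h⟩

/-! ### The syndrome determines a word within its error ball -/

theorem val_eq_iff (a b : ZMod 2) : ((a.val : ℕ) : ℤ) = (b.val : ℕ) ↔ a = b := by
  rw [Nat.cast_inj]
  exact ⟨fun h => ZMod.val_injective 2 h, fun h => by rw [h]⟩

theorem val_zero_or_one (a : ZMod 2) : ((a.val : ℕ) : ℤ) = 0 ∨ ((a.val : ℕ) : ℤ) = 1 := by
  have := ZMod.val_lt a
  omega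

theorem Near.trans {s L d d' : ℕ} {y x x' : ℕ → ZMod 2} (h : Near s L d y x)
    (h' : Near s L d' y x') :
    ((Finset.range (L - 1)).filter fun j => x (skip d j) ≠ x' (skip d' j)).card ≤ 2 * s := by
  classical
  rw [two_mul]
  refine le_trans (Finset.card_le_card ?_) ((Finset.card_union_le _ _).trans (add_le_add h h'))
  intro j hj
  simp only [Finset.mem_filter, Finset.mem_union] at hj ⊢
  by_cases h1 : y j = x (skip d j)
  · right
    exact ⟨hj.1, by rw [h1]; exact hj.2⟩
  · left
    exact ⟨hj.1, h1⟩

theorem syndrome_eq {s L : ℕ} (x : Bits L) (j : ℕ) : syndrome s x j =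
    (∑ i ∈ Finset.range L, (x.ext i).val * weight j (i + 1)) % ((2 * s + 1) * L ^ j) := by
  rw [syndrome, ← Fin.sum_univ_eq_sum_range (fun i => (x.ext i).val * weight j (i + 1)) L]
  simp only [Bits.ext_fin]

theorem eq_of_syndrome_eq {s L : ℕ} (hs : 1 ≤ s) {x x' : Bits L} {y : ℕ → ZMod 2} {d d' : ℕ}
    (hd : d < L) (hd' : d' < L) (h : Near s L d y x.ext) (h' : Near s L d' y x'.ext)
    (hf : ∀ j ∈ Finset.Icc 1 (2 * s + 1), syndrome s x j = syndrome s x' j) : x = x' := by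
  refine Bits.eq_of_ext fun j hj => (val_eq_iff _ _).1 ?_
  refine eq_of_moments (a := fun j => ((x.ext j).val : ℤ)) (b := fun j => ((x'.ext j).val : ℤ)) hs
    (fun i => val_zero_or_one _) (fun i => val_zero_or_one _) hd hd' ?_ ?_ j hj
  · simpa only [ne_eq, val_eq_iff] using h.trans h'
  · intro j hj
    have := hf j hj
    rw [syndrome_eq, syndrome_eq] at this
    have h1 := (Nat.modEq_iff_dvd.1 this.symm)
    simp only [sub_mul, Finset.sum_sub_distrib]
    exact_mod_cast h1

theorem sum_mixed_radix_lt (b f : ℕ → ℕ) (hf : ∀ j, 1 ≤ j → f j < b j) (n : ℕ) :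
    ∑ j ∈ Finset.Icc 1 n, f j * ∏ i ∈ Finset.Icc 1 (j - 1), b i < ∏ i ∈ Finset.Icc 1 n, b i := by
  induction n with
  | zero => simp
  | succ n ih =>
    rw [Finset.sum_Icc_succ_top (by omega), Finset.prod_Icc_succ_top (by omega)]
    have := hf (n + 1) (by omega)
    have h2 := Nat.mul_le_mul_left (∏ i ∈ Finset.Icc 1 n, b i) (Nat.succ_le_of_lt this)
    rw [Nat.mul_succ] at h2
    rw [Nat.add_sub_cancel, mul_comm (f (n + 1))]
    linarith

theorem mixed_radix_injective {b f g : ℕ → ℕ} (hf : ∀ j, 1 ≤ j → f j < b j)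
    (hg : ∀ j, 1 ≤ j → g j < b j) {n : ℕ}
    (h : ∑ j ∈ Finset.Icc 1 n, f j * ∏ i ∈ Finset.Icc 1 (j - 1), b i =
      ∑ j ∈ Finset.Icc 1 n, g j * ∏ i ∈ Finset.Icc 1 (j - 1), b i) :
    ∀ j ∈ Finset.Icc 1 n, f j = g j := by
  induction n with
  | zero => simp
  | succ n ih =>
    rw [Finset.sum_Icc_succ_top (by omega), Finset.sum_Icc_succ_top (by omega),
      Nat.add_sub_cancel] at h
    have h1 := sum_mixed_radix_lt b f hf n
    have h2 := sum_mixed_radix_lt b g hg n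
    have h3 : f (n + 1) = g (n + 1) := by
      have e1 := congrArg (· / ∏ i ∈ Finset.Icc 1 n, b i) h
      rwa [Nat.add_mul_div_right _ _ (by omega), Nat.add_mul_div_right _ _ (by omega),
        Nat.div_eq_of_lt h1, Nat.div_eq_of_lt h2, zero_add, zero_add] at e1
    rw [h3] at h
    intro j hj
    rw [Finset.mem_Icc] at hj
    rcases Nat.lt_or_ge n j with h4 | h4
    · obtain rfl : j = n + 1 := by omega
      exact h3
    · exact ih (by omega) j (Finset.mem_Icc.2 ⟨hj.1, h4⟩)

theorem syndrome_lt {s L : ℕ} (hL : 1 ≤ L) (x : Bits L) (j : ℕ) :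
    syndrome s x j < (2 * s + 1) * L ^ j :=
  Nat.mod_lt _ (Nat.mul_pos (by omega) (Nat.pow_pos (by omega)))

theorem prod_radix (s L n : ℕ) : ∏ i ∈ Finset.Icc 1 n, ((2 * s + 1) * L ^ i) =
    (2 * s + 1) ^ n * L ^ (∑ i ∈ Finset.Icc 1 n, i) := by
  rw [Finset.prod_mul_distrib, Finset.prod_pow_eq_pow_sum]
  simp

theorem sum_Icc_one (n : ℕ) : (∑ i ∈ Finset.Icc 1 n, i) * 2 = n * (n + 1) := by
  induction n with
  | zero => simp
  | succ n ih => rw [Finset.sum_Icc_succ_top (by omega), add_mul, ih]; ring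

theorem syndromeValue_lt {s L : ℕ} (hL : 1 ≤ L) (x : Bits L) :
    syndromeValue s x < 2 ^ syndromeLength s L := by
  refine lt_of_lt_of_le (sum_mixed_radix_lt (fun i => (2 * s + 1) * L ^ i) _
    (fun j _ => syndrome_lt hL x j) _) ?_
  rw [prod_radix]
  refine le_trans (le_of_eq ?_) (Nat.le_pow_clog (by omega) _)
  have : ∑ i ∈ Finset.Icc 1 (2 * s + 1), i = (s + 1) * (2 * s + 1) := by
    have := sum_Icc_one (2 * s + 1)
    nlinarith
  rw [this]

theorem eq_of_syndromeValue_eq {s L : ℕ} (hs : 1 ≤ s) {x x' : Bits L} {y : ℕ → ZMod 2} {d d' : ℕ}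
    (hd : d < L) (hd' : d' < L) (h : Near s L d y x.ext) (h' : Near s L d' y x'.ext)
    (hf : syndromeValue s x = syndromeValue s x') : x = x' :=
  eq_of_syndrome_eq hs hd hd' h h' (mixed_radix_injective
    (b := fun i => (2 * s + 1) * L ^ i) (fun j _ => syndrome_lt (by omega) x j)
    (fun j _ => syndrome_lt (by omega) x' j) hf)

theorem toBits_ext (w a j : ℕ) :
    (toBits w a).ext j = if j < w ∧ a.testBit j then 1 else 0 := by
  by_cases h : j < w <;> simp [Bits.ext, toBits, h]

theorem toBits_injective {w a b : ℕ} (ha : a < 2 ^ w) (hb : b < 2 ^ w)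
    (h : toBits w a = toBits w b) : a = b := by
  refine Nat.eq_of_testBit_eq fun i => ?_
  by_cases hi : i < w
  · have := congrFun h ⟨i, hi⟩
    simp only [toBits] at this
    cases h1 : a.testBit i <;> cases h2 : b.testBit i <;> simp_all
  · have h1 : a < 2 ^ i := ha.trans_le (Nat.pow_le_pow_right (by omega) (by omega))
    have h2 : b < 2 ^ i := hb.trans_le (Nat.pow_le_pow_right (by omega) (by omega))
    rw [Nat.testBit_lt_two_pow h1, Nat.testBit_lt_two_pow h2]

/-! ### The three blocks of a codeword -/

/-- The block of `y` that starts at position `o`. -/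
def shiftWord (o : ℕ) (y : ℕ → ZMod 2) : ℕ → ZMod 2 := fun j => y (o + j)

theorem append_ext {m n : ℕ} (x : Bits m) (y : Bits n) (j : ℕ) :
    Bits.ext (L := m + n) (Fin.append x y) j = if j < m then x.ext j else y.ext (j - m) := by
  simp only [Bits.ext]
  by_cases h1 : j < m
  · rw [dif_pos (by omega), if_pos h1, dif_pos h1]
    exact Fin.append_left x y ⟨j, h1⟩
  · by_cases h2 : j < m + n
    · rw [dif_pos h2, if_neg h1, dif_pos (by omega)]
      have := Fin.append_right x y ⟨j - m, by omega⟩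
      rw [← this]
      congr 1
      ext
      simp only [Fin.natAdd_mk]
      omega
    · rw [dif_neg h2, if_neg h1, dif_neg (by omega)]

/-- A block of an erroneous word lies in the error ball of the block. -/
theorem Near.block {s L d o l : ℕ} {y x z : ℕ → ZMod 2} (h : Near s L d y x) (hl : 1 ≤ l)
    (hol : o + l ≤ L) (hz : ∀ j < l, x (o + j) = z j) :
    ∃ e < l, Near s l e (shiftWord o y) z := by
  classical
  -- The truncated difference and the minimum treat all cases together: a deletion before the block
  -- acts as the deletion of its first symbol, one behind the block as the deletion of its last
  -- symbol.
  obtain ⟨e, he⟩ : ∃ e, e = min (d - o) (l - 1) := ⟨_, rfl⟩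
  have hskip : ∀ j < l - 1, skip d (o + j) = o + skip e j := by
    intro j hj
    simp only [skip]
    split_ifs <;> omega
  refine ⟨e, by omega, le_trans ?_ h⟩
  refine Finset.card_le_card_of_injOn (fun j => o + j) (fun j hj => ?_) fun a _ b _ hab => by
    simpa using hab
  rw [Finset.mem_coe, Finset.mem_filter, Finset.mem_range] at hj ⊢
  refine ⟨show o + j < L - 1 by omega, ?_⟩
  show y (o + j) ≠ x (skip d (o + j))
  rw [hskip j hj.1, hz _ (skip_lt hj.1)]
  exact hj.2

theorem rep_ext {r L : ℕ} (v : Bits L) {j : ℕ} (hj : j < L * r) :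
    (rep r v).ext j = v.ext (j / r) := by
  rw [Bits.ext_of_lt _ hj]
  exact (v.ext_fin _).symm

/-- Majority decoding of the repetition code. -/
theorem rep_majority {s L d : ℕ} {y : ℕ → ZMod 2} {v : Bits L}
    (h : Near s (L * (2 * s + 2)) d y (rep (2 * s + 2) v).ext) {i : ℕ} (hi : i < L) :
    ((Finset.range (2 * s + 1)).filter fun t => y (i * (2 * s + 2) + t) ≠ v.ext i).card ≤ s := by
  classical
  refine le_trans ?_ h
  refine Finset.card_le_card_of_injOn (fun t => i * (2 * s + 2) + t) (fun t ht => ?_)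
    fun a _ b _ hab => by simpa using hab
  rw [Finset.mem_coe, Finset.mem_filter, Finset.mem_range] at ht ⊢
  have h1 : i * (2 * s + 2) + (2 * s + 2) ≤ L * (2 * s + 2) := by nlinarith
  have h2 : i * (2 * s + 2) + t < L * (2 * s + 2) - 1 := by omega
  refine ⟨h2, ?_⟩
  rw [rep_ext v (skip_lt h2)]
  -- A deletion moves positions by at most one, so the first `2s+1` of the `2s+2` places of a
  -- repeated symbol still show that symbol. This is why `2s+2` copies are used rather than `2s+1`.
  have h3 : skip d (i * (2 * s + 2) + t) / (2 * s + 2) = i := by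
    rw [Nat.div_eq_iff (by omega)]
    simp only [skip]
    constructor <;> split_ifs <;> omega
  rw [h3]
  exact ht.2

/-- Each of the two symbols is contradicted by at most `s` of the `2s+1` places read, so two
different symbols cannot explain the same received word. -/
theorem rep_eq {s L d d' : ℕ} {y : ℕ → ZMod 2} {v v' : Bits L}
    (h : Near s (L * (2 * s + 2)) d y (rep (2 * s + 2) v).ext)
    (h' : Near s (L * (2 * s + 2)) d' y (rep (2 * s + 2) v').ext) : v = v' := by
  classical
  refine Bits.eq_of_ext fun i hi => ?_
  by_contra hne
  have h1 := rep_majority h hi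
  have h2 := rep_majority h' hi
  have h3 : (Finset.range (2 * s + 1)) ⊆
      ((Finset.range (2 * s + 1)).filter fun t => y (i * (2 * s + 2) + t) ≠ v.ext i) ∪
      ((Finset.range (2 * s + 1)).filter fun t => y (i * (2 * s + 2) + t) ≠ v'.ext i) := by
    intro t ht
    simp only [Finset.mem_union, Finset.mem_filter]
    by_cases h4 : y (i * (2 * s + 2) + t) = v.ext i
    · right
      exact ⟨ht, by rw [h4]; exact hne⟩
    · left
      exact ⟨ht, h4⟩
  have h5 := (Finset.card_le_card h3).trans (Finset.card_union_le _ _)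
  rw [Finset.card_range] at h5
  omega

section Code

variable {s : ℕ} {α : (m : ℕ) → GaloisField 2 m} {k : ℕ} (G : SyndromeCompression s α k)

theorem SyndromeCompression.width_pos : 1 ≤ G.width := by
  by_contra h
  have h1 := G.modulus_pos 0
  have h2 := G.modulus_lt 0
  have h3 : G.width = 0 := by omega
  rw [h3] at h2
  simp at h2
  omega

theorem SyndromeCompression.encode_ext (x : Bits k) (j : ℕ) :
    (G.encode x).ext j = if j < precodeLength s α k then (precode s α k x).ext j
      else if j < precodeLength s α k + G.length₁ then
        (G.compress (precode s α k x)).ext (j - precodeLength s α k)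
      else (rep (2 * s + 2) (syndromeBits s (G.compress (precode s α k x)))).ext
        (j - (precodeLength s α k + G.length₁)) := by
  rw [encode, append_ext, append_ext]
  split_ifs <;> first | rfl | omega

/-- The three blocks of a word in the error ball of a codeword. -/
theorem SyndromeCompression.near_blocks (hn : 1 ≤ precodeLength s α k) (hs : 2 ≤ s) (x : Bits k)
    {d : ℕ} {y : ℕ → ZMod 2} (h : Near s G.codeLength d y (G.encode x).ext) :
    (∃ e < precodeLength s α k, Near s (precodeLength s α k) e y (precode s α k x).ext) ∧
    (∃ e < G.length₁, Near s G.length₁ e (shiftWord (precodeLength s α k) y)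
      (G.compress (precode s α k x)).ext) ∧
    ∃ e, Near s G.length₂ e (shiftWord (precodeLength s α k + G.length₁) y)
      (rep (2 * s + 2) (syndromeBits s (G.compress (precode s α k x)))).ext := by
  have hw := G.width_pos
  have hl1 : G.length₁ = G.width + G.width := rfl
  have hl2 : G.length₂ = syndromeLength s G.length₁ * (2 * s + 2) := rfl
  have hcl : G.codeLength = precodeLength s α k + G.length₁ + G.length₂ := rfl
  have h2 : 1 ≤ G.length₂ := by
    rw [hl2]
    refine Nat.mul_pos ?_ (by omega)
    refine Nat.clog_pos (by omega) ?_
    have h3 : 5 ≤ (2 * s + 1) ^ (2 * s + 1) :=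
      le_trans (by omega : 5 ≤ 2 * s + 1) (Nat.le_self_pow (by omega) _)
    have h4 : 1 ≤ G.length₁ ^ ((s + 1) * (2 * s + 1)) := Nat.pow_pos (by omega)
    nlinarith
  refine ⟨?_, ?_, ?_⟩
  · obtain ⟨e, he, h'⟩ := h.block (o := 0) (l := precodeLength s α k)
      (z := (precode s α k x).ext) hn (by omega) (fun j hj => by
        rw [zero_add, G.encode_ext, if_pos hj])
    refine ⟨e, he, ?_⟩
    rwa [show shiftWord 0 y = y from funext fun j => by simp [shiftWord]] at h'
  · exact h.block (o := precodeLength s α k) (l := G.length₁) (by omega) (by omega)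
      (fun j hj => by
        rw [G.encode_ext, if_neg (by omega), if_pos (by omega), Nat.add_sub_cancel_left])
  · obtain ⟨e, _, h'⟩ := h.block (o := precodeLength s α k + G.length₁) (l := G.length₂) h2
      (by omega) (fun j hj => by
        rw [G.encode_ext, if_neg (by omega), if_neg (by omega), Nat.add_sub_cancel_left])
    exact ⟨e, h'⟩

theorem SyndromeCompression.compress_injective {c c' : Bits (precodeLength s α k)}
    (h : G.compress c = G.compress c') :
    syndromeValue s c % G.modulus c = syndromeValue s c' % G.modulus c' ∧
      G.modulus c = G.modulus c' := by
  have h1 : ∀ c, syndromeValue s c % G.modulus c < 2 ^ G.width := fun c =>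
    (Nat.mod_lt _ (G.modulus_pos c)).trans (G.modulus_lt c)
  constructor
  · refine toBits_injective (h1 c) (h1 c') (funext fun i => ?_)
    have := congrFun h (Fin.castAdd _ i)
    simpa only [compress, Fin.append_left] using this
  · refine toBits_injective (G.modulus_lt c) (G.modulus_lt c') (funext fun i => ?_)
    have := congrFun h (Fin.natAdd _ i)
    simpa only [compress, Fin.append_right] using this

theorem SyndromeCompression.isSystematic : IsSystematic G.encode := by
  have hlt : ∀ i : Fin k, (i : ℕ) < G.codeLength := fun i => by
    have := i.isLt
    simp only [codeLength, precodeLength]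
    omega
  have hmono : StrictMono fun i : Fin k => (⟨i, hlt i⟩ : Fin G.codeLength) := by
    intro i j h
    exact h
  refine ⟨OrderEmbedding.ofStrictMono _ hmono, fun u i => ?_⟩
  have hi := i.isLt
  have h : (G.encode u).ext i = u i := by
    rw [G.encode_ext, if_pos (by simp only [precodeLength]; omega), precode, append_ext, if_pos hi,
      Bits.ext_fin]
  rw [← h, Bits.ext_of_lt _ (hlt i)]
  rfl

/-- The blocks are recovered from right to left: the repetition block fixes `f(g)`, which fixes `g`
within its error ball; equal `g` means equal moduli and congruent syndrome values, and then
`separates` leaves only one precoded word. -/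
theorem SyndromeCompression.isDelSubCorrecting (hs : 2 ≤ s) (hk : 1 ≤ k) :
    IsDelSubCorrecting 1 s G.code := by
  rintro _ ⟨x, rfl⟩ _ ⟨x', rfl⟩ hne
  rw [Set.disjoint_left]
  intro y hy hy'
  have hn : 1 ≤ precodeLength s α k := by simp only [precodeLength]; omega
  have hc : 1 ≤ G.codeLength := by simp only [codeLength]; omega
  obtain ⟨d, hd, h⟩ := (mem_errorBall hc).1 hy
  obtain ⟨d', hd', h'⟩ := (mem_errorBall hc).1 hy'
  obtain ⟨⟨e, he, a⟩, ⟨f, hf, b⟩, ⟨g, r⟩⟩ := G.near_blocks hn hs x h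
  obtain ⟨⟨e', he', a'⟩, ⟨f', hf', b'⟩, ⟨g', r'⟩⟩ := G.near_blocks hn hs x' h'
  have hl : 1 ≤ G.length₁ := by have := G.width_pos; simp only [length₁]; omega
  have h1 := rep_eq r r'
  have h2 : syndromeValue s (G.compress (precode s α k x)) =
      syndromeValue s (G.compress (precode s α k x')) :=
    toBits_injective (syndromeValue_lt hl _) (syndromeValue_lt hl _) h1
  have h3 := eq_of_syndromeValue_eq (by omega) hf hf' b b' h2
  obtain ⟨h4, h5⟩ := G.compress_injective h3
  have h6 : precode s α k x = precode s α k x' := by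
    by_contra hcne
    -- The initial segment of the received word lies in the error balls of both precoded words and
    -- witnesses that they intersect.
    let z : Bits (precodeLength s α k - 1) := fun i => y.ext i
    have hz : ∀ j < precodeLength s α k - 1, z.ext j = y.ext j := fun j hj => by
      rw [Bits.ext_of_lt _ hj]
    have hmem : ∀ e < precodeLength s α k, ∀ c : Bits (precodeLength s α k),
        Near s (precodeLength s α k) e y.ext c.ext → z ∈ errorBall 1 s c := by
      intro e he c hN
      refine (mem_errorBall hn).2 ⟨e, he, le_trans (le_of_eq ?_) hN⟩
      congr 1
      refine Finset.filter_congr fun j hj => ?_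
      rw [hz j (Finset.mem_range.1 hj)]
    refine G.separates _ ⟨x, rfl⟩ _ ⟨x', rfl⟩ (Ne.symm hcne)
      ⟨z, hmem e he _ a, hmem e' he' _ a'⟩ ?_
    rw [← h5] at h4
    exact h4
  exact hne (by simp only [encode, h6])

end Code

end

section

/-! ### Binary numbers as polynomials and shift registers -/

/-- The value at `β` of the polynomial whose coefficients are the binary digits of `x`. -/
def bitEval {R : Type*} [CommRing R] (β : R) (x : ℕ) : R :=
  ∑ i ∈ Finset.range x, if x.testBit i then β ^ i else 0

section BitEval

variable {R : Type*} [CommRing R] (β : R)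

theorem bitEval_eq {x B : ℕ} (h : x < 2 ^ B) :
    bitEval β x = ∑ i ∈ Finset.range B, if x.testBit i then β ^ i else 0 := by
  have key : ∀ B, x < 2 ^ B → ∀ D, B ≤ D →
      ∑ i ∈ Finset.range D, (if x.testBit i then β ^ i else 0) =
      ∑ i ∈ Finset.range B, if x.testBit i then β ^ i else 0 := by
    intro B hB D hD
    refine (Finset.sum_subset (by simpa using hD) fun i _ hi => ?_).symm
    rw [Finset.mem_range, not_lt] at hi
    rw [Nat.testBit_lt_two_pow (hB.trans_le (Nat.pow_le_pow_right (by omega) hi))]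
    simp
  rw [bitEval, ← key x Nat.lt_two_pow_self (max x B) (le_max_left _ _),
    key B h (max x B) (le_max_right _ _)]

@[simp] theorem bitEval_zero : bitEval β 0 = 0 := by simp [bitEval]

@[simp] theorem bitEval_one : bitEval β 1 = 1 := by simp [bitEval]

theorem exists_lt_two_pow (x y : ℕ) : ∃ B, x < 2 ^ B ∧ y < 2 ^ B :=
  ⟨x + y, Nat.lt_two_pow_self.trans_le (Nat.pow_le_pow_right (by omega) (by omega)),
    Nat.lt_two_pow_self.trans_le (Nat.pow_le_pow_right (by omega) (by omega))⟩

theorem bitEval_xor [CharP R 2] (x y : ℕ) :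
    bitEval β (x ^^^ y) = bitEval β x + bitEval β y := by
  obtain ⟨B, hx, hy⟩ := exists_lt_two_pow x y
  rw [bitEval_eq β hx, bitEval_eq β hy, bitEval_eq β (Nat.xor_lt_two_pow hx hy),
    ← Finset.sum_add_distrib]
  refine Finset.sum_congr rfl fun i _ => ?_
  rw [Nat.testBit_xor]
  cases x.testBit i <;> cases y.testBit i <;> simp [CharTwo.add_self_eq_zero]

theorem bitEval_two_mul (x : ℕ) : bitEval β (2 * x) = β * bitEval β x := by
  obtain ⟨B, hx, -⟩ := exists_lt_two_pow x x
  rw [bitEval_eq β hx, bitEval_eq β (B := B + 1) (by rw [pow_succ]; omega),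
    Finset.sum_range_succ', Finset.mul_sum]
  simp only [Nat.testBit_zero, Nat.mul_mod_right]
  simp only [Nat.testBit_succ, Nat.mul_div_cancel_left x (by omega : 0 < 2), mul_ite, mul_zero,
    pow_succ']
  simp

theorem bitEval_two_pow_mul (n x : ℕ) : bitEval β (2 ^ n * x) = β ^ n * bitEval β x := by
  induction n with
  | zero => simp
  | succ n ih => rw [pow_succ', mul_assoc, bitEval_two_mul, ih, pow_succ', mul_assoc]

theorem bitEval_two_pow (n : ℕ) : bitEval β (2 ^ n) = β ^ n := by
  simpa using bitEval_two_pow_mul β n 1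

theorem bitEval_sq [CharP R 2] (x : ℕ) : bitEval (β ^ 2) x = bitEval β x ^ 2 := by
  rw [bitEval, bitEval, sum_pow_char 2]
  refine Finset.sum_congr rfl fun i _ => ?_
  split_ifs
  · rw [← pow_mul, ← pow_mul, mul_comm]
  · simp

theorem map_bitEval {S : Type*} [CommRing S] (f : R →+* S) (x : ℕ) :
    f (bitEval β x) = bitEval (f β) x := by
  simp only [bitEval, map_sum]
  refine Finset.sum_congr rfl fun i _ => ?_
  split_ifs <;> simp

end BitEval

/-- One step of the shift register with feedback polynomial `q`, where `Q = 2^m`. -/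
def lfsr (Q q x : ℕ) : ℕ := if Q ≤ 2 * x then (2 * x) ^^^ q else 2 * x

/-- The state of the shift register after `j` steps. -/
def lfsrState (Q q j : ℕ) : ℕ := (lfsr Q q)^[j] 1

theorem lfsrState_succ (Q q j : ℕ) : lfsrState Q q (j + 1) = lfsr Q q (lfsrState Q q j) := by
  rw [lfsrState, Function.iterate_succ_apply', lfsrState]

theorem lfsrState_add (Q q i j : ℕ) :
    lfsrState Q q (i + j) = (lfsr Q q)^[i] (lfsrState Q q j) := by
  rw [lfsrState, Function.iterate_add_apply, lfsrState]

/-- `q` is a feedback polynomial of degree `m` with full period. -/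
def FullPeriod (m q : ℕ) : Prop :=
  2 ^ m ≤ q ∧ q < 2 ^ (m + 1) ∧
    (∀ j < 2 ^ m - 2, lfsrState (2 ^ m) q (j + 1) ≠ 1) ∧ lfsrState (2 ^ m) q (2 ^ m - 1) = 1

section Lfsr

variable {m q : ℕ}

theorem testBit_top {x m : ℕ} (h : 2 ^ m ≤ x) (h' : x < 2 ^ (m + 1)) : x.testBit m = true := by
  rw [Nat.testBit_eq_decide_div_mod_eq]
  have : x / 2 ^ m = 1 := by
    rw [Nat.div_eq_iff (by positivity)]
    rw [pow_succ] at h'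
    omega
  simp [this]

theorem xor_lt_of_top {x y m : ℕ} (h : 2 ^ m ≤ x) (h' : x < 2 ^ (m + 1)) (g : 2 ^ m ≤ y)
    (g' : y < 2 ^ (m + 1)) : x ^^^ y < 2 ^ m := by
  refine Nat.lt_pow_two_of_testBit _ fun i hi => ?_
  rcases hi.eq_or_lt with rfl | hlt
  · rw [Nat.testBit_xor, testBit_top h h', testBit_top g g']
    rfl
  · exact Nat.testBit_lt_two_pow ((Nat.xor_lt_two_pow h' g').trans_le
      (Nat.pow_le_pow_right (by omega) hlt))

theorem lfsr_lt (hq : 2 ^ m ≤ q) (hq' : q < 2 ^ (m + 1)) {x : ℕ} (hx : x < 2 ^ m) :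
    lfsr (2 ^ m) q x < 2 ^ m := by
  rw [lfsr]
  split_ifs with h
  · exact xor_lt_of_top h (by rw [pow_succ]; omega) hq hq'
  · omega

theorem lfsrState_lt (hm : 1 ≤ m) (hq : 2 ^ m ≤ q) (hq' : q < 2 ^ (m + 1)) (j : ℕ) :
    lfsrState (2 ^ m) q j < 2 ^ m := by
  induction j with
  | zero => exact Nat.one_lt_two_pow (by omega)
  | succ j ih => rw [lfsrState_succ]; exact lfsr_lt hq hq' ih

/-- A step of the register is multiplication by the indeterminate modulo the feedback polynomial, so
at a root of `q` it becomes multiplication by that root. -/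
theorem bitEval_lfsr {R : Type*} [CommRing R] [CharP R 2] (β : R) (hβ : bitEval β q = 0) (Q x : ℕ) :
    bitEval β (lfsr Q q x) = β * bitEval β x := by
  rw [lfsr]
  split_ifs
  · rw [bitEval_xor, hβ, add_zero, bitEval_two_mul]
  · rw [bitEval_two_mul]

theorem bitEval_lfsrState {R : Type*} [CommRing R] [CharP R 2] (β : R) (hβ : bitEval β q = 0)
    (Q j : ℕ) : bitEval β (lfsrState Q q j) = β ^ j := by
  induction j with
  | zero => simp [lfsrState]
  | succ j ih => rw [lfsrState_succ, bitEval_lfsr β hβ, ih, pow_succ']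

theorem bitEval_injOn {K : Type*} [CommRing K] [CharP K 2] {β : K} {B : ℕ}
    (h : ∀ x, 0 < x → x < 2 ^ B → bitEval β x ≠ 0) {x y : ℕ} (hx : x < 2 ^ B) (hy : y < 2 ^ B)
    (hxy : bitEval β x = bitEval β y) : x = y := by
  by_contra hne
  refine h (x ^^^ y) (Nat.pos_of_ne_zero fun h0 => hne (Nat.xor_eq_zero_iff.1 h0))
    (Nat.xor_lt_two_pow hx hy) ?_
  rw [bitEval_xor, hxy, CharTwo.add_self_eq_zero]

theorem exists_orderOf (hm : 1 ≤ m) : ∃ γ : GaloisField 2 m, orderOf γ = 2 ^ m - 1 := by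
  obtain ⟨g, hg⟩ := IsCyclic.exists_generator (α := (GaloisField 2 m)ˣ)
  refine ⟨g, ?_⟩
  rw [orderOf_units, orderOf_eq_card_of_forall_mem_zpowers hg, Nat.card_units,
    GaloisField.card 2 m (by omega)]

/-- The minimal polynomial of a generator `γ` of the multiplicative group has full period. It is
obtained here as the least positive number that vanishes at `γ`, and it remains to see that its
degree `d` is `m`. -/
theorem exists_fullPeriod (hm : 1 ≤ m) : ∃ q, FullPeriod m q := by
  classical
  obtain ⟨γ, hγ⟩ := exists_orderOf hm
  have hcard : Nat.card (GaloisField 2 m) = 2 ^ m := GaloisField.card 2 m (by omega)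
  have : Fintype (GaloisField 2 m) := Fintype.ofFinite _
  rw [Nat.card_eq_fintype_card] at hcard
  -- Pigeonhole: there are twice as many polynomials of degree at most `m` as field elements, and
  -- the difference of two with equal value vanishes at `γ`. Hence `d ≤ m`.
  have hex : ∃ x, 0 < x ∧ x < 2 ^ (m + 1) ∧ bitEval γ x = 0 := by
    obtain ⟨x, hx, y, hy, hne, hxy⟩ := Finset.exists_ne_map_eq_of_card_lt_of_maps_to
      (s := Finset.range (2 ^ (m + 1))) (t := (Finset.univ : Finset (GaloisField 2 m)))
      (by rw [Finset.card_range, Finset.card_univ, hcard, pow_succ]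
          have : 0 < 2 ^ m := by positivity
          omega)
      (f := bitEval γ) (fun x _ => Finset.mem_coe.2 (Finset.mem_univ _))
    rw [Finset.mem_range] at hx hy
    refine ⟨x ^^^ y, Nat.pos_of_ne_zero fun h0 => hne (Nat.xor_eq_zero_iff.1 h0),
      Nat.xor_lt_two_pow hx hy, ?_⟩
    rw [bitEval_xor, hxy, CharTwo.add_self_eq_zero]
  have hex' : ∃ x, 0 < x ∧ bitEval γ x = 0 := by
    obtain ⟨x, h1, _, h2⟩ := hex
    exact ⟨x, h1, h2⟩
  set q := Nat.find hex' with hqdef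
  obtain ⟨hq0, hqev⟩ := Nat.find_spec hex'
  rw [← hqdef] at hq0 hqev
  have hqmin : ∀ x, 0 < x → x < q → bitEval γ x ≠ 0 := fun x h1 h2 h3 =>
    Nat.find_min hex' h2 ⟨h1, h3⟩
  set d := Nat.log 2 q with hd
  have h1 : 2 ^ d ≤ q := Nat.pow_log_le_self 2 (by omega)
  have h2 : q < 2 ^ (d + 1) := Nat.lt_pow_succ_log_self (by omega) q
  have hmin : ∀ x, 0 < x → x < 2 ^ d → bitEval γ x ≠ 0 := fun x h3 h4 => hqmin x h3 (by omega)
  have hd1 : 1 ≤ d := by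
    by_contra h
    have h3 : d = 0 := by omega
    rw [h3] at h2
    have h4 : q = 1 := by simp at h2; omega
    rw [h4] at hqev
    simp at hqev
  have hγ0 : γ ≠ 0 := by
    rintro rfl
    rw [orderOf_zero] at hγ
    have := Nat.one_lt_two_pow (n := m) (by omega)
    omega
  have hdm : d ≤ m := by
    obtain ⟨x, h3, h4, h5⟩ := hex
    have h6 : q ≤ x := by
      by_contra h
      exact hqmin x h3 (by omega) h5
    by_contra h
    have : 2 ^ (m + 1) ≤ 2 ^ d := Nat.pow_le_pow_right (by omega) (by omega)
    omega
  -- The `2^m - 1` powers of `γ` are distinct and are values of nonzero register states below `2^d`;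
  -- hence `m ≤ d`.
  have hmd : m ≤ d := by
    have hle : (Finset.range (2 ^ m - 1)).card ≤ ((Finset.range (2 ^ d)).erase 0).card := by
      refine Finset.card_le_card_of_injOn (lfsrState (2 ^ d) q) (fun j _ => ?_) ?_
      · rw [Finset.mem_coe, Finset.mem_erase, Finset.mem_range]
        refine ⟨fun h0 => ?_, lfsrState_lt hd1 h1 h2 j⟩
        have := bitEval_lfsrState γ hqev (2 ^ d) j
        rw [h0, bitEval_zero] at this
        exact pow_ne_zero j hγ0 this.symm
      · intro i hi j hj hij
        rw [Finset.mem_coe, Finset.mem_range] at hi hj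
        have h3 := bitEval_lfsrState γ hqev (2 ^ d) i
        rw [hij, bitEval_lfsrState γ hqev] at h3
        exact pow_injOn_Iio_orderOf (by simpa [hγ] using hi) (by simpa [hγ] using hj) h3.symm
    rw [Finset.card_erase_of_mem (by simp), Finset.card_range, Finset.card_range] at hle
    have h3 : 2 ^ m ≤ 2 ^ d := by
      have := Nat.one_lt_two_pow (n := m) (by omega)
      have := Nat.one_lt_two_pow (n := d) (by omega)
      omega
    exact (Nat.pow_le_pow_iff_right (by omega)).1 h3
  have hdm' : d = m := le_antisymm hdm hmd
  clear_value d
  subst hdm'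
  have h1' : (1 : ℕ) < 2 ^ d := Nat.one_lt_two_pow (by omega)
  -- By minimality of `q`, evaluation at `γ` is injective on the states, so the period of the
  -- register is the order of `γ`.
  have hone : ∀ j, lfsrState (2 ^ d) q j = 1 ↔ γ ^ j = 1 := by
    intro j
    rw [← bitEval_lfsrState γ hqev (2 ^ d) j]
    refine ⟨fun h => by rw [h, bitEval_one], fun h => ?_⟩
    refine bitEval_injOn hmin (lfsrState_lt hm h1 h2 j) h1' ?_
    rw [h, bitEval_one]
  refine ⟨q, h1, h2, fun j hj => ?_, ?_⟩
  · rw [Ne, hone]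
    exact pow_ne_one_of_lt_orderOf (by omega) (by omega)
  · rw [hone, ← hγ, pow_orderOf_eq_one]

theorem natDegree_bitEval_X {x B : ℕ} (hB : x < 2 ^ B) :
    (bitEval (Polynomial.X : Polynomial (ZMod 2)) x).degree < B := by
  rw [bitEval_eq _ hB]
  refine (Polynomial.degree_sum_le _ _).trans_lt ((Finset.sup_lt_iff (by
    exact WithBot.bot_lt_coe B)).2 fun i hi => ?_)
  split_ifs
  · rw [Polynomial.degree_X_pow]
    exact_mod_cast Finset.mem_range.1 hi
  · rw [Polynomial.degree_zero]
    exact WithBot.bot_lt_coe B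

/-- Full period makes `q` a divisor of `X^(2^m - 1) - 1`, which vanishes at all nonzero field
elements. If none of them were a root of `q`, the cofactor of degree `2^m - 1 - m` would have `2^m -
1` roots. Irreducibility of `q` is never needed. -/
theorem FullPeriod.exists_root (hm : 1 ≤ m) (h : FullPeriod m q) :
    ∃ a : GaloisField 2 m, a ≠ 0 ∧ bitEval a q = 0 := by
  classical
  obtain ⟨h1, h2, -, h4⟩ := h
  set K := GaloisField 2 m
  have : Fintype K := Fintype.ofFinite _
  have hcard : Fintype.card K = 2 ^ m := by
    rw [← Nat.card_eq_fintype_card, GaloisField.card 2 m (by omega)]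
  set X : Polynomial (ZMod 2) := Polynomial.X
  have hdiv : ∀ j, bitEval X q ∣ X ^ j - bitEval X (lfsrState (2 ^ m) q j) := by
    intro j
    induction j with
    | zero => simp [lfsrState]
    | succ j ih =>
      have e1 : bitEval X q ∣ X * bitEval X (lfsrState (2 ^ m) q j) -
          bitEval X (lfsrState (2 ^ m) q (j + 1)) := by
        rw [lfsrState_succ, lfsr]
        split_ifs
        · rw [bitEval_xor, bitEval_two_mul, sub_add_cancel_left, dvd_neg]
        · rw [bitEval_two_mul, sub_self]
          exact dvd_zero _
      have e2 := dvd_add (dvd_mul_of_dvd_right ih X) e1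
      rwa [mul_sub, sub_add_sub_cancel, ← pow_succ'] at e2
  obtain ⟨u, hu⟩ := hdiv (2 ^ m - 1)
  rw [h4, bitEval_one] at hu
  have hQ : (bitEval X q).degree = m := by
    have e1 : q = 2 ^ m ^^^ (2 ^ m ^^^ q) := by rw [← Nat.xor_assoc, Nat.xor_self, Nat.zero_xor]
    have e2 : 2 ^ m ^^^ q < 2 ^ m :=
      xor_lt_of_top le_rfl (Nat.pow_lt_pow_right (by omega) (by omega)) h1 h2
    rw [e1, bitEval_xor, bitEval_two_pow, Polynomial.degree_add_eq_left_of_degree_lt]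
    · exact Polynomial.degree_X_pow m
    · rw [Polynomial.degree_X_pow]
      exact natDegree_bitEval_X e2
  have hQ' : (bitEval X q).natDegree = m := Polynomial.natDegree_eq_of_degree_eq_some hQ
  have hN : 1 ≤ 2 ^ m - 1 := by
    have := Nat.one_lt_two_pow (n := m) (by omega)
    omega
  have hXd : (X ^ (2 ^ m - 1) - 1 : Polynomial (ZMod 2)).natDegree = 2 ^ m - 1 := by
    have := Polynomial.natDegree_X_pow_sub_C (n := 2 ^ m - 1) (r := (1 : ZMod 2))
    simpa using this
  have hu0 : u ≠ 0 := by
    rintro rfl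
    rw [mul_zero] at hu
    rw [hu] at hXd
    simp at hXd
    omega
  have hQ0 : bitEval X q ≠ 0 := by
    intro h0
    rw [h0] at hQ'
    simp at hQ'
    omega
  have hud : u.natDegree + m = 2 ^ m - 1 := by
    rw [hu, Polynomial.natDegree_mul hQ0 hu0, hQ'] at hXd
    omega
  by_contra hno
  push Not at hno
  set f := algebraMap (ZMod 2) K
  have hroot : ∀ a : K, a ≠ 0 → (u.map f).eval a = 0 := by
    intro a ha
    have e1 : a ^ (2 ^ m - 1) = 1 := by rw [← hcard]; exact FiniteField.pow_card_sub_one_eq_one a ha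
    have e2 := congrArg (Polynomial.eval₂RingHom f a) hu
    rw [map_mul, map_bitEval] at e2
    simp only [Polynomial.coe_eval₂RingHom, Polynomial.eval₂_sub, Polynomial.eval₂_X_pow,
      Polynomial.eval₂_one, X, Polynomial.eval₂_X, e1, sub_self] at e2
    rcases mul_eq_zero.1 e2.symm with e3 | e3
    · exact absurd e3 (hno a ha)
    · rwa [Polynomial.eval_map]
  have humap : u.map f ≠ 0 := (Polynomial.map_ne_zero_iff f.injective).2 hu0
  have hle : ((Finset.univ : Finset K).erase 0).card ≤ (u.map f).natDegree := by
    refine Polynomial.card_le_degree_of_subset_roots ?_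
    intro a ha
    rw [Finset.mem_val, Finset.mem_erase] at ha
    exact (Polynomial.mem_roots humap).2 (hroot a ha.1)
  rw [Finset.card_erase_of_mem (Finset.mem_univ _), Finset.card_univ, hcard,
    Polynomial.natDegree_map] at hle
  omega

/-- The nonzero states of a register of full period are exactly the powers of a root. -/
theorem FullPeriod.bitEval_ne_zero (hm : 1 ≤ m) (h : FullPeriod m q) {K : Type*} [Field K]
    [CharP K 2] {a : K} (ha : a ≠ 0) (haq : bitEval a q = 0) {x : ℕ} (hx : 0 < x)
    (hx' : x < 2 ^ m) : bitEval a x ≠ 0 := by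
  classical
  obtain ⟨h1, h2, h3, h4⟩ := h
  have hsub : (Finset.range (2 ^ m - 1)).image (lfsrState (2 ^ m) q) ⊆
      (Finset.range (2 ^ m)).erase 0 := by
    intro y hy
    obtain ⟨j, -, rfl⟩ := Finset.mem_image.1 hy
    rw [Finset.mem_erase, Finset.mem_range]
    refine ⟨fun h0 => ?_, lfsrState_lt hm h1 h2 j⟩
    have := bitEval_lfsrState a haq (2 ^ m) j
    rw [h0, bitEval_zero] at this
    exact pow_ne_zero j ha this.symm
  have hinj : ∀ i j, i < j → j < 2 ^ m - 1 → lfsrState (2 ^ m) q i ≠ lfsrState (2 ^ m) q j := by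
    intro i j hij hj heq
    have e1 := lfsrState_add (2 ^ m) q (2 ^ m - 1 - j) i
    rw [heq, ← lfsrState_add, show 2 ^ m - 1 - j + j = 2 ^ m - 1 by omega, h4] at e1
    refine h3 (2 ^ m - 1 - j + i - 1) (by omega) ?_
    rw [show 2 ^ m - 1 - j + i - 1 + 1 = 2 ^ m - 1 - j + i by omega, e1]
  have heq := Finset.eq_of_subset_of_card_le hsub (by
    rw [Finset.card_erase_of_mem (by simp), Finset.card_range, Finset.card_image_of_injOn,
      Finset.card_range]
    intro i hi j hj hij
    rw [Finset.mem_coe, Finset.mem_range] at hi hj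
    rcases lt_trichotomy i j with h | h | h
    · exact absurd hij (hinj i j h hj)
    · exact h
    · exact absurd hij.symm (hinj j i h hi))
  have hmem : x ∈ (Finset.range (2 ^ m - 1)).image (lfsrState (2 ^ m) q) := by
    rw [heq, Finset.mem_erase, Finset.mem_range]
    exact ⟨by omega, hx'⟩
  obtain ⟨j, -, rfl⟩ := Finset.mem_image.1 hmem
  rw [bitEval_lfsrState a haq]
  exact pow_ne_zero j ha

theorem FullPeriod.orderOf_eq (hm : 1 ≤ m) (h : FullPeriod m q) {K : Type*} [Field K]
    [CharP K 2] {a : K} (ha : a ≠ 0) (haq : bitEval a q = 0) : orderOf a = 2 ^ m - 1 := by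
  have hN : 1 < 2 ^ m := Nat.one_lt_two_pow (by omega)
  rw [orderOf_eq_iff (by omega)]
  refine ⟨?_, fun j hj hj0 hone => ?_⟩
  · rw [← bitEval_lfsrState a haq (2 ^ m), h.2.2.2, bitEval_one]
  · have e1 : lfsrState (2 ^ m) q j = 1 := by
      refine bitEval_injOn (fun x h0 hx => h.bitEval_ne_zero hm ha haq h0 hx)
        (lfsrState_lt hm h.1 h.2.1 j) hN ?_
      rw [bitEval_lfsrState a haq, hone, bitEval_one]
    refine h.2.2.1 (j - 1) (by omega) ?_
    rw [show j - 1 + 1 = j by omega, e1]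

/-- The least feedback polynomial of degree `m` with full period. -/
noncomputable def feedback (m : ℕ) : ℕ := sInf {q | FullPeriod m q}

theorem feedback_spec (hm : 1 ≤ m) : FullPeriod m (feedback m) :=
  Nat.sInf_mem (s := {q | FullPeriod m q}) (exists_fullPeriod hm)

/-- The primitive elements are tied to feedback polynomials which a program can find by search. All
field arithmetic is thereby reduced to operations on machine words. -/
theorem exists_primitiveFamily : ∃ α : (m : ℕ) → GaloisField 2 m, IsPrimitiveFamily α ∧
    ∀ m, 1 ≤ m → bitEval (α m) (feedback m) = 0 := by
  have h : ∀ m, ∃ a : GaloisField 2 m, 1 ≤ m → a ≠ 0 ∧ bitEval a (feedback m) = 0 := by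
    intro m
    by_cases hm : 1 ≤ m
    · obtain ⟨a, ha⟩ := (feedback_spec hm).exists_root hm
      exact ⟨a, fun _ => ha⟩
    · exact ⟨0, fun h => absurd h hm⟩
  choose α hα using h
  exact ⟨α, fun m hm => (feedback_spec hm).orderOf_eq hm (hα m hm).1 (hα m hm).2,
    fun m hm => (hα m hm).2⟩

end Lfsr

end

section

/-! ### BCH codes -/

/-- The polynomial with the binary digits of `v` as coefficients vanishes at `β, …, β^(2s)`. -/
def InCode {K : Type*} [CommRing K] (s : ℕ) (β : K) (v : ℕ) : Prop :=
  ∀ i ∈ Finset.Icc 1 (2 * s), bitEval (β ^ i) v = 0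

/-- The generator polynomial of the BCH code, as a number. -/
noncomputable def genWord {K : Type*} [CommRing K] (s : ℕ) (β : K) : ℕ :=
  sInf {v | 0 < v ∧ InCode s β v}

/-- The number of parity symbols of the BCH code. -/
noncomputable def bchRank {K : Type*} [CommRing K] (s : ℕ) (β : K) : ℕ := Nat.log 2 (genWord s β)

section InCode

variable {K : Type*} [Field K] [CharP K 2] {s : ℕ} {β : K}

/-- Squaring is additive in characteristic two, so the value at `β^(2j)` is the square of the value
at `β^j`. Half of the conditions are redundant, which brings the parity from `2s m` down to `s m`.
-/
theorem inCode_iff_odd {v : ℕ} : InCode s β v ↔ ∀ j < s, bitEval (β ^ (2 * j + 1)) v = 0 := by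
  refine ⟨fun h j hj => h _ (Finset.mem_Icc.2 ⟨by omega, by omega⟩), fun h i hi => ?_⟩
  rw [Finset.mem_Icc] at hi
  induction i using Nat.strong_induction_on with
  | _ i ih =>
    rcases Nat.even_or_odd' i with ⟨j, rfl | rfl⟩
    · rw [mul_comm, pow_mul, bitEval_sq, ih j (by omega) ⟨by omega, by omega⟩]
      simp
    · exact h j (by omega)

theorem InCode.xor {v w : ℕ} (hv : InCode s β v) (hw : InCode s β w) : InCode s β (v ^^^ w) :=
  fun i hi => by rw [bitEval_xor, hv i hi, hw i hi, add_zero]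

omit [CharP K 2] in
theorem inCode_two_pow_mul (hβ : β ≠ 0) {n v : ℕ} : InCode s β (2 ^ n * v) ↔ InCode s β v := by
  refine forall₂_congr fun i _ => ?_
  rw [bitEval_two_pow_mul, mul_eq_zero]
  simp [hβ]

/-- Pigeonhole: there are `2^(s m + 1)` polynomials and only `2^(s m)` vectors of odd syndromes. -/
theorem exists_inCode [Finite K] (s m : ℕ) (hcard : Nat.card K = 2 ^ m) (β : K) :
    ∃ v, 0 < v ∧ InCode s β v ∧ v < 2 ^ (s * m + 1) := by
  classical
  have : Fintype K := Fintype.ofFinite _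
  rw [Nat.card_eq_fintype_card] at hcard
  obtain ⟨x, hx, y, hy, hne, hxy⟩ := Finset.exists_ne_map_eq_of_card_lt_of_maps_to
    (s := Finset.range (2 ^ (s * m + 1))) (t := (Finset.univ : Finset (Fin s → K)))
    (by rw [Finset.card_range, Finset.card_univ, Fintype.card_fun, hcard, Fintype.card_fin,
          ← pow_mul, mul_comm m s, pow_succ]
        have : 0 < 2 ^ (s * m) := by positivity
        omega)
    (f := fun v j => bitEval (β ^ (2 * (j : ℕ) + 1)) v)
    (fun x _ => Finset.mem_coe.2 (Finset.mem_univ _))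
  rw [Finset.mem_range] at hx hy
  refine ⟨x ^^^ y, Nat.pos_of_ne_zero fun h0 => hne (Nat.xor_eq_zero_iff.1 h0),
    inCode_iff_odd.2 fun j hj => ?_, Nat.xor_lt_two_pow hx hy⟩
  have := congrFun hxy ⟨j, hj⟩
  simp only at this
  rw [bitEval_xor, this, CharTwo.add_self_eq_zero]

section Generator

variable {m : ℕ} [Finite K] (hm : 1 ≤ m) (hs : 1 ≤ s) (hcard : Nat.card K = 2 ^ m)
  (hβ : orderOf β = 2 ^ m - 1)

include hcard

theorem genWord_spec : 0 < genWord s β ∧ InCode s β (genWord s β) := by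
  obtain ⟨v, h1, h2, -⟩ := exists_inCode s m hcard β
  exact Nat.sInf_mem (s := {v | 0 < v ∧ InCode s β v}) ⟨v, h1, h2⟩

omit [Finite K] [CharP K 2] hcard in
theorem genWord_le {v : ℕ} (h0 : 0 < v) (h : InCode s β v) : genWord s β ≤ v :=
  Nat.sInf_le (s := {v | 0 < v ∧ InCode s β v}) ⟨h0, h⟩

theorem genWord_lt : genWord s β < 2 ^ (s * m + 1) := by
  obtain ⟨v, h1, h2, h3⟩ := exists_inCode s m hcard β
  exact (genWord_le h1 h2).trans_lt h3

theorem two_pow_bchRank_le : 2 ^ bchRank s β ≤ genWord s β :=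
  Nat.pow_log_le_self 2 (genWord_spec hcard).1.ne'

omit [Finite K] [CharP K 2] hcard in
theorem genWord_lt_two_pow : genWord s β < 2 ^ (bchRank s β + 1) :=
  Nat.lt_pow_succ_log_self (by omega) _

theorem bchRank_le_mul : bchRank s β ≤ s * m := by
  have h := (two_pow_bchRank_le (s := s) (β := β) hcard).trans_lt (genWord_lt hcard)
  have := (Nat.pow_lt_pow_iff_right (by omega : 1 < 2)).1 h
  omega

include hs in
theorem one_le_bchRank : 1 ≤ bchRank s β := by
  by_contra h
  have h1 : genWord s β < 2 ^ (bchRank s β + 1) := genWord_lt_two_pow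
  have h2 := genWord_spec (s := s) (β := β) hcard
  rw [show bchRank s β = 0 by omega] at h1
  have h3 : genWord s β = 1 := by simp at h1; omega
  have h4 := h2.2 1 (by simp; omega)
  rw [h3, bitEval_one] at h4
  exact one_ne_zero h4

include hm hβ in
omit [CharP K 2] [Finite K] hcard in
theorem ne_zero_of_orderOf : β ≠ 0 := by
  rintro rfl
  rw [orderOf_zero] at hβ
  have := Nat.one_lt_two_pow (n := m) (by omega)
  omega

include hm hβ in
-- The polynomial `X^(2^m - 1) - 1` vanishes at every power of `β`.
theorem bchRank_le : bchRank s β ≤ 2 ^ m - 1 := by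
  have hN : 1 < 2 ^ m := Nat.one_lt_two_pow (by omega)
  set N := 2 ^ m - 1
  have h1 : InCode s β (2 ^ N ^^^ 1) := by
    intro i _
    rw [bitEval_xor, bitEval_two_pow, bitEval_one, ← pow_mul, mul_comm, pow_mul, ← hβ,
      pow_orderOf_eq_one, one_pow, CharTwo.add_self_eq_zero]
  have hN2 : 1 < 2 ^ N := Nat.one_lt_two_pow (by omega)
  have h2 : 0 < 2 ^ N ^^^ 1 := Nat.pos_of_ne_zero fun h => by
    rw [Nat.xor_eq_zero_iff] at h
    omega
  have h3 : 2 ^ N ^^^ 1 < 2 ^ (N + 1) :=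
    Nat.xor_lt_two_pow (by rw [pow_succ]; omega) (by rw [pow_succ]; omega)
  have h4 := (two_pow_bchRank_le (s := s) (β := β) hcard).trans_lt
    ((genWord_le h2 h1).trans_lt h3)
  have := (Nat.pow_lt_pow_iff_right (by omega : 1 < 2)).1 h4
  omega

include hm hβ in
-- Otherwise the generator could be divided by `X`, and a smaller nonzero number would remain in the
-- code.
theorem genWord_odd : (genWord s β).testBit 0 = true := by
  rw [Nat.testBit_zero]
  by_contra h
  have h0 := genWord_spec (s := s) (β := β) hcard
  have h1 : genWord s β = 2 ^ 1 * (genWord s β / 2) := by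
    simp at h; omega
  have h2 := h0.2
  rw [h1, inCode_two_pow_mul (ne_zero_of_orderOf hm hβ)] at h2
  have := genWord_le (by omega) h2
  omega

include hm hβ in
/-- A codeword that vanishes outside `bchRank` consecutive coordinates vanishes. -/
theorem inCode_eq_zero {n v : ℕ} (hv : InCode s β v) (h0 : ∀ j < n, v.testBit j = false)
    (hlt : v < 2 ^ (n + bchRank s β)) : v = 0 := by
  have h1 : v = 2 ^ n * (v / 2 ^ n) := by
    refine Nat.eq_of_testBit_eq fun j => ?_
    rw [Nat.testBit_two_pow_mul]
    by_cases hj : n ≤ j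
    · rw [Nat.testBit_div_two_pow]
      simp [hj]
    · simp [h0 j (by omega), hj]
  rw [h1, inCode_two_pow_mul (ne_zero_of_orderOf hm hβ)] at hv
  have h2 : v / 2 ^ n < 2 ^ bchRank s β := by
    rw [Nat.div_lt_iff_lt_mul (by positivity), ← pow_add, add_comm]
    exact hlt
  by_contra hne
  have h3 := genWord_le (Nat.pos_of_ne_zero fun h => hne (by rw [h1, h, mul_zero])) hv
  have := two_pow_bchRank_le (s := s) (β := β) hcard
  omega

include hm hβ in
-- Since the generator has constant term one, adding its multiple by `X^t` corrects the symbol at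
-- `t` without touching earlier ones. The prescribed prefix is reached symbol by symbol.
theorem exists_inCode_of_prefix (u : ℕ) {n : ℕ} : ∀ t ≤ n,
    ∃ v, InCode s β v ∧ v < 2 ^ (n + bchRank s β) ∧ ∀ j < t, v.testBit j = u.testBit j := by
  intro t
  induction t with
  | zero => exact fun _ => ⟨0, fun i _ => bitEval_zero _, by positivity, by simp⟩
  | succ t ih =>
    intro ht
    obtain ⟨v, h1, h2, h3⟩ := ih (by omega)
    by_cases hb : v.testBit t = u.testBit t
    · refine ⟨v, h1, h2, fun j hj => ?_⟩
      rcases Nat.lt_succ_iff_lt_or_eq.1 hj with h | rfl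
      · exact h3 j h
      · exact hb
    · refine ⟨v ^^^ (2 ^ t * genWord s β), h1.xor ((inCode_two_pow_mul
        (ne_zero_of_orderOf hm hβ)).2 (genWord_spec hcard).2), Nat.xor_lt_two_pow h2 ?_, ?_⟩
      · calc 2 ^ t * genWord s β < 2 ^ t * 2 ^ (bchRank s β + 1) :=
            Nat.mul_lt_mul_of_pos_left genWord_lt_two_pow (by positivity)
          _ ≤ _ := by
            rw [← pow_add]
            exact Nat.pow_le_pow_right (by omega) (by omega)
      · intro j hj
        rw [Nat.testBit_xor, Nat.testBit_two_pow_mul]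
        rcases Nat.lt_succ_iff_lt_or_eq.1 hj with h | rfl
        · rw [h3 j h]
          simp [show ¬ t ≤ j by omega]
        · rw [Nat.sub_self, genWord_odd hm hcard hβ]
          cases h5 : v.testBit j <;> cases h6 : u.testBit j <;> simp_all

end Generator

end InCode

theorem toBits_surjective {n : ℕ} (c : Bits n) : ∃ v < 2 ^ n, toBits n v = c := by
  have h : Function.Bijective fun v : Fin (2 ^ n) => toBits n v := by
    rw [Fintype.bijective_iff_injective_and_card]
    refine ⟨fun v w h => Fin.ext (toBits_injective v.isLt w.isLt h), ?_⟩
    simp [ZMod.card]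
  obtain ⟨v, hv⟩ := h.2 c
  exact ⟨v, v.isLt, hv⟩

theorem toBits_mem_bchCode {s m : ℕ} {β : GaloisField 2 m} {v : ℕ} (hv : v < 2 ^ (2 ^ m - 1)) :
    toBits (2 ^ m - 1) v ∈ bchCode s m β ↔ InCode s β v := by
  refine forall₂_congr fun i _ => ?_
  rw [bitEval_eq _ hv, ← Fin.sum_univ_eq_sum_range (fun j => if v.testBit j then (β ^ i) ^ j else 0)]
  have : ∀ j : Fin (2 ^ m - 1), algebraMap (ZMod 2) (GaloisField 2 m) (toBits (2 ^ m - 1) v j) *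
      β ^ (i * (j : ℕ)) = if v.testBit j then (β ^ i) ^ (j : ℕ) else 0 := by
    intro j
    simp only [toBits]
    split_ifs <;> simp [pow_mul]
  simp only [this]

section Dimension

variable {s m : ℕ} {β : GaloisField 2 m} (hm : 1 ≤ m) (hβ : orderOf β = 2 ^ m - 1)

include hm hβ

theorem bchCode_eq_zero {c : Bits (2 ^ m - 1)} (hc : c ∈ bchCode s m β)
    (h0 : ∀ j < 2 ^ m - 1 - bchRank s β, c.ext j = 0) : c = 0 := by
  have hcard := GaloisField.card 2 m (by omega)
  obtain ⟨v, hv, rfl⟩ := toBits_surjective c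
  have hr := bchRank_le (s := s) hm hcard hβ
  have h1 : v = 0 := by
    refine inCode_eq_zero (s := s) hm hcard hβ ((toBits_mem_bchCode hv).1 hc)
      (n := 2 ^ m - 1 - bchRank s β) (fun j hj => ?_) (by rwa [Nat.sub_add_cancel hr])
    have := h0 j hj
    rw [toBits_ext] at this
    by_contra h
    rw [if_pos ⟨by omega, by simpa using h⟩] at this
    exact one_ne_zero this
  subst h1
  funext j
  simp [toBits]

theorem exists_bchCode_prefix (u : ℕ → ZMod 2) :
    ∃ c ∈ bchCode s m β, ∀ j < 2 ^ m - 1 - bchRank s β, c.ext j = u j := by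
  have hcard := GaloisField.card 2 m (by omega)
  have hr := bchRank_le (s := s) hm hcard hβ
  obtain ⟨w, hw, hwu⟩ := toBits_surjective (n := 2 ^ m - 1) fun j => u j
  obtain ⟨v, h1, h2, h3⟩ := exists_inCode_of_prefix (s := s) hm hcard hβ w
    (n := 2 ^ m - 1 - bchRank s β) _ le_rfl
  rw [Nat.sub_add_cancel hr] at h2
  refine ⟨toBits _ v, (toBits_mem_bchCode h2).2 h1, fun j hj => ?_⟩
  have h4 : (toBits (2 ^ m - 1) w).ext j = u j := by
    rw [hwu, Bits.ext_of_lt _ (by omega)]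
  rw [← h4, toBits_ext, toBits_ext, h3 j hj]

/-- The projection to all but the last `bchRank` coordinates is injective because no nonzero
codeword has degree below that of the generator after division by a power of `X`, and surjective
because every prefix extends to a codeword. -/
theorem finrank_bchCode :
    Module.finrank (ZMod 2) (bchCode s m β) = 2 ^ m - 1 - bchRank s β := by
  let π : bchCode s m β →ₗ[ZMod 2] (Fin (2 ^ m - 1 - bchRank s β) → ZMod 2) :=
    (LinearMap.funLeft (ZMod 2) (ZMod 2) (Fin.castLE (Nat.sub_le _ _))).comp
      (bchCode s m β).subtype
  have hπ : ∀ c j, π c j = (c : Bits (2 ^ m - 1)).ext j := fun c j => by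
    rw [Bits.ext_of_lt _ (by have := j.isLt; omega)]
    rfl
  have hbij : Function.Bijective π := by
    constructor
    · rw [injective_iff_map_eq_zero]
      intro c hc
      refine Subtype.ext (bchCode_eq_zero hm hβ c.2 fun j hj => ?_)
      rw [← hπ c ⟨j, hj⟩, hc]
      rfl
    · intro u
      obtain ⟨c, hc, hcu⟩ := exists_bchCode_prefix (s := s) hm hβ (Bits.ext u)
      refine ⟨⟨c, hc⟩, funext fun j => ?_⟩
      rw [hπ, hcu j j.isLt, Bits.ext_fin]
  rw [(LinearEquiv.ofBijective π hbij).finrank_eq]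
  simp

end Dimension

/-! ### The precoder -/

theorem Bits.ext_sub {L : ℕ} (x y : Bits L) (j : ℕ) : (x - y).ext j = x.ext j - y.ext j := by
  by_cases h : j < L <;> simp [Bits.ext, h]

theorem padLeft_ext {N L : ℕ} (v : Bits L) (hL : L ≤ N) (j : ℕ) :
    (padLeft N v).ext j = if N - L ≤ j then v.ext (j - (N - L)) else 0 := by
  by_cases hj : j < N
  · rw [Bits.ext_of_lt _ hj]
    simp only [padLeft]
    split_ifs with h
    · rw [Bits.ext_of_lt _ (by omega)]
    · rfl
  · simp only [Bits.ext, dif_neg hj]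
    split_ifs <;> first | rfl | omega

section Precode

variable {s : ℕ} {α : (m : ℕ) → GaloisField 2 m} (hα : IsPrimitiveFamily α)

theorem sq_le_four_mul_two_pow (x : ℕ) : x ^ 2 ≤ 4 * 2 ^ x := by
  induction x with
  | zero => simp
  | succ x ih =>
    rcases Nat.lt_or_ge x 3 with h | h
    · interval_cases x <;> simp
    · rw [pow_succ 2 x]
      nlinarith

/-- Completing the square in `(x - 4s)^2 ≥ 0` reduces this to the bound for `x^2`. It says that half
of the `2^x` symbols pay for the `s x` parity symbols, up to a constant. -/
theorem mul_le_two_pow (s x : ℕ) : 2 * (s * x) ≤ 4 * s ^ 2 + 2 ^ x := by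
  have h := sq_le_four_mul_two_pow x
  zify at h ⊢
  nlinarith [sq_nonneg ((x : ℤ) - 4 * s)]

include hα

theorem bchDegree_mem (k : ℕ) : 1 ≤ bchDegree s α k ∧
    k ≤ 2 ^ bchDegree s α k - 1 - bchRank s (α (bchDegree s α k)) := by
  have h : bchDegree s α k ∈ {m | 1 ≤ m ∧ k ≤ Module.finrank (ZMod 2) (bchCode s m (α m))} := by
    refine Nat.sInf_mem ?_
    -- For this `m` the bounds `2 s m ≤ 4 s^2 + 2^m` and `m < 2^m` give `2^m - 1 - s m ≥ k`. Any
    -- sufficiently large `m` would do.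
    refine ⟨2 * k + 4 * s ^ 2 + 2, by omega, ?_⟩
    rw [finrank_bchCode (by omega) (hα _ (by omega))]
    set m := 2 * k + 4 * s ^ 2 + 2 with hm
    have h1 := bchRank_le_mul (s := s) (β := α m) (GaloisField.card 2 m (by omega))
    have h2 := mul_le_two_pow s m
    have h3 : m < 2 ^ m := Nat.lt_two_pow_self
    omega
  obtain ⟨h1, h2⟩ := h
  rw [finrank_bchCode h1 (hα _ h1)] at h2
  exact ⟨h1, h2⟩

theorem lt_of_lt_bchDegree {k m : ℕ} (hm : 1 ≤ m) (h : m < bchDegree s α k) :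
    2 ^ m - 1 - bchRank s (α m) < k := by
  have := Nat.notMem_of_lt_sInf h
  by_contra hlt
  refine this ⟨hm, ?_⟩
  rw [finrank_bchCode hm (hα _ hm)]
  omega

/-- The preceding degree is too small for `k` information symbols, and the parity of that code is at
most about half of its length. Hence the field has size `O(k)` and the parity of the chosen code is
`s log k + O(1)`. -/
theorem two_pow_bchDegree_le (k : ℕ) : 2 ^ bchDegree s α k ≤ 4 * k + 8 * s ^ 2 + 2 := by
  obtain ⟨h1, -⟩ := bchDegree_mem (s := s) hα k
  rcases h1.eq_or_lt with h | h
  · rw [← h]; omega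
  · obtain ⟨x, hx⟩ : ∃ x, bchDegree s α k = x + 1 := ⟨bchDegree s α k - 1, by omega⟩
    rw [hx] at h ⊢
    have h2 := lt_of_lt_bchDegree (s := s) hα (k := k) (m := x) (by omega) (by omega)
    have h3 := bchRank_le_mul (s := s) (β := α x) (GaloisField.card 2 x (by omega))
    have h4 := mul_le_two_pow s x
    rw [pow_succ]
    omega

theorem parityLength_eq (k : ℕ) :
    parityLength s α k = bchRank s (α (bchDegree s α k)) := by
  obtain ⟨h1, -⟩ := bchDegree_mem (s := s) hα k
  have := bchRank_le (s := s) h1 (GaloisField.card 2 _ (by omega)) (hα _ h1)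
  rw [parityLength, finrank_bchCode h1 (hα _ h1)]
  omega

theorem precodeLength_le (k : ℕ) : precodeLength s α k ≤ 2 ^ bchDegree s α k - 1 := by
  obtain ⟨h1, h2⟩ := bchDegree_mem (s := s) hα k
  have := bchRank_le (s := s) h1 (GaloisField.card 2 _ (by omega)) (hα _ h1)
  rw [precodeLength, parityLength_eq hα]
  omega

theorem one_le_precodeLength (hs : 1 ≤ s) (k : ℕ) : 1 ≤ precodeLength s α k := by
  obtain ⟨h1, h2⟩ := bchDegree_mem (s := s) hα k
  have := one_le_bchRank (β := α (bchDegree s α k)) hs (GaloisField.card 2 _ (by omega))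
  rw [precodeLength, parityLength_eq hα]
  omega

theorem precode_mem {k : ℕ} (x : Bits k) : padLeft (2 ^ bchDegree s α k - 1) (precode s α k x) ∈
    bchCode s (bchDegree s α k) (α (bchDegree s α k)) := by
  obtain ⟨h1, h2⟩ := bchDegree_mem (s := s) hα k
  have hle := precodeLength_le (s := s) hα k
  have hr := parityLength_eq (s := s) hα k
  set m := bchDegree s α k with hm
  suffices h : ∃ p : Bits (parityLength s α k), padLeft (2 ^ m - 1) (Fin.append x p) ∈
      bchCode s m (α m) from Classical.epsilon_spec h
  obtain ⟨c, hc, hcu⟩ := exists_bchCode_prefix (s := s) h1 (hα _ h1) (padLeft (2 ^ m - 1 -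
    bchRank s (α m)) x).ext
  have hL : k + parityLength s α k ≤ 2 ^ m - 1 := hle
  refine ⟨fun i => c.ext (2 ^ m - 1 - bchRank s (α m) + i), ?_⟩
  convert hc
  refine Bits.eq_of_ext fun j hj => ?_
  rw [padLeft_ext _ hL, append_ext]
  rcases Nat.lt_or_ge j (2 ^ m - 1 - bchRank s (α m)) with h | h
  · rw [hcu j h, padLeft_ext _ h2]
    have e : 2 ^ m - 1 - (k + parityLength s α k) = 2 ^ m - 1 - bchRank s (α m) - k := by omega
    rw [e]
    split_ifs <;> first | rfl | omega
  · rw [if_pos (by omega), if_neg (by omega), Bits.ext_of_lt _ (by omega)]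
    congr 1
    simp only
    omega

/-- Two codewords with the same information part differ by a codeword supported on the parity
coordinates, which is zero. The parity chosen by `Classical.epsilon` is therefore the only possible
one, and every way of finding it is legitimate. -/
theorem precode_unique {k : ℕ} (x : Bits k) (p : Bits (parityLength s α k))
    (hp : padLeft (2 ^ bchDegree s α k - 1) (Fin.append x p) ∈
      bchCode s (bchDegree s α k) (α (bchDegree s α k))) : precode s α k x = Fin.append x p := by
  obtain ⟨h1, h2⟩ := bchDegree_mem (s := s) hα k
  have hle : k + parityLength s α k ≤ 2 ^ bchDegree s α k - 1 := precodeLength_le (s := s) hα k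
  have hr := parityLength_eq (s := s) hα k
  have h0 := bchCode_eq_zero h1 (hα _ h1) ((bchCode s _ _).sub_mem (precode_mem hα x) hp)
    (fun j hj => by
      rw [Bits.ext_sub,
        padLeft_ext _ hle, padLeft_ext _ hle, precode, append_ext, append_ext, sub_eq_zero]
      split_ifs <;> first | rfl | omega)
  rw [sub_eq_zero] at h0
  refine Bits.eq_of_ext fun j hj => ?_
  have h3 := congrArg (fun c => Bits.ext c (j + (2 ^ bchDegree s α k - 1 -
    (k + parityLength s α k)))) h0
  rw [padLeft_ext _ hle, padLeft_ext _ hle, if_pos (by omega), if_pos (by omega),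
    Nat.add_sub_cancel] at h3
  exact h3

/-- The sum of the powers `β^(i (o + t))` over the positions `t < L` of the ones of `x`. -/
def wordEval {K : Type*} [CommRing K] (β : K) (o L i : ℕ) (x : ℕ → ZMod 2) : K :=
  ∑ t ∈ Finset.range L, if x t = 1 then β ^ (i * (o + t)) else 0

omit hα in
theorem padLeft_mem_bchCode {m L : ℕ} {β : GaloisField 2 m} (c : Bits L) (hL : L ≤ 2 ^ m - 1) :
    padLeft (2 ^ m - 1) c ∈ bchCode s m β ↔
      ∀ i ∈ Finset.Icc 1 (2 * s), wordEval β (2 ^ m - 1 - L) L i c.ext = 0 := by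
  refine forall₂_congr fun i _ => ?_
  have h1 : ∀ a : ZMod 2, ∀ b : GaloisField 2 m,
      algebraMap (ZMod 2) (GaloisField 2 m) a * b = if a = 1 then b else 0 := by
    intro a b
    have h : ∀ a : ZMod 2, a = 0 ∨ a = 1 := by decide
    rcases h a with rfl | rfl <;> simp
  have h2 : ∀ j : Fin (2 ^ m - 1), padLeft (2 ^ m - 1) c j = (padLeft (2 ^ m - 1) c).ext j :=
    fun j => (Bits.ext_fin _ j).symm
  simp only [h1, h2]
  rw [Fin.sum_univ_eq_sum_range (fun j => if (padLeft (2 ^ m - 1) c).ext j = 1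
    then β ^ (i * j) else 0), wordEval]
  obtain ⟨o, ho⟩ : ∃ o, 2 ^ m - 1 = o + L := ⟨2 ^ m - 1 - L, by omega⟩
  rw [show Finset.range (2 ^ m - 1) = Finset.range (o + L) by rw [ho], Finset.sum_range_add,
    show 2 ^ m - 1 - L = o by omega]
  have h3 : ∑ j ∈ Finset.range o, (if (padLeft (2 ^ m - 1) c).ext j = 1 then β ^ (i * j) else 0) =
      0 := by
    refine Finset.sum_eq_zero fun j hj => ?_
    rw [Finset.mem_range] at hj
    have e : ¬ 2 ^ m - 1 - L ≤ j := by omega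
    rw [padLeft_ext _ hL, if_neg e]
    simp
  rw [h3, zero_add]
  have h4 : ∀ t, (padLeft (2 ^ m - 1) c).ext (o + t) = c.ext t := fun t => by
    rw [padLeft_ext _ hL, if_pos (by omega)]
    congr 1
    omega
  simp only [h4]

/-- Membership among the precoded words becomes a condition on syndromes, which the encoder and the
decoder can test. -/
theorem mem_range_precode {k : ℕ} {c : Bits (precodeLength s α k)} :
    c ∈ Set.range (precode s α k) ↔ ∀ i ∈ Finset.Icc 1 (2 * s),
      wordEval (α (bchDegree s α k)) (2 ^ bchDegree s α k - 1 - precodeLength s α k)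
        (precodeLength s α k) i c.ext = 0 := by
  rw [← padLeft_mem_bchCode c (precodeLength_le hα k)]
  constructor
  · rintro ⟨x, rfl⟩
    exact precode_mem hα x
  · intro h
    have h1 : Fin.append (fun i => c (Fin.castAdd _ i)) (fun i => c (Fin.natAdd _ i)) = c :=
      Fin.append_castAdd_natAdd
    refine ⟨fun i => c (Fin.castAdd _ i), ?_⟩
    rw [precode_unique hα _ (fun i => c (Fin.natAdd _ i)) (by rw [h1]; exact h), h1]

end Precode

/-! ### The minimum distance -/

/-- The power sums form a Vandermonde system with distinct nodes `f t` for the vector of the `f t`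
themselves. That vector would have to vanish, while its entries are nonzero. -/
theorem eq_empty_of_sum_pow_eq_zero {K : Type*} [Field K] (S : Finset ℕ) (f : ℕ → K)
    (hf : Set.InjOn f S) (hf0 : ∀ t ∈ S, f t ≠ 0)
    (h : ∀ i, 1 ≤ i → i ≤ S.card → ∑ t ∈ S, f t ^ i = 0) : S = ∅ := by
  by_contra hne
  let e := S.equivFin
  have h1 := Matrix.eq_zero_of_forall_pow_sum_mul_pow_eq_zero (R := K) (n := S.card)
    (f := fun j => f (e.symm j)) (v := fun j => f (e.symm j)) (fun a b hab =>
      e.symm.injective (Subtype.ext (hf (e.symm a).2 (e.symm b).2 hab))) (fun i => by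
      have h2 := h (i + 1) (by omega) (by have := i.isLt; omega)
      rw [← Finset.sum_coe_sort, ← e.symm.sum_comp] at h2
      rw [← h2]
      exact Finset.sum_congr rfl fun j _ => by rw [pow_succ'])
  obtain ⟨t, ht⟩ := Finset.nonempty_iff_ne_empty.2 hne
  have := congrFun h1 (e ⟨t, ht⟩)
  simp only [Equiv.symm_apply_apply, Pi.zero_apply] at this
  exact hf0 t ht this

theorem wordEval_add {K : Type*} [CommRing K] [CharP K 2] (β : K) (o L i : ℕ) (x y : ℕ → ZMod 2) :
    wordEval β o L i (fun t => x t + y t) = wordEval β o L i x + wordEval β o L i y := by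
  rw [wordEval, wordEval, wordEval, ← Finset.sum_add_distrib]
  refine Finset.sum_congr rfl fun t _ => ?_
  have h : ∀ a : ZMod 2, a = 0 ∨ a = 1 := by decide
  rcases h (x t) with h1 | h1 <;> rcases h (y t) with h2 | h2 <;>
    simp [h1, h2, CharTwo.add_self_eq_zero]

/-- The BCH bound. -/
theorem eq_zero_of_wordEval {K : Type*} [Field K] {β : K} {N o L s : ℕ} (hβ : orderOf β = N)
    (hβ0 : β ≠ 0) (hL : o + L ≤ N) {x : ℕ → ZMod 2}
    (hx : ((Finset.range L).filter fun t => x t = 1).card ≤ 2 * s)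
    (h : ∀ i ∈ Finset.Icc 1 (2 * s), wordEval β o L i x = 0) : ∀ t < L, x t = 0 := by
  have h1 := eq_empty_of_sum_pow_eq_zero ((Finset.range L).filter fun t => x t = 1)
    (fun t => β ^ (o + t)) (fun a ha b hb hab => by
      rw [Finset.mem_coe, Finset.mem_filter, Finset.mem_range] at ha hb
      have := pow_injOn_Iio_orderOf (x := β) (by simp; omega) (by simp; omega) hab
      omega) (fun t _ => pow_ne_zero _ hβ0) (fun i hi hi' => by
      have h2 := h i (Finset.mem_Icc.2 ⟨hi, hi'.trans hx⟩)
      rw [wordEval, ← Finset.sum_filter] at h2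
      rw [← h2]
      exact Finset.sum_congr rfl fun t _ => by rw [← pow_mul, mul_comm])
  intro t ht
  have h2 : ∀ a : ZMod 2, a = 0 ∨ a = 1 := by decide
  refine (h2 (x t)).resolve_right fun h3 => ?_
  have : t ∈ (Finset.range L).filter fun t => x t = 1 := by simp [ht, h3]
  rw [h1] at this
  simp at this

end

section

/-! ### Moduli that separate a number from many others -/

/-- The number of indices `J < N` for which `D J` is a nonzero multiple of `P`. -/
def countDvd (D : ℕ → ℕ) (N P : ℕ) : ℕ :=
  ((Finset.range N).filter fun J => D J ≠ 0 ∧ D J % P = 0).card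

theorem two_pow_le_centralBinom (n : ℕ) : 2 ^ n ≤ n.centralBinom := by
  induction n with
  | zero => simp
  | succ n ih =>
    have h := Nat.succ_mul_centralBinom_succ n
    have h1 : (n + 1) * (2 * n.centralBinom) ≤ (n + 1) * (n + 1).centralBinom := by
      rw [h]
      nlinarith
    have h2 := Nat.le_of_mul_le_mul_left h1 (by omega)
    rw [pow_succ]
    omega

/-- Compared prime by prime: the exponent of `p` in the central binomial coefficient is at most the
number of powers `p^a ≤ 2H`, and each of these powers divides at least `h` of the numbers `E J`,
thus contributing `h` to the exponent of the product. -/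
theorem centralBinom_pow_dvd_prod {ι : Type*} (S : Finset ι) (E : ι → ℕ) (hE : ∀ J ∈ S, E J ≠ 0)
    (H h : ℕ) (hcount : ∀ q, 1 ≤ q → q ≤ 2 * H → h ≤ (S.filter fun J => q ∣ E J).card) :
    H.centralBinom ^ h ∣ ∏ J ∈ S, E J := by
  classical
  have hprod : ∏ J ∈ S, E J ≠ 0 := Finset.prod_ne_zero_iff.2 hE
  rw [← Nat.factorization_le_iff_dvd (pow_ne_zero _ (Nat.centralBinom_ne_zero H)) hprod]
  intro p
  rw [Nat.factorization_pow, Nat.factorization_prod hE, Finsupp.smul_apply, Finsupp.finsetSum_apply,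
    smul_eq_mul]
  by_cases hp : p.Prime
  swap
  · simp [Nat.factorization_eq_zero_of_not_prime _ hp]
  set l := Nat.log p (2 * H) with hl
  have h1 : H.centralBinom.factorization p ≤ l := by
    rw [Nat.centralBinom_eq_two_mul_choose]
    exact Nat.factorization_choose_le_log
  have h2 : ∀ J ∈ S, ((Finset.Icc 1 l).filter fun a => p ^ a ∣ E J).card ≤
      (E J).factorization p := by
    intro J hJ
    calc _ ≤ (Finset.Icc 1 ((E J).factorization p)).card := Finset.card_le_card fun a ha => by
          rw [Finset.mem_filter, Finset.mem_Icc] at ha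
          rw [Finset.mem_Icc]
          exact ⟨ha.1.1, (hp.pow_dvd_iff_le_factorization (hE J hJ)).1 ha.2⟩
      _ = _ := by simp
  refine le_trans ?_ (Finset.sum_le_sum h2)
  have h3 : ∑ J ∈ S, ((Finset.Icc 1 l).filter fun a => p ^ a ∣ E J).card =
      ∑ a ∈ Finset.Icc 1 l, (S.filter fun J => p ^ a ∣ E J).card := by
    simp only [Finset.card_filter]
    exact Finset.sum_comm
  rw [h3]
  calc h * H.centralBinom.factorization p ≤ ∑ a ∈ Finset.Icc 1 l, h := by
        rw [Finset.sum_const, smul_eq_mul, mul_comm]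
        exact Nat.mul_le_mul_right _ (by simpa using h1)
    _ ≤ _ := Finset.sum_le_sum fun a ha => by
        rw [Finset.mem_Icc] at ha
        refine hcount _ (Nat.pow_pos hp.pos) ?_
        have hH : 2 * H ≠ 0 := by
          intro h0
          rw [hl, h0] at ha
          simp at ha
          omega
        exact Nat.pow_le_of_le_log hH ha.2

/-- Suppose that every `q ≤ 2H` leaves more than `A |S| / H` bad differences. Then the quotients `D
J / P` have a product divisible by the `h`-th power of the central binomial coefficient, hence at
least `2^(H h)`. But the product is at most `2^(A |S|)`, and `H h > A |S|`. -/
theorem exists_factor (D : ℕ → ℕ) (N : ℕ) {P A H : ℕ} (hH : 1 ≤ H)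
    (hD : ∀ J < N, D J < 2 ^ A) :
    ∃ t < 2 * H, countDvd D N (P * (t + 1)) * H ≤ A * countDvd D N P := by
  classical
  by_contra hno
  push Not at hno
  set S := (Finset.range N).filter fun J => D J ≠ 0 ∧ D J % P = 0 with hS
  set h := A * S.card / H + 1 with hh
  have hhH : A * S.card < h * H := by
    calc A * S.card < H * (A * S.card / H + 1) := Nat.lt_mul_div_succ _ (by omega)
      _ = h * H := by rw [hh, mul_comm]
  have hE : ∀ J ∈ S, D J / P ≠ 0 := by
    intro J hJ
    obtain ⟨-, h1, h2⟩ := Finset.mem_filter.1 hJ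
    have := Nat.div_mul_cancel (Nat.dvd_of_mod_eq_zero h2)
    intro h3
    rw [h3, zero_mul] at this
    exact h1 this.symm
  have hdvd := centralBinom_pow_dvd_prod S (fun J => D J / P) hE H h (fun q hq hq' => by
    have h1 := hno (q - 1) (by omega)
    rw [show q - 1 + 1 = q by omega] at h1
    have h2 : (S.filter fun J => q ∣ D J / P) =
        (Finset.range N).filter fun J => D J ≠ 0 ∧ D J % (P * q) = 0 := by
      rw [hS, Finset.filter_filter]
      refine Finset.filter_congr fun J _ => ?_
      rw [← Nat.dvd_iff_mod_eq_zero, ← Nat.dvd_iff_mod_eq_zero]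
      constructor
      · rintro ⟨⟨h3, h4⟩, h5⟩
        refine ⟨h3, ?_⟩
        rw [← Nat.mul_div_cancel' h4]
        exact Nat.mul_dvd_mul_left P h5
      · rintro ⟨h3, h4⟩
        exact ⟨⟨h3, dvd_trans (dvd_mul_right _ _) h4⟩, Nat.dvd_div_of_mul_dvd h4⟩
    rw [h2]
    change A * S.card < countDvd D N (P * q) * H at h1
    change h ≤ countDvd D N (P * q)
    rw [hh, Nat.succ_le_iff]
    exact (Nat.div_lt_iff_lt_mul (by omega)).2 h1)
  have h1 := Nat.le_of_dvd (Nat.pos_of_ne_zero (Finset.prod_ne_zero_iff.2 hE)) hdvd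
  have h2 : ∏ J ∈ S, D J / P ≤ (2 ^ A) ^ S.card := by
    refine Finset.prod_le_pow_card _ _ _ fun J hJ => ?_
    exact (Nat.div_le_self _ _).trans (hD J (Finset.mem_range.1 (Finset.mem_filter.1 hJ).1)).le
  have h3 : 2 ^ (H * h) ≤ 2 ^ (A * S.card) := by
    rw [pow_mul, pow_mul]
    exact (Nat.pow_le_pow_left (two_pow_le_centralBinom H) h).trans (h1.trans h2)
  have h4 := (Nat.pow_le_pow_iff_right (by omega)).1 h3
  rw [mul_comm] at h4
  omega

/-- The number below the least factor by which the number of multiples of `P` drops by the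
factor `H / A`. -/
noncomputable def stageFactor (D : ℕ → ℕ) (N A H P : ℕ) : ℕ :=
  sInf {t | countDvd D N (P * (t + 1)) * H ≤ A * countDvd D N P}

/-- The modulus after `j` stages. -/
noncomputable def stageModulus (D : ℕ → ℕ) (N A H : ℕ) : ℕ → ℕ
  | 0 => 1
  | j + 1 => stageModulus D N A H j * (stageFactor D N A H (stageModulus D N A H j) + 1)

section Stages

variable {D : ℕ → ℕ} {N A H : ℕ}

theorem stageFactor_spec {P : ℕ} (hH : 1 ≤ H) (hD : ∀ J < N, D J < 2 ^ A) :
    stageFactor D N A H P < 2 * H ∧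
      countDvd D N (P * (stageFactor D N A H P + 1)) * H ≤ A * countDvd D N P := by
  obtain ⟨t, h1, h2⟩ := exists_factor D N hH hD
  exact ⟨(Nat.sInf_le (s := {t | countDvd D N (P * (t + 1)) * H ≤ A * countDvd D N P}) h2).trans_lt
    h1, Nat.sInf_mem (s := {t | countDvd D N (P * (t + 1)) * H ≤ A * countDvd D N P}) ⟨t, h2⟩⟩

theorem stageModulus_pos (j : ℕ) : 1 ≤ stageModulus D N A H j := by
  induction j with
  | zero => exact le_rfl
  | succ j ih => exact Nat.mul_pos ih (by omega)

/-- A stage multiplies the modulus by at most `2H` and the number of bad differences by at most `A /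
H`. -/
theorem stageModulus_spec (hH : 1 ≤ H) (hD : ∀ J < N, D J < 2 ^ A) (j : ℕ) :
    stageModulus D N A H j ≤ (2 * H) ^ j ∧
      countDvd D N (stageModulus D N A H j) * H ^ j ≤ A ^ j * N := by
  induction j with
  | zero =>
    refine ⟨le_rfl, ?_⟩
    simp only [pow_zero, mul_one, one_mul]
    exact (Finset.card_filter_le _ _).trans (by simp)
  | succ j ih =>
    obtain ⟨h1, h2⟩ := stageFactor_spec (P := stageModulus D N A H j) hH hD
    refine ⟨?_, ?_⟩
    · rw [stageModulus, pow_succ]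
      exact Nat.mul_le_mul ih.1 h1
    · rw [stageModulus]
      calc _ = countDvd D N (stageModulus D N A H j *
            (stageFactor D N A H (stageModulus D N A H j) + 1)) * H * H ^ j := by rw [pow_succ]; ring
        _ ≤ A * countDvd D N (stageModulus D N A H j) * H ^ j := Nat.mul_le_mul_right _ h2
        _ = A * (countDvd D N (stageModulus D N A H j) * H ^ j) := by ring
        _ ≤ A * (A ^ j * N) := Nat.mul_le_mul_left _ ih.2
        _ = _ := by rw [pow_succ]; ring

/-- The final modulus: `e` stages with parameter `H` and one with parameter `H'`. -/
noncomputable def finalModulus (D : ℕ → ℕ) (N A H e H' : ℕ) : ℕ :=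
  stageModulus D N A H e * (stageFactor D N A H' (stageModulus D N A H e) + 1)

/-- After `e` stages at most `K A^e` bad differences remain. The last parameter exceeds `A` times
this number, so the inequality of the last stage leaves no room for even one of them. -/
theorem finalModulus_spec (hH : 1 ≤ H) (hD : ∀ J < N, D J < 2 ^ A) {e K : ℕ}
    (hN : N ≤ K * H ^ e) :
    1 ≤ finalModulus D N A H e (K * A ^ (e + 1) + 1) ∧
    finalModulus D N A H e (K * A ^ (e + 1) + 1) ≤ (2 * H) ^ e * (2 * (K * A ^ (e + 1) + 1)) ∧
    ∀ J < N, D J ≠ 0 → D J % finalModulus D N A H e (K * A ^ (e + 1) + 1) ≠ 0 := by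
  obtain ⟨h1, h2⟩ := stageModulus_spec hH hD e
  obtain ⟨h3, h4⟩ := stageFactor_spec (P := stageModulus D N A H e) (H := K * A ^ (e + 1) + 1)
    (by omega) hD
  refine ⟨Nat.mul_pos (stageModulus_pos e) (by omega), Nat.mul_le_mul h1 h3, ?_⟩
  have h5 : countDvd D N (stageModulus D N A H e) ≤ A ^ e * K := by
    have h6 : countDvd D N (stageModulus D N A H e) * H ^ e ≤ (A ^ e * K) * H ^ e :=
      h2.trans (by rw [mul_assoc]; exact Nat.mul_le_mul_left _ hN)
    exact Nat.le_of_mul_le_mul_right h6 (Nat.pow_pos (by omega))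
  have h6 : countDvd D N (finalModulus D N A H e (K * A ^ (e + 1) + 1)) = 0 := by
    by_contra hne
    have h7 : A * countDvd D N (stageModulus D N A H e) ≤ K * A ^ (e + 1) := by
      calc _ ≤ A * (A ^ e * K) := Nat.mul_le_mul_left _ h5
        _ = _ := by rw [pow_succ]; ring
    have h8 := h4.trans h7
    have h9 : K * A ^ (e + 1) + 1 ≤ countDvd D N (finalModulus D N A H e (K * A ^ (e + 1) + 1)) *
        (K * A ^ (e + 1) + 1) := Nat.le_mul_of_pos_left _ (Nat.pos_of_ne_zero hne)
    rw [finalModulus] at h9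
    omega
  intro J hJ h0 hmod
  rw [countDvd, Finset.card_eq_zero] at h6
  have : J ∈ (Finset.range N).filter fun J => D J ≠ 0 ∧
      D J % finalModulus D N A H e (K * A ^ (e + 1) + 1) = 0 := by simp [hJ, h0, hmod]
  rw [h6] at this
  simp at this

end Stages

/-! ### Enumeration of substitution patterns and insertions -/

/-- The pattern with number `n`: the digits of `n` in base `B` are the positions of the ones. -/
def pattern (B s n t : ℕ) : ZMod 2 :=
  ((∑ a ∈ Finset.range s, if n / B ^ a % B = t then 1 else 0 : ℕ) : ZMod 2)

theorem pattern_succ {B : ℕ} (s n d t : ℕ) (hd : d < B) :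
    pattern B (s + 1) (d + B * n) t = pattern B s n t + if d = t then 1 else 0 := by
  rw [pattern, Finset.sum_range_succ', pattern, Nat.cast_add]
  have h1 : ∀ a, (d + B * n) / B ^ (a + 1) = n / B ^ a := fun a => by
    rw [pow_succ', ← Nat.div_div_eq_div_mul, Nat.add_mul_div_left _ _ (by omega),
      Nat.div_eq_of_lt hd, zero_add]
  have h2 : (d + B * n) / B ^ 0 % B = d := by
    rw [pow_zero, Nat.div_one, Nat.add_mul_mod_self_left, Nat.mod_eq_of_lt hd]
  simp only [h1, h2]
  congr 1
  split_ifs <;> simp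

/-- The base is `L + 1` so that the digit `L`, which is no position of the word, can pad a pattern
with fewer than `s` ones. -/
theorem exists_pattern {L : ℕ} (s : ℕ) : ∀ S : Finset ℕ, S ⊆ Finset.range L → S.card ≤ s →
    ∃ n < (L + 1) ^ s, ∀ t < L, pattern (L + 1) s n t = if t ∈ S then 1 else 0 := by
  classical
  induction s with
  | zero =>
    intro S _ hc
    obtain rfl : S = ∅ := Finset.card_eq_zero.1 (by omega)
    exact ⟨0, by simp, by simp [pattern]⟩
  | succ s ih =>
    intro S hS hc
    have key : ∀ d < L + 1, ∀ S' : Finset ℕ, S' ⊆ Finset.range L → S'.card ≤ s →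
        (∀ t < L, (if t ∈ S then (1 : ZMod 2) else 0) =
          (if t ∈ S' then 1 else 0) + if d = t then 1 else 0) →
        ∃ n < (L + 1) ^ (s + 1), ∀ t < L, pattern (L + 1) (s + 1) n t = if t ∈ S then 1 else 0 := by
      intro d hd S' hS' hc' h
      obtain ⟨n, hn, hp⟩ := ih S' hS' hc'
      refine ⟨d + (L + 1) * n, ?_, fun t ht => ?_⟩
      · rw [pow_succ']
        nlinarith
      · rw [pattern_succ _ _ _ _ hd, hp t ht, h t ht]
    rcases S.eq_empty_or_nonempty with rfl | ⟨x, hx⟩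
    · refine key L (by omega) ∅ (by simp) (by simp) fun t ht => ?_
      simp [show ¬ L = t by omega]
    · have hxL := Finset.mem_range.1 (hS hx)
      refine key x (by omega) (S.erase x) ((Finset.erase_subset _ _).trans hS) ?_ fun t ht => ?_
      · rw [Finset.card_erase_of_mem hx]
        omega
      · by_cases h : x = t
        · subst h; simp [hx]
        · simp [h, Finset.mem_erase, Ne.symm h]

theorem card_pattern_le (B s n L : ℕ) :
    ((Finset.range L).filter fun t => pattern B s n t ≠ 0).card ≤ s := by
  classical
  have hsub : ((Finset.range L).filter fun t => pattern B s n t ≠ 0) ⊆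
      (Finset.range s).image fun a => n / B ^ a % B := by
    intro t ht
    rw [Finset.mem_filter] at ht
    rw [Finset.mem_image]
    by_contra hno
    push Not at hno
    refine ht.2 ?_
    rw [pattern, Finset.sum_eq_zero fun a ha => if_neg (hno a ha)]
    simp
  exact (Finset.card_le_card hsub).trans (Finset.card_image_le.trans (by simp))

/-- The number of the position `t` after the deletion of position `d`. -/
def unskip (d t : ℕ) : ℕ := if t < d then t else t - 1

/-- The word `y` with the symbol `b` inserted at position `d`. -/
def insertWord (d : ℕ) (b : ZMod 2) (y : ℕ → ZMod 2) (t : ℕ) : ZMod 2 :=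
  if t = d then b else y (unskip d t)

theorem skip_unskip {d t : ℕ} (h : t ≠ d) : skip d (unskip d t) = t := by
  simp only [skip, unskip]
  split_ifs <;> omega

theorem insertWord_skip (d : ℕ) (b : ZMod 2) (y : ℕ → ZMod 2) (j : ℕ) :
    insertWord d b y (skip d j) = y j := by
  simp only [insertWord, skip, unskip]
  split_ifs <;> first | omega | rfl

theorem card_insertWord_ne {d L s : ℕ} (hd : d < L) {y x : ℕ → ZMod 2} (b : ZMod 2)
    (h : ((Finset.range (L - 1)).filter fun j => y j ≠ x j).card ≤ s) :
    ((Finset.range L).filter fun t => insertWord d b y t ≠ insertWord d b x t).card ≤ s := by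
  refine le_trans (Finset.card_le_card_of_injOn (unskip d) ?_ ?_) h
  · intro t ht
    rw [Finset.mem_coe, Finset.mem_filter, Finset.mem_range] at ht ⊢
    obtain ⟨h1, h2⟩ := ht
    have h3 : t ≠ d := by
      rintro rfl
      simp [insertWord] at h2
    simp only [insertWord, if_neg h3] at h2
    refine ⟨?_, h2⟩
    simp only [unskip]
    split_ifs <;> omega
  · intro t ht t' ht' heq
    rw [Finset.mem_coe, Finset.mem_filter] at ht ht'
    have h3 : t ≠ d := by
      rintro rfl
      simp [insertWord] at ht
    have h4 : t' ≠ d := by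
      rintro rfl
      simp [insertWord] at ht'
    rw [← skip_unskip h3, ← skip_unskip h4, heq]

theorem insertWord_self (d : ℕ) (x : ℕ → ZMod 2) :
    insertWord d (x d) (fun j => x (skip d j)) = x := by
  funext t
  by_cases h : t = d
  · simp [insertWord, h]
  · simp [insertWord, h, skip_unskip h]

theorem exists_pattern_add {L s : ℕ} {y x : ℕ → ZMod 2}
    (h : ((Finset.range L).filter fun t => y t ≠ x t).card ≤ s) :
    ∃ n < (L + 1) ^ s, ∀ t < L, y t + pattern (L + 1) s n t = x t := by
  obtain ⟨n, hn, hp⟩ := exists_pattern s ((Finset.range L).filter fun t => y t ≠ x t)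
    (Finset.filter_subset _ _) h
  refine ⟨n, hn, fun t ht => ?_⟩
  rw [hp t ht]
  have key : ∀ a b : ZMod 2, a ≠ b → a + 1 = b := by decide
  by_cases h1 : y t = x t
  · simp [h1]
  · rw [if_pos (by simp [ht, h1])]
    exact key _ _ h1

/-- A word is recovered from an erroneous version by an insertion and `s` substitutions. -/
theorem Near.exists_insert {s L d : ℕ} {y x : ℕ → ZMod 2} (hd : d < L) (h : Near s L d y x) :
    ∃ n < (L + 1) ^ s, ∀ t < L, insertWord d (x d) y t + pattern (L + 1) s n t = x t := by
  have h1 := card_insertWord_ne hd (x d) h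
  rw [insertWord_self] at h1
  exact exists_pattern_add h1

theorem near_insert (s L d n : ℕ) (b : ZMod 2) (y : ℕ → ZMod 2) :
    Near s L d y fun t => insertWord d b y t + pattern (L + 1) s n t := by
  refine le_trans ?_ (card_pattern_le (L + 1) s n L)
  refine Finset.card_le_card_of_injOn (skip d) (fun j hj => ?_)
    ((skip_strictMono d).injective.injOn)
  rw [Finset.mem_coe, Finset.mem_filter, Finset.mem_range] at hj ⊢
  refine ⟨skip_lt hj.1, fun h0 => hj.2 ?_⟩
  show y j = insertWord d b y (skip d j) + pattern (L + 1) s n (skip d j)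
  rw [h0, insertWord_skip, add_zero]

/-! ### Syndromes of the BCH code -/

/-- The `i`-th BCH syndrome of the word `x` of length `n`, as a state of the shift register. -/
def bchSyndrome (Q q o n i : ℕ) (x : ℕ → ZMod 2) : ℕ :=
  xsum n fun t => if x t = 1 then lfsrState Q q (i * (o + t)) else 0

/-- The odd BCH syndromes, packed into one number. -/
def bchKey (Q q o n s : ℕ) (x : ℕ → ZMod 2) : ℕ :=
  ∑ i ∈ Finset.range s, bchSyndrome Q q o n (2 * i + 1) x * Q ^ i

theorem xsum_congr {n : ℕ} {f g : ℕ → ℕ} (h : ∀ j < n, f j = g j) : xsum n f = xsum n g := by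
  induction n with
  | zero => rfl
  | succ n ih => rw [xsum_succ, xsum_succ, ih fun j hj => h j (by omega), h n (by omega)]

theorem xsum_lt {n m : ℕ} {f : ℕ → ℕ} (h : ∀ j < n, f j < 2 ^ m) : xsum n f < 2 ^ m := by
  induction n with
  | zero => simp
  | succ n ih =>
    rw [xsum_succ]
    exact Nat.xor_lt_two_pow (ih fun j hj => h j (by omega)) (h n (by omega))

theorem bitEval_xsum {R : Type*} [CommRing R] [CharP R 2] (β : R) (n : ℕ) (f : ℕ → ℕ) :
    bitEval β (xsum n f) = ∑ j ∈ Finset.range n, bitEval β (f j) := by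
  induction n with
  | zero => simp
  | succ n ih => rw [xsum_succ, bitEval_xor, ih, Finset.sum_range_succ]

theorem bchSyndrome_congr {Q q o n i : ℕ} {x y : ℕ → ZMod 2} (h : ∀ t < n, x t = y t) :
    bchSyndrome Q q o n i x = bchSyndrome Q q o n i y :=
  xsum_congr fun t ht => by rw [h t ht]

theorem bchKey_congr {Q q o n s : ℕ} {x y : ℕ → ZMod 2} (h : ∀ t < n, x t = y t) :
    bchKey Q q o n s x = bchKey Q q o n s y :=
  Finset.sum_congr rfl fun i _ => by rw [bchSyndrome_congr h]

theorem sum_digits_lt {Q s : ℕ} {f : ℕ → ℕ} (hf : ∀ i < s, f i < Q) :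
    ∑ i ∈ Finset.range s, f i * Q ^ i < Q ^ s := by
  induction s with
  | zero => simp
  | succ s ih =>
    rw [Finset.sum_range_succ, pow_succ']
    have h1 := ih fun i hi => hf i (by omega)
    have h2 := Nat.mul_le_mul_right (Q ^ s) (Nat.succ_le_of_lt (hf s (by omega)))
    rw [Nat.succ_mul] at h2
    omega

theorem digits_injective {Q s : ℕ} {f g : ℕ → ℕ} (hf : ∀ i < s, f i < Q) (hg : ∀ i < s, g i < Q)
    (h : ∑ i ∈ Finset.range s, f i * Q ^ i = ∑ i ∈ Finset.range s, g i * Q ^ i) :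
    ∀ i < s, f i = g i := by
  induction s with
  | zero => simp
  | succ s ih =>
    rw [Finset.sum_range_succ, Finset.sum_range_succ] at h
    have h1 := sum_digits_lt (s := s) fun i hi => hf i (by omega)
    have h2 := sum_digits_lt (s := s) fun i hi => hg i (by omega)
    have h3 : f s = g s := by
      have e1 := congrArg (· / Q ^ s) h
      rwa [Nat.add_mul_div_right _ _ (by omega), Nat.add_mul_div_right _ _ (by omega),
        Nat.div_eq_of_lt h1, Nat.div_eq_of_lt h2, zero_add, zero_add] at e1
    rw [h3] at h
    intro i hi
    rcases Nat.lt_succ_iff_lt_or_eq.1 hi with h4 | rfl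
    · exact ih (fun i hi => hf i (by omega)) (fun i hi => hg i (by omega)) (by omega) i h4
    · exact h3

/-- Arbitrary exponents reduce to a table with `2^m - 1` entries. -/
theorem lfsrState_mod {m q : ℕ} (h : FullPeriod m q) (j : ℕ) :
    lfsrState (2 ^ m) q (j % (2 ^ m - 1)) = lfsrState (2 ^ m) q j := by
  set N := 2 ^ m - 1
  have key : ∀ a b, lfsrState (2 ^ m) q (b + N * a) = lfsrState (2 ^ m) q b := by
    intro a
    induction a with
    | zero => simp
    | succ a ih =>
      intro b
      rw [Nat.mul_succ, ← add_assoc, lfsrState_add, h.2.2.2, ← ih b]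
      rfl
  conv_rhs => rw [← Nat.mod_add_div j N]
  rw [key]

section Syndromes

variable {K : Type*} [Field K] [CharP K 2] {β : K} {m q o n s : ℕ} (hm : 1 ≤ m)
  (hq : FullPeriod m q) (hβ0 : β ≠ 0) (hβ : bitEval β q = 0)

include hβ in
theorem bitEval_bchSyndrome (i : ℕ) (x : ℕ → ZMod 2) :
    bitEval β (bchSyndrome (2 ^ m) q o n i x) = wordEval β o n i x := by
  rw [bchSyndrome, bitEval_xsum, wordEval]
  refine Finset.sum_congr rfl fun t _ => ?_
  split_ifs
  · exact bitEval_lfsrState β hβ _ _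
  · exact bitEval_zero β

include hm hq in
theorem bchSyndrome_lt (i : ℕ) (x : ℕ → ZMod 2) : bchSyndrome (2 ^ m) q o n i x < 2 ^ m := by
  refine xsum_lt fun t _ => ?_
  split_ifs
  · exact lfsrState_lt hm hq.1 hq.2.1 _
  · positivity

include hm hq hβ0 hβ

theorem bchSyndrome_eq_iff (i : ℕ) (x y : ℕ → ZMod 2) :
    bchSyndrome (2 ^ m) q o n i x = bchSyndrome (2 ^ m) q o n i y ↔
      wordEval β o n i x = wordEval β o n i y := by
  rw [← bitEval_bchSyndrome hβ, ← bitEval_bchSyndrome (m := m) hβ]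
  exact ⟨fun h => by rw [h], bitEval_injOn (fun x h0 hx => hq.bitEval_ne_zero hm hβ0 hβ h0 hx)
    (bchSyndrome_lt hm hq _ _) (bchSyndrome_lt hm hq _ _)⟩

theorem bchSyndrome_eq_zero_iff (i : ℕ) (x : ℕ → ZMod 2) :
    bchSyndrome (2 ^ m) q o n i x = 0 ↔ wordEval β o n i x = 0 := by
  rw [← bitEval_bchSyndrome (m := m) hβ]
  refine ⟨fun h => by rw [h, bitEval_zero], fun h => ?_⟩
  by_contra hne
  exact hq.bitEval_ne_zero hm hβ0 hβ (Nat.pos_of_ne_zero hne) (bchSyndrome_lt hm hq _ _) h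

omit hm hq hβ0 hβ in
theorem wordEval_two_mul (i : ℕ) (x : ℕ → ZMod 2) :
    wordEval β o n (2 * i) x = wordEval β o n i x ^ 2 := by
  rw [wordEval, wordEval, sum_pow_char 2]
  refine Finset.sum_congr rfl fun t _ => ?_
  split_ifs
  · rw [← pow_mul]; congr 1; ring
  · simp

omit hm hq hβ0 hβ in
theorem wordEval_eq_zero_of_odd {x : ℕ → ZMod 2}
    (h : ∀ j < s, wordEval β o n (2 * j + 1) x = 0) :
    ∀ i ∈ Finset.Icc 1 (2 * s), wordEval β o n i x = 0 := by
  intro i hi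
  rw [Finset.mem_Icc] at hi
  induction i using Nat.strong_induction_on with
  | _ i ih =>
    rcases Nat.even_or_odd' i with ⟨j, rfl | rfl⟩
    · rw [wordEval_two_mul, ih j (by omega) ⟨by omega, by omega⟩]
      simp
    · exact h j (by omega)

theorem bchKey_eq_iff (x y : ℕ → ZMod 2) :
    bchKey (2 ^ m) q o n s x = bchKey (2 ^ m) q o n s y ↔
      ∀ j < s, wordEval β o n (2 * j + 1) x = wordEval β o n (2 * j + 1) y := by
  constructor
  · intro h j hj
    exact (bchSyndrome_eq_iff hm hq hβ0 hβ _ _ _).1 (digits_injective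
      (fun i _ => bchSyndrome_lt hm hq _ _) (fun i _ => bchSyndrome_lt hm hq _ _) h j hj)
  · intro h
    refine Finset.sum_congr rfl fun i hi => ?_
    rw [(bchSyndrome_eq_iff hm hq hβ0 hβ _ _ _).2 (h i (Finset.mem_range.1 hi))]

/-- The sum of the two patterns has weight at most `2s` and all its syndromes vanish, so it is zero
by the BCH bound. -/
theorem eq_of_bchKey_eq (hL : o + n ≤ 2 ^ m - 1) {x y : ℕ → ZMod 2}
    (hx : ((Finset.range n).filter fun t => x t ≠ 0).card ≤ s)
    (hy : ((Finset.range n).filter fun t => y t ≠ 0).card ≤ s)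
    (h : bchKey (2 ^ m) q o n s x = bchKey (2 ^ m) q o n s y) : ∀ t < n, x t = y t := by
  classical
  rw [bchKey_eq_iff hm hq hβ0 hβ] at h
  have h1 := eq_zero_of_wordEval (hq.orderOf_eq hm hβ0 hβ) hβ0 hL (s := s)
    (x := fun t => x t + y t) (by
      rw [two_mul]
      refine le_trans (Finset.card_le_card fun t ht => ?_) ((Finset.card_union_le _ _).trans
        (add_le_add hx hy))
      simp only [Finset.mem_filter, Finset.mem_union] at ht ⊢
      by_cases h2 : x t = 0
      · right
        refine ⟨ht.1, fun h3 => ?_⟩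
        rw [h2, h3] at ht
        simp at ht
      · left
        exact ⟨ht.1, h2⟩)
    (wordEval_eq_zero_of_odd fun j hj => by
      rw [wordEval_add, h j hj, CharTwo.add_self_eq_zero])
  intro t ht
  exact CharTwo.add_eq_zero.1 (h1 t ht)

end Syndromes

/-! ### The decoding table -/

/-- The table that maps the syndrome of a pattern to the number of a pattern with this syndrome,
after the first `j` patterns have been entered. -/
def syndromeTable (key : ℕ → ℕ) : ℕ → ℕ → ℕ
  | 0 => fun _ => 0
  | j + 1 => Function.update (syndromeTable key j) (key j) j

/-- A later pattern may overwrite an earlier one, but only one with the same syndromes; together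
with `eq_of_bchKey_eq` the entry is still the right pattern. -/
theorem syndromeTable_spec (key : ℕ → ℕ) (M : ℕ) : ∀ n < M, syndromeTable key M (key n) < M ∧
    key (syndromeTable key M (key n)) = key n := by
  induction M with
  | zero => simp
  | succ M ih =>
    intro n hn
    by_cases h : key n = key M
    · rw [syndromeTable, h, Function.update_self]
      exact ⟨by omega, rfl⟩
    · rw [syndromeTable, Function.update_of_ne h]
      have hne : n ≠ M := fun h' => h (by rw [h'])
      obtain ⟨h1, h2⟩ := ih n (by omega)
      exact ⟨by omega, h2⟩

theorem syndromeTable_lt (key : ℕ → ℕ) {M : ℕ} (hM : 1 ≤ M) (x : ℕ) : syndromeTable key M x < M := by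
  have : ∀ M, syndromeTable key M x < M + 1 ∧ (1 ≤ M → syndromeTable key M x < M) := by
    intro M
    induction M with
    | zero => simp [syndromeTable]
    | succ M ih =>
      rw [syndromeTable]
      by_cases h : x = key M
      · rw [h, Function.update_self]
        omega
      · rw [Function.update_of_ne h]
        omega
  exact (this M).2 hM

end

section

/-! ### Candidates for the decoding of a deletion and substitutions -/

/-- The number of ways to insert a symbol and to change at most `s` symbols of a word of length
`L`. -/
def candidateCount (s L : ℕ) : ℕ := 2 * L * (L + 1) ^ s

/-- The word that is obtained from `y` by an insertion and substitutions, as coded in `J`. -/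
def candidate (s L : ℕ) (y : ℕ → ZMod 2) (J t : ℕ) : ZMod 2 :=
  insertWord (J / (L + 1) ^ s / 2) ((J / (L + 1) ^ s % 2 : ℕ) : ZMod 2) y t +
    pattern (L + 1) s (J % (L + 1) ^ s) t

theorem exists_candidate_eq {s L d n : ℕ} (hd : d < L) (hn : n < (L + 1) ^ s) (b : ZMod 2) :
    ∃ J < candidateCount s L, ∀ (y : ℕ → ZMod 2) (t : ℕ),
      candidate s L y J t = insertWord d b y t + pattern (L + 1) s n t := by
  have hb := b.val_lt
  have h1 : (n + (L + 1) ^ s * (b.val + 2 * d)) / (L + 1) ^ s = b.val + 2 * d := by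
    rw [Nat.add_mul_div_left _ _ (by positivity), Nat.div_eq_of_lt hn, zero_add]
  refine ⟨n + (L + 1) ^ s * (b.val + 2 * d), ?_, fun y t => ?_⟩
  · rw [candidateCount, mul_comm (2 * L)]
    have : b.val + 2 * d + 1 ≤ 2 * L := by omega
    have := Nat.mul_le_mul_left ((L + 1) ^ s) this
    rw [Nat.mul_succ] at this
    omega
  · rw [candidate, h1, show (n + (L + 1) ^ s * (b.val + 2 * d)) % (L + 1) ^ s = n by
        rw [Nat.add_mul_mod_self_left, Nat.mod_eq_of_lt hn],
      show (b.val + 2 * d) / 2 = d by omega, show (b.val + 2 * d) % 2 = b.val by omega,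
      ZMod.natCast_zmod_val]

theorem Near.exists_candidate {s L d : ℕ} {y x : ℕ → ZMod 2} (hd : d < L) (h : Near s L d y x) :
    ∃ J < candidateCount s L, ∀ t < L, candidate s L y J t = x t := by
  obtain ⟨n, hn, hp⟩ := h.exists_insert hd
  obtain ⟨J, hJ, hc⟩ := exists_candidate_eq hd hn (x d)
  exact ⟨J, hJ, fun t ht => by rw [hc, hp t ht]⟩

theorem near_candidate {s L J : ℕ} (hJ : J < candidateCount s L) (y : ℕ → ZMod 2) :
    ∃ d < L, Near s L d y (candidate s L y J) := by
  refine ⟨J / (L + 1) ^ s / 2, ?_, near_insert ..⟩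
  rw [Nat.div_div_eq_div_mul, Nat.div_lt_iff_lt_mul (by positivity)]
  rw [candidateCount] at hJ
  calc J < 2 * L * (L + 1) ^ s := hJ
    _ = _ := by ring

/-! ### The neighbours of a codeword -/

/-- The table that finds a pattern of `s` substitutions from its BCH syndromes. -/
def keyTable (Q q o n s : ℕ) : ℕ → ℕ :=
  syndromeTable (fun a => bchKey Q q o n s (pattern (n + 1) s a)) ((n + 1) ^ s)

/-- The word that is obtained from `c` by the deletion of the symbol `J / candidateCount s n`, an
insertion and substitutions. -/
def corrupted (n s : ℕ) (c : ℕ → ZMod 2) (J : ℕ) : ℕ → ZMod 2 :=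
  candidate s n (fun j => c (skip (J / candidateCount s n) j)) (J % candidateCount s n)

/-- The decoding of a corrupted word. -/
def neighbour (Q q o n s : ℕ) (c : ℕ → ZMod 2) (J t : ℕ) : ZMod 2 :=
  corrupted n s c J t +
    pattern (n + 1) s (keyTable Q q o n s (bchKey Q q o n s (corrupted n s c J))) t

theorem candidateCount_pos {s n : ℕ} (hn : 1 ≤ n) : 0 < candidateCount s n := by
  unfold candidateCount
  positivity

/-- Let `y` lie in both error balls. Deleting the symbol `d` of `c` gives `y` up to `s`
substitutions, so inserting `c' d'` at position `d'` and making `s` substitutions yields the word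
`y` with this symbol inserted. That word is within distance `s` of the codeword `c'`, and the
syndrome table removes the remaining errors. The second set of substitutions is looked up instead of
enumerated, which keeps the number of trials at `O(n^(s+2))`. -/
theorem exists_neighbour {K : Type*} [Field K] [CharP K 2] {β : K} {m q o n s : ℕ} (hm : 1 ≤ m)
    (hq : FullPeriod m q) (hβ0 : β ≠ 0) (hβ : bitEval β q = 0) (hL : o + n ≤ 2 ^ m - 1)
    {c c' y : ℕ → ZMod 2} {d d' : ℕ} (hd : d < n) (hd' : d' < n)
    (hc' : ∀ i ∈ Finset.Icc 1 (2 * s), wordEval β o n i c' = 0)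
    (h : Near s n d y c) (h' : Near s n d' y c') :
    ∃ J < n * candidateCount s n, ∀ t < n, neighbour (2 ^ m) q o n s c J t = c' t := by
  have h1 : ((Finset.range (n - 1)).filter fun j => c (skip d j) ≠ y j).card ≤ s := by
    refine le_trans (le_of_eq ?_) h
    simp only [ne_comm]
  obtain ⟨a, ha, hpa⟩ := exists_pattern_add (card_insertWord_ne hd' (c' d') h1)
  obtain ⟨e, he, hpe⟩ := h'.exists_insert hd'
  obtain ⟨J, hJ, hcJ⟩ := exists_candidate_eq hd' ha (c' d')
  have hpos := candidateCount_pos (s := s) (show 1 ≤ n by omega)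
  have hz : ∀ t < n, corrupted n s c (J + candidateCount s n * d) t =
      insertWord d' (c' d') y t := by
    intro t ht
    rw [corrupted, Nat.add_mul_div_left _ _ hpos, Nat.div_eq_of_lt hJ, zero_add,
      Nat.add_mul_mod_self_left, Nat.mod_eq_of_lt hJ, hcJ, hpa t ht]
  refine ⟨J + candidateCount s n * d, ?_, fun t ht => ?_⟩
  · have := Nat.mul_le_mul_left (candidateCount s n) (Nat.succ_le_of_lt hd)
    rw [Nat.mul_succ, mul_comm _ n] at this
    omega
  -- The codeword `c'` contributes nothing to the syndromes, so only those of the error pattern `e`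
  -- are seen.
  have hkey : bchKey (2 ^ m) q o n s (corrupted n s c (J + candidateCount s n * d)) =
      bchKey (2 ^ m) q o n s (pattern (n + 1) s e) := by
    have h2 : ∀ t < n, corrupted n s c (J + candidateCount s n * d) t =
        c' t + pattern (n + 1) s e t := by
      intro t ht
      rw [hz t ht, ← hpe t ht, add_assoc, CharTwo.add_self_eq_zero, add_zero]
    rw [bchKey_congr h2, bchKey_eq_iff hm hq hβ0 hβ]
    intro j hj
    rw [wordEval_add, hc' _ (by rw [Finset.mem_Icc]; omega), zero_add]
  obtain ⟨h3, h4⟩ := syndromeTable_spec (fun a => bchKey (2 ^ m) q o n s (pattern (n + 1) s a))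
    ((n + 1) ^ s) e he
  have h5 := eq_of_bchKey_eq hm hq hβ0 hβ hL (card_pattern_le _ _ _ _) (card_pattern_le _ _ _ _) h4
  rw [neighbour, hkey, keyTable, h5 t ht, hz t ht, hpe t ht]

/-! ### The compression -/

/-- The syndrome value of the word `x` of length `L`. -/
def wordValue (s L : ℕ) (x : ℕ → ZMod 2) : ℕ :=
  ∑ j ∈ Finset.range (2 * s + 1),
    (∑ i ∈ Finset.range L, (x i).val * weight (j + 1) (i + 1)) % ((2 * s + 1) * L ^ (j + 1)) *
      ((2 * s + 1) ^ j * L ^ (j * (j + 1) / 2))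

theorem syndromeValue_eq {s L : ℕ} (x : Bits L) : syndromeValue s x = wordValue s L x.ext := by
  rw [syndromeValue, wordValue, Finset.range_eq_Ico]
  refine (Finset.sum_Ico_add' (fun j => syndrome s x j * ∏ i ∈ Finset.Icc 1 (j - 1),
      ((2 * s + 1) * L ^ i)) 0 (2 * s + 1) 1).symm.trans (Finset.sum_congr rfl fun j _ => ?_)
  rw [syndrome_eq, Nat.add_sub_cancel, prod_radix,
    show j * (j + 1) / 2 = ∑ i ∈ Finset.Icc 1 j, i by have := sum_Icc_one j; omega]

theorem wordValue_congr {s L : ℕ} {x y : ℕ → ZMod 2} (h : ∀ t < L, x t = y t) :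
    wordValue s L x = wordValue s L y := by
  refine Finset.sum_congr rfl fun j _ => ?_
  congr 2
  exact Finset.sum_congr rfl fun i hi => by rw [h i (Finset.mem_range.1 hi)]

theorem wordValue_eq_syndromeValue (s L : ℕ) (x : ℕ → ZMod 2) :
    wordValue s L x = syndromeValue s (fun i : Fin L => x i) := by
  rw [syndromeValue_eq]
  exact wordValue_congr fun t ht => by rw [Bits.ext_of_lt _ ht]

theorem wordValue_lt {s L : ℕ} (hL : 1 ≤ L) (x : ℕ → ZMod 2) :
    wordValue s L x < 2 ^ syndromeLength s L := by
  rw [wordValue_eq_syndromeValue]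
  exact syndromeValue_lt hL _

theorem eq_of_wordValue_eq {s L : ℕ} (hs : 1 ≤ s) {x x' y : ℕ → ZMod 2} {d d' : ℕ}
    (hd : d < L) (hd' : d' < L) (h : Near s L d y x) (h' : Near s L d' y x')
    (hf : wordValue s L x = wordValue s L x') : ∀ t < L, x t = x' t := by
  have key : ∀ {d} {z : ℕ → ZMod 2}, Near s L d y z →
      Near s L d y (Bits.ext (L := L) fun i : Fin L => z i) := by
    intro d z hz
    refine le_trans (le_of_eq ?_) hz
    congr 1
    refine Finset.filter_congr fun j hj => ?_
    rw [Bits.ext_of_lt _ (skip_lt (Finset.mem_range.1 hj))]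
  have := eq_of_syndromeValue_eq hs hd hd' (key h) (key h')
    (by rw [← wordValue_eq_syndromeValue, ← wordValue_eq_syndromeValue, hf])
  intro t ht
  exact congrFun this ⟨t, ht⟩

/-- The distance of the syndrome values of `c` and of a neighbour. -/
def valueDist (Q q o n s : ℕ) (c : ℕ → ZMod 2) (J : ℕ) : ℕ :=
  (wordValue s n (neighbour Q q o n s c J) - wordValue s n c) +
    (wordValue s n c - wordValue s n (neighbour Q q o n s c J))

/-- The parameter of the last stage of the search for a modulus. -/
def lastParameter (s n : ℕ) : ℕ := 2 ^ (s + 1) * syndromeLength s n ^ (s + 2 + 1) + 1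

/-- The modulus for the word `c`. -/
noncomputable def compressionModulus (Q q o n s : ℕ) (c : ℕ → ZMod 2) : ℕ :=
  finalModulus (valueDist Q q o n s c) (n * candidateCount s n) (syndromeLength s n) n (s + 2)
    (lastParameter s n)

/-- The number of binary digits of the moduli. -/
def compressionWidth (s n : ℕ) : ℕ := Nat.clog 2 ((2 * n) ^ (s + 2) * (2 * lastParameter s n) + 1)

theorem valueDist_lt {Q q o n s : ℕ} (hn : 1 ≤ n) (c : ℕ → ZMod 2) (J : ℕ) :
    valueDist Q q o n s c J < 2 ^ syndromeLength s n := by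
  have h1 := wordValue_lt (s := s) hn c
  have h2 := wordValue_lt (s := s) hn (neighbour Q q o n s c J)
  unfold valueDist
  omega

/-- This provides `K = 2^(s+1)` and `e = s+2` for the search of the modulus with `H = n`, and so
fixes the number of stages and `lastParameter`. -/
theorem candidateCount_le {s n : ℕ} (hn : 1 ≤ n) :
    n * candidateCount s n ≤ 2 ^ (s + 1) * n ^ (s + 2) := by
  have h1 : (n + 1) ^ s ≤ (2 * n) ^ s := Nat.pow_le_pow_left (by omega) s
  calc n * candidateCount s n ≤ n * (2 * n * (2 * n) ^ s) := by
        unfold candidateCount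
        gcongr
    _ = _ := by rw [mul_pow]; ring

theorem compressionModulus_spec {Q q o n s : ℕ} (hn : 1 ≤ n) (c : ℕ → ZMod 2) :
    1 ≤ compressionModulus Q q o n s c ∧
    compressionModulus Q q o n s c < 2 ^ compressionWidth s n ∧
    ∀ J < n * candidateCount s n, valueDist Q q o n s c J ≠ 0 →
      valueDist Q q o n s c J % compressionModulus Q q o n s c ≠ 0 := by
  obtain ⟨h1, h2, h3⟩ := finalModulus_spec (D := valueDist Q q o n s c)
    (N := n * candidateCount s n) (A := syndromeLength s n) hn
    (fun J _ => valueDist_lt hn c J) (candidateCount_le hn)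
  exact ⟨h1, lt_of_lt_of_le (Nat.lt_succ_of_le h2) (Nat.le_pow_clog (by omega) _), h3⟩

section Compression

variable {s : ℕ} {α : (m : ℕ) → GaloisField 2 m} (hs : 1 ≤ s) (hα : IsPrimitiveFamily α)
  (hf : ∀ m, 1 ≤ m → bitEval (α m) (feedback m) = 0) (k : ℕ)

/-- The number of leading zeros of the shortened code. -/
noncomputable def precodeOffset (s : ℕ) (α : (m : ℕ) → GaloisField 2 m) (k : ℕ) : ℕ :=
  2 ^ bchDegree s α k - 1 - precodeLength s α k

/-- The syndrome compression with the moduli that are found by the stagewise search. -/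
noncomputable def stageCompression : SyndromeCompression s α k where
  width := compressionWidth s (precodeLength s α k)
  modulus c := compressionModulus (2 ^ bchDegree s α k) (feedback (bchDegree s α k))
    (precodeOffset s α k) (precodeLength s α k) s c.ext
  modulus_pos c := (compressionModulus_spec (one_le_precodeLength hα hs k) _).1
  modulus_lt c := (compressionModulus_spec (one_le_precodeLength hα hs k) _).2.1
  separates := by
    intro c hc c' hc' hne hball hmod
    have hn := one_le_precodeLength hα hs k
    obtain ⟨hm, -⟩ := bchDegree_mem hα k
    obtain ⟨y, hy, hy'⟩ := hball
    obtain ⟨d, hd, h⟩ := (mem_errorBall hn).1 hy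
    obtain ⟨d', hd', h'⟩ := (mem_errorBall hn).1 hy'
    have hβ0 : α (bchDegree s α k) ≠ 0 := ne_zero_of_orderOf hm (hα _ hm)
    obtain ⟨J, hJ, hJc⟩ := exists_neighbour hm (feedback_spec hm) hβ0 (hf _ hm)
      (o := precodeOffset s α k)
      (by have := precodeLength_le (s := s) hα k; unfold precodeOffset; omega) hd hd'
      ((mem_range_precode hα).1 hc') h h'
    have hval : wordValue s (precodeLength s α k) (neighbour (2 ^ bchDegree s α k)
        (feedback (bchDegree s α k)) (precodeOffset s α k) (precodeLength s α k) s c.ext J) =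
        syndromeValue s c' := by
      rw [syndromeValue_eq]
      exact wordValue_congr hJc
    have hne' : syndromeValue s c ≠ syndromeValue s c' := fun heq =>
      hne (eq_of_syndromeValue_eq hs hd hd' h h' heq).symm
    refine (compressionModulus_spec (Q := 2 ^ bchDegree s α k) (q := feedback (bchDegree s α k))
      (o := precodeOffset s α k) hn c.ext).2.2 J hJ ?_ ?_
    -- The distance is not zero: distinct words with intersecting error balls have different
    -- syndrome values.
    · unfold valueDist
      rw [hval, ← syndromeValue_eq]
      omega
    -- One of the two truncated differences in `valueDist` is zero, so congruence of the values
    -- means that the modulus divides their distance.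
    · rw [← Nat.dvd_iff_mod_eq_zero]
      generalize compressionModulus _ _ _ _ _ _ = P at hmod ⊢
      unfold valueDist
      rw [hval, ← syndromeValue_eq]
      rcases le_total (syndromeValue s c) (syndromeValue s c') with hle | hle
      · rw [Nat.sub_eq_zero_of_le hle, add_zero]
        exact (Nat.modEq_iff_dvd' hle).1 hmod
      · rw [Nat.sub_eq_zero_of_le hle, zero_add]
        exact (Nat.modEq_iff_dvd' hle).1 hmod.symm

end Compression

end

section

/-! ### Asymptotic estimates -/

/-- From `log x ≤ x - 1` at `x = δ y log 2`. Used with `y` of order `log n`, it expresses that `log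
log n` is `o(log n)`. -/
theorem exists_logb_le {δ : ℝ} (hδ : 0 < δ) : ∃ C, 0 ≤ C ∧ ∀ y : ℝ, 0 < y →
    Real.logb 2 y ≤ δ * y + C := by
  have h2 : 0 < Real.log 2 := Real.log_pos (by norm_num)
  refine ⟨|Real.log (δ * Real.log 2)| / Real.log 2, by positivity, fun y hy => ?_⟩
  have h1 := Real.log_le_sub_one_of_pos (show 0 < δ * Real.log 2 * y by positivity)
  rw [Real.log_mul (by positivity) hy.ne'] at h1
  have h3 := neg_abs_le (Real.log (δ * Real.log 2))
  rw [Real.logb, div_le_iff₀ h2, add_mul, div_mul_cancel₀ _ h2.ne']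
  nlinarith

theorem clog_le_logb {n : ℕ} (hn : 1 ≤ n) : (Nat.clog 2 n : ℝ) ≤ Real.logb 2 n + 1 := by
  rw [← Real.natCeil_logb_natCast 2 n]
  have h : 0 ≤ Real.logb 2 n := Real.logb_nonneg (by norm_num) (by exact_mod_cast hn)
  exact_mod_cast (Nat.ceil_lt_add_one h).le

theorem logb_le_clog {n : ℕ} : Real.logb 2 n ≤ (Nat.clog 2 n : ℝ) := by
  rw [← Real.natCeil_logb_natCast 2 n]
  exact Nat.le_ceil _

theorem exists_syndromeLength_le (s : ℕ) : ∃ E C : ℝ, 0 ≤ E ∧ 0 ≤ C ∧ ∀ L : ℕ, 1 ≤ L →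
    (syndromeLength s L : ℝ) ≤ E * Real.logb 2 L + C := by
  refine ⟨((s + 1) * (2 * s + 1) : ℕ), Real.logb 2 ((2 * s + 1) ^ (2 * s + 1) : ℕ) + 1,
    by positivity, ?_, fun L hL => ?_⟩
  · have : 0 ≤ Real.logb 2 ((2 * s + 1) ^ (2 * s + 1) : ℕ) :=
      Real.logb_nonneg (by norm_num) (by exact_mod_cast Nat.one_le_pow _ _ (by omega))
    linarith
  · refine (clog_le_logb (Nat.mul_pos (by positivity) (by positivity))).trans (le_of_eq ?_)
    rw [Nat.cast_mul, Real.logb_mul (by positivity) (by positivity), Nat.cast_pow L,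
      Real.logb_pow]
    ring

theorem exists_syndromeLength_le_mul (s : ℕ) {δ : ℝ} (hδ : 0 < δ) : ∃ C, 0 ≤ C ∧ ∀ L : ℕ, 1 ≤ L →
    (syndromeLength s L : ℝ) ≤ δ * L + C := by
  obtain ⟨E, C, hE, hC, h⟩ := exists_syndromeLength_le s
  obtain ⟨C', hC', h'⟩ := exists_logb_le (show 0 < δ / (E + 1) by positivity)
  refine ⟨E * C' + C, by positivity, fun L hL => (h L hL).trans ?_⟩
  have h1 := mul_le_mul_of_nonneg_left (h' L (by exact_mod_cast hL)) hE
  have h2 : E * (δ / (E + 1) * L) ≤ δ * L := by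
    have h3 : E / (E + 1) ≤ 1 := by rw [div_le_one (by positivity)]; linarith
    calc E * (δ / (E + 1) * L) = E / (E + 1) * (δ * L) := by ring
      _ ≤ 1 * (δ * L) := mul_le_mul_of_nonneg_right h3 (by positivity)
      _ = _ := one_mul _
  rw [mul_add] at h1
  linarith

section

variable {s : ℕ} {α : (m : ℕ) → GaloisField 2 m} (hα : IsPrimitiveFamily α)

include hα

/-- At most `s` parity symbols per unit of the degree `m`, and `2^m = O(k)`. -/
theorem exists_parityLength_le (s : ℕ) : ∃ C : ℝ, ∀ k : ℕ, 1 ≤ k →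
    (parityLength s α k : ℝ) ≤ s * Real.logb 2 k + C := by
  refine ⟨s * Real.logb 2 (8 * s ^ 2 + 6 : ℕ), fun k hk => ?_⟩
  obtain ⟨hm, -⟩ := bchDegree_mem (s := s) hα k
  have h1 : parityLength s α k ≤ s * bchDegree s α k := by
    rw [parityLength_eq hα]
    exact bchRank_le_mul (GaloisField.card 2 _ (by omega))
  have h2 : 2 ^ bchDegree s α k ≤ (8 * s ^ 2 + 6) * k := by
    have := two_pow_bchDegree_le (s := s) hα k
    nlinarith [Nat.zero_le (s ^ 2)]
  have h3 : (bchDegree s α k : ℝ) ≤ Real.logb 2 (((8 * s ^ 2 + 6 : ℕ) : ℝ) * k) := by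
    rw [Real.le_logb_iff_rpow_le (by norm_num) (by positivity), Real.rpow_natCast]
    exact_mod_cast h2
  rw [Real.logb_mul (by positivity) (by positivity)] at h3
  calc (parityLength s α k : ℝ) ≤ s * (bchDegree s α k : ℝ) := by exact_mod_cast h1
    _ ≤ s * (Real.logb 2 (8 * s ^ 2 + 6 : ℕ) + Real.logb 2 k) :=
        mul_le_mul_of_nonneg_left h3 (by positivity)
    _ = _ := by ring

omit hα in
theorem tendsto_logb_precodeLength :
    Tendsto (fun k => Real.logb 2 (precodeLength s α k)) atTop atTop := by
  refine tendsto_atTop_mono' atTop (f₁ := fun k : ℕ => Real.logb 2 (k : ℝ)) ?_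
    ((Real.tendsto_logb_atTop (by norm_num)).comp tendsto_natCast_atTop_atTop)
  filter_upwards [eventually_ge_atTop 1] with k hk
  exact Real.logb_le_logb_of_le (by norm_num) (by exact_mod_cast hk)
    (by exact_mod_cast Nat.le_add_right _ _)

/-- The parity contributes `s log n`, the compressed syndrome `2(s+2) log n`, and the repetition
block a multiple of the logarithm of `n₁ = O(log n)`. The two error terms that grow are given the
share `δ/3` each, and the last third absorbs the constants for large `k`. -/
theorem exists_redundancy_le (hs : 2 ≤ s) (G : (k : ℕ) → SyndromeCompression s α k)
    (hG : HasCompressedLength G) {δ : ℝ} (hδ : 0 < δ) : ∀ᶠ k in atTop,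
    ((G k).codeLength : ℝ) - k ≤ (3 * s + 4) * Real.logb 2 (G k).codeLength +
      δ * Real.logb 2 (G k).codeLength := by
  obtain ⟨C₁, h₁⟩ := exists_parityLength_le hα s
  have h₂ := isLittleO_iff.1 hG (show 0 < min (δ / 3) 1 by positivity)
  obtain ⟨C₃, hC₃, h₃⟩ := exists_syndromeLength_le_mul s
    (show 0 < δ / (3 * (2 * s + 2) * (2 * (s + 2) + 1)) by positivity)
  have h₄ := (tendsto_logb_precodeLength (s := s) (α := α)).eventually_ge_atTop
    (3 * (C₁ + (2 * s + 2) * C₃) / δ)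
  filter_upwards [h₂, h₄, eventually_ge_atTop 1] with k h₂ h₄ hk
  have hn := one_le_precodeLength (s := s) hα (by omega) k
  have hw := (G k).width_pos
  set l := Real.logb 2 (precodeLength s α k) with hl
  have hl0 : 0 ≤ l := Real.logb_nonneg (by norm_num) (by exact_mod_cast hn)
  rw [Real.norm_of_nonneg hl0] at h₂
  have h₂' := (le_abs_self _).trans h₂
  have h5 : ((G k).length₁ : ℝ) ≤ 2 * (s + 2) * l + δ / 3 * l := by
    have := mul_le_mul_of_nonneg_right (min_le_left (δ / 3) 1) hl0
    linarith
  have h6 : ((G k).length₁ : ℝ) ≤ (2 * (s + 2) + 1) * l := by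
    have := mul_le_mul_of_nonneg_right (min_le_right (δ / 3) 1) hl0
    linarith
  have h7 := h₃ (G k).length₁ (by simp only [SyndromeCompression.length₁]; omega)
  have h8 : ((G k).length₂ : ℝ) ≤ δ / 3 * l + (2 * s + 2) * C₃ := by
    have : ((G k).length₂ : ℝ) = (2 * s + 2) * (syndromeLength s (G k).length₁ : ℝ) := by
      push_cast [SyndromeCompression.length₂]; ring
    rw [this]
    calc _ ≤ (2 * s + 2) * (δ / (3 * (2 * s + 2) * (2 * (s + 2) + 1)) *
          ((2 * (s + 2) + 1) * l) + C₃) := by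
            refine mul_le_mul_of_nonneg_left (h7.trans ?_) (by positivity)
            gcongr
      _ = _ := by field_simp
  have h9 := h₁ k hk
  have h10 : 3 * (C₁ + (2 * s + 2) * C₃) ≤ l * δ := (div_le_iff₀ hδ).1 h₄
  have h11 : Real.logb 2 k ≤ l := Real.logb_le_logb_of_le (by norm_num) (by exact_mod_cast hk)
    (by exact_mod_cast Nat.le_add_right _ _)
  have h12 : l ≤ Real.logb 2 (G k).codeLength :=
    Real.logb_le_logb_of_le (by norm_num) (by exact_mod_cast hn)
      (by exact_mod_cast (by simp only [SyndromeCompression.codeLength]; omega))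
  have h13 : ((G k).codeLength : ℝ) - k =
      parityLength s α k + (G k).length₁ + (G k).length₂ := by
    simp only [SyndromeCompression.codeLength, precodeLength]
    push_cast
    ring
  rw [h13]
  have h14 := mul_le_mul_of_nonneg_left h11 (show (0 : ℝ) ≤ s by positivity)
  have h15 := mul_le_mul_of_nonneg_left h12 (show (0 : ℝ) ≤ 3 * s + 4 + δ by positivity)
  nlinarith

/-- The error term has to depend on the length `n` alone, although several `k` might lead to the
same length. It is taken as the largest positive excess over all these `k`, finitely many because `k
≤ n`; a large length forces a large `k`. -/
theorem redundancy_le (hs : 2 ≤ s) (G : (k : ℕ) → SyndromeCompression s α k)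
    (hG : HasCompressedLength G) : ∃ ε : ℕ → ℝ, ε =o[atTop] (fun n : ℕ => Real.logb 2 (n : ℝ)) ∧
      ∀ k, 1 ≤ k → redundancy (G k).code ≤
        (3 * s + 4) * Real.logb 2 ((G k).codeLength : ℝ) + ε (G k).codeLength := by
  classical
  set e : ℕ → ℝ := fun k => (G k).codeLength - k - (3 * s + 4) * Real.logb 2 (G k).codeLength
    with he
  have hle : ∀ k, k ≤ (G k).codeLength := fun k => by
    simp only [SyndromeCompression.codeLength, precodeLength]; omega
  -- Nonnegative reals make the supremum over an empty set of `k` equal to zero.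
  refine ⟨fun n => (((Finset.range (n + 1)).filter fun k => (G k).codeLength = n).sup
    fun k => (e k).toNNReal : NNReal), ?_, fun k hk => ?_⟩
  · rw [isLittleO_iff]
    intro δ hδ
    obtain ⟨K, hK⟩ := eventually_atTop.1 (exists_redundancy_le hα hs G hG hδ)
    filter_upwards [eventually_gt_atTop ((Finset.range K).sup fun k => (G k).codeLength),
      eventually_ge_atTop 1] with n hn hn1
    have hl : 0 ≤ Real.logb 2 n := Real.logb_nonneg (by norm_num) (by exact_mod_cast hn1)
    rw [Real.norm_of_nonneg (NNReal.coe_nonneg _), Real.norm_of_nonneg hl]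
    rw [← Real.le_toNNReal_iff_coe_le (by positivity)]
    refine Finset.sup_le fun k hk => Real.toNNReal_le_toNNReal ?_
    obtain ⟨-, rfl⟩ := Finset.mem_filter.1 hk
    have hkK : K ≤ k := by
      by_contra hlt
      have := Finset.le_sup (f := fun k => (G k).codeLength) (Finset.mem_range.2 (not_le.1 hlt))
      omega
    have := hK k hkK
    simp only [he]
    linarith
  · have h1 : redundancy (G k).code = (G k).codeLength - k := by
      obtain ⟨I, hI⟩ := (G k).isSystematic
      have hinj : Function.Injective (G k).encode := fun x y hxy => by
        funext i
        rw [← hI x i, ← hI y i, hxy]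
      rw [redundancy, SyndromeCompression.code, ← Set.image_univ,
        Set.ncard_image_of_injective _ hinj, Set.ncard_univ, Nat.card_eq_fintype_card]
      simp [Real.logb_pow]
    have h2 := Finset.le_sup (f := fun k => (e k).toNNReal)
      (show k ∈ (Finset.range ((G k).codeLength + 1)).filter
        (fun j => (G j).codeLength = (G k).codeLength) by
          rw [Finset.mem_filter, Finset.mem_range]
          exact ⟨by have := hle k; omega, rfl⟩)
    have h3 : e k ≤ _ := (Real.le_coe_toNNReal (e k)).trans (NNReal.coe_le_coe.2 h2)
    rw [h1]
    simp only [he] at h3 ⊢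
    linarith

/-- The moduli are at most `(2n)^(s+2)` times twice `lastParameter`, and the latter is a power of
`syndromeLength s n = O(log n)` up to constants; its logarithm is therefore negligible. The lower
bound comes from the factor `n^(s+2)`, which the width accommodates in any case. -/
theorem hasCompressedLength_stageCompression (hs : 1 ≤ s)
    (hf : ∀ m, 1 ≤ m → bitEval (α m) (feedback m) = 0) :
    HasCompressedLength (stageCompression hs hα hf) := by
  rw [HasCompressedLength, isLittleO_iff]
  intro δ hδ
  obtain ⟨E, C, hE, hC, h⟩ := exists_syndromeLength_le s
  -- The slope makes the contribution `(s+3) η E log n` of the last stage at most a quarter of `δ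
  -- log n`.
  obtain ⟨C', hC', h'⟩ := exists_logb_le (show 0 < δ / (4 * (s + 3) * (E + 1)) by positivity)
  set η := δ / (4 * (s + 3) * (E + 1)) with hη
  set B : ℝ := 2 * (3 + (s + 2) + (s + 2) + (s + 3) * (η * (C + 1) + C')) with hB
  filter_upwards [(tendsto_logb_precodeLength (s := s) (α := α)).eventually_ge_atTop (2 * B / δ)]
    with k hk
  have hn := one_le_precodeLength hα hs k
  change |(((compressionWidth s (precodeLength s α k) + compressionWidth s (precodeLength s α k) : ℕ)
    : ℝ) - _)| ≤ _
  generalize precodeLength s α k = n at hn hk ⊢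
  have hn' : (1 : ℝ) ≤ n := by exact_mod_cast hn
  set l := Real.logb 2 n with hl
  have hl0 : 0 ≤ l := Real.logb_nonneg (by norm_num) hn'
  rw [Real.norm_of_nonneg hl0]
  have hBl : 2 * B ≤ l * δ := (div_le_iff₀ hδ).1 hk
  have hA := h n hn
  set A := syndromeLength s n with hAdef
  have hH1 : lastParameter s n ≤ 2 ^ (s + 2) * (A + 1) ^ (s + 3) := by
    rw [lastParameter, ← hAdef]
    have h1 : A ^ (s + 2 + 1) ≤ (A + 1) ^ (s + 3) := Nat.pow_le_pow_left (by omega) _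
    have h2 : 1 ≤ 2 ^ (s + 1) * (A + 1) ^ (s + 3) := Nat.mul_pos (by positivity) (by positivity)
    rw [pow_succ 2 (s + 1)]
    nlinarith [Nat.pos_of_ne_zero (show (2 : ℕ) ^ (s + 1) ≠ 0 by positivity)]
  have hH0 : 1 ≤ lastParameter s n := by rw [lastParameter]; omega
  have hH : Real.logb 2 (lastParameter s n) ≤ (s + 2) + (s + 3) * (η * (E * l + C + 1) + C') := by
    have h1 : Real.logb 2 (lastParameter s n) ≤
        Real.logb 2 (2 ^ (s + 2) * ((A : ℝ) + 1) ^ (s + 3)) :=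
      Real.logb_le_logb_of_le (by norm_num) (by exact_mod_cast hH0) (by exact_mod_cast hH1)
    rw [Real.logb_mul (by positivity) (by positivity), Real.logb_pow, Real.logb_pow,
      Real.logb_self_eq_one (by norm_num)] at h1
    have h2 := h' ((A : ℝ) + 1) (by positivity)
    have h3 : η * ((A : ℝ) + 1) ≤ η * (E * l + C + 1) :=
      mul_le_mul_of_nonneg_left (by linarith) (by positivity)
    have h4 := mul_le_mul_of_nonneg_left (h2.trans (add_le_add_left h3 C'))
      (show (0 : ℝ) ≤ s + 3 by positivity)
    push_cast at h1
    linarith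
  have hbound : 1 ≤ (2 * n) ^ (s + 2) * (2 * lastParameter s n) :=
    Nat.mul_pos (by positivity) (by omega)
  have hlow : (s + 2) * l ≤ compressionWidth s n := by
    refine le_trans ?_ logb_le_clog
    have h1 : n ^ (s + 2) ≤ (2 * n) ^ (s + 2) * (2 * lastParameter s n) + 1 := by
      have := Nat.pow_le_pow_left (show n ≤ 2 * n by omega) (s + 2)
      nlinarith
    have h2 := Real.logb_le_logb_of_le (b := 2) (by norm_num)
      (show (0 : ℝ) < (n ^ (s + 2) : ℕ) by positivity) (Nat.cast_le.2 h1)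
    rw [Nat.cast_pow n, Real.logb_pow] at h2
    push_cast at h2 ⊢
    exact h2
  have hup : (compressionWidth s n : ℝ) ≤ 3 + (s + 2) * (1 + l) + Real.logb 2 (lastParameter s n) := by
    refine (clog_le_logb (by omega)).trans ?_
    have h1 : ((2 * n) ^ (s + 2) * (2 * lastParameter s n) + 1 : ℕ) ≤
        2 * ((2 * n) ^ (s + 2) * (2 * lastParameter s n)) := by omega
    have h2 : Real.logb 2 (((2 * n) ^ (s + 2) * (2 * lastParameter s n) + 1 : ℕ) : ℝ) ≤
        Real.logb 2 (2 * ((2 * n) ^ (s + 2) * (2 * lastParameter s n))) :=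
      Real.logb_le_logb_of_le (by norm_num) (by positivity) (by exact_mod_cast h1)
    have hHp : (0 : ℝ) < lastParameter s n := by exact_mod_cast hH0
    rw [Real.logb_mul (by positivity) (by positivity),
      Real.logb_mul (by positivity) (by positivity), Real.logb_pow,
      Real.logb_mul (by positivity) (by positivity),
      Real.logb_mul (by positivity) (by positivity),
      Real.logb_self_eq_one (by norm_num)] at h2
    push_cast at h2 ⊢
    linarith
  have hηE : (s + 3) * (η * (E * l)) ≤ δ / 4 * l := by
    have h1 : E / (E + 1) ≤ 1 := by rw [div_le_one (by positivity)]; linarith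
    calc (s + 3) * (η * (E * l)) = E / (E + 1) * (δ / 4 * l) := by rw [hη]; field_simp
      _ ≤ 1 * (δ / 4 * l) := mul_le_mul_of_nonneg_right h1 (by positivity)
      _ = _ := one_mul _
  push_cast
  rw [abs_le]
  constructor
  · nlinarith
  · nlinarith

end

end

section

variable {ι κ : Type} {c : Ctx ι}

/-! ### Running times that are powers of the size -/

/-- `f` grows at most like the power `a` of the size. -/
def Ctx.Growth (c : Ctx ι) (a : ℕ) (f : ι → ℕ) : Prop := ∃ C, ∀ i, f i ≤ C * c.size i ^ a

namespace Ctx.Growth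

variable {a a' : ℕ} {f g : ι → ℕ}

theorem mono (h : c.Growth a g) (hf : ∀ i, f i ≤ g i) : c.Growth a f := by
  obtain ⟨C, hC⟩ := h
  exact ⟨C, fun i => (hf i).trans (hC i)⟩

theorem le (h : c.Growth a f) (ha : a ≤ a') : c.Growth a' f := by
  obtain ⟨C, hC⟩ := h
  exact ⟨C, fun i => (hC i).trans
    (Nat.mul_le_mul_left _ (Nat.pow_le_pow_right (c.size_pos i) ha))⟩

theorem const (v : ℕ) : c.Growth a fun _ => v :=
  ⟨v, fun i => Nat.le_mul_of_pos_right _ (Nat.pow_pos (c.size_pos i))⟩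

theorem size : c.Growth 1 c.size := ⟨1, fun i => by simp⟩

theorem add (h : c.Growth a f) (h' : c.Growth a g) : c.Growth a fun i => f i + g i := by
  obtain ⟨C, hC⟩ := h
  obtain ⟨C', hC'⟩ := h'
  exact ⟨C + C', fun i => by rw [add_mul]; exact add_le_add (hC i) (hC' i)⟩

theorem mul (h : c.Growth a f) (h' : c.Growth a' g) : c.Growth (a + a') fun i => f i * g i := by
  obtain ⟨C, hC⟩ := h
  obtain ⟨C', hC'⟩ := h'
  refine ⟨C * C', fun i => (Nat.mul_le_mul (hC i) (hC' i)).trans (le_of_eq ?_)⟩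
  rw [pow_add]
  ring

theorem const_mul (v : ℕ) (h : c.Growth a f) : c.Growth a fun i => v * f i := by
  simpa using (const (c := c) (a := 0) v).mul h

theorem pow (h : c.Growth a f) (e : ℕ) : c.Growth (a * e) fun i => f i ^ e := by
  obtain ⟨C, hC⟩ := h
  exact ⟨C ^ e, fun i => by
    rw [pow_mul, ← mul_pow]
    exact Nat.pow_le_pow_left (hC i) e⟩

theorem succ (h : c.Growth a f) : c.Growth a fun i => f i + 1 := h.add (const 1)

theorem bdd (h : c.Growth a f) : c.Bdd f := by
  obtain ⟨C, hC⟩ := h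
  exact ((Bdd.const C).mul (Bdd.size.pow a)).mono hC

theorem loop (h : c.Growth a f) {b : ι → ℕ} : (c.loop b).Growth a fun p => f p.1 := by
  obtain ⟨C, hC⟩ := h
  exact ⟨C, fun p => hC p.1⟩

theorem counter {b : ι → ℕ} (h : c.Growth a b) : (c.loop b).Growth a fun p => (p.2 : ℕ) :=
  h.loop.mono fun p => p.2.isLt.le

theorem push (h : c.Growth a f) : (c.push g).Growth a f := h

/-- Reduces the cost of loops to exponents: a loop of `O(size^a)` passes with bodies of cost
`O(size^e')` takes `O(size^(a + e'))` steps. -/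
theorem time {b : ι → ℕ} {e e' : ℕ} (h : c.Growth a b) (he : a + e' ≤ e) :
    ∃ K, ∀ i, (b i + 1) * (c.size i ^ e' + 1) ≤ K * (c.size i ^ e + 1) := by
  obtain ⟨C, hC⟩ := h
  refine ⟨2 * (C + 1), fun i => ?_⟩
  have h1 := Nat.pow_pos (n := a) (c.size_pos i)
  have h2 := Nat.pow_pos (n := e') (c.size_pos i)
  calc (b i + 1) * (c.size i ^ e' + 1) ≤ ((C + 1) * c.size i ^ a) * (2 * c.size i ^ e') :=
        Nat.mul_le_mul (by rw [add_mul]; have := hC i; omega) (by omega)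
    _ = 2 * (C + 1) * c.size i ^ (a + e') := by rw [pow_add]; ring
    _ ≤ 2 * (C + 1) * c.size i ^ e :=
        Nat.mul_le_mul_left _ (Nat.pow_le_pow_right (c.size_pos i) he)
    _ ≤ _ := Nat.mul_le_mul_left _ (by omega)

theorem time_zero {b : ι → ℕ} {e : ℕ} (h : c.Growth e b) :
    ∃ K, ∀ i, b i + 1 ≤ K * (c.size i ^ e + 1) := by
  obtain ⟨K, hK⟩ := h.time (e := e) (e' := 0) le_rfl
  exact ⟨K, fun i => le_trans (Nat.le_mul_of_pos_right _ (by positivity)) (hK i)⟩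

end Ctx.Growth

/-- In the context `c`, one program computes all `f i` in time `O(size ^ e)`. -/
abbrev CompE (c : Ctx ι) (e : ℕ) (f : ι → ℕ) : Prop := Comp c (fun i => c.size i ^ e) f

/-- The predicate `P` is decided in time `O(size ^ e)`. -/
abbrev CompPE (c : Ctx ι) (e : ℕ) (P : ι → Prop) : Prop := CompP c (fun i => c.size i ^ e) P

/-- In the context `c`, one program establishes `Q` in time `O(size ^ e)`. -/
abbrev AchievesE (c : Ctx ι) (e : ℕ) (Q : ι → RamState → Prop) : Prop :=
  Achieves c (fun i => c.size i ^ e) Q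

namespace Comp

variable {T f : ι → ℕ}

theorem sumRange {g : ι → ℕ → ℕ} : ∀ {r : ℕ}, (∀ j < r, Comp c T fun i => g i j) →
    Comp c T fun i => ∑ j ∈ Finset.range r, g i j
  | 0, _ => by simpa using const 0
  | r + 1, h => by
    simp only [Finset.sum_range_succ]
    exact (sumRange fun j hj => h j (by omega)).add (h r (by omega))

end Comp

theorem CompP.trivial {T : ι → ℕ} : CompP c T fun _ => True :=
  (CompP.eq (Comp.const 0) (Comp.const 0)).congr fun i => by simp

theorem CompP.ballRange {T : ι → ℕ} {P : ι → ℕ → Prop} {r : ℕ}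
    (h : ∀ j < r, CompP c T fun i => P i j) : CompP c T fun i => ∀ j < r, P i j := by
  induction r with
  | zero => exact CompP.trivial.congr fun i => by simp
  | succ r ih =>
    refine ((ih fun j hj => h j (by omega)).and (h r (by omega))).congr fun i => ?_
    constructor
    · exact fun H => ⟨fun j hj => H j (by omega), H r (by omega)⟩
    · rintro ⟨H, H'⟩ j hj
      rcases Nat.lt_succ_iff_lt_or_eq.1 hj with h1 | rfl
      exacts [H j h1, H']

namespace CompE

variable {e e' a : ℕ} {f b L : ι → ℕ} {g : ι → ℕ → ℕ} {P : ι → ℕ → Prop}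

theorem le (h : CompE c e f) (he : e ≤ e') : CompE c e' f :=
  h.mono 1 fun i => by
    have := Nat.pow_le_pow_right (c.size_pos i) he
    omega

theorem sum (hb : CompE c e b) (ha : c.Growth a b)
    (hg : CompE (c.loop b) e' fun p => g p.1 p.2) (h : a + e' ≤ e) :
    CompE c e fun i => ∑ j ∈ Finset.range (b i), g i j := by
  obtain ⟨K, hK⟩ := ha.time h
  exact Comp.sum (T' := fun i => c.size i ^ e') hb hg K hK

theorem xsum (hb : CompE c e b) (ha : c.Growth a b)
    (hg : CompE (c.loop b) e' fun p => g p.1 p.2) (h : a + e' ≤ e) :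
    CompE c e fun i => _root_.xsum (b i) (g i) := by
  obtain ⟨K, hK⟩ := ha.time h
  exact Comp.xsum (T' := fun i => c.size i ^ e') hb hg K hK

theorem findP (h0 : ∀ i, ∀ j < L i, ¬ P i j) (h1 : ∀ i, P i (L i)) (ha : c.Growth a L)
    (hP : CompPE (c.loop fun i => L i + 1) e' fun p => P p.1 p.2) (h : a + e' ≤ e) :
    CompE c e L := by
  obtain ⟨K, hK⟩ := ha.time h
  exact Comp.findP (T' := fun i => c.size i ^ e') h0 h1 ha.bdd hP K hK

theorem count [∀ i j, Decidable (P i j)] (hb : CompE c e b) (ha : c.Growth a b)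
    (hP : CompPE (c.loop b) e' fun p => P p.1 p.2) (h : a + e' ≤ e) :
    CompE c e fun i => ((Finset.range (b i)).filter (P i)).card := by
  obtain ⟨K, hK⟩ := ha.time h
  exact Comp.count (T' := fun i => c.size i ^ e') hb hP K hK

theorem pow_two (hf : CompE c e f) (ha : c.Growth e f) (hB : c.Bdd fun i => 2 ^ f i) :
    CompE c e fun i => 2 ^ f i := by
  obtain ⟨K, hK⟩ := ha.time_zero
  exact Comp.pow_two hf hB K hK

end CompE

theorem CompPE.ball {e e' a : ℕ} {b : ι → ℕ} {P : ι → ℕ → Prop} (hb : CompE c e b)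
    (ha : c.Growth a b) (hP : CompPE (c.loop b) e' fun p => P p.1 p.2) (h : a + e' ≤ e) :
    CompPE c e fun i => ∀ j < b i, P i j := by
  obtain ⟨K, hK⟩ := ha.time h
  exact CompP.ball (T' := fun i => c.size i ^ e') hb hP K hK

theorem AchievesE.fill {e e' x : ℕ} {Q : ι → RamState → Prop} (a : ℕ) (ha : a ≠ 4) {b : ι → ℕ}
    {g : ι → ℕ → ℕ} (hb : CompE c e b) (hx : c.Growth x b)
    (hg : CompE ((c.loop b).setArr a fun p x => if x < p.2 then g p.1 x else c.arr p.1 a x)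
      e' fun p => g p.1 p.2) (h : x + e' ≤ e)
    (hQ : AchievesE (c.setArr a fun i x => if x < b i then g i x else c.arr i a x) e Q) :
    AchievesE c e Q := by
  obtain ⟨K, hK⟩ := hx.time h
  exact Achieves.fill (T' := fun i => c.size i ^ e') a ha hb hg K hK hQ

theorem AchievesE.scatter {e e' x : ℕ} {Q : ι → RamState → Prop} (a : ℕ) (ha : a ≠ 4) {b : ι → ℕ}
    {addr value : ι → ℕ → ℕ} (S : ι → ℕ → ℕ → ℕ) (h0 : ∀ i, S i 0 = c.arr i a)
    (hS : ∀ i, ∀ j < b i, S i (j + 1) = Function.update (S i j) (addr i j) (value i j))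
    (hb : CompE c e b) (hx : c.Growth x b)
    (haddr : CompE ((c.loop b).setArr a fun p => S p.1 p.2) e' fun p => addr p.1 p.2)
    (hvalue : CompE ((c.loop b).setArr a fun p => S p.1 p.2) e' fun p => value p.1 p.2)
    (h : x + e' ≤ e) (hQ : AchievesE (c.setArr a fun i => S i (b i)) e Q) : AchievesE c e Q := by
  obtain ⟨K, hK⟩ := hx.time h
  exact Achieves.scatter (T' := fun i => c.size i ^ e') a ha S h0 hS hb haddr hvalue K hK hQ

/-! ### Logarithms -/

theorem exists_pow_le_two_pow (e : ℕ) : ∃ C, ∀ l : ℕ, l ^ e ≤ C * 2 ^ l := by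
  have h := (tendsto_pow_const_div_const_pow_of_one_lt e (show (1 : ℝ) < 2 by norm_num)).bddAbove_range
  obtain ⟨C, hC⟩ := h
  refine ⟨⌈C⌉₊, fun l => ?_⟩
  have h1 : (l : ℝ) ^ e / 2 ^ l ≤ C := hC ⟨l, rfl⟩
  rw [div_le_iff₀ (by positivity)] at h1
  have h2 : (l : ℝ) ^ e ≤ ⌈C⌉₊ * 2 ^ l :=
    h1.trans (mul_le_mul_of_nonneg_right (Nat.le_ceil C) (by positivity))
  exact_mod_cast h2

/-- Every power of a logarithm is bounded linearly. This crude estimate suffices for the widths, for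
the syndrome lengths and for the parameter of the last stage. -/
theorem Ctx.Bdd.clog_pow {f : ι → ℕ} (h : c.Bdd f) (e : ℕ) :
    c.Growth 1 fun i => Nat.clog 2 (f i) ^ e := by
  obtain ⟨C, hC⟩ := h
  obtain ⟨K, hK⟩ := exists_pow_le_two_pow e
  refine ⟨(2 * C + 1) ^ e * (2 * K), fun i => ?_⟩
  have hn := c.size_pos i
  have h1 : Nat.clog 2 (f i) ≤ C + C * (Nat.log 2 (c.size i) + 1) := by
    rw [Nat.clog_le_iff_le_pow (by omega), pow_add, pow_mul']
    refine (hC i).le.trans (Nat.mul_le_mul Nat.lt_two_pow_self.le (Nat.pow_le_pow_left ?_ C))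
    exact (Nat.lt_pow_succ_log_self (by omega) _).le
  set l := Nat.log 2 (c.size i)
  have h2 : 2 ^ l ≤ c.size i := Nat.pow_log_le_self 2 (by omega)
  have h3 : Nat.clog 2 (f i) ≤ (2 * C + 1) * (l + 1) := by nlinarith
  have h4 : (l + 1) ^ e ≤ 2 * K * 2 ^ l := by
    have h5 := hK (l + 1)
    rw [pow_succ 2 l] at h5
    calc (l + 1) ^ e ≤ K * (2 ^ l * 2) := h5
      _ = _ := by ring
  rw [pow_one]
  calc _ ≤ ((2 * C + 1) * (l + 1)) ^ e := Nat.pow_le_pow_left h3 e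
    _ = (2 * C + 1) ^ e * (l + 1) ^ e := mul_pow ..
    _ ≤ (2 * C + 1) ^ e * (2 * K * 2 ^ l) := Nat.mul_le_mul_left _ h4
    _ = (2 * C + 1) ^ e * (2 * K) * 2 ^ l := by ring
    _ ≤ _ := Nat.mul_le_mul_left _ h2

theorem Ctx.Bdd.clog {f : ι → ℕ} (h : c.Bdd f) : c.Growth 1 fun i => Nat.clog 2 (f i) := by
  simpa using h.clog_pow 1

theorem Ctx.Bdd.two_pow_clog {f : ι → ℕ} (hf : c.Bdd f) : c.Bdd fun i => 2 ^ Nat.clog 2 (f i) :=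
  ((hf.mul (.const 2)).add (.const 1)).mono fun i => by
    rcases Nat.lt_or_ge 1 (f i) with h | h
    · have := Nat.pow_pred_clog_lt_self (b := 2) (by omega) h
      have h2 := Nat.clog_pos (b := 2) (by omega) h
      rw [← Nat.succ_pred_eq_of_pos h2, pow_succ]
      omega
    · rw [Nat.clog_of_right_le_one h]
      omega

/-- Linear search in which every power of two is computed afresh. The resulting quadratic bound is
wasteful but lies below all the costs that matter. -/
theorem CompE.clog {e : ℕ} (he : 2 ≤ e) {f : ι → ℕ} (hf : CompE c e f) :
    CompE c e fun i => Nat.clog 2 (f i) := by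
  refine hf.letv ?_
  have hB : c.Bdd fun i => 2 ^ Nat.clog 2 (f i) := hf.bdd.two_pow_clog
  refine findP (a := 1) (e' := 1) (P := fun i j => f i ≤ 2 ^ j) (fun i j hj => ?_)
    (fun i => Nat.le_pow_clog (by omega) _) hf.bdd.clog ?_ (by omega)
  · rw [← Nat.clog_le_iff_le_pow (by omega)]
    omega
  · have hc : (c.push f).Bdd fun i => Nat.clog 2 (f i) + 1 := hf.bdd.clog.succ.bdd
    refine CompP.le (Var.head hf.bdd).loop.comp (pow_two (Var.counter hc).comp ?_ ?_)
    · exact (Ctx.Growth.counter (c := c.push f) hf.bdd.clog.succ)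
    · exact ((hB.mul (.const 2)).loop (b := fun i => Nat.clog 2 (f i) + 1)).mono fun p => by
        have := Nat.pow_le_pow_right (n := 2) (by omega) (Nat.le_of_lt_succ p.2.isLt)
        omega

end

section

variable {ι κ : Type} {c : Ctx ι}

theorem CompP.letv {T f : ι → ℕ} {P : ι → Prop} (hf : Comp c T f) (hP : CompP (c.push f) T P) :
    CompP c T P := Comp.letv hf hP

theorem CompE.log {e : ℕ} (he : 2 ≤ e) {f : ι → ℕ} (h0 : ∀ i, f i ≠ 0) (hf : CompE c e f) :
    CompE c e fun i => Nat.log 2 (f i) := by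
  refine hf.letv ?_
  have hB : c.Bdd fun i => 2 ^ Nat.log 2 (f i) := hf.bdd.mono fun i => Nat.pow_log_le_self 2 (h0 i)
  have hG : c.Growth 1 fun i => Nat.log 2 (f i) :=
    hf.bdd.clog.mono fun i => Nat.log_le_clog 2 (f i)
  refine CompE.findP (a := 1) (e' := 1) (P := fun i j => f i < 2 ^ (j + 1)) (fun i j hj => ?_)
    (fun i => Nat.lt_pow_succ_log_self (by omega) _) hG ?_ (by omega)
  · exact not_lt.2 (Nat.pow_le_of_le_log (h0 i) (Nat.succ_le_of_lt hj))
  · have hc : (c.push f).Growth 1 fun i => Nat.log 2 (f i) + 1 := hG.succ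
    refine CompP.lt (Var.head hf.bdd).loop.comp
      (CompE.pow_two ((Var.counter hc.bdd).comp.add (.const 1)) ?_ ?_)
    · exact (Ctx.Growth.counter hc).succ
    · exact ((hB.mul (.const 2)).loop (b := fun i => Nat.log 2 (f i) + 1)).mono fun p => by
        have := Nat.pow_le_pow_right (n := 2) (by omega) (Nat.le_of_lt_succ p.2.isLt)
        rw [pow_succ]
        omega

/-! ### The shift register -/

theorem CompP.testBit {T x j : ι → ℕ} (hx : Comp c T x) (hj : Comp c T fun i => 2 ^ j i) :
    CompP c T fun i => (x i).testBit (j i) = true :=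
  (CompP.eq ((hx.div hj).mod (.const 2)) (.const 1)).congr fun i => by
    rw [Nat.testBit_eq_decide_div_mod_eq]
    simp

section Register

variable {T m q j : ι → ℕ} (hm : ∀ i, 1 ≤ m i) (hq : ∀ i, 2 ^ m i ≤ q i ∧ q i < 2 ^ (m i + 1))
  (hQv : Var c fun i => 2 ^ m i) (hqv : Var c q)

include hm hq hQv hqv

theorem comp_lfsrState (hj : Comp c T j) (K : ℕ) (hT : ∀ i, j i + 1 ≤ K * (T i + 1)) :
    Comp c T fun i => lfsrState (2 ^ m i) (q i) (j i) := by
  have hF : ∀ (a : ι → ℕ), (c.loop a).Bdd fun p => lfsrState (2 ^ m p.1) (q p.1) p.2 :=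
    fun a => (hQv.2.loop (b := a)).mono fun p =>
      (lfsrState_lt (hm p.1) (hq p.1).1 (hq p.1).2 _).le
  refine Comp.fold (T' := 0) (F := fun i j => lfsrState (2 ^ m i) (q i) j) hj (.const 1)
    (Ctx.Bdd.of_loop (hF _)) ?_ K (by simpa using hT)
  simp only [lfsrState_succ, lfsr]
  have h1 : Comp ((c.loop j).push fun p => lfsrState (2 ^ m p.1) (q p.1) p.2)
      (fun _ => 0) fun p => 2 * lfsrState (2 ^ m p.1) (q p.1) p.2 :=
    (Comp.const 2).mul (Var.head (hF j)).comp
  exact Comp.ite (CompP.le hQv.loop.push.comp h1) (h1.xor hqv.loop.push.comp) h1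

/-- Every state is computed from the beginning, so the test is quadratic in the field size; no array
is needed at this point. -/
theorem compPE_fullPeriod (hG : c.Growth 1 fun i => 2 ^ m i) :
    CompPE c 2 fun i => FullPeriod (m i) (q i) := by
  have hQ : ∀ e, CompE c e fun i => 2 ^ m i := fun e => hQv.comp
  have hG2 : c.Growth 1 fun i => 2 ^ m i - 2 := hG.mono fun i => Nat.sub_le _ _
  have h1 : CompPE c 2 fun i => ∀ j < 2 ^ m i - 2, lfsrState (2 ^ m i) (q i) (j + 1) ≠ 1 := by
    refine CompPE.ball (a := 1) (e' := 1) ((hQ 2).sub (.const 2)) hG2 ?_ (by omega)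
    have hG3 : (c.loop fun i => 2 ^ m i - 2).Growth 1 fun p => (p.2 : ℕ) + 1 := hG2.counter.succ
    obtain ⟨K, hK⟩ := hG3.time_zero
    exact CompP.ne (comp_lfsrState (m := fun p => m p.1) (q := fun p => q p.1) (fun p => hm p.1)
      (fun p => hq p.1) hQv.loop hqv.loop ((Var.counter hG2.bdd).comp.add (.const 1)) K hK)
      (.const 1)
  have h2 : CompPE c 2 fun i => lfsrState (2 ^ m i) (q i) (2 ^ m i - 1) = 1 := by
    obtain ⟨K, hK⟩ := ((hG.mono fun i => Nat.sub_le _ 1).le (show 1 ≤ 2 by omega)).time_zero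
    exact CompP.eq (comp_lfsrState hm hq hQv hqv ((hQ 2).sub (.const 1)) K hK) (.const 1)
  refine (h1.and h2).congr fun i => ?_
  unfold FullPeriod
  have := hq i
  tauto

end Register

/-- At most `2^m` numbers between `2^m` and `2^(m+1)` are tried, each in quadratic time. -/
theorem compE_feedback {m : ι → ℕ} (hm : ∀ i, 1 ≤ m i) (hQv : Var c fun i => 2 ^ m i)
    (hG : c.Growth 1 fun i => 2 ^ m i) : CompE c 3 fun i => feedback (m i) := by
  have hs := fun i => feedback_spec (hm i)
  have hlt : ∀ i, feedback (m i) - 2 ^ m i < 2 ^ m i := fun i => by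
    have h1 := (hs i).1
    have h2 := (hs i).2.1
    rw [pow_succ] at h2
    omega
  have hL : c.Growth 1 fun i => feedback (m i) - 2 ^ m i := hG.mono fun i => (hlt i).le
  have h : CompE c 3 fun i => feedback (m i) - 2 ^ m i := by
    refine CompE.findP (a := 1) (e' := 2) (P := fun i j => FullPeriod (m i) (2 ^ m i + j))
      (fun i j hj hp => ?_) (fun i => ?_) hL ?_ (by omega)
    · have := Nat.sInf_le (s := {q | FullPeriod (m i) q}) hp
      unfold feedback at hj
      omega
    · rw [Nat.add_sub_cancel' (hs i).1]
      exact hs i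
    · have hf : CompE (c.loop fun i => feedback (m i) - 2 ^ m i + 1) 2
          fun p => 2 ^ m p.1 + p.2 := hQv.loop.comp.add (Var.counter hL.succ.bdd).comp
      refine CompP.letv hf ?_
      refine compPE_fullPeriod (ι := Σ i, Fin (feedback (m i) - 2 ^ m i + 1))
        (m := fun p => m p.1) (q := fun p => 2 ^ m p.1 + p.2)
        (fun p => hm p.1) (fun p => ?_) hQv.loop.push (Var.head hf.bdd) hG.loop.push
      have := hlt p.1
      have h1 := p.2.isLt
      rw [pow_succ]
      omega
  exact (h.add hQv.comp).congr fun i => (Nat.sub_add_cancel (hs i).1).symm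

/-! ### The dimension of the BCH code -/

section Dimension

variable {s : ℕ} {α : (m : ℕ) → GaloisField 2 m} (hα : IsPrimitiveFamily α)
  (hf : ∀ m, 1 ≤ m → bitEval (α m) (feedback m) = 0)

include hα hf

theorem inCode_iff_xsum {m v : ℕ} (hm : 1 ≤ m) (hv : v < 2 ^ (s * m + 1)) :
    InCode s (α m) v ↔ ∀ j < s, xsum (s * m + 1) (fun t =>
      if v.testBit t = true then lfsrState (2 ^ m) (feedback m) ((2 * j + 1) * t) else 0) = 0 := by
  have hp := feedback_spec hm
  rw [inCode_iff_odd]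
  refine forall₂_congr fun j _ => ?_
  have h1 : bitEval (α m ^ (2 * j + 1)) v = bitEval (α m) (xsum (s * m + 1) (fun t =>
      if v.testBit t = true then lfsrState (2 ^ m) (feedback m) ((2 * j + 1) * t) else 0)) := by
    rw [bitEval_xsum, bitEval_eq _ hv]
    refine Finset.sum_congr rfl fun t _ => ?_
    split_ifs
    · rw [bitEval_lfsrState _ (hf m hm), pow_mul]
    · exact (bitEval_zero _).symm
  rw [h1]
  refine ⟨fun h => ?_, fun h => by rw [h, bitEval_zero]⟩
  by_contra hne
  refine hp.bitEval_ne_zero hm (ne_zero_of_orderOf hm (hα m hm)) (hf m hm)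
    (Nat.pos_of_ne_zero hne) (xsum_lt fun t _ => ?_) h
  split_ifs
  · exact lfsrState_lt hm hp.1 hp.2.1 _
  · positivity

/-- Only the `s m + 1` coefficients of a possible generator matter, and each register state used is
reached in `O(m)` steps. The total `O(m^2)` is at most linear in `2^m`. -/
theorem compPE_inCode {m v : ι → ℕ} (hm : ∀ i, 1 ≤ m i) (hv : ∀ i, v i < 2 ^ (s * m i + 1))
    (hmv : Var c m) (hQv : Var c fun i => 2 ^ m i) (hqv : Var c fun i => feedback (m i))
    (hvv : Var c v) (hG : c.Growth 1 fun i => 2 ^ m i) :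
    CompPE c 1 fun i => InCode s (α (m i)) (v i) := by
  refine CompP.congr ?_ fun i => inCode_iff_xsum hα hf (hm i) (hv i)
  refine CompP.ballRange fun j hj => CompP.eq ?_ (.const 0)
  have hb : c.Bdd fun i => s * m i + 1 := ((Ctx.Bdd.const s).mul hmv.2).add (.const 1)
  obtain ⟨K, hK⟩ := exists_pow_le_two_pow 2
  obtain ⟨C, hC⟩ := hG
  have hB : c.Bdd fun i => 2 ^ (s * m i + 1) :=
    ((hQv.2.pow s).mul (.const 2)).mono fun i => by rw [pow_succ, pow_mul']
  refine Comp.xsum (T' := m) (g := fun i t => if (v i).testBit t = true then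
      lfsrState (2 ^ m i) (feedback (m i)) ((2 * j + 1) * t) else 0)
    (((Comp.const s).mul hmv.comp).add (.const 1)) ?_ ((s + 2) * (4 * (K * C))) fun i => ?_
  · have ht : (c.loop fun i => s * m i + 1).Bdd fun p => 2 ^ (p.2 : ℕ) :=
      hB.loop.mono fun p => Nat.pow_le_pow_right (by omega) p.2.isLt.le
    have hle : ∀ p : (Σ i, Fin (s * m i + 1)), (p.2 : ℕ) ≤ s * m p.1 := fun p =>
      Nat.le_of_lt_succ p.2.isLt
    refine Comp.ite (CompP.testBit hvv.loop.comp ?_) ?_ (.const 0)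
    · refine Comp.pow_two (Var.counter hb).comp ht (s + 1) fun p => ?_
      have := hle p
      nlinarith
    · refine comp_lfsrState (m := fun p => m p.1) (q := fun p => feedback (m p.1))
        (fun p => hm p.1) (fun p => ⟨(feedback_spec (hm p.1)).1, (feedback_spec (hm p.1)).2.1⟩)
        hQv.loop hqv.loop ((Comp.const (2 * j + 1)).mul (Var.counter hb).comp)
        ((2 * j + 1) * s + 1) fun p => ?_
      have := Nat.mul_le_mul_left (2 * j + 1) (hle p)
      nlinarith
  · have h1 := hK (m i + 1)
    have h2 := hC i
    rw [pow_succ 2 (m i)] at h1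
    calc (s * m i + 1 + 1) * (m i + 1) ≤ ((s + 2) * (m i + 1)) * (m i + 1) :=
          Nat.mul_le_mul_right _ (by nlinarith)
      _ = (s + 2) * (m i + 1) ^ 2 := by ring
      _ ≤ (s + 2) * (4 * (K * C) * (c.size i ^ 1)) := Nat.mul_le_mul_left _ (h1.trans (by nlinarith))
      _ = (s + 2) * (4 * (K * C)) * (c.size i ^ 1) := by ring
      _ ≤ _ := Nat.mul_le_mul_left _ (by omega)

omit hα hf in
theorem growth_genWord {m : ι → ℕ} (hm : ∀ i, 1 ≤ m i) (hG : c.Growth 1 fun i => 2 ^ m i) :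
    c.Growth s fun i => genWord s (α (m i)) := by
  have h := ((hG.pow s).const_mul 2)
  rw [one_mul] at h
  refine h.mono fun i => ?_
  have h1 := genWord_lt (s := s) (β := α (m i)) (GaloisField.card 2 (m i) (by have := hm i; omega))
  rw [pow_succ, pow_mul'] at h1
  omega

/-- There are `O(n^s)` numbers below `2^(s m + 1)`, and each test takes linear time. -/
theorem compE_genWord {m : ι → ℕ} (hm : ∀ i, 1 ≤ m i)
    (hmv : Var c m) (hQv : Var c fun i => 2 ^ m i) (hqv : Var c fun i => feedback (m i))
    (hG : c.Growth 1 fun i => 2 ^ m i) :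
    CompE c (s + 1) fun i => genWord s (α (m i)) := by
  have hcard : ∀ i, Nat.card (GaloisField 2 (m i)) = 2 ^ m i := fun i =>
    GaloisField.card 2 (m i) (by have := hm i; omega)
  have hL : c.Growth s fun i => genWord s (α (m i)) := growth_genWord hm hG
  refine CompE.findP (a := s) (e' := 1) (P := fun i j => 0 < j ∧ InCode s (α (m i)) j)
    (fun i j hj hp => ?_) (fun i => ?_) hL ?_ (by omega)
  · have := genWord_le hp.1 hp.2
    omega
  · exact genWord_spec (hcard i)
  · refine CompP.and (CompP.lt (.const 0) (Var.counter hL.succ.bdd).comp) ?_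
    refine compPE_inCode (ι := Σ i, Fin (genWord s (α (m i)) + 1)) hα hf (m := fun p => m p.1)
      (v := fun p => p.2) (fun p => hm p.1) (fun p => ?_) hmv.loop hQv.loop
      hqv.loop (Var.counter hL.succ.bdd) hG.loop
    exact (Nat.le_of_lt_succ p.2.isLt).trans_lt (genWord_lt (hcard p.1))

/-- All degrees up to the right one are tried, and for each of them the feedback and the generator
polynomial are found anew in `O(n^(s+1))` steps. The cubic search for the feedback polynomial fits
into this bound because `s ≥ 2`. -/
theorem compE_bchDegree {k : ι → ℕ} (hs : 2 ≤ s) (hk : ∀ i, c.size i = k i) (hkv : Var c k) :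
    CompE c (s + 2) fun i => bchDegree s α (k i) := by
  have hmem := fun i => bchDegree_mem (s := s) hα (k i)
  have hGQ : c.Growth 1 fun i => 2 ^ bchDegree s α (k i) := by
    refine ⟨8 * s ^ 2 + 6, fun i => ?_⟩
    have h1 := two_pow_bchDegree_le (s := s) hα (k i)
    have h2 := c.size_pos i
    rw [pow_one, hk]
    rw [hk] at h2
    nlinarith [Nat.zero_le (s ^ 2)]
  have hL : c.Growth 1 fun i => bchDegree s α (k i) - 1 :=
    hGQ.mono fun i => (Nat.sub_le _ _).trans Nat.lt_two_pow_self.le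
  -- The search counts from zero, while the admissible degrees start at one.
  have h : CompE c (s + 2) fun i => bchDegree s α (k i) - 1 := by
    refine CompE.findP (a := 1) (e' := s + 1)
      (P := fun i j => k i ≤ 2 ^ (j + 1) - 1 - bchRank s (α (j + 1)))
      (fun i j hj => ?_) (fun i => ?_) hL ?_ (by omega)
    · exact not_le.2 (lt_of_lt_bchDegree hα (by omega) (by omega))
    · rw [Nat.sub_add_cancel (hmem i).1]
      exact (hmem i).2
    · set c₁ := c.loop fun i => bchDegree s α (k i) - 1 + 1 with hc₁
      have hcnt : c₁.Growth 1 fun p => (p.2 : ℕ) + 1 := hL.succ.counter.succ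
      have hQ₁ : c₁.Growth 1 fun p => 2 ^ ((p.2 : ℕ) + 1) := hGQ.loop.mono fun p => by
        refine Nat.pow_le_pow_right (by omega) ?_
        have h1 := p.2.isLt
        have h2 := (hmem p.1).1
        omega
      have hm₁ : CompE c₁ (s + 1) fun p => (p.2 : ℕ) + 1 :=
        (Var.counter hL.succ.bdd).comp.add (.const 1)
      refine CompP.letv hm₁ ?_
      have hQc : CompE (c₁.push fun p => (p.2 : ℕ) + 1) (s + 1) fun p => 2 ^ ((p.2 : ℕ) + 1) :=
        CompE.pow_two (Var.head hcnt.bdd).comp ((hcnt.le (by omega)).push) hQ₁.bdd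
      refine CompP.letv hQc ?_
      have hqc := (compE_feedback
        (m := fun p : (Σ i, Fin (bchDegree s α (k i) - 1 + 1)) => (p.2 : ℕ) + 1) (fun p => by omega)
        (Var.head hQc.bdd) hQ₁.push.push).le (show 3 ≤ s + 1 by omega)
      refine CompP.letv hqc ?_
      have hvc := compE_genWord (s := s) hα hf
        (m := fun p : (Σ i, Fin (bchDegree s α (k i) - 1 + 1)) => (p.2 : ℕ) + 1) (fun p => by omega)
        (Var.head hcnt.bdd).push.push (Var.head hQc.bdd).push (Var.head hqc.bdd)
        hQ₁.push.push.push
      have hr := CompE.log (by omega) (fun p : (Σ i, Fin (bchDegree s α (k i) - 1 + 1)) =>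
        (genWord_spec (s := s) (β := α ((p.2 : ℕ) + 1))
        (GaloisField.card 2 ((p.2 : ℕ) + 1) (by omega))).1.ne') hvc
      exact CompP.le hkv.loop.push.push.push.comp
        (((Var.head hQc.bdd).push.comp.sub (.const 1)).sub hr)
  exact (h.add (.const 1)).congr fun i => (Nat.sub_add_cancel (hmem i).1).symm

end Dimension

end

section

variable {ι κ : Type} {c : Ctx ι}

/-! ### The parameters of the code -/

section Parameters

variable {s : ℕ} {α : (m : ℕ) → GaloisField 2 m}

/-- The parameters of the code are the values of variables, and the arrays `5` and `6` hold the
states of the shift register and the weights. -/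
structure Ready (s : ℕ) (α : (m : ℕ) → GaloisField 2 m) (c : Ctx ι) (k : ι → ℕ) : Prop where
  size : ∀ i, c.size i = k i
  varK : Var c k
  varQ : Var c fun i => 2 ^ bchDegree s α (k i)
  varN : Var c fun i => precodeLength s α (k i)
  varO : Var c fun i => precodeOffset s α (k i)
  varA : Var c fun i => syndromeLength s (precodeLength s α (k i))
  varW : Var c fun i => compressionWidth s (precodeLength s α (k i))
  varB : Var c fun i => syndromeLength s (compressionWidth s (precodeLength s α (k i)) +
    compressionWidth s (precodeLength s α (k i)))
  states : ∀ i, ∀ e < 2 ^ bchDegree s α (k i) - 1, c.arr i 5 e =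
    lfsrState (2 ^ bchDegree s α (k i)) (feedback (bchDegree s α (k i))) e
  weights : ∀ i, ∀ e < (precodeLength s α (k i) + (compressionWidth s (precodeLength s α (k i)) +
    compressionWidth s (precodeLength s α (k i)))) * (2 * s + 1), c.arr i 6 e =
    weight (e % (2 * s + 1) + 1) (e / (2 * s + 1) + 1)

namespace Ready

variable {k : ι → ℕ}

theorem push (h : Ready s α c k) {f : ι → ℕ} : Ready s α (c.push f) k :=
  ⟨h.size, h.varK.push, h.varQ.push, h.varN.push, h.varO.push, h.varA.push, h.varW.push,
    h.varB.push, h.states, h.weights⟩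

theorem loop (h : Ready s α c k) {b : ι → ℕ} : Ready s α (c.loop b) fun p => k p.1 :=
  ⟨fun p => h.size p.1, h.varK.loop, h.varQ.loop, h.varN.loop, h.varO.loop, h.varA.loop,
    h.varW.loop, h.varB.loop, fun p => h.states p.1, fun p => h.weights p.1⟩

theorem setArr (h : Ready s α c k) {a : ℕ} {A : ι → ℕ → ℕ} (h5 : a ≠ 5) (h6 : a ≠ 6) :
    Ready s α (c.setArr a A) k :=
  ⟨h.size, h.varK, h.varQ, h.varN, h.varO, h.varA, h.varW, h.varB,
    fun i e he => by rw [← h.states i e he]; simp [Ctx.setArr, h5.symm],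
    fun i e he => by rw [← h.weights i e he]; simp [Ctx.setArr, h6.symm]⟩

end Ready

variable {k : ι → ℕ} (hα : IsPrimitiveFamily α) (hk : ∀ i, c.size i = k i)

include hα hk

theorem growth_two_pow : c.Growth 1 fun i => 2 ^ bchDegree s α (k i) := by
  refine ⟨8 * s ^ 2 + 6, fun i => ?_⟩
  have h1 := two_pow_bchDegree_le (s := s) hα (k i)
  have h2 := c.size_pos i
  rw [pow_one, hk]
  rw [hk] at h2
  nlinarith [Nat.zero_le (s ^ 2)]

theorem growth_precodeLength : c.Growth 1 fun i => precodeLength s α (k i) :=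
  (growth_two_pow hα hk).mono fun _ => (precodeLength_le hα _).trans (Nat.sub_le _ _)

theorem bdd_syndromeBound : c.Bdd fun i => (2 * s + 1) ^ (2 * s + 1) *
    precodeLength s α (k i) ^ ((s + 1) * (2 * s + 1)) :=
  (Ctx.Bdd.const _).mul ((growth_precodeLength hα hk).bdd.pow _)

theorem growth_syndromeLength : c.Growth 1 fun i => syndromeLength s (precodeLength s α (k i)) :=
  (bdd_syndromeBound hα hk).clog

theorem growth_lastParameter : c.Growth 1 fun i => lastParameter s (precodeLength s α (k i)) :=
  (((bdd_syndromeBound hα hk).clog_pow (s + 2 + 1)).const_mul (2 ^ (s + 1))).succ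

theorem bdd_modulusBound : c.Bdd fun i => (2 * precodeLength s α (k i)) ^ (s + 2) *
    (2 * lastParameter s (precodeLength s α (k i))) + 1 :=
  ((((Ctx.Bdd.const 2).mul (growth_precodeLength hα hk).bdd).pow (s + 2)).mul
    ((Ctx.Bdd.const 2).mul (growth_lastParameter hα hk).bdd)).add (.const 1)

theorem growth_width : c.Growth 1 fun i => compressionWidth s (precodeLength s α (k i)) :=
  (bdd_modulusBound hα hk).clog

theorem growth_checkLength : c.Growth 1 fun i =>
    syndromeLength s (compressionWidth s (precodeLength s α (k i)) +
      compressionWidth s (precodeLength s α (k i))) :=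
  ((Ctx.Bdd.const _).mul (((growth_width hα hk).add (growth_width hα hk)).bdd.pow _)).clog

omit hα hk in
theorem compE_weight {e : ℕ} {j i : ι → ℕ} (he : 1 ≤ e) {r : ℕ} (hr : ∀ x, j x ≤ r)
    (hj : CompE c e j) (hi : CompE c e i) (hG : c.Growth 1 i) :
    CompE c e fun x => weight (j x + 1) (i x + 1) := by
  refine hj.letv (Comp.letv hi.weaken ?_)
  simp only [weight_succ, Nat.add_sub_cancel]
  have hG1 : ((c.push j).push i).Growth 1 fun x => i x + 1 := hG.succ
  have hcnt : (c.loop fun x => i x + 1).Bdd fun p => (p.2 : ℕ) + 1 := hG.succ.counter.succ.bdd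
  refine CompE.sum (a := 1) (e' := 0) (g := fun x l => (l + 1) ^ j x)
    (Comp.add (Var.comp (Var.head hi.bdd)) (.const 1)) hG1 ?_ (by omega)
  refine Comp.vpow (Comp.add (Var.counter hG1.bdd).comp (.const 1))
    (Var.comp (Var.loop (v := j) (Var.push (Var.head hj.bdd)))) ?_ (r + 1) fun p => ?_
  · exact ((hcnt.add (.const 1)).pow r).mono fun p =>
      Nat.pow_le_pow_right (by omega) (hr p.1)
  · have := hr p.1
    nlinarith

omit hk in
-- Stages of a program are stated in continuation form: whatever can be achieved in every context
-- that has the new tables and variables can be achieved in the old context. The same form is used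
-- for the further stages of the encoder and the decoder.
theorem achievesE_tables (hk : ∀ i, c.size i = k i) {e : ℕ} (he : 2 ≤ e) {P : ι → RamState → Prop}
    (varK : Var c k) (varQ : Var c fun i => 2 ^ bchDegree s α (k i))
    (varF : Var c fun i => feedback (bchDegree s α (k i)))
    (varN : Var c fun i => precodeLength s α (k i))
    (varO : Var c fun i => precodeOffset s α (k i))
    (varA : Var c fun i => syndromeLength s (precodeLength s α (k i)))
    (varW : Var c fun i => compressionWidth s (precodeLength s α (k i)))
    (varB : Var c fun i => syndromeLength s (compressionWidth s (precodeLength s α (k i)) +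
      compressionWidth s (precodeLength s α (k i))))
    (hP : ∀ c' : Ctx ι, Ready s α c' k → (∀ i a, a ≠ 5 → a ≠ 6 → c'.arr i a = c.arr i a) →
      AchievesE c' e P) : AchievesE c e P := by
  have hm := fun i => (bchDegree_mem (s := s) hα (k i)).1
  have hGQ : c.Growth 1 fun i => 2 ^ bchDegree s α (k i) - 1 :=
    (growth_two_pow hα hk).mono fun i => Nat.sub_le _ _
  refine AchievesE.fill (x := 1) (e' := 1) 5 (by omega) (b := fun i => 2 ^ bchDegree s α (k i) - 1)
    (g := fun i e => lfsrState (2 ^ bchDegree s α (k i)) (feedback (bchDegree s α (k i))) e)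
    (varQ.comp.sub (.const 1)) hGQ ?_ (by omega) ?_
  · obtain ⟨K, hK⟩ := (Ctx.Growth.counter hGQ).time_zero
    exact comp_lfsrState (ι := Σ i, Fin (2 ^ bchDegree s α (k i) - 1))
      (m := fun p => bchDegree s α (k p.1)) (q := fun p => feedback (bchDegree s α (k p.1)))
      (j := fun p => (p.2 : ℕ)) (fun p => hm p.1)
      (fun p => ⟨(feedback_spec (hm p.1)).1, (feedback_spec (hm p.1)).2.1⟩)
      varQ.loop.setArr varF.loop.setArr (Var.counter hGQ.bdd).setArr.comp K hK
  have hGW : c.Growth 1 fun i => (precodeLength s α (k i) +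
      (compressionWidth s (precodeLength s α (k i)) +
        compressionWidth s (precodeLength s α (k i)))) * (2 * s + 1) := by
    simpa only [mul_comm] using ((growth_precodeLength hα hk).add
      ((growth_width hα hk).add (growth_width hα hk))).const_mul (2 * s + 1)
  refine AchievesE.fill (x := 1) (e' := 1) 6 (by omega) (b := fun i => (precodeLength s α (k i) +
      (compressionWidth s (precodeLength s α (k i)) +
        compressionWidth s (precodeLength s α (k i)))) * (2 * s + 1))
    (g := fun _ e => weight (e % (2 * s + 1) + 1) (e / (2 * s + 1) + 1))
    ((varN.setArr.comp.add (varW.setArr.comp.add varW.setArr.comp)).mul (.const _))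
    hGW ?_ (by omega) (hP _ ?_ ?_)
  · have key : ∀ {κ : Type} (c' : Ctx κ) (f : κ → ℕ), Var c' f → c'.Growth 1 f →
        CompE c' 1 fun p => weight (f p % (2 * s + 1) + 1) (f p / (2 * s + 1) + 1) :=
      fun c' f hv hG => compE_weight le_rfl (r := 2 * s + 1) (fun p => (Nat.mod_lt _ (by omega)).le)
        (hv.comp.mod (.const _)) (hv.comp.div (.const _)) (hG.mono fun p => Nat.div_le_self _ _)
    exact key _ (fun p : (Σ i, Fin _) => (p.2 : ℕ)) (Var.setArr (Var.counter (c := c.setArr 5 _) hGW.bdd))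
      hGW.counter
  · exact ⟨hk, varK, varQ, varN, varO, varA, varW, varB,
      fun i e he => by simp [Ctx.setArr, he], fun i e he => by simp [Ctx.setArr, he]⟩
  · intro i a h5 h6
    simp [Ctx.setArr, h5, h6]

set_option maxHeartbeats 1000000 in
theorem achievesE_init (hs : 2 ≤ s) (hf : ∀ m, 1 ≤ m → bitEval (α m) (feedback m) = 0)
    (h0 : ∀ i, c.arr i 0 0 = k i) {e : ℕ} (he : s + 2 ≤ e) {P : ι → RamState → Prop}
    (hP : ∀ c' : Ctx ι, Ready s α c' k → (∀ i a, a ≠ 5 → a ≠ 6 → c'.arr i a = c.arr i a) →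
      AchievesE c' e P) : AchievesE c e P := by
  have hGk : c.Growth 1 k := Ctx.Growth.size.mono fun i => (hk i).ge
  have hGQ := growth_two_pow (s := s) hα hk
  have hBn := (growth_precodeLength (s := s) hα hk).bdd
  have hBA := (growth_syndromeLength (s := s) hα hk).bdd
  have hBw := (growth_width (s := s) hα hk).bdd
  have hBB := (growth_checkLength (s := s) hα hk).bdd
  have hm := fun i => (bchDegree_mem (s := s) hα (k i)).1
  have hGm : c.Growth 1 fun i => bchDegree s α (k i) := hGQ.mono fun i => Nat.lt_two_pow_self.le
  have hBv := (growth_genWord (s := s) (α := α) hm hGQ).bdd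
  have hBq : c.Bdd fun i => feedback (bchDegree s α (k i)) :=
    (hGQ.bdd.mul (.const 2)).mono fun i => by
      have := (feedback_spec (hm i)).2.1
      rw [pow_succ] at this
      exact this.le
  have hBo : c.Bdd fun i => precodeOffset s α (k i) := hGQ.bdd.mono fun i =>
    (Nat.sub_le _ _).trans (Nat.sub_le _ _)
  have hlen : ∀ (c' : Ctx ι) (f : ι → ℕ), CompE c' e f →
      CompE c' e fun i => syndromeLength s (f i) := fun c' f h =>
    CompE.clog (by omega) ((Comp.const _).mul (h.pow _))
  have hwidth : ∀ (c' : Ctx ι), CompE c' e (fun i => precodeLength s α (k i)) →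
      CompE c' e (fun i => syndromeLength s (precodeLength s α (k i))) →
      CompE c' e fun i => compressionWidth s (precodeLength s α (k i)) := fun c' h h' =>
    CompE.clog (by omega) (((((Comp.const 2).mul h).pow _).mul
      ((Comp.const 2).mul (((Comp.const _).mul (h'.pow _)).add (.const 1)))).add (.const 1))
  refine Achieves.letv (f := k) ?_ ?_
  · exact (Comp.cell (A := fun i => c.arr i 0) 0 (by omega) (fun _ => rfl) (.const 0)
      (hGk.bdd.mono fun i => (h0 i).le)).congr fun i => (h0 i).symm
  refine Achieves.letv (f := fun i => bchDegree s α (k i)) ?_ ?_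
  · exact (compE_bchDegree (c := c.push k) hα hf hs hk (Var.head hGk.bdd)).le he
  refine Achieves.letv (f := fun i => 2 ^ bchDegree s α (k i)) ?_ ?_
  · exact CompE.pow_two (Comp.var (by simp [Ctx.push]) hGm.bdd) (hGm.push.push.le (by omega))
      hGQ.bdd
  refine Achieves.letv (f := fun i => feedback (bchDegree s α (k i))) ?_ ?_
  · exact CompE.le (e := 3) (compE_feedback hm ⟨by simp [Ctx.push], hGQ.bdd⟩ hGQ) (by omega)
  refine Achieves.letv (f := fun i => genWord s (α (bchDegree s α (k i)))) ?_ ?_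
  · exact CompE.le (e := s + 1) (compE_genWord hα hf hm ⟨by simp [Ctx.push], hGm.bdd⟩
      ⟨by simp [Ctx.push], hGQ.bdd⟩ ⟨by simp [Ctx.push], hBq⟩ hGQ) (by omega)
  refine Achieves.letv (f := fun i => precodeLength s α (k i)) ?_ ?_
  · refine Comp.congr (f := fun i => k i + Nat.log 2 (genWord s (α (bchDegree s α (k i)))))
      (Comp.add (Comp.var (by simp [Ctx.push]) hGk.bdd) (CompE.log (by omega) (fun i => ?_)
        (Comp.var (by simp [Ctx.push]) hBv))) fun i => ?_
    · exact (genWord_spec (GaloisField.card 2 _ (by have := hm i; omega))).1.ne'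
    · rw [precodeLength, parityLength_eq hα, bchRank]
  refine Achieves.letv (f := fun i => precodeOffset s α (k i)) ?_ ?_
  · exact Comp.sub (Comp.sub (Comp.var (by simp [Ctx.push]) hGQ.bdd) (.const 1))
      (Comp.var (by simp [Ctx.push]) hBn)
  refine Achieves.letv (f := fun i => syndromeLength s (precodeLength s α (k i))) ?_ ?_
  · exact hlen _ _ (Comp.var (by simp [Ctx.push]) hBn)
  refine Achieves.letv (f := fun i => compressionWidth s (precodeLength s α (k i))) ?_ ?_
  · exact hwidth _ (Comp.var (by simp [Ctx.push]) hBn) (Comp.var (by simp [Ctx.push]) hBA)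
  refine Achieves.letv (f := fun i => syndromeLength s
      (compressionWidth s (precodeLength s α (k i)) + compressionWidth s (precodeLength s α (k i))))
    ?_ ?_
  · exact hlen _ _ (Comp.add (Comp.var (by simp [Ctx.push]) hBw)
      (Comp.var (by simp [Ctx.push]) hBw))
  refine achievesE_tables (s := s) (k := k) hα ?_ (by omega) ?_ ?_ ?_ ?_ ?_ ?_ ?_ ?_ ?_
  · exact hk
  on_goal 9 => exact hP
  all_goals refine ⟨by simp [Ctx.push], ?_⟩
  exacts [hGk.bdd, hGQ.bdd, hBq, hBn, hBo, hBA, hBw, hBB]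

end Parameters

end

section

variable {ι κ : Type} {c : Ctx ι}

/-! ### Words in arrays -/

/-- Array `a` holds the word `x`. -/
def HoldsWord (c : Ctx ι) (a : ℕ) (x : ι → ℕ → ZMod 2) : Prop := ∀ i t, c.arr i a t = (x i t).val

namespace HoldsWord

variable {a : ℕ} {x : ι → ℕ → ZMod 2}

theorem push {f : ι → ℕ} (h : HoldsWord c a x) : HoldsWord (c.push f) a x := h

theorem loop {b : ι → ℕ} (h : HoldsWord c a x) : HoldsWord (c.loop b) a fun p => x p.1 :=
  fun p => h p.1

theorem setArr {a' : ℕ} {A : ι → ℕ → ℕ} (h : HoldsWord c a x) (ha : a' ≠ a) :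
    HoldsWord (c.setArr a' A) a x := fun i t => by
  rw [← h i t]
  simp [Ctx.setArr, ha.symm]

end HoldsWord

theorem val_le_one (a : ZMod 2) : a.val ≤ 1 := Nat.le_of_lt_succ a.val_lt

theorem bdd_val {x : ι → ZMod 2} : c.Bdd fun i => (x i).val :=
  (Ctx.Bdd.const 1).mono fun _ => val_le_one _

section Letters

variable {T t : ι → ℕ}

theorem HoldsWord.comp {a : ℕ} {x : ι → ℕ → ZMod 2} (h : HoldsWord c a x) (ha : a ≠ 4)
    (ht : Comp c T t) : Comp c T fun i => (x i (t i)).val :=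
  Comp.cell (A := fun i t => (x i t).val) a ha (fun i => funext (h i)) ht bdd_val

theorem comp_add_val {x y : ι → ZMod 2} (hx : Comp c T fun i => (x i).val)
    (hy : Comp c T fun i => (y i).val) : Comp c T fun i => (x i + y i).val :=
  ((hx.add hy).mod (.const 2)).congr fun _ => ZMod.val_add _ _

theorem comp_pattern {s : ℕ} {B n : ι → ℕ} (hB : Comp c T B) (hn : Comp c T n)
    (ht : Comp c T t) : Comp c T fun i => (pattern (B i) s (n i) (t i)).val := by
  refine Comp.congr (f := fun i => (∑ a ∈ Finset.range s,
    if n i / B i ^ a % B i = t i then 1 else 0) % 2) ?_ fun i => ?_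
  · refine (Comp.sumRange (g := fun i a => if n i / B i ^ a % B i = t i then 1 else 0)
      fun a _ => ?_).mod (.const 2)
    exact Comp.ite (CompP.eq ((hn.div (hB.pow a)).mod hB) ht) (.const 1) (.const 0)
  · rw [pattern, ZMod.val_natCast]

theorem comp_skip {d : ι → ℕ} (hd : Comp c T d) (ht : Comp c T t) :
    Comp c T fun i => skip (d i) (t i) := by
  simp only [skip]
  exact Comp.ite (CompP.lt ht hd) ht (ht.add (.const 1))

theorem comp_unskip {d : ι → ℕ} (hd : Comp c T d) (ht : Comp c T t) :
    Comp c T fun i => unskip (d i) (t i) := by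
  simp only [unskip]
  exact Comp.ite (CompP.lt ht hd) ht (ht.sub (.const 1))

theorem comp_candidate {s : ℕ} {L J : ι → ℕ} {y : ι → ℕ → ZMod 2} (hL : Comp c T L)
    (hJ : Comp c T J) (ht : Comp c T t)
    (hy : Comp c T fun i => (y i (unskip (J i / (L i + 1) ^ s / 2) (t i))).val) :
    Comp c T fun i => (candidate s (L i) (y i) (J i) (t i)).val := by
  have hB := (hL.add (.const 1)).pow s
  refine comp_add_val ?_ (comp_pattern (hL.add (.const 1)) (hJ.mod hB) ht)
  refine Comp.congr (f := fun i => if t i = J i / (L i + 1) ^ s / 2 then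
    J i / (L i + 1) ^ s % 2 else (y i (unskip (J i / (L i + 1) ^ s / 2) (t i))).val) ?_ fun i => ?_
  · exact Comp.ite (CompP.eq ht ((hJ.div hB).div (.const 2))) ((hJ.div hB).mod (.const 2)) hy
  · rw [insertWord]
    split_ifs
    · rw [ZMod.val_natCast, Nat.mod_mod]
    · rfl

theorem comp_candidateCount {s : ℕ} {L : ι → ℕ} (hL : Comp c T L) :
    Comp c T fun i => candidateCount s (L i) :=
  ((Comp.const 2).mul hL).mul ((hL.add (.const 1)).pow s)

theorem comp_corrupted {s a : ℕ} {n J : ι → ℕ} {x : ι → ℕ → ZMod 2} (hx : HoldsWord c a x)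
    (ha : a ≠ 4) (hn : Comp c T n) (hJ : Comp c T J) (ht : Comp c T t) :
    Comp c T fun i => (corrupted (n i) s (x i) (J i) (t i)).val := by
  have hN := comp_candidateCount (s := s) hn
  have hJ' := hJ.mod hN
  refine comp_candidate (y := fun i j => x i (skip (J i / candidateCount s (n i)) j)) hn hJ' ht ?_
  exact hx.comp ha (comp_skip (hJ.div hN)
    (comp_unskip ((hJ'.div ((hn.add (.const 1)).pow s)).div (.const 2)) ht))

end Letters

/-! ### Syndromes of words -/

section Syndromes

variable {s : ℕ} {α : (m : ℕ) → GaloisField 2 m} (hα : IsPrimitiveFamily α) {k : ι → ℕ}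
  (h : Ready s α c k)

include hα h

/-- With the table of register states every term costs one look-up, the exponent being reduced
modulo `2^m - 1` to stay inside the table. A syndrome of a word with letters in constant time then
takes linear time. -/
theorem compE_bchSyndrome {e e' : ℕ} (he : 1 + e' ≤ e) (r : ℕ) {x : ι → ℕ → ZMod 2}
    (hx : CompE (c.loop fun i => precodeLength s α (k i)) e' fun p => (x p.1 p.2).val) :
    CompE c e fun i => bchSyndrome (2 ^ bchDegree s α (k i)) (feedback (bchDegree s α (k i)))
      (precodeOffset s α (k i)) (precodeLength s α (k i)) r (x i) := by
  have hm := fun i => (bchDegree_mem (s := s) hα (k i)).1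
  have hp := fun i => feedback_spec (hm i)
  have hG := growth_precodeLength (s := s) hα h.size
  have hl := h.loop (b := fun i => precodeLength s α (k i))
  refine CompE.xsum (e' := e') (a := 1) (g := fun i t => if x i t = 1 then lfsrState
    (2 ^ bchDegree s α (k i)) (feedback (bchDegree s α (k i)))
      (r * (precodeOffset s α (k i) + t)) else 0) h.varN.comp hG ?_ he
  refine Comp.ite ((CompP.eq hx (.const 1)).congr fun p => ?_) ?_ (.const 0)
  · generalize x p.1 p.2 = a
    revert a
    decide
  · have hpos : ∀ i, 0 < 2 ^ bchDegree s α (k i) - 1 := fun i => by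
      have := Nat.pow_le_pow_right (n := 2) (by omega) (hm i)
      omega
    have harr := fun p : (Σ i, Fin (precodeLength s α (k i))) => hl.states p
      ((r * (precodeOffset s α (k p.1) + p.2)) % (2 ^ bchDegree s α (k p.1) - 1))
      (Nat.mod_lt _ (hpos p.1))
    refine Comp.congr (f := fun p => (c.loop fun i => precodeLength s α (k i)).arr p 5
      ((r * (precodeOffset s α (k p.1) + p.2)) % (2 ^ bchDegree s α (k p.1) - 1))) ?_ fun p => ?_
    · refine Comp.cell (A := fun p => (c.loop fun i => precodeLength s α (k i)).arr p 5) 5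
        (by omega) (fun _ => rfl) ?_ ?_
      · exact ((Comp.const r).mul (hl.varO.comp.add (Var.counter hG.bdd).comp)).mod
          (hl.varQ.comp.sub (.const 1))
      · refine hl.varQ.2.mono fun p => ?_
        rw [harr]
        exact (lfsrState_lt (hm p.1) (hp p.1).1 (hp p.1).2.1 _).le
    · rw [harr, lfsrState_mod (hp p.1)]

theorem compE_bchKey {e : ℕ} (he : 1 ≤ e) {x : ι → ℕ → ZMod 2}
    (hx : CompE (c.loop fun i => precodeLength s α (k i)) 0 fun p => (x p.1 p.2).val) :
    CompE c e fun i => bchKey (2 ^ bchDegree s α (k i)) (feedback (bchDegree s α (k i)))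
      (precodeOffset s α (k i)) (precodeLength s α (k i)) s (x i) := by
  simp only [bchKey]
  exact Comp.sumRange fun r _ => (compE_bchSyndrome hα h he _ hx).mul (h.varQ.comp.pow r)

theorem compPE_bchSyndrome {e e' : ℕ} (he : 1 + e' ≤ e) {x : ι → ℕ → ZMod 2}
    (hx : CompE (c.loop fun i => precodeLength s α (k i)) e' fun p => (x p.1 p.2).val) :
    CompPE c e fun i => ∀ r < s, bchSyndrome (2 ^ bchDegree s α (k i))
      (feedback (bchDegree s α (k i))) (precodeOffset s α (k i)) (precodeLength s α (k i))
      (2 * r + 1) (x i) = 0 :=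
  CompP.ballRange fun _ _ => CompP.eq (compE_bchSyndrome hα h he _ hx) (.const 0)

omit hα in
-- The number `2s+1` of components is constant, and the weights are read from array `6`, where the
-- weight for component `j` and position `t` stands at address `t (2s+1) + j`.
theorem compE_wordValue {e : ℕ} (he : 1 ≤ e) {L : ι → ℕ} {x : ι → ℕ → ZMod 2} (hL : CompE c e L)
    (hLe : ∀ i, L i ≤ precodeLength s α (k i) + (compressionWidth s (precodeLength s α (k i)) +
      compressionWidth s (precodeLength s α (k i)))) (hG : c.Growth 1 L)
    (hx : CompE (c.loop L) 0 fun p => (x p.1 p.2).val) :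
    CompE c e fun i => wordValue s (L i) (x i) := by
  simp only [wordValue]
  refine Comp.sumRange fun j hj => Comp.mul (Comp.mod ?_ ((Comp.const _).mul (hL.pow _)))
    ((Comp.const _).mul (hL.pow _))
  refine CompE.sum (e' := 0) (a := 1) (g := fun i t => (x i t).val * weight (j + 1) (t + 1)) hL hG
    (Comp.mul hx ?_) (by omega)
  have hl := h.loop (b := L)
  have harr : ∀ p : (Σ i, Fin (L i)), (c.loop L).arr p 6 (p.2 * (2 * s + 1) + j) =
      weight (j + 1) (p.2 + 1) := fun p => by
    have hdiv : ((p.2 : ℕ) * (2 * s + 1) + j) / (2 * s + 1) = p.2 := by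
      rw [add_comm, Nat.add_mul_div_right _ _ (by omega), Nat.div_eq_of_lt hj, zero_add]
    rw [hl.weights p _ ?_, Nat.mul_add_mod_self_right, Nat.mod_eq_of_lt hj, hdiv]
    have h1 := Nat.mul_le_mul_right (2 * s + 1) (Nat.succ_le_of_lt (p.2.isLt.trans_le (hLe p.1)))
    rw [Nat.succ_mul] at h1
    omega
  refine Comp.congr (f := fun p => (c.loop L).arr p 6 (p.2 * (2 * s + 1) + j)) ?_
    fun p => (harr p).symm
  refine Comp.cell (A := fun p => (c.loop L).arr p 6) 6 (by omega) (fun _ => rfl)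
    (((Var.counter hG.bdd).comp.mul (.const _)).add (.const j)) ?_
  refine ((hG.counter.succ.bdd.mul (hG.counter.succ.bdd.pow j))).mono fun p => ?_
  rw [harr, weight_succ]
  refine (Finset.sum_le_card_nsmul _ _ (((p.2 : ℕ) + 1) ^ j) fun l hl => ?_).trans (by simp)
  rw [Nat.add_sub_cancel]
  exact Nat.pow_le_pow_left (by have := Finset.mem_range.1 hl; omega) j

end Syndromes

end

section

variable {ι κ : Type} {c : Ctx ι}

/-! ### The search for a modulus -/

section Modulus

variable {D : ι → ℕ → ℕ} {N A H P : ι → ℕ} {a b : ℕ}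

theorem compE_countDvd {e : ℕ} (hD : ∀ i, ∀ J < N i, c.arr i 9 J = D i J)
    (hBD : c.Bdd fun i => 2 ^ A i) (hlt : ∀ i, ∀ J < N i, D i J < 2 ^ A i)
    (hN : Var c N) (hG : c.Growth e N) (hP : CompE c e P) :
    CompE c e fun i => countDvd (D i) (N i) (P i) := by
  refine hP.letv (CompE.count (a := e) (e' := 0)
    (P := fun i J => D i J ≠ 0 ∧ D i J % P i = 0) hN.push.comp hG ?_ (by omega))
  have h1 : CompE ((c.push P).loop N) 0 fun p => D p.1 p.2 := by
    refine Comp.congr (f := fun p => ((c.push P).loop N).arr p 9 p.2) ?_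
      fun p => (hD p.1 p.2 p.2.isLt).symm
    refine Comp.cell (A := fun p => ((c.push P).loop N).arr p 9) 9 (by omega) (fun _ => rfl)
      (Var.counter (c := c.push P) hN.2).comp ?_
    exact (Ctx.Bdd.loop (c := c.push P) hBD).mono fun p =>
      (hD p.1 p.2 p.2.isLt).le.trans (hlt p.1 p.2 p.2.isLt).le
  exact (CompP.ne h1 (.const 0)).and
    (CompP.eq (h1.mod (Var.head hP.bdd).loop.comp) (.const 0))

/-- Each of the at most `2H` multipliers is tested by one pass through the stored differences,
whence the exponent `a + b`. -/
theorem compE_stageFactor {e : ℕ} (hD : ∀ i, ∀ J < N i, c.arr i 9 J = D i J)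
    (hBD : c.Bdd fun i => 2 ^ A i) (hlt : ∀ i, ∀ J < N i, D i J < 2 ^ A i)
    (hN : Var c N) (hG : c.Growth b N) (hA : Var c A) (hHv : Var c H) (hH : c.Growth a H)
    (hH1 : ∀ i, 1 ≤ H i) (hPv : Var c P) (he : a + b ≤ e) :
    CompE c e fun i => stageFactor (D i) (N i) (A i) (H i) (P i) := by
  have hspec := fun i => stageFactor_spec (P := P i) (hH1 i) (hlt i)
  have hL : c.Growth a fun i => stageFactor (D i) (N i) (A i) (H i) (P i) :=
    (hH.const_mul 2).mono fun i => (hspec i).1.le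
  have hc : CompE c e fun i => countDvd (D i) (N i) (P i) :=
    compE_countDvd hD hBD hlt hN (hG.le (by omega)) hPv.comp
  refine hc.letv (CompE.findP (a := a) (e' := b) (P := fun i t =>
    countDvd (D i) (N i) (P i * (t + 1)) * H i ≤ A i * countDvd (D i) (N i) (P i))
    (fun i t ht => Nat.notMem_of_lt_sInf (s := {t | countDvd (D i) (N i) (P i * (t + 1)) * H i ≤
      A i * countDvd (D i) (N i) (P i)}) ht) (fun i => (hspec i).2) hL ?_ (by omega))
  refine CompP.le (Comp.mul ?_ hHv.push.loop.comp) (Comp.mul hA.push.loop.comp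
    (Var.head hc.bdd).loop.comp)
  have hcnt := Var.counter (c := c.push fun i => countDvd (D i) (N i) (P i)) hL.succ.bdd
  exact compE_countDvd (D := fun p : (Σ i, Fin _) => D p.1) (A := fun p => A p.1)
    (fun p => hD p.1) (Ctx.Bdd.loop (c := c.push _) hBD) (fun p => hlt p.1) hN.push.loop
    hG.push.loop (hPv.push.loop.comp.mul (hcnt.comp.add (.const 1)))

theorem compE_stageModulus {e : ℕ} (hD : ∀ i, ∀ J < N i, c.arr i 9 J = D i J)
    (hBD : c.Bdd fun i => 2 ^ A i) (hlt : ∀ i, ∀ J < N i, D i J < 2 ^ A i)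
    (hN : Var c N) (hG : c.Growth b N) (hA : Var c A) (hHv : Var c H) (hH : c.Growth a H)
    (hH1 : ∀ i, 1 ≤ H i) (he : a + b ≤ e) :
    ∀ j, CompE c e fun i => stageModulus (D i) (N i) (A i) (H i) j
  | 0 => Comp.const 1
  | j + 1 => by
    have ih := compE_stageModulus hD hBD hlt hN hG hA hHv hH hH1 he j
    simp only [stageModulus]
    refine ih.letv ((Var.head ih.bdd).comp.mul (Comp.add ?_ (.const 1)))
    exact compE_stageFactor hD hBD hlt hN.push hG.push hA.push hHv.push hH.push hH1
      (Var.head ih.bdd) he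

theorem compE_finalModulus {e r : ℕ} {H' : ι → ℕ} (hD : ∀ i, ∀ J < N i, c.arr i 9 J = D i J)
    (hBD : c.Bdd fun i => 2 ^ A i) (hlt : ∀ i, ∀ J < N i, D i J < 2 ^ A i)
    (hN : Var c N) (hG : c.Growth b N) (hA : Var c A) (hHv : Var c H) (hH : c.Growth a H)
    (hH1 : ∀ i, 1 ≤ H i) (hHv' : Var c H') (hH' : c.Growth a H') (hH1' : ∀ i, 1 ≤ H' i)
    (he : a + b ≤ e) :
    CompE c e fun i => finalModulus (D i) (N i) (A i) (H i) r (H' i) := by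
  have h := compE_stageModulus hD hBD hlt hN hG hA hHv hH hH1 he r
  simp only [finalModulus]
  refine h.letv ((Var.head h.bdd).comp.mul (Comp.add ?_ (.const 1)))
  exact compE_stageFactor hD hBD hlt hN.push hG.push hA.push hHv'.push hH'.push hH1'
    (Var.head h.bdd) he

end Modulus

section Neighbours

variable {s : ℕ} {α : (m : ℕ) → GaloisField 2 m} (hα : IsPrimitiveFamily α) {k : ι → ℕ}

include hα

/-- A letter of a corrupted word is computed from its coordinates in constant time, without storing
the word. One pass gives the syndromes, one look-up the correcting pattern, and a second pass the
syndrome value. -/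
theorem compE_valueDist (h : Ready s α c k) {x : ι → ℕ → ZMod 2} {J : ι → ℕ}
    (hx : HoldsWord c 7 x) (hT : ∀ i, c.arr i 8 = keyTable (2 ^ bchDegree s α (k i))
      (feedback (bchDegree s α (k i))) (precodeOffset s α (k i)) (precodeLength s α (k i)) s)
    (hV : Var c fun i => wordValue s (precodeLength s α (k i)) (x i)) (hJ : Var c J) :
    CompE c 1 fun i => valueDist (2 ^ bchDegree s α (k i)) (feedback (bchDegree s α (k i)))
      (precodeOffset s α (k i)) (precodeLength s α (k i)) s (x i) (J i) := by
  have hG := growth_precodeLength (s := s) hα h.size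
  have hcor : ∀ {κ : Type} (c' : Ctx κ) (π : κ → ι) (t : κ → ℕ), HoldsWord c' 7 (fun p => x (π p)) →
      Var c' (fun p => precodeLength s α (k (π p))) → Var c' (fun p => J (π p)) → Var c' t →
      CompE c' 0 fun p => (corrupted (precodeLength s α (k (π p))) s (x (π p)) (J (π p)) (t p)).val :=
    fun c' π t h1 h2 h3 h4 => comp_corrupted h1 (by omega) h2.comp h3.comp h4.comp
  have hK := compE_bchKey hα h (e := 1) le_rfl (x := fun i =>
    corrupted (precodeLength s α (k i)) s (x i) (J i))
    (hcor _ (fun p : (Σ i, Fin _) => p.1) (fun p => (p.2 : ℕ)) hx.loop h.varN.loop hJ.loop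
      (Var.counter hG.bdd))
  set E : ι → ℕ := fun i => keyTable (2 ^ bchDegree s α (k i))
      (feedback (bchDegree s α (k i))) (precodeOffset s α (k i)) (precodeLength s α (k i)) s
      (bchKey (2 ^ bchDegree s α (k i)) (feedback (bchDegree s α (k i))) (precodeOffset s α (k i))
        (precodeLength s α (k i)) s (corrupted (precodeLength s α (k i)) s (x i) (J i)))
  have hE : CompE c 1 E := by
    refine Comp.cell (A := fun i => keyTable (2 ^ bchDegree s α (k i))
      (feedback (bchDegree s α (k i))) (precodeOffset s α (k i)) (precodeLength s α (k i)) s) 8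
      (by omega) hT hK ?_
    exact (hG.succ.bdd.pow s).mono fun i =>
      (syndromeTable_lt _ (Nat.pow_pos (Nat.succ_pos _)) _).le
  refine Comp.letv hE ?_
  have hW := compE_wordValue (c := c.push E) h.push (e := 1) le_rfl (x := fun i => neighbour
      (2 ^ bchDegree s α (k i)) (feedback (bchDegree s α (k i))) (precodeOffset s α (k i))
      (precodeLength s α (k i)) s (x i) (J i)) h.varN.push.comp (fun i => Nat.le_add_right _ _)
    hG.push ?_
  · refine Comp.letv hW ?_
    exact Comp.add (Comp.sub (Var.comp (Var.head hW.bdd)) (Var.comp hV.push.push))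
      (Comp.sub (Var.comp hV.push.push) (Var.comp (Var.head hW.bdd)))
  · have hcnt := Var.counter (c := c.push E) hG.bdd
    refine comp_add_val ?_ (comp_pattern (Comp.add h.varN.push.loop.comp (.const 1))
      (Var.head hE.bdd).loop.comp hcnt.comp)
    exact hcor _ (fun p : (Σ i, Fin _) => p.1) (fun p => (p.2 : ℕ)) hx.push.loop
      h.varN.push.loop hJ.push.loop hcnt

end Neighbours

end

section

variable {ι κ : Type} {c : Ctx ι}

/-! ### The encoder -/

/-- The word that starts with `k` symbols of `x`, followed by the binary digits of `p`. -/
def prefixWord (k : ℕ) (x : ℕ → ZMod 2) (p t : ℕ) : ZMod 2 :=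
  if t < k then x t else if p.testBit (t - k) = true then 1 else 0

/-- The least number whose binary digits can be used as parity symbols. -/
noncomputable def parityWord (s : ℕ) (α : (m : ℕ) → GaloisField 2 m) (k : ℕ) (x : ℕ → ZMod 2) : ℕ :=
  sInf {p | ∀ r < s, bchSyndrome (2 ^ bchDegree s α k) (feedback (bchDegree s α k))
    (precodeOffset s α k) (precodeLength s α k) (2 * r + 1) (prefixWord k x p) = 0}

theorem append_toBits_ext {k r p : ℕ} (x : Bits k) {t : ℕ} (ht : t < k + r) :
    Bits.ext (L := k + r) (Fin.append x (toBits r p)) t = prefixWord k x.ext p t := by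
  rw [append_ext, prefixWord, toBits_ext]
  have : t - k < r ∨ t < k := by omega
  split_ifs <;> simp_all

theorem comp_prefixWord {T k p t : ι → ℕ} {a : ℕ} {x : ι → ℕ → ZMod 2} (hx : HoldsWord c a x)
    (ha : a ≠ 4) (hk : Comp c T k) (hp : Comp c T p) (ht : Comp c T t)
    (ht' : Comp c T fun i => 2 ^ (t i - k i)) :
    Comp c T fun i => (prefixWord (k i) (x i) (p i) (t i)).val := by
  refine Comp.congr (f := fun i => if t i < k i then (x i (t i)).val else
    if (p i).testBit (t i - k i) = true then 1 else 0) ?_ fun i => ?_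
  · exact Comp.ite (CompP.lt ht hk) (hx.comp ha ht)
      (Comp.ite (CompP.testBit (j := fun i => t i - k i) hp ht') (.const 1) (.const 0))
  · rw [prefixWord]
    split_ifs <;> rfl

section Encoder

variable {s : ℕ} {α : (m : ℕ) → GaloisField 2 m} (hα : IsPrimitiveFamily α)

include hα

/-- The true parity symbols form a solution, so the least solution has no more digits than there are
parity positions; by `precode_unique` it then is the true one. -/
theorem parityWord_spec (hf : ∀ m, 1 ≤ m → bitEval (α m) (feedback m) = 0) {k : ℕ} (x : Bits k) :
    parityWord s α k x.ext < 2 ^ parityLength s α k ∧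
    (∀ r < s, bchSyndrome (2 ^ bchDegree s α k) (feedback (bchDegree s α k))
      (precodeOffset s α k) (precodeLength s α k) (2 * r + 1)
      (prefixWord k x.ext (parityWord s α k x.ext)) = 0) ∧
    ∀ t < precodeLength s α k, (precode s α k x).ext t =
      prefixWord k x.ext (parityWord s α k x.ext) t := by
  obtain ⟨hm, -⟩ := bchDegree_mem (s := s) hα k
  have hβ0 : α (bchDegree s α k) ≠ 0 := ne_zero_of_orderOf hm (hα _ hm)
  have hβ := hf _ hm
  have hp := feedback_spec hm
  obtain ⟨v, hv, hv'⟩ := toBits_surjective (Classical.epsilon fun p : Bits (parityLength s α k) =>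
    padLeft (2 ^ bchDegree s α k - 1) (Fin.append x p) ∈
      bchCode s (bchDegree s α k) (α (bchDegree s α k)))
  have hpre : precode s α k x = Fin.append x (toBits (parityLength s α k) v) := by
    rw [precode, hv']
  have hmem : ∀ r < s, bchSyndrome (2 ^ bchDegree s α k) (feedback (bchDegree s α k))
      (precodeOffset s α k) (precodeLength s α k) (2 * r + 1) (prefixWord k x.ext v) = 0 := by
    intro r hr
    rw [← bchSyndrome_congr fun t ht => append_toBits_ext x ht,
      bchSyndrome_eq_zero_iff hm hp hβ0 hβ]
    refine (mem_range_precode hα).1 ⟨x, hpre⟩ _ ?_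
    rw [Finset.mem_Icc]
    omega
  have hmin := Nat.sInf_mem (s := {p | ∀ r < s, bchSyndrome (2 ^ bchDegree s α k)
    (feedback (bchDegree s α k)) (precodeOffset s α k) (precodeLength s α k) (2 * r + 1)
    (prefixWord k x.ext p) = 0}) ⟨v, hmem⟩
  have hle : parityWord s α k x.ext ≤ v := Nat.sInf_le hmem
  refine ⟨hle.trans_lt hv, hmin, fun t ht => ?_⟩
  rw [precode_unique hα x (toBits _ (parityWord s α k x.ext)), append_toBits_ext x ht]
  refine (padLeft_mem_bchCode (L := k + parityLength s α k) _ (precodeLength_le hα k)).2 ?_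
  refine wordEval_eq_zero_of_odd fun r hr => ?_
  rw [← bchSyndrome_eq_zero_iff hm hp hβ0 hβ, bchSyndrome_congr fun t ht => append_toBits_ext x ht]
  exact hmin r hr

variable {k : ι → ℕ} (h : Ready s α c k)

theorem growth_two_pow_parityLength (hk : ∀ i, c.size i = k i) :
    c.Growth s fun i => 2 ^ parityLength s α (k i) := by
  have hG := (growth_two_pow (s := s) hα hk).pow s
  rw [one_mul] at hG
  refine hG.mono fun i => ?_
  have hm := (bchDegree_mem (s := s) hα (k i)).1
  rw [parityLength_eq hα, ← pow_mul']
  exact Nat.pow_le_pow_right (by omega)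
    (bchRank_le_mul (GaloisField.card 2 _ (by omega)))

include h

/-- Exhaustive search over `2^(parityLength) = O(n^s)` numbers. A test is quadratic, since reading a
binary digit includes the computation of a power of two. -/
theorem compE_parityWord (hf : ∀ m, 1 ≤ m → bitEval (α m) (feedback m) = 0)
    {x : (i : ι) → Bits (k i)} (hx : HoldsWord c 1 fun i => (x i).ext) :
    CompE c (s + 2) fun i => parityWord s α (k i) (x i).ext := by
  have hspec := fun i => parityWord_spec (s := s) hα hf (x i)
  have hr := growth_two_pow_parityLength (s := s) hα h.size
  have hL : c.Growth s fun i => parityWord s α (k i) (x i).ext := hr.mono fun i => (hspec i).1.le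
  have hG := growth_precodeLength (s := s) hα h.size
  refine CompE.findP (a := s) (e' := 2) (P := fun i p => ∀ r < s, bchSyndrome
    (2 ^ bchDegree s α (k i)) (feedback (bchDegree s α (k i))) (precodeOffset s α (k i))
    (precodeLength s α (k i)) (2 * r + 1) (prefixWord (k i) (x i).ext p) = 0)
    (fun i p hp => Nat.notMem_of_lt_sInf (s := {p | ∀ r < s, bchSyndrome (2 ^ bchDegree s α (k i))
      (feedback (bchDegree s α (k i))) (precodeOffset s α (k i)) (precodeLength s α (k i))
      (2 * r + 1) (prefixWord (k i) (x i).ext p) = 0}) hp)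
    (fun i => (hspec i).2.1) hL ?_ (by omega)
  have hl := h.loop (b := fun i => parityWord s α (k i) (x i).ext + 1)
  refine compPE_bchSyndrome (ι := Σ i, Fin (parityWord s α (k i) (x i).ext + 1)) hα hl
    (e' := 1) (by omega) (x := fun p => prefixWord (k p.1) (x p.1).ext p.2) ?_
  have hGl := hG.loop (b := fun i => parityWord s α (k i) (x i).ext + 1)
  have hcnt := Var.counter (c := c.loop fun i => parityWord s α (k i) (x i).ext + 1) hGl.bdd
  refine comp_prefixWord hx.loop.loop (by omega) hl.loop.varK.comp
    (Var.counter hL.succ.bdd).loop.comp hcnt.comp 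
    (CompE.pow_two (Comp.sub hcnt.comp hl.loop.varK.comp) ?_ ?_)
  · exact (Ctx.Growth.counter hGl).mono fun p => Nat.sub_le _ _
  · refine (hr.bdd.loop.loop).mono fun p => Nat.pow_le_pow_right (by omega) ?_
    have := p.2.isLt
    have h1 : precodeLength s α (k p.1.1) = k p.1.1 + parityLength s α (k p.1.1) := rfl
    omega

theorem achievesE_precode (hf : ∀ m, 1 ≤ m → bitEval (α m) (feedback m) = 0)
    {x : (i : ι) → Bits (k i)} (hx : HoldsWord c 1 fun i => (x i).ext)
    (h7 : ∀ i t, c.arr i 7 t = 0) {e : ℕ} (he : s + 2 ≤ e) {P : ι → RamState → Prop}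
    (hP : ∀ c' : Ctx ι, Ready s α c' k → HoldsWord c' 7 (fun i => (precode s α (k i) (x i)).ext) →
      (∀ i a, a ≠ 7 → c'.arr i a = c.arr i a) → AchievesE c' e P) : AchievesE c e P := by
  have hp := compE_parityWord hα h hf hx
  have hG := growth_precodeLength (s := s) hα h.size
  refine Achieves.letv (hp.le he) ?_
  refine AchievesE.fill (x := 1) (e' := 1) 7 (by omega) (g := fun i t =>
    (prefixWord (k i) (x i).ext (parityWord s α (k i) (x i).ext) t).val) h.push.varN.comp
    hG.push ?_ (by omega) ?_
  · have hcnt := Var.counter (c := c.push fun i => parityWord s α (k i) (x i).ext) hG.bdd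
    have hl := (h.push (f := fun i => parityWord s α (k i) (x i).ext)).loop
      (b := fun i => precodeLength s α (k i))
    refine comp_prefixWord (HoldsWord.setArr hx.push.loop (by omega)) (by omega)
      hl.varK.setArr.comp (Var.head hp.bdd).loop.setArr.comp hcnt.setArr.comp
      (CompE.pow_two (Comp.sub hcnt.setArr.comp hl.varK.setArr.comp) ?_ ?_)
    · exact (Ctx.Growth.counter (c := c) hG).mono fun p => Nat.sub_le _ _
    · refine ((growth_two_pow_parityLength (s := s) hα h.size).bdd.loop).mono fun p =>
        Nat.pow_le_pow_right (by omega) ?_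
      have := p.2.isLt
      have h1 : precodeLength s α (k p.1) = k p.1 + parityLength s α (k p.1) := rfl
      omega
  · refine hP _ (h.push.setArr (by omega) (by omega)) (fun i t => ?_) fun i a ha => ?_
    · have hs := (parityWord_spec (s := s) hα hf (x i)).2.2 t
      simp only [Ctx.setArr, Function.update_self]
      split_ifs with ht
      · rw [hs ht]
      · rw [Bits.ext, dif_neg ht]
        exact h7 i t
    · simp [Ctx.setArr, ha, Ctx.push]

theorem achievesE_keyTable (h8 : ∀ i t, c.arr i 8 t = 0) {e : ℕ} (he : s + 1 ≤ e)
    {P : ι → RamState → Prop}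
    (hP : ∀ c' : Ctx ι, Ready s α c' k → (∀ i, c'.arr i 8 = keyTable (2 ^ bchDegree s α (k i))
      (feedback (bchDegree s α (k i))) (precodeOffset s α (k i)) (precodeLength s α (k i)) s) →
      (∀ i a, a ≠ 8 → c'.arr i a = c.arr i a) → AchievesE c' e P) : AchievesE c e P := by
  have hG := growth_precodeLength (s := s) hα h.size
  have hGs : c.Growth s fun i => (precodeLength s α (k i) + 1) ^ s := by
    simpa using hG.succ.pow s
  have hl := (h.loop (b := fun i => (precodeLength s α (k i) + 1) ^ s))
  refine AchievesE.scatter (x := s) (e' := 1) 8 (by omega)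
    (b := fun i => (precodeLength s α (k i) + 1) ^ s)
    (addr := fun i a => bchKey (2 ^ bchDegree s α (k i)) (feedback (bchDegree s α (k i)))
      (precodeOffset s α (k i)) (precodeLength s α (k i)) s (pattern (precodeLength s α (k i) + 1) s a))
    (value := fun _ a => a)
    (fun i => syndromeTable (fun a => bchKey (2 ^ bchDegree s α (k i))
      (feedback (bchDegree s α (k i))) (precodeOffset s α (k i)) (precodeLength s α (k i)) s
      (pattern (precodeLength s α (k i) + 1) s a)))
    (fun i => funext fun t => (h8 i t).symm) (fun i j _ => rfl)
    ((h.varN.comp.add (.const 1)).pow s) hGs ?_ (Var.counter hGs.bdd).setArr.comp he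
    (hP _ (h.setArr (by omega) (by omega)) (fun i => ?_) fun i a ha => ?_)
  · have key : ∀ {κ : Type} (c' : Ctx κ) (k' : κ → ℕ) (a : κ → ℕ), Ready s α c' k' → Var c' a →
        CompE c' 1 fun p => bchKey (2 ^ bchDegree s α (k' p)) (feedback (bchDegree s α (k' p)))
          (precodeOffset s α (k' p)) (precodeLength s α (k' p)) s
          (pattern (precodeLength s α (k' p) + 1) s (a p)) := fun c' k' a h' ha =>
      compE_bchKey hα h' le_rfl (comp_pattern (Comp.add h'.varN.loop.comp (.const 1)) ha.loop.comp
        (Var.counter (growth_precodeLength (s := s) hα h'.size).bdd).comp)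
    exact key _ (fun p : (Σ i, Fin _) => k p.1) (fun p => (p.2 : ℕ))
      (hl.setArr (by omega) (by omega)) (Var.counter hGs.bdd).setArr
  · simp only [Ctx.setArr, Function.update_self]
    rfl
  · simp [Ctx.setArr, ha]

end Encoder

end

/-! ### The encoder: modulus and compressed syndrome. -/

section

variable {ι κ : Type} {c : Ctx ι}

theorem append_toBits_toBits_ext {w a b : ℕ} (t : ℕ) :
    Bits.ext (L := w + w) (Fin.append (toBits w a) (toBits w b)) t =
      if t < w + w then if t < w then if a.testBit t = true then 1 else 0
        else if b.testBit (t - w) = true then 1 else 0 else 0 := by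
  rw [append_ext, toBits_ext, toBits_ext]
  rcases Nat.lt_or_ge t w with h1 | h1
  · simp [h1, show t < w + w by omega]
  · by_cases h2 : t < w + w
    · simp [h1.not_gt, h2, show t - w < w by omega]
    · simp [h1.not_gt, h2, show ¬ t - w < w by omega]

theorem stageCompression_compress_ext {s : ℕ} {α : (m : ℕ) → GaloisField 2 m} (hs : 1 ≤ s)
    (hα : IsPrimitiveFamily α) (hf : ∀ m, 1 ≤ m → bitEval (α m) (feedback m) = 0) {k : ℕ}
    (x : Bits (precodeLength s α k)) (t : ℕ) :
    ((stageCompression hs hα hf k).compress x).ext t =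
      if t < compressionWidth s (precodeLength s α k) + compressionWidth s (precodeLength s α k)
      then if t < compressionWidth s (precodeLength s α k) then
        if (wordValue s (precodeLength s α k) x.ext % compressionModulus (2 ^ bchDegree s α k)
          (feedback (bchDegree s α k)) (precodeOffset s α k) (precodeLength s α k) s
          x.ext).testBit t = true then 1 else 0
        else if (compressionModulus (2 ^ bchDegree s α k) (feedback (bchDegree s α k))
          (precodeOffset s α k) (precodeLength s α k) s x.ext).testBit
            (t - compressionWidth s (precodeLength s α k)) = true then 1 else 0
      else 0 := by
  rw [SyndromeCompression.compress, syndromeValue_eq]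
  exact append_toBits_toBits_ext t

section Encoder

variable {s : ℕ} {α : (m : ℕ) → GaloisField 2 m} (hα : IsPrimitiveFamily α) {k : ι → ℕ}
  (h : Ready s α c k)

include hα h

theorem bdd_two_pow_syndromeLength :
    c.Bdd fun i => 2 ^ syndromeLength s (precodeLength s α (k i)) :=
  (bdd_syndromeBound hα h.size).two_pow_clog

theorem bdd_two_pow_width : c.Bdd fun i => 2 ^ compressionWidth s (precodeLength s α (k i)) :=
  (bdd_modulusBound hα h.size).two_pow_clog

theorem bdd_two_pow_checkLength :
    c.Bdd fun i => 2 ^ syndromeLength s (compressionWidth s (precodeLength s α (k i)) +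
      compressionWidth s (precodeLength s α (k i))) :=
  ((Ctx.Bdd.const _).mul
    (((growth_width hα h.size).add (growth_width hα h.size)).bdd.pow _)).two_pow_clog

theorem growth_candidateCount : c.Growth (s + 2) fun i =>
    precodeLength s α (k i) * candidateCount s (precodeLength s α (k i)) := by
  have hG := growth_precodeLength (s := s) hα h.size
  have h1 := hG.mul ((hG.const_mul 2).mul (hG.succ.pow s))
  rw [show 1 + (1 + 1 * s) = s + 2 by omega] at h1
  exact h1

/-- The dominating part of the encoder. Array `9` receives `O(n^(s+2))` differences, each in linear
time, and a constant number of stages passes through this array `O(n)` times. -/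
theorem achievesE_modulus (hs : 1 ≤ s) {x : ι → ℕ → ZMod 2} (hx : HoldsWord c 7 x)
    (hT : ∀ i, c.arr i 8 = keyTable (2 ^ bchDegree s α (k i)) (feedback (bchDegree s α (k i)))
      (precodeOffset s α (k i)) (precodeLength s α (k i)) s) {e : ℕ} (he : s + 3 ≤ e)
    {P : ι → RamState → Prop}
    (hP : ∀ c' : Ctx ι, Ready s α c' k →
      Var c' (fun i => wordValue s (precodeLength s α (k i)) (x i)) →
      Var c' (fun i => compressionModulus (2 ^ bchDegree s α (k i)) (feedback (bchDegree s α (k i)))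
        (precodeOffset s α (k i)) (precodeLength s α (k i)) s (x i)) →
      (∀ i a, a ≠ 9 → c'.arr i a = c.arr i a) → AchievesE c' e P) : AchievesE c e P := by
  have hG := growth_precodeLength (s := s) hα h.size
  have hGN := growth_candidateCount hα h
  have hn := fun i => one_le_precodeLength (s := s) hα hs (k i)
  have hV : CompE c e fun i => wordValue s (precodeLength s α (k i)) (x i) :=
    compE_wordValue h (by omega) h.varN.comp (fun i => Nat.le_add_right _ _) hG
      (hx.loop.comp (by omega) (Var.counter hG.bdd).comp)
  have hBD := bdd_two_pow_syndromeLength hα h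
  refine Achieves.letv hV ?_
  refine Achieves.letv (f := fun i => precodeLength s α (k i) *
    candidateCount s (precodeLength s α (k i)))
    (Comp.mul h.push.varN.comp (comp_candidateCount h.push.varN.comp)) ?_
  have hB' := (growth_lastParameter (s := s) hα h.size)
  refine Achieves.letv (f := fun i => lastParameter s (precodeLength s α (k i)))
    (Comp.add (Comp.mul (.const _) (Comp.pow h.push.push.varA.comp _)) (.const 1)) ?_
  have h3 := (((h.push (f := fun i => wordValue s (precodeLength s α (k i)) (x i))).push
    (f := fun i => precodeLength s α (k i) * candidateCount s (precodeLength s α (k i)))).push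
    (f := fun i => lastParameter s (precodeLength s α (k i))))
  have hvN := (Var.head (c := c.push fun i => wordValue s (precodeLength s α (k i)) (x i))
    hGN.bdd).push (f := fun i => lastParameter s (precodeLength s α (k i)))
  have hvV := ((Var.head hV.bdd).push (f := fun i => precodeLength s α (k i) *
    candidateCount s (precodeLength s α (k i)))).push
    (f := fun i => lastParameter s (precodeLength s α (k i)))
  have hvH := Var.head (c := (c.push fun i => wordValue s (precodeLength s α (k i)) (x i)).push
    fun i => precodeLength s α (k i) * candidateCount s (precodeLength s α (k i))) hB'.bdd
  refine AchievesE.fill (x := s + 2) (e' := 1) 9 (by omega) (g := fun i => valueDist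
    (2 ^ bchDegree s α (k i)) (feedback (bchDegree s α (k i))) (precodeOffset s α (k i))
    (precodeLength s α (k i)) s (x i)) hvN.comp hGN ?_ (by omega) ?_
  · refine compE_valueDist (ι := Σ i, Fin _) hα (k := fun p => k p.1)
      (x := fun p => x p.1) (J := fun p => (p.2 : ℕ)) (h3.loop.setArr (by omega) (by omega))
      (HoldsWord.setArr hx.push.push.push.loop (by omega)) (fun p => ?_) hvV.loop.setArr
      (Var.counter hvN.2).setArr
    simp only [Ctx.setArr, Function.update_of_ne (show (8 : ℕ) ≠ 9 by omega)]
    exact hT p.1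
  · refine Achieves.letv (f := fun i => compressionModulus (2 ^ bchDegree s α (k i))
      (feedback (bchDegree s α (k i))) (precodeOffset s α (k i)) (precodeLength s α (k i)) s (x i))
      ?_ (hP _ (Ready.push (h3.setArr (by omega) (by omega))) hvV.setArr.push
        (Var.head ((bdd_two_pow_width hα h).mono fun i => (compressionModulus_spec (hn i) _).2.1.le))
        fun i a ha => ?_)
    · refine compE_finalModulus (a := 1) (b := s + 2) (fun i J hJ => ?_)
        hBD (fun i J hJ => valueDist_lt (hn i) _ _) hvN.setArr hGN
        h3.varA.setArr h3.varN.setArr hG hn hvH.setArr hB' (fun i => Nat.succ_pos _) (by omega)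
      simp only [Ctx.setArr, Function.update_self]
      exact if_pos hJ
    · simp [Ctx.setArr, ha, Ctx.push]

theorem achievesE_compress (hs : 1 ≤ s) (hf : ∀ m, 1 ≤ m → bitEval (α m) (feedback m) = 0)
    {x : (i : ι) → Bits (precodeLength s α (k i))}
    (h10 : ∀ i t, c.arr i 10 t = 0)
    (hV : Var c fun i => wordValue s (precodeLength s α (k i)) (x i).ext)
    (hM : Var c fun i => compressionModulus (2 ^ bchDegree s α (k i))
      (feedback (bchDegree s α (k i))) (precodeOffset s α (k i)) (precodeLength s α (k i)) s
      (x i).ext) {e : ℕ} (he : 2 ≤ e) {P : ι → RamState → Prop}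
    (hP : ∀ c' : Ctx ι, Ready s α c' k →
      HoldsWord c' 10 (fun i => ((stageCompression hs hα hf (k i)).compress (x i)).ext) →
      (∀ i a, a ≠ 10 → c'.arr i a = c.arr i a) → AchievesE c' e P) : AchievesE c e P := by
  have hG := growth_width (s := s) hα h.size
  have hGG := hG.add hG
  have hR : CompE c e _ := hV.comp.mod hM.comp
  refine Achieves.letv hR ?_
  set R : ι → ℕ := _
  refine AchievesE.fill (x := 1) (e' := 1) 10 (by omega) (g := fun i t =>
    if t < compressionWidth s (precodeLength s α (k i)) then if (R i).testBit t = true then 1 else 0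
    else if (compressionModulus (2 ^ bchDegree s α (k i))
      (feedback (bchDegree s α (k i))) (precodeOffset s α (k i)) (precodeLength s α (k i)) s
      (x i).ext).testBit (t - compressionWidth s (precodeLength s α (k i))) = true then 1 else 0)
    (Comp.add h.varW.push.comp h.varW.push.comp) hGG ?_ (by omega) ?_
  · have hcnt := Var.counter (c := c.push R) hGG.bdd
    have hB := (bdd_two_pow_width hα h)
    refine Comp.ite (CompP.lt hcnt.setArr.comp h.varW.push.loop.setArr.comp)
      (Comp.ite (CompP.testBit (Var.head hR.bdd).loop.setArr.comp (CompE.pow_two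
        hcnt.setArr.comp ?_ ?_)) (.const 1) (.const 0))
      (Comp.ite (CompP.testBit (j := fun p : (Σ i, Fin _) => (p.2 : ℕ) - compressionWidth s (precodeLength s α (k p.1)))
        hM.push.loop.setArr.comp (CompE.pow_two
        (Comp.sub hcnt.setArr.comp h.varW.push.loop.setArr.comp) ?_ ?_)) (.const 1) (.const 0))
    · exact Ctx.Growth.counter (c := c) hGG
    · refine ((hB.mul hB).loop).mono fun p => ?_
      rw [← pow_add]
      exact Nat.pow_le_pow_right (by omega) p.2.isLt.le
    · exact (Ctx.Growth.counter (c := c) hGG).mono fun p => Nat.sub_le _ _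
    · refine ((hB.mul hB).loop).mono fun p => ?_
      rw [← pow_add]
      exact Nat.pow_le_pow_right (by omega) ((Nat.sub_le _ _).trans p.2.isLt.le)
  · refine hP _ (h.push.setArr (by omega) (by omega)) (fun i t => ?_) fun i a ha => ?_
    · simp only [Ctx.setArr, Function.update_self]
      rw [stageCompression_compress_ext]
      have h0 : (c.push R).arr i 10 t = 0 := h10 i t
      rw [h0]
      split_ifs <;> rfl
    · simp [Ctx.setArr, ha, Ctx.push]

end Encoder

end

/-! ### The encoder: output and assembly. -/

section

variable {ι κ : Type} {c : Ctx ι}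

/-- Leaves the calculus: in a context without variables that starts from the input memory, the
calculus yields an honest program. Costs are measured there in a size that is at most the code
length. -/
theorem AchievesE.exists_program {e : ℕ} {k n L L' : ι → ℕ} {v : (i : ι) → Bits (L i)}
    {u : (i : ι) → Bits (L' i)} (hvars : c.vars = [])
    (harr : ∀ i, c.arr i = RamState.input (k i) (v i)) (hn : ∀ i, c.size i ≤ n i)
    (h : AchievesE c e fun i σ => σ.HasOutput (u i)) :
    ∃ (p : RamProgram) (C : ℕ), ∀ i,
      p.ComputesWithin (C * n i ^ C) (C * n i ^ e) (k i) (v i) (u i) := by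
  obtain ⟨p, C, hp⟩ := h [] 0 (by simp)
  refine ⟨p, 2 * C, fun i => ?_⟩
  obtain ⟨t, σ, ht, hr, ho⟩ := hp i (RamState.input (k i) (v i))
    ⟨fun a _ => by rw [harr], by simp [hvars], by simp⟩
  have h1 := c.size_pos i
  have h2 : 1 ≤ n i := h1.trans (hn i)
  refine ⟨t, σ, ht.trans ?_, hr.mono ?_, ho⟩
  · have h3 := Nat.pow_le_pow_left (hn i) e
    have h4 := Nat.one_le_pow e (n i) h2
    rw [mul_comm 2 C, mul_assoc]
    exact Nat.mul_le_mul_left _ (show c.size i ^ e + 1 ≤ 2 * n i ^ e by omega)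
  · exact Nat.mul_le_mul (by omega) ((Nat.pow_le_pow_left (hn i) C).trans
      (Nat.pow_le_pow_right h2 (by omega)))

theorem SyndromeCompression.encode_ext_eq {s : ℕ} {α : (m : ℕ) → GaloisField 2 m} {k : ℕ}
    (G : SyndromeCompression s α k) (x : Bits k) {j : ℕ} (hj : j < G.codeLength) :
    (G.encode x).ext j = if j < precodeLength s α k then (precode s α k x).ext j
      else if j < precodeLength s α k + G.length₁ then
        (G.compress (precode s α k x)).ext (j - precodeLength s α k)
      else if (wordValue s G.length₁ (G.compress (precode s α k x)).ext).testBit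
        ((j - (precodeLength s α k + G.length₁)) / (2 * s + 2)) = true then 1 else 0 := by
  rw [G.encode_ext]
  split_ifs with h1 h2 h3 <;> try rfl
  all_goals
    have h4 : j - (precodeLength s α k + G.length₁) < G.length₂ := by
      have : G.codeLength = precodeLength s α k + G.length₁ + G.length₂ := rfl
      omega
    have h5 : (j - (precodeLength s α k + G.length₁)) / (2 * s + 2) <
      syndromeLength s G.length₁ := Nat.div_lt_of_lt_mul (by rwa [mul_comm])
    rw [rep_ext _ h4, syndromeBits, toBits_ext, syndromeValue_eq]
    simp [h3, h5]

section Encoder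

variable {s : ℕ} {α : (m : ℕ) → GaloisField 2 m} (hα : IsPrimitiveFamily α) {k : ι → ℕ}

theorem achievesE_output (hs : 1 ≤ s) (hf : ∀ m, 1 ≤ m → bitEval (α m) (feedback m) = 0)
    (h : Ready s α c k) {x : (i : ι) → Bits (k i)}
    (h7 : HoldsWord c 7 fun i => (precode s α (k i) (x i)).ext)
    (h10 : HoldsWord c 10 fun i => ((stageCompression hs hα hf (k i)).compress
      (precode s α (k i) (x i))).ext) {e : ℕ} (he : 2 ≤ e) :
    AchievesE c e fun i σ => σ.HasOutput ((stageCompression hs hα hf (k i)).encode (x i)) := by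
  have hGn := growth_precodeLength (s := s) hα h.size
  have hGw := growth_width (s := s) hα h.size
  have hGB := growth_checkLength (s := s) hα h.size
  have hG : c.Growth 1 fun i => (stageCompression hs hα hf (k i)).codeLength := by
    have h1 := (hGn.add (hGw.add hGw)).add (hGB.const_mul (2 * s + 2))
    simp only [mul_comm (2 * s + 2)] at h1
    exact h1
  set M : ι → ℕ := fun i => wordValue s (compressionWidth s (precodeLength s α (k i)) +
    compressionWidth s (precodeLength s α (k i))) ((stageCompression hs hα hf (k i)).compress
      (precode s α (k i) (x i))).ext
  have hM : CompE c e M := compE_wordValue h (by omega) (Comp.add h.varW.comp h.varW.comp)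
    (fun i => Nat.le_add_left _ _) (hGw.add hGw)
    (h10.loop.comp (by omega) (Var.counter (hGw.add hGw).bdd).comp)
  refine Achieves.letv hM ?_
  have hlen : ∀ (c' : Ctx ι) (T : ι → ℕ), Ready s α c' k →
      Comp c' T fun i => (stageCompression hs hα hf (k i)).codeLength := fun c' T h' =>
    Comp.add (Comp.add h'.varN.comp (Comp.add h'.varW.comp h'.varW.comp))
      (Comp.mul h'.varB.comp (.const (2 * s + 2)))
  refine AchievesE.fill (x := 1) (e' := 1) 2 (by omega) (g := fun i j =>
      ((stageCompression hs hα hf (k i)).encode (x i)).ext j |>.val)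
    (hlen _ _ h.push) hG ?_ (by omega) ?_
  · refine Comp.congr ?_ fun p => congrArg ZMod.val
      ((stageCompression hs hα hf (k p.1)).encode_ext_eq (x p.1) p.2.isLt)
    have hcnt := (Var.counter (c := c.push M) hG.bdd)
    have hl := (h.push (f := M)).loop (b := fun i => (stageCompression hs hα hf (k i)).codeLength)
    refine Comp.congr (f := fun p : (Σ i, Fin (stageCompression hs hα hf (k i)).codeLength) =>
      if (p.2 : ℕ) < precodeLength s α (k p.1) then ((precode s α (k p.1) (x p.1)).ext p.2).val
      else if (p.2 : ℕ) < precodeLength s α (k p.1) + (compressionWidth s (precodeLength s α (k p.1)) +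
        compressionWidth s (precodeLength s α (k p.1))) then
        (((stageCompression hs hα hf (k p.1)).compress (precode s α (k p.1) (x p.1))).ext
          (p.2 - precodeLength s α (k p.1))).val
      else if (M p.1).testBit ((p.2 - (precodeLength s α (k p.1) +
        (compressionWidth s (precodeLength s α (k p.1)) +
          compressionWidth s (precodeLength s α (k p.1))))) / (2 * s + 2)) = true then 1 else 0)
      ?_ fun p => ?_
    · have hw : ∀ {κ : Type} (c' : Ctx κ) (k' : κ → ℕ), Ready s α c' k' → CompE c' 1 fun p =>
          precodeLength s α (k' p) + (compressionWidth s (precodeLength s α (k' p)) +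
            compressionWidth s (precodeLength s α (k' p))) := fun c' k' h' =>
        Comp.add h'.varN.comp (Comp.add h'.varW.comp h'.varW.comp)
      have hw' := hw _ _ (hl.setArr (a := 2) (A := fun p j => if j < p.2 then
        (((stageCompression hs hα hf (k p.1)).encode (x p.1)).ext j).val else
          (c.push M).arr p.1 2 j) (by omega) (by omega))
      refine Comp.ite (CompP.lt hcnt.setArr.comp hl.varN.setArr.comp)
        (HoldsWord.comp (HoldsWord.setArr h7.push.loop (by omega)) (by omega) hcnt.setArr.comp)
        (Comp.ite (CompP.lt hcnt.setArr.comp hw') (HoldsWord.comp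
          (HoldsWord.setArr h10.push.loop (by omega)) (by omega)
            (Comp.sub hcnt.setArr.comp hl.varN.setArr.comp))
          (Comp.ite (CompP.testBit (Var.head hM.bdd).loop.setArr.comp (CompE.pow_two
            (Comp.div (Comp.sub hcnt.setArr.comp hw') (.const (2 * s + 2))) ?_ ?_))
            (.const 1) (.const 0)))
      · exact (Ctx.Growth.counter (c := c) hG).mono fun p =>
          (Nat.div_le_self _ _).trans (Nat.sub_le _ _)
      · refine ((bdd_two_pow_checkLength hα h).loop).mono fun p =>
          Nat.pow_le_pow_right (by omega) ?_
        refine Nat.div_le_of_le_mul ?_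
        have h1 := p.2.isLt
        have h2 : (stageCompression hs hα hf (k p.1)).codeLength = precodeLength s α (k p.1) +
          (compressionWidth s (precodeLength s α (k p.1)) +
            compressionWidth s (precodeLength s α (k p.1))) + syndromeLength s
              (compressionWidth s (precodeLength s α (k p.1)) +
                compressionWidth s (precodeLength s α (k p.1))) * (2 * s + 2) := rfl
        rw [mul_comm]
        omega
    · split_ifs <;> first | rfl | contradiction
  · refine AchievesE.fill (x := 0) (e' := 0) 3 (by omega) (b := fun _ => 1) (g := fun i _ =>
      (stageCompression hs hα hf (k i)).codeLength) (.const 1) (.const 1) ?_ (by omega) ?_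
    · have hl := ((h.push (f := M)).setArr (a := 2) (A := fun i j =>
        if j < (stageCompression hs hα hf (k i)).codeLength then
          (((stageCompression hs hα hf (k i)).encode (x i)).ext j).val
        else (c.push M).arr i 2 j) (by omega) (by omega)).loop (b := fun _ => 1)
      exact Comp.add (Comp.add hl.varN.setArr.comp (Comp.add hl.varW.setArr.comp
        hl.varW.setArr.comp)) (Comp.mul hl.varB.setArr.comp (.const (2 * s + 2)))
    · refine Achieves.skip fun i σ hσ => ⟨?_, fun j => ?_⟩
      · rw [hσ 3 (by omega)]
        simp [Ctx.setArr]
      · rw [hσ 2 (by omega)]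
        simp only [Ctx.setArr, Function.update_of_ne (show (2 : ℕ) ≠ 3 by omega),
          Function.update_self]
        rw [if_pos j.isLt, Bits.ext_fin]

end Encoder

/-- Parameters, parity symbols and syndrome table cost at most `O(n^(s+2))`; only the modulus
requires `O(n^(s+3))`. -/
theorem encodingComplexity_stageCompression {s : ℕ} {α : (m : ℕ) → GaloisField 2 m} (hs : 2 ≤ s)
    (hs' : 1 ≤ s) (hα : IsPrimitiveFamily α)
    (hf : ∀ m, 1 ≤ m → bitEval (α m) (feedback m) = 0) :
    EncodingComplexity (stageCompression hs' hα hf) (s + 3) := by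
  -- All lengths and all messages are indices of one context, so the uniformity of the calculus
  -- gives one program for the whole family.
  let c : Ctx (Σ k : {k : ℕ // 1 ≤ k}, Bits k) :=
    { size := fun i => i.1
      size_pos := fun i => i.1.2
      arr := fun i => RamState.input i.1 i.2
      vars := [] }
  have h : AchievesE c (s + 3) fun i σ => σ.HasOutput
      ((stageCompression hs' hα hf i.1).encode i.2) := by
    refine achievesE_init hα (fun _ => rfl) hs hf (k := fun i => (i.1 : ℕ)) (fun i => rfl)
      (by omega) fun c₁ h₁ ha₁ => ?_
    have hz : ∀ i a t, 7 ≤ a → c₁.arr i a t = 0 := fun i a t ha => by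
      rw [ha₁ i a (by omega) (by omega)]
      simp [c, RamState.input, show a ≠ 0 by omega, show a ≠ 1 by omega]
    refine achievesE_precode hα h₁ hf (x := fun i => i.2) (fun i t => ?_)
      (fun i t => hz i 7 t (by omega)) (by omega) fun c₂ h₂ h7 ha₂ => ?_
    · rw [ha₁ i 1 (by omega) (by omega)]
      simp only [c, RamState.input, Bits.ext]
      split_ifs <;> simp_all
    refine achievesE_keyTable hα h₂ (fun i t => ?_) (by omega) fun c₃ h₃ hT ha₃ => ?_
    · rw [ha₂ i 8 (by omega)]
      exact hz i 8 t (by omega)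
    have h7₃ : HoldsWord c₃ 7 _ := fun i t => by
      rw [ha₃ i 7 (by omega)]
      exact h7 i t
    refine achievesE_modulus hα h₃ hs' h7₃ hT le_rfl fun c₄ h₄ hV hM ha₄ => ?_
    refine achievesE_compress hα h₄ hs' hf (fun i t => ?_) hV hM (by omega)
      fun c₅ h₅ h10 ha₅ => ?_
    · rw [ha₄ i 10 (by omega), ha₃ i 10 (by omega), ha₂ i 10 (by omega)]
      exact hz i 10 t (by omega)
    refine achievesE_output hα hs' hf h₅ (fun i t => ?_) h10 (by omega)
    rw [ha₅ i 7 (by omega), ha₄ i 7 (by omega)]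
    exact h7₃ i t
  obtain ⟨p, C, hp⟩ := h.exists_program (k := fun i => (i.1 : ℕ)) (v := fun i => i.2)
    (n := fun i : (Σ k : {k : ℕ // 1 ≤ k}, Bits k) => (stageCompression hs' hα hf i.1).codeLength)
    rfl (fun i => rfl) fun i => by
      have h1 : (stageCompression hs' hα hf i.1).codeLength = (i.1 : ℕ) + parityLength s α i.1 +
        (stageCompression hs' hα hf i.1).length₁ + (stageCompression hs' hα hf i.1).length₂ := rfl
      show (i.1 : ℕ) ≤ _
      omega
  exact ⟨p, C, fun k hk x => hp ⟨⟨k, hk⟩, x⟩⟩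

end

section

/-! ### The decoder -/

theorem sum_testBit (a B : ℕ) :
    ∑ i ∈ Finset.range B, (if a.testBit i = true then 2 ^ i else 0) = a % 2 ^ B := by
  induction B with
  | zero => simp [Nat.mod_one]
  | succ B ih =>
    rw [Finset.sum_range_succ, ih, Nat.mod_pow_succ, Nat.testBit_eq_decide_div_mod_eq]
    rcases Nat.mod_two_eq_zero_or_one (a / 2 ^ B) with h | h <;> simp [h]

/-- The number with the binary digits that are obtained from `y` by majority votes. -/
def majorityValue (s B : ℕ) (y : ℕ → ZMod 2) : ℕ :=
  ∑ i ∈ Finset.range B,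
    if s < ∑ t ∈ Finset.range (2 * s + 1), (y (i * (2 * s + 2) + t)).val then 2 ^ i else 0

theorem majorityValue_eq {s B d a : ℕ} {y : ℕ → ZMod 2} (ha : a < 2 ^ B)
    (h : Near s (B * (2 * s + 2)) d y (rep (2 * s + 2) (toBits B a)).ext) :
    majorityValue s B y = a := by
  rw [majorityValue, ← Nat.mod_eq_of_lt ha, ← sum_testBit]
  refine Finset.sum_congr rfl fun i hi => ?_
  rw [Finset.mem_range] at hi
  have hmaj := rep_majority h hi
  have hv : (toBits B a).ext i = if a.testBit i = true then 1 else 0 := by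
    rw [toBits_ext]
    simp [hi]
  have hones : ∑ t ∈ Finset.range (2 * s + 1), (y (i * (2 * s + 2) + t)).val =
      ((Finset.range (2 * s + 1)).filter fun t => y (i * (2 * s + 2) + t) = 1).card := by
    rw [Finset.card_filter]
    refine Finset.sum_congr rfl fun t _ => ?_
    generalize y (i * (2 * s + 2) + t) = b
    revert b
    decide
  have hsplit := Finset.card_filter_add_card_filter_not (s := Finset.range (2 * s + 1))
    fun t => y (i * (2 * s + 2) + t) = 1
  rw [Finset.card_range] at hsplit
  rw [hones]
  congr 1
  rw [hv] at hmaj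
  by_cases hb : a.testBit i = true
  · rw [if_pos hb] at hmaj
    simp only [ne_eq] at hmaj
    simp only [hb, eq_iff_iff, iff_true]
    omega
  · rw [if_neg hb] at hmaj
    simp only [hb, eq_iff_iff, Bool.false_eq_true, iff_false, not_lt]
    refine le_trans (Finset.card_le_card fun t ht => ?_) hmaj
    rw [Finset.mem_filter] at ht ⊢
    exact ⟨ht.1, by rw [ht.2]; decide⟩

/-- The least candidate with the syndrome value `M`. -/
noncomputable def valueCandidate (s L : ℕ) (y : ℕ → ZMod 2) (M : ℕ) : ℕ :=
  sInf {J | wordValue s L (candidate s L y J) = M}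

/-- Every candidate has the received word in its error ball, and within such candidates the syndrome
value determines the word. The least match is therefore the sent block. -/
theorem valueCandidate_spec {s L d : ℕ} (hs : 1 ≤ s) {y x : ℕ → ZMod 2} (hd : d < L)
    (h : Near s L d y x) :
    valueCandidate s L y (wordValue s L x) < candidateCount s L ∧
    wordValue s L (candidate s L y (valueCandidate s L y (wordValue s L x))) = wordValue s L x ∧
    ∀ t < L, candidate s L y (valueCandidate s L y (wordValue s L x)) t = x t := by
  obtain ⟨J, hJ, hx⟩ := h.exists_candidate hd
  have hmem : J ∈ {J | wordValue s L (candidate s L y J) = wordValue s L x} :=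
    wordValue_congr hx
  have hlt : valueCandidate s L y (wordValue s L x) < candidateCount s L :=
    (Nat.sInf_le hmem).trans_lt hJ
  have hval : wordValue s L (candidate s L y (valueCandidate s L y (wordValue s L x))) =
    wordValue s L x := Nat.sInf_mem ⟨J, hmem⟩
  obtain ⟨d', hd', h'⟩ := near_candidate hlt y
  exact ⟨hlt, hval, eq_of_wordValue_eq hs hd' hd h' h hval⟩

section Decoder

variable {s : ℕ} {α : (m : ℕ) → GaloisField 2 m} (hs : 1 ≤ s) (hα : IsPrimitiveFamily α)
  (hf : ∀ m, 1 ≤ m → bitEval (α m) (feedback m) = 0)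

theorem Near.bits {s n d : ℕ} {y x : ℕ → ZMod 2} (h : Near s n d y x) :
    Near s n d (Bits.ext (L := n - 1) fun i : Fin (n - 1) => y i)
      (Bits.ext (L := n) fun i : Fin n => x i) := by
  refine le_trans (le_of_eq ?_) h
  congr 1
  refine Finset.filter_congr fun j hj => ?_
  rw [Finset.mem_range] at hj
  rw [Bits.ext_of_lt _ hj, Bits.ext_of_lt _ (skip_lt hj)]

/-- The least candidate whose BCH syndromes vanish and whose syndrome value is congruent to `R`
modulo `P`. -/
noncomputable def codeCandidate (s : ℕ) (α : (m : ℕ) → GaloisField 2 m) (k : ℕ) (y : ℕ → ZMod 2)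
    (R P : ℕ) : ℕ :=
  sInf {J | (∀ r < s, bchSyndrome (2 ^ bchDegree s α k) (feedback (bchDegree s α k))
    (precodeOffset s α k) (precodeLength s α k) (2 * r + 1)
    (candidate s (precodeLength s α k) y J) = 0) ∧
    wordValue s (precodeLength s α k) (candidate s (precodeLength s α k) y J) % P = R}

include hs hα hf in
-- A candidate with vanishing syndromes is a precoded word whose error ball contains the received
-- block. If its value also has the transmitted residue modulo the transmitted modulus, then
-- `separates` identifies it with the sent word.
theorem codeCandidate_spec {k : ℕ} (G : SyndromeCompression s α k) (x : Bits k) {y : ℕ → ZMod 2}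
    {d : ℕ} (hd : d < precodeLength s α k)
    (h : Near s (precodeLength s α k) d y (precode s α k x).ext) {R P : ℕ}
    (hP : P = G.modulus (precode s α k x)) (hR : R = syndromeValue s (precode s α k x) % P) :
    codeCandidate s α k y R P < candidateCount s (precodeLength s α k) ∧
    ((∀ r < s, bchSyndrome (2 ^ bchDegree s α k) (feedback (bchDegree s α k))
      (precodeOffset s α k) (precodeLength s α k) (2 * r + 1)
      (candidate s (precodeLength s α k) y (codeCandidate s α k y R P)) = 0) ∧
      wordValue s (precodeLength s α k) (candidate s (precodeLength s α k) y
        (codeCandidate s α k y R P)) % P = R) ∧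
    ∀ t < precodeLength s α k, candidate s (precodeLength s α k) y (codeCandidate s α k y R P) t =
      (precode s α k x).ext t := by
  have hn := one_le_precodeLength hα hs k
  obtain ⟨hm, -⟩ := bchDegree_mem (s := s) hα k
  have hβ0 : α (bchDegree s α k) ≠ 0 := ne_zero_of_orderOf hm (hα _ hm)
  have hβ := hf _ hm
  have hp := feedback_spec hm
  obtain ⟨J, hJ, hx⟩ := h.exists_candidate hd
  have hmem : J ∈ {J | (∀ r < s, bchSyndrome (2 ^ bchDegree s α k) (feedback (bchDegree s α k))
      (precodeOffset s α k) (precodeLength s α k) (2 * r + 1)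
      (candidate s (precodeLength s α k) y J) = 0) ∧
      wordValue s (precodeLength s α k) (candidate s (precodeLength s α k) y J) % P = R} := by
    refine ⟨fun r hr => ?_, ?_⟩
    · rw [bchSyndrome_congr hx, bchSyndrome_eq_zero_iff hm hp hβ0 hβ]
      refine (mem_range_precode hα).1 ⟨x, rfl⟩ _ ?_
      rw [Finset.mem_Icc]
      omega
    · rw [wordValue_congr hx, hR, syndromeValue_eq]
  have hlt : codeCandidate s α k y R P < candidateCount s (precodeLength s α k) :=
    (Nat.sInf_le hmem).trans_lt hJ
  have hspec := Nat.sInf_mem ⟨J, hmem⟩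
  refine ⟨hlt, hspec, ?_⟩
  obtain ⟨h1, h2⟩ := hspec
  change ∀ r < s, bchSyndrome _ _ _ _ _ (candidate s _ y (codeCandidate s α k y R P)) = 0 at h1
  change wordValue s _ (candidate s _ y (codeCandidate s α k y R P)) % P = R at h2
  generalize codeCandidate s α k y R P = J' at *
  set z : Bits (precodeLength s α k) := fun i => candidate s (precodeLength s α k) y J' i
  have hz : ∀ t < precodeLength s α k, candidate s (precodeLength s α k) y J' t = z.ext t :=
    fun t ht => by rw [Bits.ext_of_lt _ ht]
  obtain ⟨d', hd', h'⟩ := near_candidate hlt y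
  have hzr : z ∈ Set.range (precode s α k) := by
    refine (mem_range_precode hα).2 (wordEval_eq_zero_of_odd fun r hr => ?_)
    rw [← bchSyndrome_eq_zero_iff hm hp hβ0 hβ, ← bchSyndrome_congr hz]
    exact h1 r hr
  have heq : z = precode s α k x := by
    by_contra hne
    -- The modulus belongs to the sent word, so separation is applied at the sent word, with the
    -- candidate in the role of the neighbour.
    refine G.separates _ ⟨x, rfl⟩ z hzr hne ⟨fun i => y i, ?_, ?_⟩ ?_
    · refine (mem_errorBall hn).2 ⟨d, hd, ?_⟩
      have := h.bits
      rwa [show (fun i : Fin (precodeLength s α k) => (precode s α k x).ext i) = precode s α k x from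
        funext fun i => Bits.ext_fin _ _] at this
    · exact (mem_errorBall hn).2 ⟨d', hd', h'.bits⟩
    · rw [← hP, Nat.ModEq, ← hR, ← h2, syndromeValue_eq z, wordValue_congr hz]
  intro t ht
  rw [hz t ht, heq]

end Decoder

end

/-! ### Running times of the parts of the decoder. -/

section

variable {ι κ : Type} {c : Ctx ι}

theorem compE_digits {a : ℕ} {x : ι → ℕ → ZMod 2} {o w : ι → ℕ} (hx : HoldsWord c a x) (ha : a ≠ 4)
    (ho : Var c o) (hw : Var c w) (hG : c.Growth 1 w) (hB : c.Bdd fun i => 2 ^ w i) {e : ℕ}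
    (he : 2 ≤ e) : CompE c e fun i => ∑ t ∈ Finset.range (w i), (x i (o i + t)).val * 2 ^ t :=
  CompE.sum (a := 1) (e' := 1) (g := fun i t => (x i (o i + t)).val * 2 ^ t) hw.comp hG
    (Comp.mul (HoldsWord.comp hx.loop ha (Comp.add ho.loop.comp (Var.counter hG.bdd).comp))
      (CompE.pow_two (Var.counter hG.bdd).comp (Ctx.Growth.counter hG)
        (hB.loop.mono fun p => Nat.pow_le_pow_right (by omega) p.2.isLt.le))) (by omega)

theorem sum_digits_val {w a : ℕ} (ha : a < 2 ^ w) {x : ℕ → ZMod 2}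
    (hx : ∀ t < w, x t = if a.testBit t = true then 1 else 0) :
    ∑ t ∈ Finset.range w, (x t).val * 2 ^ t = a := by
  rw [← Nat.mod_eq_of_lt ha, ← sum_testBit]
  refine Finset.sum_congr rfl fun t ht => ?_
  rw [hx t (Finset.mem_range.1 ht)]
  split_ifs
  · exact one_mul _
  · exact zero_mul _

section Decoder

variable {s : ℕ} {α : (m : ℕ) → GaloisField 2 m} (hα : IsPrimitiveFamily α) {k : ι → ℕ}
  (h : Ready s α c k) {y : ι → ℕ → ZMod 2} (hy : HoldsWord c 1 y)

include hα h hy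

theorem compE_majorityValue {e : ℕ} (he : 2 ≤ e) :
    CompE c e fun i => majorityValue s (syndromeLength s (compressionWidth s
      (precodeLength s α (k i)) + compressionWidth s (precodeLength s α (k i))))
      (shiftWord (precodeLength s α (k i) + (compressionWidth s (precodeLength s α (k i)) +
        compressionWidth s (precodeLength s α (k i)))) (y i)) := by
  have hG := growth_checkLength (s := s) hα h.size
  have hl := h.loop (b := fun i => syndromeLength s (compressionWidth s
      (precodeLength s α (k i)) + compressionWidth s (precodeLength s α (k i))))
  have hcnt := Var.counter hG.bdd
  refine CompE.sum (a := 1) (e' := 1) (g := fun i j => if s < ∑ t ∈ Finset.range (2 * s + 1),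
    (shiftWord (precodeLength s α (k i) + (compressionWidth s (precodeLength s α (k i)) +
        compressionWidth s (precodeLength s α (k i)))) (y i) (j * (2 * s + 2) + t)).val
    then 2 ^ j else 0) h.varB.comp hG ?_ (by omega)
  refine Comp.ite (CompP.lt (.const s) (Comp.sumRange fun t _ => ?_))
    (CompE.pow_two hcnt.comp (Ctx.Growth.counter hG) ?_) (.const 0)
  · simp only [shiftWord]
    exact HoldsWord.comp hy.loop (by omega) (Comp.add (Comp.add hl.varN.comp
      (Comp.add hl.varW.comp hl.varW.comp)) (Comp.add (Comp.mul hcnt.comp (.const (2 * s + 2)))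
        (.const t)))
  · exact (bdd_two_pow_checkLength hα h).loop.mono fun p =>
      Nat.pow_le_pow_right (by omega) p.2.isLt.le

theorem compE_valueCandidate (hs : 1 ≤ s) {x : ι → ℕ → ZMod 2}
    (hx : ∀ i, ∃ d < compressionWidth s (precodeLength s α (k i)) +
      compressionWidth s (precodeLength s α (k i)), Near s (compressionWidth s
        (precodeLength s α (k i)) + compressionWidth s (precodeLength s α (k i))) d
        (shiftWord (precodeLength s α (k i)) (y i)) (x i))
    (hM : Var c fun i => wordValue s (compressionWidth s
        (precodeLength s α (k i)) + compressionWidth s (precodeLength s α (k i))) (x i)) :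
    CompE c (s + 2) fun i => valueCandidate s (compressionWidth s
        (precodeLength s α (k i)) + compressionWidth s (precodeLength s α (k i)))
        (shiftWord (precodeLength s α (k i)) (y i)) (wordValue s (compressionWidth s
        (precodeLength s α (k i)) + compressionWidth s (precodeLength s α (k i))) (x i)) := by
  have hw := growth_width (s := s) hα h.size
  have hww := hw.add hw
  have hspec := fun i => valueCandidate_spec hs (hx i).choose_spec.1 (hx i).choose_spec.2
  have hGc := (hww.const_mul 2).mul (hww.succ.pow s)
  rw [show 1 + 1 * s = s + 1 by omega] at hGc
  have hL := hGc.mono fun i => (hspec i).1.le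
  refine CompE.findP (a := s + 1) (e' := 1) (P := fun i J => wordValue s (compressionWidth s
      (precodeLength s α (k i)) + compressionWidth s (precodeLength s α (k i)))
      (candidate s (compressionWidth s (precodeLength s α (k i)) +
        compressionWidth s (precodeLength s α (k i))) (shiftWord (precodeLength s α (k i)) (y i)) J)
      = wordValue s (compressionWidth s (precodeLength s α (k i)) +
        compressionWidth s (precodeLength s α (k i))) (x i))
    (fun i J hJ => Nat.notMem_of_lt_sInf (s := {J | wordValue s (compressionWidth s
      (precodeLength s α (k i)) + compressionWidth s (precodeLength s α (k i)))
      (candidate s (compressionWidth s (precodeLength s α (k i)) +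
        compressionWidth s (precodeLength s α (k i))) (shiftWord (precodeLength s α (k i)) (y i)) J)
      = wordValue s (compressionWidth s (precodeLength s α (k i)) +
        compressionWidth s (precodeLength s α (k i))) (x i)}) hJ)
    (fun i => (hspec i).2.1) hL ?_ (by omega)
  refine CompP.eq ?_ hM.loop.comp
  have key : ∀ {κ : Type} (c' : Ctx κ) (k' : κ → ℕ) (y' : κ → ℕ → ZMod 2) (J : κ → ℕ),
      Ready s α c' k' → HoldsWord c' 1 y' → Var c' J →
      CompE c' 1 fun p => wordValue s (compressionWidth s (precodeLength s α (k' p)) +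
        compressionWidth s (precodeLength s α (k' p)))
        (candidate s (compressionWidth s (precodeLength s α (k' p)) +
          compressionWidth s (precodeLength s α (k' p)))
          (shiftWord (precodeLength s α (k' p)) (y' p)) (J p)) := by
    intro κ c' k' y' J h' hy' hJ
    have hw' := growth_width (s := s) hα h'.size
    have hl := h'.loop (b := fun p => compressionWidth s (precodeLength s α (k' p)) +
      compressionWidth s (precodeLength s α (k' p)))
    have hL' := fun T => Comp.add (T := T) hl.varW.comp hl.varW.comp
    have hcnt := Var.counter (hw'.add hw').bdd
    refine compE_wordValue h' le_rfl (Comp.add h'.varW.comp h'.varW.comp)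
      (fun i => Nat.le_add_left _ _) (hw'.add hw') (comp_candidate (hL' _) hJ.loop.comp hcnt.comp ?_)
    simp only [shiftWord]
    exact HoldsWord.comp hy'.loop (by omega) (Comp.add hl.varN.comp (comp_unskip
      (Comp.div (Comp.div hJ.loop.comp (Comp.pow (Comp.add (hL' _) (.const 1)) s)) (.const 2))
      hcnt.comp))
  exact key _ (fun p : (Σ i, Fin _) => k p.1) (fun p => y p.1) (fun p => (p.2 : ℕ)) h.loop hy.loop
    (Var.counter hL.succ.bdd)

/-- There are `O(n^(s+1))` candidates, and the tables make the test of each of them linear. -/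
theorem compE_codeCandidate (hs : 1 ≤ s) (hf : ∀ m, 1 ≤ m → bitEval (α m) (feedback m) = 0)
    (G : (i : ι) → SyndromeCompression s α (k i)) (x : (i : ι) → Bits (k i))
    (hx : ∀ i, ∃ d < precodeLength s α (k i), Near s (precodeLength s α (k i)) d (y i)
      (precode s α (k i) (x i)).ext)
    {R P : ι → ℕ} (hP : ∀ i, P i = (G i).modulus (precode s α (k i) (x i)))
    (hR : ∀ i, R i = syndromeValue s (precode s α (k i) (x i)) % P i) (hRv : Var c R)
    (hPv : Var c P) : CompE c (s + 2) fun i => codeCandidate s α (k i) (y i) (R i) (P i) := by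
  have hG := growth_precodeLength (s := s) hα h.size
  have hspec := fun i => codeCandidate_spec hs hα hf (G i) (x i) (hx i).choose_spec.1
    (hx i).choose_spec.2 (hP i) (hR i)
  have hGc := (hG.const_mul 2).mul (hG.succ.pow s)
  rw [show 1 + 1 * s = s + 1 by omega] at hGc
  have hL := hGc.mono fun i => (hspec i).1.le
  refine CompE.findP (a := s + 1) (e' := 1) (P := fun i J => (∀ r < s, bchSyndrome
    (2 ^ bchDegree s α (k i)) (feedback (bchDegree s α (k i))) (precodeOffset s α (k i))
    (precodeLength s α (k i)) (2 * r + 1) (candidate s (precodeLength s α (k i)) (y i) J) = 0) ∧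
    wordValue s (precodeLength s α (k i)) (candidate s (precodeLength s α (k i)) (y i) J) % P i = R i)
    (fun i J hJ => Nat.notMem_of_lt_sInf (s := {J | (∀ r < s, bchSyndrome
    (2 ^ bchDegree s α (k i)) (feedback (bchDegree s α (k i))) (precodeOffset s α (k i))
    (precodeLength s α (k i)) (2 * r + 1) (candidate s (precodeLength s α (k i)) (y i) J) = 0) ∧
    wordValue s (precodeLength s α (k i)) (candidate s (precodeLength s α (k i)) (y i) J) % P i =
      R i}) hJ) (fun i => (hspec i).2.1) hL ?_ (by omega)
  have key : ∀ {κ : Type} (c' : Ctx κ) (k' : κ → ℕ) (y' : κ → ℕ → ZMod 2) (J : κ → ℕ),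
      Ready s α c' k' → HoldsWord c' 1 y' → Var c' J →
      CompE (c'.loop fun p => precodeLength s α (k' p)) 0 fun p =>
        (candidate s (precodeLength s α (k' p.1)) (y' p.1) (J p.1) p.2).val := by
    intro κ c' k' y' J h' hy' hJ
    have hcnt := Var.counter (growth_precodeLength (s := s) hα h'.size).bdd
    refine comp_candidate h'.loop.varN.comp hJ.loop.comp hcnt.comp ?_
    exact HoldsWord.comp hy'.loop (by omega) (comp_unskip (Comp.div (Comp.div hJ.loop.comp
      (Comp.pow (Comp.add h'.loop.varN.comp (.const 1)) s)) (.const 2)) hcnt.comp)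
  have hl := h.loop (b := fun i => codeCandidate s α (k i) (y i) (R i) (P i) + 1)
  have hkey := key _ (fun p : (Σ i, Fin _) => k p.1) (fun p => y p.1) (fun p => (p.2 : ℕ)) hl hy.loop
    (Var.counter hL.succ.bdd)
  exact (compPE_bchSyndrome hα hl (by omega) hkey).and (CompP.eq (Comp.mod
    (compE_wordValue hl le_rfl hl.varN.comp (fun p => Nat.le_add_right _ _)
      (growth_precodeLength (s := s) hα hl.size) hkey) hPv.loop.comp) hRv.loop.comp)

end Decoder

end

/-! ### Assembly of the decoder. -/

section

variable {ι κ : Type} {c : Ctx ι}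

theorem SyndromeCompression.majorityValue_eq {s : ℕ} {α : (m : ℕ) → GaloisField 2 m} {k : ℕ}
    (G : SyndromeCompression s α k) (g : Bits G.length₁) {d : ℕ} {y : ℕ → ZMod 2}
    (h : Near s G.length₂ d y (rep (2 * s + 2) (syndromeBits s g)).ext) :
    majorityValue s (syndromeLength s G.length₁) y = wordValue s G.length₁ g.ext := by
  have hw := G.width_pos
  have hl : 1 ≤ G.length₁ := by
    have : G.length₁ = G.width + G.width := rfl
    omega
  rw [← syndromeValue_eq]
  exact _root_.majorityValue_eq (syndromeValue_lt hl g) h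

theorem precode_ext_of_lt {s : ℕ} {α : (m : ℕ) → GaloisField 2 m} {k : ℕ} (x : Bits k) {t : ℕ}
    (ht : t < k) : (precode s α k x).ext t = x.ext t := by
  rw [precode, append_ext, if_pos ht]

section Decoder

variable {s : ℕ} {α : (m : ℕ) → GaloisField 2 m} (hα : IsPrimitiveFamily α) {k : ι → ℕ}
  {y : ι → ℕ → ZMod 2}

include hα in
theorem achievesE_message (hs : 1 ≤ s) (hf : ∀ m, 1 ≤ m → bitEval (α m) (feedback m) = 0)
    (h : Ready s α c k) (hy : HoldsWord c 1 y) (G : (i : ι) → SyndromeCompression s α (k i))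
    (x : (i : ι) → Bits (k i))
    (hx : ∀ i, ∃ d < precodeLength s α (k i), Near s (precodeLength s α (k i)) d (y i)
      (precode s α (k i) (x i)).ext)
    {R P : ι → ℕ} (hP : ∀ i, P i = (G i).modulus (precode s α (k i) (x i)))
    (hR : ∀ i, R i = syndromeValue s (precode s α (k i) (x i)) % P i) (hRv : Var c R)
    (hPv : Var c P) : AchievesE c (s + 2) fun i σ => σ.HasOutput (x i) := by
  have hJ := compE_codeCandidate hα h hy hs hf G x hx hP hR hRv hPv
  have hspec := fun i => (codeCandidate_spec hs hα hf (G i) (x i) (hx i).choose_spec.1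
    (hx i).choose_spec.2 (hP i) (hR i)).2.2
  refine Achieves.letv hJ ?_
  have h₁ := h.push (f := fun i => codeCandidate s α (k i) (y i) (R i) (P i))
  have hGk : c.Growth 1 k := Ctx.Growth.size.mono fun i => (h.size i).ge
  refine AchievesE.fill (x := 1) (e' := 0) 2 (by omega) (b := k) (g := fun i j => ((x i).ext j).val)
    h₁.varK.comp hGk ?_ (by omega) ?_
  · have hcnt := Var.counter (c := c.push fun i => codeCandidate s α (k i) (y i) (R i) (P i)) hGk.bdd
    have hJv := (Var.head hJ.bdd).loop (b := k)
    have hl := h₁.loop (b := k)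
    refine Comp.congr (f := fun p : (Σ i, Fin (k i)) => (candidate s (precodeLength s α (k p.1))
      (y p.1) (codeCandidate s α (k p.1) (y p.1) (R p.1) (P p.1)) p.2).val) ?_ fun p => ?_
    · refine comp_candidate hl.varN.setArr.comp hJv.setArr.comp hcnt.setArr.comp ?_
      exact HoldsWord.comp (HoldsWord.setArr hy.push.loop (by omega)) (by omega) (comp_unskip
        (Comp.div (Comp.div hJv.setArr.comp (Comp.pow (Comp.add hl.varN.setArr.comp (.const 1)) s))
          (.const 2)) hcnt.setArr.comp)
    · rw [hspec p.1 p.2 (p.2.isLt.trans_le (Nat.le_add_right _ _)), precode_ext_of_lt _ p.2.isLt]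
  · refine AchievesE.fill (x := 0) (e' := 0) 3 (by omega) (b := fun _ => 1) (g := fun i _ => k i)
      (.const 1) (.const 1) h₁.varK.setArr.loop.setArr.comp (by omega) ?_
    refine Achieves.skip fun i σ hσ => ⟨?_, fun j => ?_⟩
    · rw [hσ 3 (by omega)]
      simp [Ctx.setArr]
    · rw [hσ 2 (by omega)]
      simp only [Ctx.setArr, Function.update_of_ne (show (2 : ℕ) ≠ 3 by omega),
        Function.update_self]
      rw [if_pos j.isLt, Bits.ext_fin]

theorem achievesE_decode (hs : 2 ≤ s) (hs' : 1 ≤ s)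
    (hf : ∀ m, 1 ≤ m → bitEval (α m) (feedback m) = 0)
    (h : Ready s α c k) (hy : HoldsWord c 1 y) (h10 : ∀ i t, c.arr i 10 t = 0)
    (x : (i : ι) → Bits (k i))
    (hx : ∀ i, ∃ d, Near s (stageCompression hs' hα hf (k i)).codeLength d (y i)
      ((stageCompression hs' hα hf (k i)).encode (x i)).ext) :
    AchievesE c (s + 2) fun i σ => σ.HasOutput (x i) := by
  have hblocks := fun i => (stageCompression hs' hα hf (k i)).near_blocks
    (one_le_precodeLength hα hs' _) hs (x i) (hx i).choose_spec
  have hG := growth_width (s := s) hα h.size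
  have hGG := hG.add hG
  have hB := bdd_two_pow_width hα h
  have hspec := fun i => compressionModulus_spec (Q := 2 ^ bchDegree s α (k i))
    (q := feedback (bchDegree s α (k i))) (o := precodeOffset s α (k i)) (s := s)
    (one_le_precodeLength (s := s) hα hs' (k i)) (precode s α (k i) (x i)).ext
  set g : ι → ℕ → ZMod 2 := fun i => ((stageCompression hs' hα hf (k i)).compress
    (precode s α (k i) (x i))).ext with hg
  set P : ι → ℕ := fun i => compressionModulus (2 ^ bchDegree s α (k i))
    (feedback (bchDegree s α (k i))) (precodeOffset s α (k i)) (precodeLength s α (k i)) s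
    (precode s α (k i) (x i)).ext with hPdef
  set R : ι → ℕ := fun i => wordValue s (precodeLength s α (k i)) (precode s α (k i) (x i)).ext % P i
    with hRdef
  have hgt := fun i t => stageCompression_compress_ext hs' hα hf (precode s α (k i) (x i)) t
  have hP2 : ∀ i, P i < 2 ^ compressionWidth s (precodeLength s α (k i)) := fun i => (hspec i).2.1
  have hR2 : ∀ i, R i < 2 ^ compressionWidth s (precodeLength s α (k i)) := fun i =>
    (Nat.mod_lt _ (hspec i).1).trans (hP2 i)
  set M : ι → ℕ := fun i => wordValue s (compressionWidth s (precodeLength s α (k i)) +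
    compressionWidth s (precodeLength s α (k i))) (g i)
  have hM : CompE c (s + 2) M := (compE_majorityValue hα h hy (by omega)).congr fun i =>
    ((stageCompression hs' hα hf (k i)).majorityValue_eq _ (hblocks i).2.2.choose_spec).symm
  refine Achieves.letv hM ?_
  set J : ι → ℕ := fun i => valueCandidate s (compressionWidth s (precodeLength s α (k i)) +
    compressionWidth s (precodeLength s α (k i))) (shiftWord (precodeLength s α (k i)) (y i)) (M i)
  have hJ : CompE (c.push M) (s + 2) J :=
    compE_valueCandidate hα h.push hy.push hs' (fun i => (hblocks i).2.1) (Var.head hM.bdd)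
  refine Achieves.letv hJ ?_
  have h₂ := (h.push (f := M)).push (f := J)
  refine AchievesE.fill (x := 1) (e' := 0) 10 (by omega) (b := fun i => compressionWidth s
    (precodeLength s α (k i)) + compressionWidth s (precodeLength s α (k i)))
    (g := fun i t => (g i t).val) (Comp.add h₂.varW.comp h₂.varW.comp) hGG ?_ (by omega) ?_
  · have hcnt := Var.counter (c := (c.push M).push J) hGG.bdd
    have hJv := (Var.head hJ.bdd).loop (b := fun i => compressionWidth s
      (precodeLength s α (k i)) + compressionWidth s (precodeLength s α (k i)))
    have hl := h₂.loop (b := fun i => compressionWidth s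
      (precodeLength s α (k i)) + compressionWidth s (precodeLength s α (k i)))
    refine Comp.congr (f := fun p : (Σ i, Fin (compressionWidth s
      (precodeLength s α (k i)) + compressionWidth s (precodeLength s α (k i)))) =>
      (candidate s (compressionWidth s (precodeLength s α (k p.1)) +
        compressionWidth s (precodeLength s α (k p.1))) (shiftWord (precodeLength s α (k p.1))
        (y p.1)) (J p.1) p.2).val) ?_ fun p => ?_
    · refine comp_candidate (Comp.add hl.varW.setArr.comp hl.varW.setArr.comp) hJv.setArr.comp
        hcnt.setArr.comp ?_
      simp only [shiftWord]
      exact HoldsWord.comp (HoldsWord.setArr hy.push.push.loop (by omega)) (by omega)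
        (Comp.add hl.varN.setArr.comp (comp_unskip (Comp.div (Comp.div hJv.setArr.comp (Comp.pow
          (Comp.add (Comp.add hl.varW.setArr.comp hl.varW.setArr.comp) (.const 1)) s)) (.const 2))
          hcnt.setArr.comp))
    · obtain ⟨d, hd, hnear⟩ := (hblocks p.1).2.1
      exact congrArg ZMod.val ((valueCandidate_spec hs' hd hnear).2.2 p.2 p.2.isLt).symm
  set c₃ : Ctx ι := ((c.push M).push J).setArr 10 _ with hc₃
  have h₃ : Ready s α c₃ k := h₂.setArr (by omega) (by omega)
  have hg₃ : HoldsWord c₃ 10 g := fun i t => by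
    simp only [hc₃, Ctx.setArr, Function.update_self]
    split_ifs with ht
    · rfl
    · refine (h10 i t).trans ?_
      simp only [hg]
      rw [hgt, if_neg ht, ZMod.val_zero]
  have hR : CompE c₃ (s + 2) R := by
    -- A variable with value zero serves as the offset of the residue, which occupies the first half
    -- of the compressed syndrome.
    refine Comp.letv (f := fun _ => 0) (.const 0) ?_
    refine (compE_digits (hg₃.push) (by omega) (Var.head (.const 0)) h₃.varW.push hG hB
      (by omega)).congr fun i => (sum_digits_val (hR2 i) fun t ht => ?_).symm
    simp only [hg]
    rw [hgt, zero_add, if_pos (by omega), if_pos ht]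
  have hP : CompE (c₃.push R) (s + 2) P := by
    refine (compE_digits (hg₃.push) (by omega) h₃.varW.push h₃.varW.push hG hB
      (by omega)).congr fun i => (sum_digits_val (hP2 i) fun t ht => ?_).symm
    simp only [hg]
    rw [hgt, if_pos (by omega), if_neg (by omega),
      Nat.add_sub_cancel_left]
  refine Achieves.letv hR (Achieves.letv hP ?_)
  refine achievesE_message hα hs' hf h₃.push.push (y := y) (fun i t => ?_)
    (fun i => stageCompression hs' hα hf (k i)) x (fun i => (hblocks i).1) (fun i => rfl)
    (fun i => ?_) (Var.head hR.bdd).push (Var.head hP.bdd)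
  · rw [← hy i t]
    simp [hc₃, Ctx.push, Ctx.setArr]
  · rw [syndromeValue_eq]
    rfl

end Decoder

theorem decodingComplexity_stageCompression {s : ℕ} {α : (m : ℕ) → GaloisField 2 m} (hs : 2 ≤ s)
    (hs' : 1 ≤ s) (hα : IsPrimitiveFamily α)
    (hf : ∀ m, 1 ≤ m → bitEval (α m) (feedback m) = 0) :
    DecodingComplexity (stageCompression hs' hα hf) (s + 2) := by
  let ι : Type := Σ k : {k : ℕ // 1 ≤ k}, Σ x : Bits k,
    {y // y ∈ errorBall 1 s ((stageCompression hs' hα hf k).encode x)}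
  have hlen : ∀ k : ℕ, k ≤ (stageCompression hs' hα hf k).codeLength := fun k => by
    have h1 : (stageCompression hs' hα hf k).codeLength = k + parityLength s α k +
      (stageCompression hs' hα hf k).length₁ + (stageCompression hs' hα hf k).length₂ := rfl
    omega
  let c : Ctx ι :=
    { size := fun i => i.1
      size_pos := fun i => i.1.2
      arr := fun i => RamState.input i.1 i.2.2.1
      vars := [] }
  have h : AchievesE c (s + 2) fun i σ => σ.HasOutput i.2.1 := by
    refine achievesE_init hα (fun _ => rfl) hs hf (k := fun i => (i.1 : ℕ)) (fun i => rfl)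
      le_rfl fun c₁ h₁ ha₁ => ?_
    refine achievesE_decode hα hs hs' hf h₁ (y := fun i => i.2.2.1.ext) (fun i t => ?_)
      (fun i t => ?_) (fun i => i.2.1) fun i => ?_
    · rw [ha₁ i 1 (by omega) (by omega)]
      simp only [c, RamState.input, Bits.ext]
      split_ifs <;> simp_all
    · rw [ha₁ i 10 (by omega) (by omega)]
      simp [c, RamState.input]
    · obtain ⟨d, -, hd⟩ := (mem_errorBall (i.1.2.trans (hlen i.1))).1 i.2.2.2
      exact ⟨d, hd⟩
  obtain ⟨p, C, hp⟩ := h.exists_program (k := fun i => (i.1 : ℕ)) (v := fun i => i.2.2.1)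
    (n := fun i : ι => (stageCompression hs' hα hf i.1).codeLength) rfl (fun i => rfl)
    fun i => hlen i.1
  exact ⟨p, C, fun k hk x y hy => hp ⟨⟨k, hk⟩, x, y, hy⟩⟩

end

/-- For every choice of the primitive elements and of the moduli, the code is systematic,
corrects a single deletion and `s` substitutions, and has the stated redundancy; and there is a
choice with the stated encoding and decoding complexity. -/
theorem theorem1 (s : ℕ) (hs : 2 ≤ s) :
    (∀ α : (m : ℕ) → GaloisField 2 m, IsPrimitiveFamily α →
      ∀ G : (k : ℕ) → SyndromeCompression s α k,
        (∀ k, 1 ≤ k →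
          IsSystematic (G k).encode ∧ IsDelSubCorrecting 1 s (G k).code) ∧
        (HasCompressedLength G → ∃ ε : ℕ → ℝ, ε =o[atTop] (fun n : ℕ => Real.logb 2 (n : ℝ)) ∧
          ∀ k, 1 ≤ k → redundancy (G k).code ≤
            (3 * s + 4) * Real.logb 2 ((G k).codeLength : ℝ) + ε (G k).codeLength)) ∧
    (∃ α : (m : ℕ) → GaloisField 2 m, IsPrimitiveFamily α ∧
      ∃ G : (k : ℕ) → SyndromeCompression s α k, HasCompressedLength G ∧
        EncodingComplexity G (s + 3) ∧ DecodingComplexity G (s + 2)) := by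
  refine ⟨fun α hα G => ⟨fun k hk => ⟨(G k).isSystematic, (G k).isDelSubCorrecting hs hk⟩,
    redundancy_le hα hs G⟩, ?_⟩
  obtain ⟨α, hα, hf⟩ := exists_primitiveFamily
  exact ⟨α, hα, stageCompression (by omega) hα hf,
    hasCompressedLength_stageCompression hα (by omega) hf,
    encodingComplexity_stageCompression hs (by omega) hα hf,
    decodingComplexity_stageCompression hs (by omega) hα hf⟩
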